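/- Let $d\ge 1$, $\gamma>1$, $\alpha\ge -1$, $c_\alpha>0$, $T>0$, and let $\Omega\subset\mathbb R^d$ be an open set, bounded or unbounded, with boundary of class $C^3$ (uniformly so if $\Omega$ is unbounded; $\Omega=\mathbb R^d$ is allowed) and outward unit normal $n$. Put $p(\rho)=\rho^\gamma$, $f(\rho)=\frac{\rho^\gamma}{\gamma-1}$, $k(\rho)=c_\alpha\rho^\alpha$, $\beta(\rho)=\int_0^\rho\sqrt{k(s)}\,ds=\frac{2\sqrt{c_\alpha}}{2+\alpha}\rho^{1+\alpha/2}$, $K(\rho)=\int_0^\rho s\,k(s)\,ds=\frac{c_\alpha}{2+\alpha}\rho^{2+\alpha}$, and $f(\rho|r)=f(\rho)-f'(r)(\rho-r)-f(r)$. Define the relative entropy $$\mathcal E([\rho,\Lambda]|[r,U])=\int_\Omega \tfrac12|\Lambda-\sqrt\rho\,U|^2+f(\rho|r)+\tfrac{\varepsilon^2}{2}|\nabla\beta(\rho)|^2\,dx\in[0,\infty].$$ **Weak solutions.** Let $\varepsilon>0$, $\rho_0\ge0$, $(\rho_0,J_0)\in L^1(\Omega)$ with $$E_0=\int_\Omega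 \tfrac12\tfrac{|J_0|^2}{\rho_0}+f(\rho_0)+\tfrac{\varepsilon^2}{2}|\nabla\beta(\rho_0)|^2\,dx<\infty .$$ A finite energy weak solution on $[0,T]\times\Omega$ of the Euler–Korteweg system $$\partial_t\rho+\operatorname{div}J=0,\qquad \partial_tJ+\operatorname{div}(\Lambda\otimes\Lambda)+\nabla p(\rho)=\varepsilon^2\nabla\big(\Delta K(\rho)-\tfrac12K''(\rho)|\nabla\rho|^2\big)-\varepsilon^2\operatorname{div}(\nabla\beta(\rho)\otimes\nabla\beta(\rho))$$ with no-flux boundary conditions $\Lambda\cdot n=0$, $\partial_n\beta(\rho)=0$ and initial data $(\rho_0,J_0)$ is a pair $(\rho,J)$, $\rho\ge0$, $J=\sqrt\rho\,\Lambda$, such that $\sqrt\rho\in L^{2\gamma}_{loc}$, $\Lambda\in L^2_{loc}$, $\nabla\beta(\rho)\in L^2_{loc}$, $\nabla K(\rho)\in L^1_{loc}([0,T]\times\Omega)$ (weak gradients in $x$); for all boundedly supported test functions $\psi$ ($C^1$ on $[0,T]\times\overline\Omega$) and $\phi$ ($\mathbb R^d$-valued, $C^2$ in $x$ and $C^1$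 in $t$ up to the boundary, $\phi\cdot n=0$ on $\partial\Omega$), with all integrands integrable, $$\int_\Omega\rho(T)\psi(T)-\int_\Omega\rho_0\psi(0)=\int_0^T\!\!\int_\Omega\rho\,\partial_t\psi+J\cdot\nabla\psi,$$ $$\int_\Omega J(T)\cdot\phi(T)-\int_\Omega J_0\cdot\phi(0)=\int_0^T\!\!\int_\Omega J\cdot\partial_t\phi+\Lambda\otimes\Lambda:\nabla\phi+p(\rho)\operatorname{div}\phi+\varepsilon^2\nabla\beta(\rho)\otimes\nabla\beta(\rho):\nabla\phi+\tfrac{\varepsilon^2}{2}K''(\rho)|\nabla\rho|^2\operatorname{div}\phi+\varepsilon^2\nabla K(\rho)\cdot\nabla\operatorname{div}\phi,$$ where $K''(\rho)|\nabla\rho|^2$ means $(1+\alpha)|\nabla\beta(\rho)|^2$; and for a.e. $\tau\in[0,T]$ $$\int_\Omega\big(\tfrac12|\Lambda|^2+\tfrac{\varepsilon^2}{2}|\nabla\beta(\rho)|^2+f(\rho)\big)(\tau,x)\,dx\le E_0 .$$ **Theorem.** For all sufficiently small $\varepsilon>0$ let $(\rho^\varepsilon,J^\varepsilon)$, $J^\varepsilon=\sqrt{\rho^\varepsilon}\Lambda^\varepsilon$,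 be such a finite energy weak solution with initial data $(\rho_0^\varepsilon,J_0^\varepsilon)$, and put $\Lambda_0^\varepsilon=J_0^\varepsilon/\sqrt{\rho_0^\varepsilon}$ ($=0$ where $\rho_0^\varepsilon=0$). Let $(\rho^E,u^E)$ be a strong solution on $[0,T]\times\overline\Omega$ of the compressible Euler system $$\partial_t\rho^E+\operatorname{div}(\rho^Eu^E)=0,\quad \partial_t(\rho^Eu^E)+\operatorname{div}(\rho^Eu^E\otimes u^E)+\nabla p(\rho^E)=0,\quad u^E\cdot n|_{\partial\Omega}=0,$$ with $\rho^E>0$ on $[0,T]\times\overline\Omega$, such that $\rho^E,u^E$, their space derivatives up to order two and their first time derivatives are bounded and continuous on $[0,T]\times\overline\Omega$. If $\Omega$ is unbounded, assume moreover decay at infinity: $\rho^E(0)\in L^1(\Omega)$, and for every $\eta>0$ there is $R$ such that $\int_{\Omega\cap\{|x|>R\}}\rho_0^\varepsilon\,dx\le\eta$ for all sufficiently small $\varepsilon$. If $$\mathcal E([\rho_0^\varepsilon,\Lambda_0^\varepsilon]|[\rho^E(0),u^E(0)])\to0\qquad(\varepsilon\to0^+),$$ then, as $\varepsilon\to0^+$,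 $$\|\rho^\varepsilon-\rho^E\|_{L^\infty([0,T];L^1\cap L^\gamma(\Omega))}+\|\Lambda^\varepsilon-\sqrt{\rho^\varepsilon}u^E\|_{L^\infty([0,T];L^2(\Omega))}\to0$$ and $$\|J^\varepsilon-\rho^Eu^E\|_{L^\infty([0,T];L^1(\Omega))}\to0 .$$ -/

import Mathlib

open MeasureTheory Set Filter Topology
open scoped ENNReal ContDiff InnerProductSpace

noncomputable section

namespace EulerKorteweg

/-- The Euclidean space `ℝᵈ`. -/
abbrev Sp (d : ℕ) : Type := EuclideanSpace ℝ (Fin d)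

/-! ### Domains with (uniformly) `C³` boundary -/

/-- An open set `Ω = {g < 0} ⊆ ℝᵈ` with boundary of class `C³`, presented by a defining function `g`
whose gradient does not vanish on `∂Ω = {g = 0}`. The two quantitative bounds say that the boundary
is *uniformly* `C³`. They are no restriction for a bounded open set with `C³` boundary
(one can change `g` away from the compact boundary). The whole space is the case `g = -1`. -/
structure C3Domain (d : ℕ) where
  /-- the open set `Ω` -/
  carrier : Set (Sp d)
  /-- the defining function -/
  g : Sp d → ℝ
  contDiff_g : ContDiff ℝ 3 g
  carrier_eq : carrier = {x | g x < 0}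
  grad_lower : ∃ c : ℝ, 0 < c ∧ ∀ x, g x = 0 → c ≤ ‖gradient g x‖
  deriv_bound : ∃ M : ℝ, ∀ j : ℕ, 1 ≤ j → j ≤ 3 → ∀ x, ‖iteratedFDeriv ℝ j g x‖ ≤ M

/-- The unit outward normal (meaningful at boundary points). -/
def C3Domain.normal {d : ℕ} (Ω : C3Domain d) (x : Sp d) : Sp d :=
  ‖gradient Ω.g x‖⁻¹ • gradient Ω.g x

/-! ### Differential operators -/

/-- Divergence of a vector field. -/
def divg {d : ℕ} (v : Sp d → Sp d) (x : Sp d) : ℝ :=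
  ∑ i : Fin d, (fderiv ℝ v x (EuclideanSpace.single i 1)) i

/-- Time derivative on `[0,T]` (one-sided at the end points). -/
def dt {d : ℕ} {F : Type*} [NormedAddCommGroup F] [NormedSpace ℝ F]
    (T : ℝ) (u : ℝ → Sp d → F) (t : ℝ) (x : Sp d) : F :=
  derivWithin (fun s => u s x) (Icc 0 T) t

/-- `G` is the weak gradient of `b` in the open set `Ω`. -/
def HasWeakGrad {d : ℕ} (Ω : Set (Sp d)) (b : Sp d → ℝ) (G : Sp d → Sp d) : Prop :=
  LocallyIntegrableOn b Ω ∧ LocallyIntegrableOn G Ω ∧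
    ∀ φ : Sp d → ℝ, ContDiff ℝ ∞ φ → HasCompactSupport φ → tsupport φ ⊆ Ω →
      ∫ x in Ω, b x • gradient φ x = -∫ x in Ω, φ x • G x

/-- `∫_Ω |∇b|² dx`, equal to `∞` if `b` has no weak gradient in `Ω`
(the weak gradient is unique almost everywhere, so the infimum is over at most one value). -/
def dirichletEnergy {d : ℕ} (Ω : Set (Sp d)) (b : Sp d → ℝ) : ℝ≥0∞ :=
  ⨅ (G : Sp d → Sp d) (_ : HasWeakGrad Ω b G), ∫⁻ x in Ω, ENNReal.ofReal (‖G x‖ ^ 2)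

/-! ### Function classes on `[0,T] × Ω` -/

/-- `g`, given on `[0,T] × Ω`, is bounded and extends continuously to `[0,T] × closure Ω`. -/
def ExtendsCont {d : ℕ} {F : Type*} [NormedAddCommGroup F]
    (T : ℝ) (Ω : Set (Sp d)) (g : ℝ → Sp d → F) : Prop :=
  ∃ h : ℝ → Sp d → F, ContinuousOn (Function.uncurry h) (Icc 0 T ×ˢ closure Ω) ∧
    (∃ C : ℝ, ∀ t ∈ Icc 0 T, ∀ x ∈ closure Ω, ‖h t x‖ ≤ C) ∧
    ∀ t ∈ Icc 0 T, ∀ x ∈ Ω, h t x = g t x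

/-- `u` is continuous on `[0,T] × closure Ω`, each `u(t,·)` is `Cᵏ` in `Ω`, and the space derivatives
up to order `k` are bounded and continuous on `[0,T] × closure Ω`. -/
structure IsSpaceCk {d : ℕ} {F : Type*} [NormedAddCommGroup F] [NormedSpace ℝ F]
    (T : ℝ) (Ω : Set (Sp d)) (k : ℕ) (u : ℝ → Sp d → F) : Prop where
  continuousOn : ContinuousOn (Function.uncurry u) (Icc 0 T ×ˢ closure Ω)
  contDiffOn : ∀ t ∈ Icc 0 T, ContDiffOn ℝ k (u t) Ω
  extends_deriv : ∀ j : ℕ, j ≤ k → ExtendsCont T Ω (fun t x => iteratedFDeriv ℝ j (u t) x)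

/-- `u` is differentiable in time on `[0,T] × Ω`, and `∂ₜu` is bounded and continuous on
`[0,T] × closure Ω`. -/
structure IsTimeC1 {d : ℕ} {F : Type*} [NormedAddCommGroup F] [NormedSpace ℝ F]
    (T : ℝ) (Ω : Set (Sp d)) (u : ℝ → Sp d → F) : Prop where
  differentiableOn : ∀ x ∈ Ω, DifferentiableOn ℝ (fun s => u s x) (Icc 0 T)
  extends_dt : ExtendsCont T Ω (dt T u)

/-- `u ∈ Lᵖ_loc([0,T] × Ω)`. -/
def LpLoc {d : ℕ} {F : Type*} [NormedAddCommGroup F]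
    (T : ℝ) (Ω : Set (Sp d)) (p : ℝ≥0∞) (u : ℝ → Sp d → F) : Prop :=
  ∀ S : Set (Sp d), IsCompact S → S ⊆ Ω →
    MemLp (Function.uncurry u) p (volume.restrict (Icc 0 T ×ˢ S))

/-- The norm of `L^∞([0,T]; Lᵖ(Ω))`. -/
def normLinfLp {d : ℕ} {F : Type*} [NormedAddCommGroup F]
    (T : ℝ) (Ω : Set (Sp d)) (p : ℝ≥0∞) (u : ℝ → Sp d → F) : ℝ≥0∞ :=
  essSup (fun t => eLpNorm (u t) p (volume.restrict Ω)) (volume.restrict (Icc 0 T))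

/-- Test functions for the continuity equation: once continuously differentiable up to the boundary,
with bounded support in `closure Ω` (no condition on `∂Ω`). -/
structure IsTestScalar {d : ℕ} (T : ℝ) (Ω : Set (Sp d)) (ψ : ℝ → Sp d → ℝ) : Prop where
  space : IsSpaceCk T Ω 1 ψ
  time : IsTimeC1 T Ω ψ
  support : ∃ R : ℝ, ∀ t ∈ Icc 0 T, ∀ x ∈ closure Ω, R < ‖x‖ → ψ t x = 0

/-- Test fields for the momentum equation: `C²` in space and `C¹` in time up to the boundary,
with bounded support in `closure Ω` and tangential on `∂Ω`. -/
structure IsTestField {d : ℕ} (T : ℝ) (Ω : C3Domain d) (φ : ℝ → Sp d → Sp d) : Prop where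
  space : IsSpaceCk T Ω.carrier 2 φ
  time : IsTimeC1 T Ω.carrier φ
  support : ∃ R : ℝ, ∀ t ∈ Icc 0 T, ∀ x ∈ closure Ω.carrier, R < ‖x‖ → φ t x = 0
  tangent : ∀ t ∈ Icc 0 T, ∀ x ∈ frontier Ω.carrier, ⟪φ t x, Ω.normal x⟫_ℝ = 0

/-! ### State functions -/

/-- Pressure `p(ρ) = ρ^γ`. -/
def pressure (γ ρ : ℝ) : ℝ := ρ ^ γ

/-- Internal energy density `f(ρ) = ρ^γ / (γ - 1)`. -/
def internalEnergy (γ ρ : ℝ) : ℝ := ρ ^ γ / (γ - 1)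

/-- Relative internal energy density `f(ρ|r) = f(ρ) - f'(r)(ρ - r) - f(r)`. -/
def relInternalEnergy (γ ρ r : ℝ) : ℝ :=
  internalEnergy γ ρ - deriv (internalEnergy γ) r * (ρ - r) - internalEnergy γ r

/-- Capillarity coefficient `k(ρ) = c_α ρ^α`. -/
def capillarity (c α ρ : ℝ) : ℝ := c * ρ ^ α

/-- `β(ρ) = ∫₀^ρ √k(s) ds` in closed form. -/
def capBeta (c α ρ : ℝ) : ℝ := 2 * √c / (2 + α) * ρ ^ (1 + α / 2)

/-- `K(ρ) = ∫₀^ρ s k(s) ds` in closed form. -/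
def capK (c α ρ : ℝ) : ℝ := c / (2 + α) * ρ ^ (2 + α)

theorem capBeta_eq_integral {c α ρ : ℝ} (hc : 0 < c) (hα : -1 ≤ α) (hρ : 0 ≤ ρ) :
    capBeta c α ρ = ∫ s in (0 : ℝ)..ρ, √(capillarity c α s) := by
  have h : ∀ s ∈ Set.uIcc 0 ρ, √(capillarity c α s) = √c * s ^ (α / 2) := by
    intro s hs
    rw [Set.uIcc_of_le hρ] at hs
    rw [capillarity, Real.sqrt_mul hc.le, Real.sqrt_eq_rpow (s ^ α), ← Real.rpow_mul hs.1]
    congr 2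
    ring
  rw [intervalIntegral.integral_congr h, intervalIntegral.integral_const_mul,
    integral_rpow (Or.inl (by linarith)), Real.zero_rpow (by linarith), capBeta, add_comm (α / 2) 1]
  have h2 : (2 + α) ≠ 0 := by linarith
  have h3 : (1 + α / 2) ≠ 0 := by linarith
  field_simp
  ring

theorem capK_eq_integral {c α ρ : ℝ} (hα : -1 ≤ α) (hρ : 0 ≤ ρ) :
    capK c α ρ = ∫ s in (0 : ℝ)..ρ, s * capillarity c α s := by
  have h : ∀ s ∈ Set.uIoc 0 ρ, s * capillarity c α s = c * s ^ (1 + α) := by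
    intro s hs
    rw [Set.uIoc_of_le hρ] at hs
    rw [capillarity, Real.rpow_add hs.1, Real.rpow_one]
    ring
  rw [intervalIntegral.integral_congr_ae (Filter.Eventually.of_forall h),
    intervalIntegral.integral_const_mul,
    integral_rpow (Or.inl (by linarith)), Real.zero_rpow (by linarith), capK,
    show 1 + α + 1 = 2 + α by ring]
  ring

/-- `K''(ρ) = (1 + α) k(ρ)`. -/
theorem deriv_deriv_capK {c α ρ : ℝ} (hα : -1 ≤ α) (hρ : 0 < ρ) :
    deriv (deriv (capK c α)) ρ = (1 + α) * capillarity c α ρ := by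
  have h1 : ∀ s : ℝ, 0 < s → deriv (capK c α) s = c * s ^ (1 + α) := by
    intro s hs
    have := ((Real.hasDerivAt_rpow_const (p := 2 + α) (Or.inl hs.ne')).const_mul
      (c / (2 + α))).deriv
    have h2 : (2 + α) ≠ 0 := by linarith
    calc deriv (capK c α) s = c / (2 + α) * ((2 + α) * s ^ (2 + α - 1)) := this
      _ = c * s ^ (1 + α) := by
        rw [show 2 + α - 1 = 1 + α by ring]; field_simp
  have h2 : deriv (capK c α) =ᶠ[𝓝 ρ] fun s => c * s ^ (1 + α) :=
    (eventually_gt_nhds hρ).mono h1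
  rw [h2.deriv_eq, ((Real.hasDerivAt_rpow_const (p := 1 + α) (Or.inl hρ.ne')).const_mul c).deriv,
    capillarity, show 1 + α - 1 = α by ring]
  ring

/-! ### Energies -/

/-- Total energy of a state `(ρ, J)`; the kinetic density `|J|²/ρ` is `0` where `ρ = 0`, `J = 0`
and `∞` where `ρ = 0`, `J ≠ 0`. The capillary energy is `(ε²/2) ∫ k(ρ)|∇ρ|² = (ε²/2) ∫ |∇β(ρ)|²`. -/
def totalEnergy {d : ℕ} (Ω : Set (Sp d)) (γ c α ε : ℝ) (ρ : Sp d → ℝ) (J : Sp d → Sp d) : ℝ≥0∞ :=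
  (∫⁻ x in Ω, (ENNReal.ofReal (‖J x‖ ^ 2 / 2) / ENNReal.ofReal (ρ x) +
      ENNReal.ofReal (internalEnergy γ (ρ x)))) +
    ENNReal.ofReal (ε ^ 2 / 2) * dirichletEnergy Ω (fun x => capBeta c α (ρ x))

/-- Total energy of a state in the variables `(ρ, Λ)`. -/
def totalEnergyPseudo {d : ℕ} (Ω : Set (Sp d)) (γ c α ε : ℝ) (ρ : Sp d → ℝ) (Λ : Sp d → Sp d) :
    ℝ≥0∞ :=
  (∫⁻ x in Ω, ENNReal.ofReal (‖Λ x‖ ^ 2 / 2 + internalEnergy γ (ρ x))) +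
    ENNReal.ofReal (ε ^ 2 / 2) * dirichletEnergy Ω (fun x => capBeta c α (ρ x))

/-- Relative entropy `𝓔([ρ, Λ] | [r, U])`. -/
def relEntropy {d : ℕ} (Ω : Set (Sp d)) (γ c α ε : ℝ) (ρ : Sp d → ℝ) (Λ : Sp d → Sp d)
    (r : Sp d → ℝ) (U : Sp d → Sp d) : ℝ≥0∞ :=
  (∫⁻ x in Ω, ENNReal.ofReal
      (‖Λ x - √(ρ x) • U x‖ ^ 2 / 2 + relInternalEnergy γ (ρ x) (r x))) +
    ENNReal.ofReal (ε ^ 2 / 2) * dirichletEnergy Ω (fun x => capBeta c α (ρ x))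

/-- The pseudo-velocity `Λ = J / √ρ` of a finite energy state (`0` where `ρ = 0`). -/
def pseudoVelocity {d : ℕ} (ρ : Sp d → ℝ) (J : Sp d → Sp d) (x : Sp d) : Sp d :=
  (√(ρ x))⁻¹ • J x

/-! ### Weak solutions of the Euler–Korteweg system -/

/-- The integrand of the space-time integral in the weak continuity equation:
`ρ ∂ₜψ + J · ∇ψ`. -/
def massIntegrand {d : ℕ} (T : ℝ) (ρ : ℝ → Sp d → ℝ) (J : ℝ → Sp d → Sp d) (ψ : ℝ → Sp d → ℝ)
    (t : ℝ) (x : Sp d) : ℝ :=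
  ρ t x * dt T ψ t x + ⟪J t x, gradient (ψ t) x⟫_ℝ

/-- The integrand of the space-time integral in the weak momentum equation:
`J·∂ₜφ + Λ⊗Λ:∇φ + p(ρ) div φ + ε² ∇β⊗∇β:∇φ + (ε²/2) K''(ρ)|∇ρ|² div φ + ε² ∇K·∇div φ`,
where `B` stands for `∇β(ρ)` and `H` for `∇K(ρ)`. Since `K'' = (1 + α) k` and
`k(ρ)|∇ρ|² = |∇β(ρ)|²`, the expression `K''(ρ)|∇ρ|²` is `(1 + α)|∇β(ρ)|²`. -/
def momentumIntegrand {d : ℕ} (T γ α ε : ℝ) (ρ : ℝ → Sp d → ℝ) (J Λ B H : ℝ → Sp d → Sp d)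
    (φ : ℝ → Sp d → Sp d) (t : ℝ) (x : Sp d) : ℝ :=
  ⟪J t x, dt T φ t x⟫_ℝ + ⟪Λ t x, fderiv ℝ (φ t) x (Λ t x)⟫_ℝ
    + pressure γ (ρ t x) * divg (φ t) x
    + ε ^ 2 * ⟪B t x, fderiv ℝ (φ t) x (B t x)⟫_ℝ
    + ε ^ 2 / 2 * ((1 + α) * ‖B t x‖ ^ 2) * divg (φ t) x
    + ε ^ 2 * ⟪H t x, gradient (divg (φ t)) x⟫_ℝ

/-- `(ρ, J)`, with pseudo-velocity `Λ` and `B = ∇β(ρ)`, `H = ∇K(ρ)`, is a finite energy weak solution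
on `[0,T] × Ω` with initial data `(ρ₀, J₀)` and no-flux boundary conditions (which are encoded in the
choice of the test functions). -/
structure IsWeakSolutionWith {d : ℕ} (Ω : C3Domain d) (γ c α ε T : ℝ)
    (ρ₀ : Sp d → ℝ) (J₀ : Sp d → Sp d) (ρ : ℝ → Sp d → ℝ) (J Λ B H : ℝ → Sp d → Sp d) :
    Prop where
  initial_nonneg : ∀ᵐ x ∂volume.restrict Ω.carrier, 0 ≤ ρ₀ x
  initial_rho : IntegrableOn ρ₀ Ω.carrier
  initial_J : IntegrableOn J₀ Ω.carrier
  initial_energy : totalEnergy Ω.carrier γ c α ε ρ₀ J₀ < ⊤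
  nonneg : ∀ t ∈ Icc 0 T, ∀ᵐ x ∂volume.restrict Ω.carrier, 0 ≤ ρ t x
  J_eq : ∀ t ∈ Icc 0 T, ∀ᵐ x ∂volume.restrict Ω.carrier, J t x = √(ρ t x) • Λ t x
  sqrt_rho_mem : LpLoc T Ω.carrier (ENNReal.ofReal (2 * γ)) (fun t x => √(ρ t x))
  Λ_mem : LpLoc T Ω.carrier 2 Λ
  grad_beta : ∀ᵐ t ∂volume.restrict (Icc 0 T),
    HasWeakGrad Ω.carrier (fun x => capBeta c α (ρ t x)) (B t)
  grad_beta_mem : LpLoc T Ω.carrier 2 B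
  grad_K : ∀ᵐ t ∂volume.restrict (Icc 0 T),
    HasWeakGrad Ω.carrier (fun x => capK c α (ρ t x)) (H t)
  grad_K_mem : LpLoc T Ω.carrier 1 H
  weak_mass : ∀ ψ : ℝ → Sp d → ℝ, IsTestScalar T Ω.carrier ψ →
    IntegrableOn (fun x => ρ T x * ψ T x) Ω.carrier ∧
    IntegrableOn (Function.uncurry (massIntegrand T ρ J ψ)) (Icc 0 T ×ˢ Ω.carrier) ∧
    (∫ x in Ω.carrier, ρ T x * ψ T x) - (∫ x in Ω.carrier, ρ₀ x * ψ 0 x) =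
      ∫ t in (0 : ℝ)..T, ∫ x in Ω.carrier, massIntegrand T ρ J ψ t x
  weak_momentum : ∀ φ : ℝ → Sp d → Sp d, IsTestField T Ω φ →
    IntegrableOn (fun x => ⟪J T x, φ T x⟫_ℝ) Ω.carrier ∧
    IntegrableOn (Function.uncurry (momentumIntegrand T γ α ε ρ J Λ B H φ))
      (Icc 0 T ×ˢ Ω.carrier) ∧
    (∫ x in Ω.carrier, ⟪J T x, φ T x⟫_ℝ) - (∫ x in Ω.carrier, ⟪J₀ x, φ 0 x⟫_ℝ) =
      ∫ t in (0 : ℝ)..T, ∫ x in Ω.carrier, momentumIntegrand T γ α ε ρ J Λ B H φ t x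
  energy_ineq : ∀ᵐ t ∂volume.restrict (Icc 0 T),
    totalEnergyPseudo Ω.carrier γ c α ε (ρ t) (Λ t) ≤ totalEnergy Ω.carrier γ c α ε ρ₀ J₀

/-- Finite energy weak solutions `(ρ, J)` with pseudo-velocity `Λ`. -/
def IsFiniteEnergyWeakSolution {d : ℕ} (Ω : C3Domain d) (γ c α ε T : ℝ)
    (ρ₀ : Sp d → ℝ) (J₀ : Sp d → Sp d) (ρ : ℝ → Sp d → ℝ) (J Λ : ℝ → Sp d → Sp d) : Prop :=
  ∃ B H : ℝ → Sp d → Sp d, IsWeakSolutionWith Ω γ c α ε T ρ₀ J₀ ρ J Λ B H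

/-! ### Strong solutions of the compressible Euler system -/

/-- `(ρ, u)` is a strong solution, of class `C²`, of the compressible Euler system on
`[0,T] × Ω` with `u · n = 0` on `∂Ω` and without vacuum. If `Ω` is bounded, then `[0,T] × closure Ω` is
compact and `rho_pos` says that `ρ` is bounded below by a positive constant. -/
structure IsStrongEulerSolution {d : ℕ} (Ω : C3Domain d) (γ T : ℝ)
    (ρ : ℝ → Sp d → ℝ) (u : ℝ → Sp d → Sp d) : Prop where
  rho_space : IsSpaceCk T Ω.carrier 2 ρ
  rho_time : IsTimeC1 T Ω.carrier ρ
  u_space : IsSpaceCk T Ω.carrier 2 u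
  u_time : IsTimeC1 T Ω.carrier u
  rho_pos : ∀ t ∈ Icc 0 T, ∀ x ∈ closure Ω.carrier, 0 < ρ t x
  mass : ∀ t ∈ Icc 0 T, ∀ x ∈ Ω.carrier,
    dt T ρ t x + divg (fun y => ρ t y • u t y) x = 0
  momentum : ∀ t ∈ Icc 0 T, ∀ x ∈ Ω.carrier,
    dt T (fun s y => ρ s y • u s y) t x
      + ∑ j : Fin d, fderiv ℝ (fun y => (ρ t y * u t y j) • u t y) x (EuclideanSpace.single j 1)
      + gradient (fun y => pressure γ (ρ t y)) x = 0
  no_flux : ∀ t ∈ Icc 0 T, ∀ x ∈ frontier Ω.carrier, ⟪u t x, Ω.normal x⟫_ℝ = 0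

end EulerKorteweg

end

open MeasureTheory Set Filter Topology
open scoped ENNReal ContDiff InnerProductSpace

noncomputable section

namespace EulerKorteweg

/-! ### Weak gradients -/

/-! The proof is the relative entropy method. Let (r, u) be the Euler solution and h = f'. Expanding
squares, the relative entropy density equals the energy density plus ρ(|u|²/2 - h(r)) - J·u + p(r)
(`relative_entropy_density_eq`). The energy is at most its initial value; the correction evolves by
the weak continuity equation tested with |u|²/2 - h(r), the weak momentum equation tested with u,
and the Euler equations. Inserting ∂ₜu + (u·∇)u = -∇h(r) cancels all terms linear in Λ
(`entropy_production_identity`). What is left is quadratic in Λ - √ρ u and in ε∇β(ρ), or a multiple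
of f(ρ|r), hence bounded by the relative entropy, except for the single term ε²∇K(ρ)·∇div u. A weak
form of Grönwall's lemma (`ae_le_exp_of_weak_inequality`) then gives
`IsStrongEulerSolution.exists_relative_entropy_bound`, and the theorem is reduced to ε²∫|∇K(ρ)| → 0
uniformly in time.

This smallness is `C3Domain.capillary_small`. Since K is a multiple of β², ε²‖∇K‖₁ is at most a
constant times (ε‖∇β‖₂)(ε‖β‖₂), and the first factor is bounded by the energy. The energy does not
make the second factor small, because ρ^(2+α) need not be controlled by ρ^γ. On a bounded range of
densities β² is at most a constant times ρ, and the mass is bounded. On a high level set, of small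
measure by Chebyshev, β(x) is compared with β(x+z) for the many short z that lead to low values;
this costs r‖∇β‖₂ with r as small as desired (`HasWeakGrad.lintegral_sq_superlevel_le`). Staying
inside Ω is possible by the interior cone property of a uniformly C³ boundary
(`C3Domain.exists_cone`).

On unbounded domains every test function carries a cutoff at scale R, whose gradient contributes
errors of order 1/R that vanish by the mass and energy bounds. As r may tend to zero at infinity, no
step uses a positive lower bound for r: ∇h(r) is bounded through the equation of motion
(`IsStrongEulerSolution.velocity_eq`), and the coercivity of f(ρ|r) is used in a scale-invariant
form with an error η r^γ (`exists_abs_sub_rpow_le`). The decay of the initial masses propagates in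
time, for the Euler solution by finite speed (`IsStrongEulerSolution.lintegral_outside_le`) and for
the weak solutions by a weighted mass estimate (`exists_tail_bound`).

Coercivity and decay turn a small relative entropy into L¹ and L^γ closeness of the densities, and J
- r u = √ρ(Λ - √ρ u) + (ρ - r)u gives the momentum. -/

theorem LocallyIntegrableOn.integrable_smul_test {d : ℕ} {F : Type*} [NormedAddCommGroup F]
    [NormedSpace ℝ F] {Ω : Set (Sp d)} {b : Sp d → F} (hb : LocallyIntegrableOn b Ω)
    {φ : Sp d → ℝ} (hφ : Continuous φ) (hφc : HasCompactSupport φ) (hφs : tsupport φ ⊆ Ω) :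
    Integrable (fun x => φ x • b x) := by
  have h1 : IntegrableOn b (tsupport φ) := hb.integrableOn_compact_subset hφs hφc
  have h2 : IntegrableOn (fun x => φ x • b x) (tsupport φ) :=
    h1.continuousOn_smul hφ.continuousOn hφc
  rw [integrableOn_iff_integrable_of_support_subset] at h2
  · exact h2
  · intro x hx
    by_contra hx'
    exact hx (by simp [image_eq_zero_of_notMem_tsupport hx'])

theorem HasWeakGrad.integral_fderiv {d : ℕ} {Ω : Set (Sp d)} {b : Sp d → ℝ} {G : Sp d → Sp d}
    (h : HasWeakGrad Ω b G) {φ : Sp d → ℝ} (hφ : ContDiff ℝ ∞ φ) (hφc : HasCompactSupport φ)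
    (hφs : tsupport φ ⊆ Ω) (z : Sp d) :
    ∫ x in Ω, b x * fderiv ℝ φ x z = -∫ x in Ω, φ x * ⟪G x, z⟫_ℝ := by
  have h1 := congrArg (fun y => ⟪z, y⟫_ℝ) (h.2.2 φ hφ hφc hφs)
  have i2 : IntegrableOn (fun x => φ x • G x) Ω :=
    (LocallyIntegrableOn.integrable_smul_test h.2.1 hφ.continuous hφc hφs).integrableOn
  have i1 : IntegrableOn (fun x => b x • gradient φ x) Ω := by
    refine Integrable.integrableOn ?_
    have hc : Continuous (gradient φ) := by
      unfold gradient
      exact (LinearIsometryEquiv.continuous _).comp (hφ.continuous_fderiv (by simp))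
    have hs : tsupport (gradient φ) ⊆ tsupport φ := by
      refine closure_minimal ?_ (isClosed_tsupport _)
      intro x hx
      by_contra hx'
      apply hx
      have : fderiv ℝ φ x = 0 := by
        have := support_fderiv_subset ℝ (f := φ)
        by_contra h0
        exact hx' (this h0)
      simp [gradient, this]
    have h1 : IntegrableOn b (tsupport φ) := h.1.integrableOn_compact_subset hφs hφc
    have h2 : IntegrableOn (fun x => b x • gradient φ x) (tsupport φ) :=
      h1.smul_continuousOn hc.continuousOn hφc
    rw [integrableOn_iff_integrable_of_support_subset] at h2
    · exact h2
    · intro x hx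
      by_contra hx'
      exact hx (by simp [image_eq_zero_of_notMem_tsupport (fun h => hx' (hs h))])
  simp only [inner_neg_right] at h1
  rw [← integral_inner i1, ← integral_inner i2] at h1
  calc _ = _ := by
        refine integral_congr_ae (Eventually.of_forall fun x => ?_)
        simp only [inner_smul_right]
        rw [real_inner_comm, gradient, InnerProductSpace.toDual_symm_apply]
    _ = _ := h1
    _ = _ := by
        congr 1
        refine integral_congr_ae (Eventually.of_forall fun x => ?_)
        simp only [inner_smul_right, real_inner_comm]

theorem HasWeakGrad.ae_unique {d : ℕ} {Ω : Set (Sp d)} (hΩ : IsOpen Ω) {b : Sp d → ℝ}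
    {G G' : Sp d → Sp d} (h : HasWeakGrad Ω b G) (h' : HasWeakGrad Ω b G') :
    ∀ᵐ x, x ∈ Ω → G x = G' x := by
  have := hΩ.ae_eq_zero_of_integral_contDiff_smul_eq_zero (μ := volume)
    (f := fun x => G x - G' x) (h.2.1.sub h'.2.1) ?_
  · filter_upwards [this] with x hx hxΩ
    exact sub_eq_zero.1 (hx hxΩ)
  · intro φ hφ hφc hφs
    have e1 := LocallyIntegrableOn.integrable_smul_test h.2.1 hφ.continuous hφc hφs
    have e2 := LocallyIntegrableOn.integrable_smul_test h'.2.1 hφ.continuous hφc hφs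
    simp only [smul_sub]
    rw [integral_sub e1 e2, sub_eq_zero]
    have key : ∀ F : Sp d → Sp d, ∫ x, φ x • F x = ∫ x in Ω, φ x • F x := by
      intro F
      rw [setIntegral_eq_integral_of_forall_compl_eq_zero]
      intro x hx
      simp [image_eq_zero_of_notMem_tsupport (fun h => hx (hφs h))]
    rw [key, key, ← neg_inj, ← h.2.2 φ hφ hφc hφs, ← h'.2.2 φ hφ hφc hφs]

theorem HasWeakGrad.congr {d : ℕ} {Ω : Set (Sp d)} {b b' : Sp d → ℝ}
    {G G' : Sp d → Sp d} (h : HasWeakGrad Ω b G) (hb : b =ᵐ[volume.restrict Ω] b')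
    (hG : G =ᵐ[volume.restrict Ω] G') : HasWeakGrad Ω b' G' := by
  refine ⟨h.1.congr hb, h.2.1.congr hG, fun φ h1 h2 h3 => ?_⟩
  have e1 : ∫ x in Ω, b' x • gradient φ x = ∫ x in Ω, b x • gradient φ x :=
    integral_congr_ae (by filter_upwards [hb] with x hx; rw [hx])
  have e2 : ∫ x in Ω, φ x • G' x = ∫ x in Ω, φ x • G x :=
    integral_congr_ae (by filter_upwards [hG] with x hx; rw [hx])
  rw [e1, e2]
  exact h.2.2 φ h1 h2 h3

/-- All weak gradients agree almost everywhere. The energy inequality bounds an infimum over weak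
gradients; this transfers the bound to the particular field carried by the solution. -/
theorem HasWeakGrad.lintegral_le_dirichletEnergy {d : ℕ} {Ω : Set (Sp d)} (hΩ : IsOpen Ω)
    {b : Sp d → ℝ} {G : Sp d → Sp d} (h : HasWeakGrad Ω b G) :
    ∫⁻ x in Ω, ENNReal.ofReal (‖G x‖ ^ 2) ≤ dirichletEnergy Ω b := by
  refine le_iInf₂ fun G' h' => le_of_eq (lintegral_congr_ae ?_)
  rw [EventuallyEq, ae_restrict_iff' hΩ.measurableSet]
  filter_upwards [h.ae_unique hΩ h'] with x hx hxΩ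
  rw [hx hxΩ]

/-! ### Translations along segments inside an open set -/

/-- The points `x` for which the segment `[x, x + z]` is contained in `Ω`. -/
def starSet {d : ℕ} (Ω : Set (Sp d)) (z : Sp d) : Set (Sp d) :=
  {x | ∀ s ∈ Icc (0 : ℝ) 1, x + s • z ∈ Ω}

/-- Tube lemma for the compact parameter interval. Joint openness is used twice: for the
measurability behind Tonelli's theorem, and to see that a compact subset of Ω stays inside Ω under
all small translations. -/
theorem isOpen_starSet_prod {d : ℕ} {Ω : Set (Sp d)} (hΩ : IsOpen Ω) :
    IsOpen {p : Sp d × Sp d | p.1 ∈ starSet Ω p.2} := by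
  rw [isOpen_iff_eventually]
  rintro p hp
  refine isCompact_Icc.eventually_forall_of_forall_eventually fun s hs => ?_
  have hc : Continuous fun q : (Sp d × Sp d) × ℝ => q.1.1 + q.2 • q.1.2 := by fun_prop
  exact hc.continuousAt.eventually (hΩ.mem_nhds (hp s hs))

theorem isOpen_starSet {d : ℕ} {Ω : Set (Sp d)} (hΩ : IsOpen Ω) (z : Sp d) :
    IsOpen (starSet Ω z) :=
  (isOpen_starSet_prod hΩ).preimage (f := fun x => (x, z)) (by fun_prop)

theorem integrable_prod_translate {d : ℕ} {B : Sp d → ℝ} (hBm : StronglyMeasurable B)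
    (hB : Integrable B) (z : Sp d) :
    Integrable (fun p : Sp d × ℝ => B (p.1 + p.2 • z))
      (volume.prod (volume.restrict (Icc (0 : ℝ) 1))) := by
  have hm : AEStronglyMeasurable (fun p : Sp d × ℝ => B (p.1 + p.2 • z))
      (volume.prod (volume.restrict (Icc (0 : ℝ) 1))) :=
    (hBm.comp_measurable (by fun_prop)).aestronglyMeasurable
  rw [integrable_prod_iff' hm]
  refine ⟨Eventually.of_forall fun τ => hB.comp_add_right (τ • z), ?_⟩
  have : ∀ τ : ℝ, ∫ x : Sp d, ‖B (x + τ • z)‖ = ∫ x, ‖B x‖ := fun τ =>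
    integral_add_right_eq_self (fun x => ‖B x‖) (τ • z)
  simp only [this]
  exact integrable_const _

/-- The union of the segments `[x, x + z]`, `x ∈ S`. -/
def segHull {d : ℕ} (S : Set (Sp d)) (z : Sp d) : Set (Sp d) :=
  (fun p : Sp d × ℝ => p.1 + p.2 • z) '' (S ×ˢ Icc (0 : ℝ) 1)

theorem isCompact_segHull {d : ℕ} {S : Set (Sp d)} (hS : IsCompact S) (z : Sp d) :
    IsCompact (segHull S z) :=
  (hS.prod isCompact_Icc).image (by fun_prop)

theorem segHull_subset {d : ℕ} {Ω S : Set (Sp d)} {z : Sp d} (h : S ⊆ starSet Ω z) :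
    segHull S z ⊆ Ω := by
  rintro _ ⟨p, hp, rfl⟩
  exact h hp.1 _ hp.2

theorem mem_segHull {d : ℕ} {S : Set (Sp d)} {z x : Sp d} {τ : ℝ} (hx : x ∈ S)
    (hτ : τ ∈ Icc (0 : ℝ) 1) : x + τ • z ∈ segHull S z :=
  ⟨(x, τ), ⟨hx, hτ⟩, rfl⟩

/-- Differentiate τ ↦ ∫ v φ(· - τz). By the definition of the weak gradient, with the shifted test
function, the derivative is ∫ φ ⟪B(· + τz), z⟫; integrate over [0,1] and exchange the integrals.
Strong measurability of `B` makes B(x + τz) jointly measurable. -/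
theorem HasWeakGrad.integral_translate {d : ℕ} {Ω : Set (Sp d)} {v : Sp d → ℝ}
    {B : Sp d → Sp d} (h : HasWeakGrad Ω v B) (hB : StronglyMeasurable B) {z : Sp d}
    {φ : Sp d → ℝ} (hφ : ContDiff ℝ ∞ φ) (hφc : HasCompactSupport φ)
    (hφs : tsupport φ ⊆ starSet Ω z) :
    ∫ x, φ x * (v (x + z) - v x - ∫ τ in Icc (0 : ℝ) 1, ⟪B (x + τ • z), z⟫_ℝ) = 0 := by
  set S := tsupport φ with hS
  have hSc : IsCompact S := hφc
  set S' := segHull S z with hS'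
  have hS'c : IsCompact S' := isCompact_segHull hSc z
  have hS'Ω : S' ⊆ Ω := segHull_subset hφs
  -- `v` and `B` are only locally integrable. Truncating to the compact hull `S'` of the segments
  -- changes no integral below and makes everything globally integrable.
  set v' : Sp d → ℝ := S'.indicator v with hv'
  set b : Sp d → ℝ := S'.indicator (fun y => ⟪B y, z⟫_ℝ) with hb
  have hv'i : Integrable v' :=
    (integrable_indicator_iff hS'c.measurableSet).2 (h.1.integrableOn_compact_subset hS'Ω hS'c)
  have hbm : StronglyMeasurable b :=
    (hB.inner stronglyMeasurable_const).indicator hS'c.measurableSet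
  have hbi : Integrable b := by
    refine (integrable_indicator_iff hS'c.measurableSet).2 ?_
    have := h.2.1.integrableOn_compact_subset hS'Ω hS'c
    exact this.inner_const z
  have hφ0 : ∀ x, x ∉ S → φ x = 0 := fun x hx => image_eq_zero_of_notMem_tsupport hx
  obtain ⟨C, hC⟩ : ∃ C, ∀ x, ‖fderiv ℝ φ x‖ ≤ C := by
    exact (hφ.continuous_fderiv (by simp)).bounded_above_of_compact_support (hφc.fderiv ℝ)
  obtain ⟨C0, hC0⟩ : ∃ C, ∀ x, ‖φ x‖ ≤ C :=
    hφ.continuous.bounded_above_of_compact_support hφc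
  have hdφ : ∀ x, HasFDerivAt φ (fderiv ℝ φ x) x := fun x =>
    (hφ.differentiable (by simp) x).hasFDerivAt
  -- the translated pairing
  set F : ℝ → ℝ := fun τ => ∫ y, v' y * φ (y - τ • z) with hF
  have hint : ∀ τ : ℝ, Integrable fun y => v' y * φ (y - τ • z) := fun τ => by
    refine hv'i.mul_bdd (c := C0) ?_ (Eventually.of_forall fun y => hC0 _)
    exact (hφ.continuous.comp (by fun_prop : Continuous fun y : Sp d => y - τ • z)).aestronglyMeasurable
  have hF' : ∀ τ : ℝ, HasDerivAt F (∫ y, -(v' y * fderiv ℝ φ (y - τ • z) z)) τ := by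
    intro τ
    refine (hasDerivAt_integral_of_dominated_loc_of_deriv_le (μ := volume) (s := univ)
      (F := fun τ y => v' y * φ (y - τ • z))
      (F' := fun τ y => -(v' y * fderiv ℝ φ (y - τ • z) z)) (x₀ := τ)
      (bound := fun y => ‖v' y‖ * (C * ‖z‖)) univ_mem ?_ (hint τ) ?_ ?_ ?_ ?_).2
    · exact Eventually.of_forall fun s => (hint s).aestronglyMeasurable
    · refine (hv'i.aestronglyMeasurable.mul ?_).neg
      refine Continuous.aestronglyMeasurable ?_
      have := hφ.continuous_fderiv (by simp)
      fun_prop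
    · refine Eventually.of_forall fun y s _ => ?_
      rw [norm_neg, norm_mul]
      gcongr
      exact (ContinuousLinearMap.le_opNorm _ _).trans (by gcongr; exact hC _)
    · exact hv'i.norm.mul_const _
    · refine Eventually.of_forall fun y s _ => ?_
      have h1 : HasDerivAt (fun s : ℝ => y - s • z) (-z) s := by
        simpa using ((hasDerivAt_id s).smul_const z).const_sub y
      have h2 := ((hdφ (y - s • z)).comp_hasDerivAt s h1).const_mul (v' y)
      simpa using h2
  -- For τ in [0,1] the shifted test function is supported in `S'`, hence in Ω; this is where the
  -- condition on the segments enters.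
  have hF'' : ∀ τ ∈ Icc (0 : ℝ) 1, ∫ y, -(v' y * fderiv ℝ φ (y - τ • z) z)
      = ∫ x, φ x * b (x + τ • z) := by
    intro τ hτ
    set φτ : Sp d → ℝ := fun y => φ (y - τ • z) with hφτ
    have c1 : ContDiff ℝ ∞ φτ := hφ.comp (by fun_prop)
    have hsup : ∀ y, y ∉ S' → φτ y = 0 := by
      intro y hy
      refine hφ0 _ fun hy' => hy ?_
      have := mem_segHull (z := z) hy' hτ
      simpa using this
    have c3 : tsupport φτ ⊆ S' := by
      refine closure_minimal ?_ hS'c.isClosed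
      intro y hy
      by_contra hy'
      exact hy (hsup y hy')
    have c2 : HasCompactSupport φτ := hS'c.of_isClosed_subset (isClosed_tsupport _) c3
    have key := h.integral_fderiv c1 c2 (c3.trans hS'Ω) z
    have hfd : ∀ y, fderiv ℝ φτ y = fderiv ℝ φ (y - τ • z) := fun y => by
      rw [hφτ, fderiv_comp_sub]
    have e1 : ∫ y, -(v' y * fderiv ℝ φ (y - τ • z) z) = - ∫ x in Ω, v x * fderiv ℝ φτ x z := by
      rw [integral_neg, setIntegral_eq_integral_of_forall_compl_eq_zero]
      · congr 1
        refine integral_congr_ae (Eventually.of_forall fun y => ?_)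
        by_cases hy : y ∈ S'
        · simp [hv', hy, hfd]
        · have : fderiv ℝ φτ y = 0 := by
            by_contra h0
            exact hy (c3 (support_fderiv_subset ℝ h0))
          simp [hv', hy, this]
      · intro y hy
        have : fderiv ℝ φτ y = 0 := by
          by_contra h0
          exact hy (hS'Ω (c3 (support_fderiv_subset ℝ h0)))
        simp [this]
    rw [e1, key, neg_neg, setIntegral_eq_integral_of_forall_compl_eq_zero]
    · rw [← integral_sub_right_eq_self (fun x => φ x * b (x + τ • z)) (τ • z)]
      refine integral_congr_ae (Eventually.of_forall fun y => ?_)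
      simp only [sub_add_cancel]
      by_cases hy : y ∈ S'
      · simp [hb, hy, hφτ]
      · have := hsup y hy
        simp only [hφτ] at this
        simp [hφτ, this]
    · intro y hy
      simp [hsup y (fun h => hy (hS'Ω h))]
  have hprod : Integrable (fun p : Sp d × ℝ => φ p.1 * b (p.1 + p.2 • z))
      (volume.prod (volume.restrict (Icc (0 : ℝ) 1))) := by
    refine (integrable_prod_translate hbm hbi z).bdd_mul (c := C0) ?_
      (Eventually.of_forall fun p => hC0 _)
    exact (hφ.continuous.comp continuous_fst).aestronglyMeasurable
  have hFTC : ∫ τ in (0 : ℝ)..1, (∫ y, -(v' y * fderiv ℝ φ (y - τ • z) z)) = F 1 - F 0 := by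
    refine intervalIntegral.integral_eq_sub_of_hasDerivAt (fun τ _ => hF' τ) ?_
    rw [intervalIntegrable_iff_integrableOn_Icc_of_le zero_le_one]
    exact hprod.integral_prod_right.congr (by
      rw [EventuallyEq, ae_restrict_iff' measurableSet_Icc]
      exact Eventually.of_forall fun τ hτ => (hF'' τ hτ).symm)
  have hswap : ∫ τ in (0 : ℝ)..1, (∫ y, -(v' y * fderiv ℝ φ (y - τ • z) z))
      = ∫ x, φ x * ∫ τ in Icc (0 : ℝ) 1, b (x + τ • z) := by
    rw [intervalIntegral.integral_of_le zero_le_one, ← integral_Icc_eq_integral_Ioc,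
      setIntegral_congr_fun measurableSet_Icc hF'', ← integral_integral_swap hprod]
    simp only [integral_const_mul]
  have hF1 : F 1 = ∫ x, φ x * v' (x + z) := by
    rw [hF, ← integral_sub_right_eq_self (fun x => φ x * v' (x + z)) z]
    simp only [one_smul, sub_add_cancel]
    simp only [mul_comm]
  have hF0 : F 0 = ∫ x, φ x * v' x := by
    simp only [hF, zero_smul, sub_zero, mul_comm]
  have hi1 : Integrable fun x => φ x * v' (x + z) :=
    (hv'i.comp_add_right z).bdd_mul (c := C0) hφ.continuous.aestronglyMeasurable
      (Eventually.of_forall hC0)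
  have hi0 : Integrable fun x => φ x * v' x :=
    hv'i.bdd_mul (c := C0) hφ.continuous.aestronglyMeasurable (Eventually.of_forall hC0)
  have hi2 : Integrable fun x => φ x * ∫ τ in Icc (0 : ℝ) 1, b (x + τ • z) := by
    have := hprod.integral_prod_left
    simpa only [integral_const_mul] using this
  have hpt : ∀ x, φ x * (v (x + z) - v x - ∫ τ in Icc (0 : ℝ) 1, ⟪B (x + τ • z), z⟫_ℝ)
      = φ x * v' (x + z) - φ x * v' x - φ x * ∫ τ in Icc (0 : ℝ) 1, b (x + τ • z) := by
    intro x
    by_cases hx : x ∈ S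
    · have m1 : x + z ∈ S' := by simpa using mem_segHull (z := z) hx (right_mem_Icc.2 zero_le_one)
      have m0 : x ∈ S' := by simpa using mem_segHull (z := z) hx (left_mem_Icc.2 zero_le_one)
      have : ∫ τ in Icc (0 : ℝ) 1, b (x + τ • z) = ∫ τ in Icc (0 : ℝ) 1, ⟪B (x + τ • z), z⟫_ℝ :=
        setIntegral_congr_fun measurableSet_Icc fun τ hτ => by
          have m : x + τ • z ∈ S' := mem_segHull hx hτ
          simp only [hb, indicator_of_mem m]
      rw [this]
      simp only [hv', indicator_of_mem m1, indicator_of_mem m0]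
      ring
    · simp [hφ0 x hx]
  simp only [hpt]
  rw [integral_sub (f := fun x => φ x * v' (x + z) - φ x * v' x) (hi1.sub hi0) hi2,
    integral_sub hi1 hi0, ← hF1, ← hF0, ← hswap, hFTC, sub_self]

theorem HasWeakGrad.ae_translate {d : ℕ} {Ω : Set (Sp d)} (hΩ : IsOpen Ω) {v : Sp d → ℝ}
    {B : Sp d → Sp d} (h : HasWeakGrad Ω v B) (hB : StronglyMeasurable B) (z : Sp d) :
    ∀ᵐ x, x ∈ starSet Ω z →
      v (x + z) - v x = ∫ τ in Icc (0 : ℝ) 1, ⟪B (x + τ • z), z⟫_ℝ := by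
  have hU := isOpen_starSet hΩ z
  have hli : LocallyIntegrableOn
      (fun x => v (x + z) - v x - ∫ τ in Icc (0 : ℝ) 1, ⟪B (x + τ • z), z⟫_ℝ) (starSet Ω z) := by
    rw [locallyIntegrableOn_iff hU.isLocallyClosed]
    intro S hSs hS
    have hS'Ω := segHull_subset hSs
    have hS'c := isCompact_segHull hS z
    have hv := h.1.integrableOn_compact_subset hS'Ω hS'c
    have hv' := (integrable_indicator_iff hS'c.measurableSet).2 hv
    have hb : Integrable ((segHull S z).indicator (fun y => ⟪B y, z⟫_ℝ)) := by
      refine (integrable_indicator_iff hS'c.measurableSet).2 ?_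
      exact (h.2.1.integrableOn_compact_subset hS'Ω hS'c).inner_const z
    have hbm : StronglyMeasurable ((segHull S z).indicator (fun y => ⟪B y, z⟫_ℝ)) :=
      (hB.inner stronglyMeasurable_const).indicator hS'c.measurableSet
    have hi := (((hv'.comp_add_right z).sub hv').sub
      (integrable_prod_translate hbm hb z).integral_prod_left).integrableOn (s := S)
    refine hi.congr_fun (fun x hx => ?_) hS.measurableSet
    have m1 : x + z ∈ segHull S z := by
      simpa using mem_segHull (z := z) hx (right_mem_Icc.2 zero_le_one)
    have m0 : x ∈ segHull S z := by
      simpa using mem_segHull (z := z) hx (left_mem_Icc.2 zero_le_one)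
    have : ∫ τ in Icc (0 : ℝ) 1, (segHull S z).indicator (fun y => ⟪B y, z⟫_ℝ) (x + τ • z)
        = ∫ τ in Icc (0 : ℝ) 1, ⟪B (x + τ • z), z⟫_ℝ :=
      setIntegral_congr_fun measurableSet_Icc fun τ hτ => by
        simp [mem_segHull (z := z) hx hτ]
    simp only [Pi.sub_apply, this, indicator_of_mem m1, indicator_of_mem m0]
  filter_upwards [hU.ae_eq_zero_of_integral_contDiff_smul_eq_zero hli
    fun φ h1 h2 h3 => h.integral_translate hB h1 h2 h3] with x hx hxU
  exact sub_eq_zero.1 (hx hxU)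

/-- The usual difference quotient bound: Cauchy–Schwarz in the segment parameter, then Tonelli and
translation invariance. Only segments inside Ω are used, so no extension operator is needed. -/
theorem HasWeakGrad.lintegral_translate_sq_le {d : ℕ} {Ω : Set (Sp d)} (hΩ : IsOpen Ω)
    {v : Sp d → ℝ} {B : Sp d → Sp d} (h : HasWeakGrad Ω v B) (hB : StronglyMeasurable B)
    (z : Sp d) :
    ∫⁻ x in starSet Ω z, ‖v (x + z) - v x‖ₑ ^ 2 ≤ ‖z‖ₑ ^ 2 * ∫⁻ x in Ω, ‖B x‖ₑ ^ 2 := by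
  -- Extension of the gradient by zero: on the segments it agrees with `B`, and it allows
  -- integration over the whole space, where translations preserve the measure.
  set Bi : Sp d → Sp d := Ω.indicator B with hBi
  have hBim : StronglyMeasurable Bi := hB.indicator hΩ.measurableSet
  have hpt : ∀ᵐ x ∂volume.restrict (starSet Ω z),
      ‖v (x + z) - v x‖ₑ ^ 2 ≤ ‖z‖ₑ ^ 2 * ∫⁻ τ in Icc (0 : ℝ) 1, ‖Bi (x + τ • z)‖ₑ ^ 2 := by
    rw [ae_restrict_iff' (isOpen_starSet hΩ z).measurableSet]
    filter_upwards [h.ae_translate hΩ hB z] with x hx hxU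
    rw [hx hxU]
    have h1 : ‖∫ τ in Icc (0 : ℝ) 1, ⟪B (x + τ • z), z⟫_ℝ‖ₑ
        ≤ ∫⁻ τ in Icc (0 : ℝ) 1, ‖z‖ₑ * ‖Bi (x + τ • z)‖ₑ := by
      refine (enorm_integral_le_lintegral_enorm _).trans ?_
      refine setLIntegral_mono' measurableSet_Icc fun τ hτ => ?_
      simp only [hBi, indicator_of_mem (hxU τ hτ)]
      rw [← enorm_norm z, ← enorm_norm (B _), ← enorm_mul, mul_comm]
      refine enorm_le_iff_norm_le.2 ?_
      simpa using norm_inner_le_norm (𝕜 := ℝ) (B (x + τ • z)) z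
    have hm : Measurable fun τ : ℝ => ‖Bi (x + τ • z)‖ₑ :=
      (hBim.comp_measurable (by fun_prop : Measurable fun τ : ℝ => x + τ • z)).enorm
    have h2 : (∫⁻ τ in Icc (0 : ℝ) 1, ‖Bi (x + τ • z)‖ₑ) ^ 2
        ≤ ∫⁻ τ in Icc (0 : ℝ) 1, ‖Bi (x + τ • z)‖ₑ ^ 2 := by
      have := ENNReal.lintegral_mul_le_Lp_mul_Lq (volume.restrict (Icc (0 : ℝ) 1))
        Real.HolderConjugate.two_two hm.aemeasurable (aemeasurable_const (b := (1 : ℝ≥0∞)))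
      simp only [Pi.mul_apply, mul_one, ENNReal.one_rpow, lintegral_const, Measure.restrict_apply,
        MeasurableSet.univ, univ_inter, Real.volume_Icc, sub_zero, ENNReal.ofReal_one] at this
      calc _ ≤ ((∫⁻ τ in Icc (0 : ℝ) 1, ‖Bi (x + τ • z)‖ₑ ^ (2 : ℝ)) ^ (1 / 2 : ℝ)) ^ 2 := by
            gcongr
        _ = _ := by
            rw [← ENNReal.rpow_natCast, ← ENNReal.rpow_mul]
            norm_num
    rw [lintegral_const_mul _ hm] at h1
    calc _ ≤ (‖z‖ₑ * ∫⁻ τ in Icc (0 : ℝ) 1, ‖Bi (x + τ • z)‖ₑ) ^ 2 := by gcongr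
      _ ≤ _ := by rw [mul_pow]; gcongr
  have hm2 : Measurable fun p : Sp d × ℝ => ‖Bi (p.1 + p.2 • z)‖ₑ ^ 2 :=
    ((hBim.comp_measurable (by fun_prop : Measurable fun p : Sp d × ℝ => p.1 + p.2 • z)).enorm).pow_const 2
  calc _ ≤ ∫⁻ x in starSet Ω z, ‖z‖ₑ ^ 2 * ∫⁻ τ in Icc (0 : ℝ) 1, ‖Bi (x + τ • z)‖ₑ ^ 2 :=
        lintegral_mono_ae hpt
    _ ≤ ∫⁻ x, ‖z‖ₑ ^ 2 * ∫⁻ τ in Icc (0 : ℝ) 1, ‖Bi (x + τ • z)‖ₑ ^ 2 :=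
        setLIntegral_le_lintegral _ _
    _ = ‖z‖ₑ ^ 2 * ∫⁻ x, ∫⁻ τ in Icc (0 : ℝ) 1, ‖Bi (x + τ • z)‖ₑ ^ 2 := by
        rw [lintegral_const_mul _ hm2.lintegral_prod_right']
    _ = ‖z‖ₑ ^ 2 * ∫⁻ τ in Icc (0 : ℝ) 1, ∫⁻ x, ‖Bi (x + τ • z)‖ₑ ^ 2 := by
        rw [lintegral_lintegral_swap hm2.aemeasurable]
    _ = ‖z‖ₑ ^ 2 * ∫⁻ τ in Icc (0 : ℝ) 1, ∫⁻ x, ‖Bi x‖ₑ ^ 2 := by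
        congr 2
        ext τ
        exact lintegral_add_right_eq_self (fun x => ‖Bi x‖ₑ ^ 2) (τ • z)
    _ = ‖z‖ₑ ^ 2 * ∫⁻ x, ‖Bi x‖ₑ ^ 2 := by simp
    _ = _ := by
        congr 1
        rw [← lintegral_indicator hΩ.measurableSet]
        congr 1
        ext x
        by_cases hx : x ∈ Ω <;> simp [hBi, hx]

/-! ### The interior cone property of uniformly `C³` domains -/

theorem C3Domain.isOpen {d : ℕ} (Ω : C3Domain d) : IsOpen Ω.carrier := by
  rw [Ω.carrier_eq]
  exact isOpen_lt Ω.contDiff_g.continuous continuous_const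

theorem C3Domain.hasFDerivAt_g {d : ℕ} (Ω : C3Domain d) (x : Sp d) :
    HasFDerivAt Ω.g (fderiv ℝ Ω.g x) x :=
  (Ω.contDiff_g.differentiable (by simp) x).hasFDerivAt

theorem C3Domain.exists_fderiv_lipschitz {d : ℕ} (Ω : C3Domain d) :
    ∃ M : ℝ, 0 < M ∧ ∀ x y, ‖fderiv ℝ Ω.g x - fderiv ℝ Ω.g y‖ ≤ M * ‖x - y‖ := by
  obtain ⟨M, hM⟩ := Ω.deriv_bound
  refine ⟨max M 1, by positivity, fun x y => ?_⟩
  have hd : ∀ x, DifferentiableAt ℝ (fderiv ℝ Ω.g) x := fun x =>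
    ((Ω.contDiff_g.fderiv_right (m := 2) (by norm_num)).differentiable (by simp)) x
  refine convex_univ.norm_image_sub_le_of_norm_fderiv_le (𝕜 := ℝ) (fun x _ => hd x)
    (fun x _ => ?_) (mem_univ y) (mem_univ x)
  have := hM 2 (by norm_num) (by norm_num) x
  rw [← norm_iteratedFDeriv_fderiv, norm_iteratedFDeriv_one] at this
  exact this.trans (le_max_left _ _)

theorem norm_gradient {d : ℕ} (g : Sp d → ℝ) (x : Sp d) : ‖gradient g x‖ = ‖fderiv ℝ g x‖ := by
  simp [gradient]

theorem inner_gradient {d : ℕ} (g : Sp d → ℝ) (x z : Sp d) :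
    ⟪gradient g x, z⟫_ℝ = fderiv ℝ g x z := by
  rw [gradient, InnerProductSpace.toDual_symm_apply]

/-- If the ball of radius h about x lies in Ω, every short z works. Otherwise a boundary point y
lies within distance h, and `g` decreases along every direction close to the inner normal at y, so
the segment cannot leave {g < 0}. Such directions fill a ball of radius h/8. -/
theorem C3Domain.exists_cone {d : ℕ} (Ω : C3Domain d) :
    ∃ h₀ : ℝ, 0 < h₀ ∧ ∀ h, 0 < h → h ≤ h₀ → ∀ x ∈ Ω.carrier,
      volume (Metric.ball (0 : Sp d) (h / 8))
        ≤ volume {z ∈ Metric.ball (0 : Sp d) h | x ∈ starSet Ω.carrier z} := by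
  obtain ⟨c, hc, hgrad⟩ := Ω.grad_lower
  obtain ⟨M, hM, hlip⟩ := Ω.exists_fderiv_lipschitz
  -- All points considered are within 2h of the boundary point y; for h ≤ c/(8M) the derivative of
  -- `g` varies there by at most c/4.
  refine ⟨c / (8 * M), by positivity, fun h hh hh0 x hx => ?_⟩
  have hhM : M * (2 * h) ≤ c / 4 := by
    rw [le_div_iff₀ (by positivity)] at hh0
    linarith
  by_cases hb : Metric.ball x h ⊆ Ω.carrier
  · refine measure_mono fun z hz => ?_
    have hz' : ‖z‖ < h / 8 := by simpa using hz
    refine ⟨by simp; linarith, fun s hs => hb ?_⟩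
    rw [Metric.mem_ball, dist_eq_norm, add_sub_cancel_left, norm_smul, Real.norm_of_nonneg hs.1]
    nlinarith [hs.1, hs.2, norm_nonneg z]
  have hxg : Ω.g x < 0 := by rw [Ω.carrier_eq] at hx; exact hx
  obtain ⟨w, hw, hwΩ⟩ := not_subset.1 hb
  have hwg : 0 ≤ Ω.g w := by
    rw [Ω.carrier_eq] at hwΩ
    exact not_lt.1 hwΩ
  have hgc := Ω.contDiff_g.continuous
  obtain ⟨s, hs, hsg⟩ : ∃ s ∈ Icc (0 : ℝ) 1, Ω.g (x + s • (w - x)) = 0 := by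
    have := intermediate_value_Icc (zero_le_one (α := ℝ))
      (f := fun s : ℝ => Ω.g (x + s • (w - x))) (by fun_prop)
    obtain ⟨s, hs, h⟩ := this ⟨by simpa using hxg.le, by simpa using hwg⟩
    exact ⟨s, hs, h⟩
  set y := x + s • (w - x) with hy
  have hxy : ‖x - y‖ ≤ h := by
    rw [hy, sub_add_cancel_left, norm_neg, norm_smul, Real.norm_of_nonneg hs.1]
    have : ‖w - x‖ < h := by simpa [dist_eq_norm] using hw
    nlinarith [hs.1, hs.2, norm_nonneg (w - x)]
  have hcy := hgrad y hsg
  set n := gradient Ω.g y with hn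
  have hn0 : 0 < ‖n‖ := hc.trans_le hcy
  set N := ‖n‖⁻¹ • n with hN
  have hN1 : ‖N‖ = 1 := by
    rw [hN, norm_smul, norm_inv, norm_norm, inv_mul_cancel₀ hn0.ne']
  -- The ball of radius h/8 is moved to the centre -(h/2)N, half a length h along the inner normal
  -- at y.
  rw [← Measure.addHaar_ball_center (volume : Measure (Sp d)) (-(h / 2) • N) (h / 8)]
  refine measure_mono fun z hz => ?_
  set w' := z - (-(h / 2) • N) with hw'
  have hw'n : ‖w'‖ < h / 8 := by
    rw [hw', ← dist_eq_norm]
    exact hz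
  have hz' : z = w' - (h / 2) • N := by rw [hw']; module
  have hzn : ‖z‖ < 5 * h / 8 := by
    calc ‖z‖ ≤ ‖w'‖ + ‖(h / 2) • N‖ := by rw [hz']; exact norm_sub_le _ _
      _ < h / 8 + h / 2 := by
          rw [norm_smul, hN1, Real.norm_of_nonneg (by positivity), mul_one]
          linarith
      _ = _ := by ring
  have hzN : ⟪N, z⟫_ℝ ≤ -(3 * h / 8) := by
    rw [hz', inner_sub_right, inner_smul_right, real_inner_self_eq_norm_sq, hN1]
    have := real_inner_le_norm N w'
    rw [hN1] at this
    linarith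
  -- Follows from ⟪N, z⟫ ≤ -3h/8 and ‖z‖ < 5h/8, since 3/8 > (1/2)(5/8). After the loss c/4 from the
  -- variation of the gradient a negative slope remains.
  have hnz : fderiv ℝ Ω.g y z ≤ -(c / 2) * ‖z‖ := by
    rw [← inner_gradient, ← hn]
    have : n = ‖n‖ • N := by rw [hN, smul_smul, mul_inv_cancel₀ hn0.ne', one_smul]
    rw [this, inner_smul_left]
    simp only [conj_trivial]
    nlinarith [norm_nonneg z]
  refine ⟨by simp; linarith, fun t ht => ?_⟩
  have hanti : AntitoneOn (fun t : ℝ => Ω.g (x + t • z)) (Icc 0 1) := by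
    have hder : ∀ t : ℝ, HasDerivAt (fun t : ℝ => Ω.g (x + t • z))
        (fderiv ℝ Ω.g (x + t • z) z) t := fun t => by
      have h1 : HasDerivAt (fun t : ℝ => x + t • z) z t := by
        simpa using ((hasDerivAt_id t).smul_const z).const_add x
      exact (Ω.hasFDerivAt_g _).comp_hasDerivAt t h1
    refine antitoneOn_of_deriv_nonpos (convex_Icc 0 1) (by fun_prop)
      (fun t _ => (hder t).differentiableAt.differentiableWithinAt) fun t ht => ?_
    rw [interior_Icc] at ht
    rw [(hder t).deriv]
    have h1 := (le_abs_self _).trans (((fderiv ℝ Ω.g (x + t • z) - fderiv ℝ Ω.g y).le_opNorm z))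
    have h2 : ‖x + t • z - y‖ ≤ 2 * h := by
      calc ‖x + t • z - y‖ = ‖(x - y) + t • z‖ := by congr 1; module
        _ ≤ ‖x - y‖ + ‖t • z‖ := norm_add_le _ _
        _ ≤ h + h := by
            rw [norm_smul, Real.norm_of_nonneg ht.1.le]
            nlinarith [ht.1, ht.2, norm_nonneg z]
        _ = _ := by ring
    have h3 : ‖fderiv ℝ Ω.g (x + t • z) - fderiv ℝ Ω.g y‖ ≤ c / 4 :=
      (hlip _ _).trans ((by gcongr : _ ≤ M * (2 * h)).trans hhM)
    have h4 : (fderiv ℝ Ω.g (x + t • z) - fderiv ℝ Ω.g y) z ≤ c / 4 * ‖z‖ :=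
      h1.trans (by gcongr)
    simp only [sub_apply] at h4
    nlinarith [norm_nonneg z]
  rw [Ω.carrier_eq]
  have := hanti (left_mem_Icc.2 zero_le_one) ht ht.1
  simp only [zero_smul, add_zero] at this
  exact lt_of_le_of_lt this hxg

/-! ### Square integrals over high level sets, by averaging over translations. -/

/-- A Poincaré-type inequality. Where v > 2M, a fixed amount of translations z leads to points with
v(x+z) ≤ M, so that v(x) is at most twice the increment; averaging the squared increments over z in
the ball brings in the translation estimate. The point is the factor r², which can be made small as
long as the set {v > M} is small compared with the cone volume κ. -/
theorem HasWeakGrad.lintegral_sq_superlevel_le {d : ℕ} {Ω : Set (Sp d)} (hΩ : IsOpen Ω)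
    {v : Sp d → ℝ} {B : Sp d → Sp d} (h : HasWeakGrad Ω v B) (hv : Measurable v)
    (hB : StronglyMeasurable B) {κ : ℝ≥0∞} (hκ : κ ≠ ⊤) {r M : ℝ} (hM : 0 ≤ M)
    (hcone : ∀ x ∈ Ω, κ ≤ volume {z ∈ Metric.ball (0 : Sp d) r | x ∈ starSet Ω z})
    (hsmall : volume {x ∈ Ω | M < v x} ≤ κ / 2) :
    κ / 2 * ∫⁻ x in {x ∈ Ω | 2 * M < v x}, ‖v x‖ₑ ^ 2
      ≤ 4 * (volume (Metric.ball (0 : Sp d) r) * ENNReal.ofReal r ^ 2)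
        * ∫⁻ x in Ω, ‖B x‖ₑ ^ 2 := by
  set Z : Set (Sp d × Sp d) := {p | p.2 ∈ Metric.ball (0 : Sp d) r ∧ p.1 ∈ starSet Ω p.2} with hZ
  have hZm : MeasurableSet Z :=
    ((Metric.isOpen_ball.preimage continuous_snd).inter (isOpen_starSet_prod hΩ)).measurableSet
  set Q : Sp d × Sp d → ℝ≥0∞ := Z.indicator fun p => ‖v (p.1 + p.2) - v p.1‖ₑ ^ 2 with hQ
  have hQm : Measurable Q := by
    refine Measurable.indicator ?_ hZm
    exact (((hv.comp (measurable_fst.add measurable_snd)).sub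
      (hv.comp measurable_fst)).enorm).pow_const 2
  have hGm : MeasurableSet {x ∈ Ω | 2 * M < v x} :=
    hΩ.measurableSet.inter (measurableSet_lt measurable_const hv)
  have hpt : ∀ x ∈ {x ∈ Ω | 2 * M < v x}, κ / 2 * ‖v x‖ₑ ^ 2 ≤ 4 * ∫⁻ z, Q (x, z) := by
    rintro x ⟨hx, hxv⟩
    have hx0 : 0 ≤ v x := by linarith
    set Y : Set (Sp d) := {z | (x, z) ∈ Z ∧ v (x + z) ≤ M} with hY
    have hYm : MeasurableSet Y := by
      refine MeasurableSet.inter (hZm.preimage (by fun_prop)) ?_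
      exact measurableSet_le (hv.comp (by fun_prop)) measurable_const
    -- The admissible z have measure at least κ, and those with v(x+z) > M at most κ/2, by
    -- translation invariance and `hsmall`.
    have hYv : κ / 2 ≤ volume Y := by
      have h1 : {z ∈ Metric.ball (0 : Sp d) r | x ∈ starSet Ω z}
          ⊆ Y ∪ (fun z => x + z) ⁻¹' {y ∈ Ω | M < v y} := by
        rintro z ⟨hz1, hz2⟩
        by_cases hz : v (x + z) ≤ M
        · exact Or.inl ⟨⟨hz1, hz2⟩, hz⟩
        · exact Or.inr ⟨by simpa using hz2 1 (right_mem_Icc.2 zero_le_one), not_le.1 hz⟩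
      have h2 := (hcone x hx).trans ((measure_mono h1).trans (measure_union_le _ _))
      rw [measure_preimage_add] at h2
      have h3 : κ / 2 + κ / 2 ≤ volume Y + κ / 2 := by
        rw [ENNReal.add_halves]
        exact h2.trans (by gcongr)
      exact (ENNReal.add_le_add_iff_right (ENNReal.div_ne_top hκ (by norm_num))).1 h3
    calc κ / 2 * ‖v x‖ₑ ^ 2 ≤ volume Y * ‖v x‖ₑ ^ 2 := by gcongr
      _ = ∫⁻ z in Y, ‖v x‖ₑ ^ 2 := by rw [lintegral_const, Measure.restrict_apply_univ, mul_comm]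
      _ ≤ ∫⁻ z in Y, 4 * Q (x, z) := by
          refine setLIntegral_mono' hYm fun z hz => ?_
          simp only [hQ, indicator_of_mem hz.1]
          -- From v(x) > 2M and v(x+z) ≤ M, the increment exceeds v(x)/2.
          have h1 : ‖v x‖ₑ ≤ 2 * ‖v (x + z) - v x‖ₑ := by
            have e2 : ‖(2 : ℝ) * (v (x + z) - v x)‖ₑ = 2 * ‖v (x + z) - v x‖ₑ := by
              rw [enorm_mul, Real.enorm_of_nonneg (by norm_num : (0 : ℝ) ≤ 2)]
              simp
            rw [← e2, enorm_le_iff_norm_le]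
            have := hz.2
            rw [norm_mul, Real.norm_of_nonneg hx0, Real.norm_two, Real.norm_eq_abs]
            linarith [neg_le_abs (v (x + z) - v x)]
          calc ‖v x‖ₑ ^ 2 ≤ (2 * ‖v (x + z) - v x‖ₑ) ^ 2 := by gcongr
            _ = _ := by rw [mul_pow]; norm_num
      _ ≤ ∫⁻ z, 4 * Q (x, z) := setLIntegral_le_lintegral _ _
      _ = _ := lintegral_const_mul _ (hQm.comp (by fun_prop))
  calc κ / 2 * ∫⁻ x in {x ∈ Ω | 2 * M < v x}, ‖v x‖ₑ ^ 2
      = ∫⁻ x in {x ∈ Ω | 2 * M < v x}, κ / 2 * ‖v x‖ₑ ^ 2 :=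
        (lintegral_const_mul _ (hv.enorm.pow_const 2)).symm
    _ ≤ ∫⁻ x in {x ∈ Ω | 2 * M < v x}, 4 * ∫⁻ z, Q (x, z) := setLIntegral_mono' hGm hpt
    _ ≤ ∫⁻ x, 4 * ∫⁻ z, Q (x, z) := setLIntegral_le_lintegral _ _
    _ = 4 * ∫⁻ x, ∫⁻ z, Q (x, z) := lintegral_const_mul _ hQm.lintegral_prod_right'
    _ = 4 * ∫⁻ z, ∫⁻ x, Q (x, z) := by rw [lintegral_lintegral_swap (f := fun x z => Q (x, z)) hQm.aemeasurable]
    _ ≤ 4 * ∫⁻ z, (Metric.ball (0 : Sp d) r).indicator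
          (fun _ => ENNReal.ofReal r ^ 2 * ∫⁻ x in Ω, ‖B x‖ₑ ^ 2) z := by
        gcongr with z
        by_cases hz : z ∈ Metric.ball (0 : Sp d) r
        · rw [indicator_of_mem hz]
          have e : ∀ x, Q (x, z) = (starSet Ω z).indicator (fun x => ‖v (x + z) - v x‖ₑ ^ 2) x := by
            intro x
            by_cases hx : x ∈ starSet Ω z
            · have : (x, z) ∈ Z := ⟨hz, hx⟩
              simp [hQ, this, hx]
            · have : (x, z) ∉ Z := fun h => hx h.2
              simp [hQ, this, hx]
          simp only [e]
          rw [lintegral_indicator (isOpen_starSet hΩ z).measurableSet]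
          refine (h.lintegral_translate_sq_le hΩ hB z).trans ?_
          gcongr
          rw [← ofReal_norm]
          exact ENNReal.ofReal_le_ofReal (by simpa using (mem_ball_zero_iff.1 hz).le)
        · have e : ∀ x, Q (x, z) = 0 := fun x =>
            indicator_of_notMem (fun h => hz h.1) _
          simp [e]
    _ = _ := by
        rw [lintegral_indicator Metric.isOpen_ball.measurableSet, lintegral_const,
          Measure.restrict_apply_univ]
        ring

/-! ### Duality between test functions and `L¹` -/

/-- The sign of `h` on a compact set S is the optimal bounded test function. Its mollifications are
smooth, bounded by one, supported in a thin neighbourhood of S inside Ω, and converge almost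
everywhere; then Ω is exhausted by compact sets. -/
theorem lintegral_enorm_le_of_test {d : ℕ} {Ω : Set (Sp d)} (hΩ : IsOpen Ω) {h : Sp d → ℝ}
    (hm : Measurable h) (hh : LocallyIntegrableOn h Ω) {C : ℝ}
    (hC : ∀ φ : Sp d → ℝ, ContDiff ℝ ∞ φ → HasCompactSupport φ → tsupport φ ⊆ Ω →
      (∀ x, ‖φ x‖ ≤ 1) → ∫ x, φ x * h x ≤ C) :
    ∫⁻ x in Ω, ‖h x‖ₑ ≤ ENNReal.ofReal C := by
  have key : ∀ S : Set (Sp d), IsCompact S → S ⊆ Ω → ∫⁻ x in S, ‖h x‖ₑ ≤ ENNReal.ofReal C := by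
    intro S hS hSΩ
    obtain ⟨δ, hδ, hδΩ⟩ := hS.exists_cthickening_subset_open hΩ hSΩ
    set S' := Metric.cthickening δ S with hS'
    have hS'c : IsCompact S' := hS.cthickening
    set σ : Sp d → ℝ := S.indicator fun x => if 0 ≤ h x then 1 else -1 with hσ
    have hσm : Measurable σ := by
      refine Measurable.indicator ?_ hS.measurableSet
      exact Measurable.ite (measurableSet_le measurable_const hm) measurable_const measurable_const
    have hσ1 : ∀ x, ‖σ x‖ ≤ 1 := by
      intro x
      by_cases hx : x ∈ S
      · simp only [hσ, indicator_of_mem hx]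
        split_ifs <;> simp
      · simp [hσ, hx]
    have hσi : Integrable σ := by
      have : Integrable (S.indicator fun _ : Sp d => (1 : ℝ)) :=
        (integrable_indicator_iff hS.measurableSet).2 (by
          simpa using hS.measure_lt_top)
      refine this.mono' hσm.aestronglyMeasurable (Eventually.of_forall fun x => ?_)
      by_cases hx : x ∈ S
      · simpa [hx] using hσ1 x
      · simp [hσ, hx]
    -- The ratio of the radii is kept equal to 2, because almost everywhere convergence of the
    -- mollifications requires a bounded ratio; the outer radius is at most δ, so the supports stay
    -- in `S'`.
    let B : ℕ → ContDiffBump (0 : Sp d) := fun n =>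
      { rIn := δ / (2 * (n + 1)), rOut := δ / (n + 1), rIn_pos := by positivity,
        rIn_lt_rOut := by
          apply div_lt_div_of_pos_left hδ (by positivity)
          have : (0 : ℝ) ≤ n := n.cast_nonneg
          linarith }
    have hB0 : Tendsto (fun n => (B n).rOut) atTop (𝓝 0) := by
      have := (tendsto_one_div_add_atTop_nhds_zero_nat (𝕜 := ℝ)).const_mul δ
      simpa [B, div_eq_mul_inv] using this
    have hBK : ∀ᶠ n in atTop, (B n).rOut ≤ 2 * (B n).rIn := Eventually.of_forall fun n => by
      simp only [B]
      apply le_of_eq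
      field_simp
    have hBδ : ∀ n, (B n).rOut ≤ δ := fun n => by
      simp only [B]
      apply div_le_self hδ.le
      have : (0 : ℝ) ≤ n := n.cast_nonneg
      linarith
    set f : ℕ → Sp d → ℝ := fun n => 
      convolution ((B n).normed volume) σ (ContinuousLinearMap.lsmul ℝ ℝ) volume with hf
    have hlim := ContDiffBump.ae_convolution_tendsto_right_of_locallyIntegrable (μ := volume)
      hB0 hBK hσi.locallyIntegrable
    have hfs : ∀ n, ContDiff ℝ ∞ (f n) := fun n =>
      (B n).hasCompactSupport_normed.contDiff_convolution_left _ (B n).contDiff_normed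
        hσi.locallyIntegrable
    have hfsup : ∀ n, tsupport (f n) ⊆ S' := by
      intro n
      refine closure_minimal ?_ hS'c.isClosed
      refine (support_convolution_subset _).trans ?_
      rintro _ ⟨a, ha, b, hb, rfl⟩
      rw [(B n).support_normed_eq] at ha
      have hbS : b ∈ S := by
        by_contra hb'
        exact hb (by simp [hσ, hb'])
      refine Metric.mem_cthickening_of_dist_le _ b δ S hbS ?_
      simp only [dist_eq_norm, add_sub_cancel_right]
      exact (mem_ball_zero_iff.1 ha).le.trans (hBδ n)
    have hf1 : ∀ n x, ‖f n x‖ ≤ 1 := by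
      intro n x
      rw [← (B n).integral_normed (μ := volume)]
      refine norm_integral_le_of_norm_le (B n).integrable_normed (Eventually.of_forall fun t => ?_)
      simp only [ContinuousLinearMap.lsmul_apply, norm_smul]
      rw [Real.norm_of_nonneg ((B n).nonneg_normed t)]
      exact mul_le_of_le_one_right ((B n).nonneg_normed t) (hσ1 _)
    have hhi : IntegrableOn h S' := hh.integrableOn_compact_subset hδΩ hS'c
    have hconv : Tendsto (fun n => ∫ x, f n x * h x) atTop (𝓝 (∫ x, σ x * h x)) := by
      refine tendsto_integral_of_dominated_convergence (S'.indicator fun x => ‖h x‖) ?_ ?_ ?_ ?_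
      · exact fun n => ((hfs n).continuous.measurable.mul hm).aestronglyMeasurable
      · exact (integrable_indicator_iff hS'c.measurableSet).2 hhi.norm
      · refine fun n => Eventually.of_forall fun x => ?_
        by_cases hx : x ∈ S'
        · rw [indicator_of_mem hx, norm_mul]
          exact mul_le_of_le_one_left (norm_nonneg _) (hf1 n x)
        · simp [hx, image_eq_zero_of_notMem_tsupport (fun h => hx (hfsup n h))]
      · filter_upwards [hlim] with x hx
        exact hx.mul_const _
    have hle : ∫ x, σ x * h x ≤ C := le_of_tendsto hconv (Eventually.of_forall fun n =>
      hC _ (hfs n) (hS'c.of_isClosed_subset (isClosed_tsupport _) (hfsup n))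
        ((hfsup n).trans hδΩ) (hf1 n))
    have hσh : ∀ x, σ x * h x = S.indicator (fun x => ‖h x‖) x := by
      intro x
      by_cases hx : x ∈ S
      · simp only [hσ, indicator_of_mem hx, Real.norm_eq_abs]
        split_ifs with h0
        · rw [abs_of_nonneg h0, one_mul]
        · rw [abs_of_neg (not_le.1 h0), neg_one_mul]
      · simp [hσ, hx]
    simp only [hσh] at hle
    rw [integral_indicator hS.measurableSet] at hle
    have hhS : IntegrableOn h S := hh.integrableOn_compact_subset hSΩ hS
    rw [← ofReal_integral_norm_eq_lintegral_enorm hhS]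
    exact ENNReal.ofReal_le_ofReal hle
  obtain ⟨F, hFc, hFU, hFun, hFm⟩ := hΩ.exists_iUnion_isClosed
  have hU : Ω = ⋃ n : ℕ, (F n ∩ Metric.closedBall (0 : Sp d) n) := by
    ext x
    simp only [mem_iUnion, mem_inter_iff]
    constructor
    · intro hx
      rw [← hFun] at hx
      obtain ⟨i, hi⟩ := mem_iUnion.1 hx
      obtain ⟨j, hj⟩ := exists_nat_ge ‖x‖
      refine ⟨max i j, hFm (le_max_left _ _) hi, ?_⟩
      simp only [mem_closedBall_zero_iff]
      exact hj.trans (by exact_mod_cast le_max_right _ _)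
    · rintro ⟨n, hn, -⟩
      exact hFU n hn
  have hmono : Monotone fun n : ℕ => F n ∩ Metric.closedBall (0 : Sp d) n := fun a b hab =>
    inter_subset_inter (hFm hab) (Metric.closedBall_subset_closedBall (by exact_mod_cast hab))
  rw [hU, setLIntegral_iUnion_of_directed _ hmono.directed_le]
  refine iSup_le fun n => key _ ((isCompact_closedBall _ _).inter_left (hFc n)) ?_
  exact inter_subset_left.trans (hFU n)

/-! ### The gradient of a square -/

theorem lintegral_enorm_mul_le_sqrt {X : Type*} [MeasurableSpace X] (μ : Measure X)
    {f g : X → ℝ} (hf : AEMeasurable f μ) (hg : AEMeasurable g μ) :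
    ∫⁻ x, ‖f x‖ₑ * ‖g x‖ₑ ∂μ
      ≤ (∫⁻ x, ‖f x‖ₑ ^ 2 ∂μ) ^ (1 / 2 : ℝ) * (∫⁻ x, ‖g x‖ₑ ^ 2 ∂μ) ^ (1 / 2 : ℝ) := by
  simpa using ENNReal.lintegral_mul_le_Lp_mul_Lq μ Real.HolderConjugate.two_two hf.enorm hg.enorm

/-- Factor the difference of squares and apply Cauchy–Schwarz: the difference is bounded by the
translation estimate, the sum by twice the L² norm of `v`. -/
theorem HasWeakGrad.lintegral_translate_sq_sub_sq_le {d : ℕ} {Ω : Set (Sp d)} (hΩ : IsOpen Ω)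
    {v : Sp d → ℝ} {B : Sp d → Sp d} (h : HasWeakGrad Ω v B) (hv : Measurable v)
    (hB : StronglyMeasurable B) (z : Sp d) :
    ∫⁻ x in starSet Ω z, ‖v (x + z) ^ 2 - v x ^ 2‖ₑ
      ≤ ‖z‖ₑ * (2 * ((∫⁻ x in Ω, ‖B x‖ₑ ^ 2) ^ (1 / 2 : ℝ)
        * (∫⁻ x in Ω, ‖v x‖ₑ ^ 2) ^ (1 / 2 : ℝ))) := by
  have hvz : Measurable fun x => v (x + z) := hv.comp (by fun_prop)
  have hAΩ : starSet Ω z ⊆ Ω := fun x hx => by simpa using hx 0 (left_mem_Icc.2 zero_le_one)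
  have hAm := (isOpen_starSet hΩ z).measurableSet
  have h1 : ∫⁻ x in starSet Ω z, ‖v (x + z) + v x‖ₑ ^ 2 ≤ 2 ^ 2 * ∫⁻ x in Ω, ‖v x‖ₑ ^ 2 := by
    calc _ ≤ ∫⁻ x in starSet Ω z, (2 * ‖v (x + z)‖ₑ ^ 2 + 2 * ‖v x‖ₑ ^ 2) := by
          refine lintegral_mono fun x => ?_
          have : ‖v (x + z) + v x‖ ^ 2 ≤ 2 * ‖v (x + z)‖ ^ 2 + 2 * ‖v x‖ ^ 2 := by
            simp only [Real.norm_eq_abs, sq_abs]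
            nlinarith [sq_nonneg (v (x + z) - v x)]
          have := ENNReal.ofReal_le_ofReal this
          rw [ENNReal.ofReal_add (by positivity) (by positivity), ENNReal.ofReal_mul (by norm_num),
            ENNReal.ofReal_mul (by norm_num), ENNReal.ofReal_pow (norm_nonneg _),
            ENNReal.ofReal_pow (norm_nonneg _), ENNReal.ofReal_pow (norm_nonneg _), ofReal_norm,
            ofReal_norm, ofReal_norm] at this
          simpa using this
      _ = 2 * (∫⁻ x in starSet Ω z, ‖v (x + z)‖ₑ ^ 2) + 2 * ∫⁻ x in starSet Ω z, ‖v x‖ₑ ^ 2 := by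
          rw [lintegral_add_left ((hvz.enorm.pow_const 2).const_mul 2),
            lintegral_const_mul _ (hvz.enorm.pow_const 2),
            lintegral_const_mul _ (hv.enorm.pow_const 2)]
      _ ≤ 2 * (∫⁻ x in Ω, ‖v x‖ₑ ^ 2) + 2 * ∫⁻ x in Ω, ‖v x‖ₑ ^ 2 := by
          refine add_le_add (mul_le_mul_right ?_ _) (by gcongr)
          have e : ∀ x, (starSet Ω z).indicator (fun x => ‖v (x + z)‖ₑ ^ 2) x
              ≤ Ω.indicator (fun x => ‖v x‖ₑ ^ 2) (x + z) := by
            intro x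
            by_cases hx : x ∈ starSet Ω z
            · have : x + z ∈ Ω := by simpa using hx 1 (right_mem_Icc.2 zero_le_one)
              simp [hx, this]
            · simp [hx]
          rw [← lintegral_indicator hAm, ← lintegral_indicator hΩ.measurableSet,
            ← lintegral_add_right_eq_self (Ω.indicator fun x => ‖v x‖ₑ ^ 2) z]
          exact lintegral_mono e
      _ = _ := by rw [← add_mul]; norm_num
  calc ∫⁻ x in starSet Ω z, ‖v (x + z) ^ 2 - v x ^ 2‖ₑ
      = ∫⁻ x in starSet Ω z, ‖v (x + z) - v x‖ₑ * ‖v (x + z) + v x‖ₑ := by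
        refine lintegral_congr fun x => ?_
        rw [← enorm_mul]
        congr 1
        ring
    _ ≤ _ := lintegral_enorm_mul_le_sqrt _ (hvz.sub hv).aemeasurable (hvz.add hv).aemeasurable
    _ ≤ (‖z‖ₑ ^ 2 * ∫⁻ x in Ω, ‖B x‖ₑ ^ 2) ^ (1 / 2 : ℝ)
        * (2 ^ 2 * ∫⁻ x in Ω, ‖v x‖ₑ ^ 2) ^ (1 / 2 : ℝ) := by
        gcongr
        exact h.lintegral_translate_sq_le hΩ hB z
    _ = _ := by
        have e : ∀ a : ℝ≥0∞, (a ^ 2) ^ (1 / 2 : ℝ) = a := fun a => by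
          rw [← ENNReal.rpow_natCast, ← ENNReal.rpow_mul]
          norm_num
        rw [ENNReal.mul_rpow_of_nonneg _ _ (by norm_num), ENNReal.mul_rpow_of_nonneg _ _ (by norm_num),
          e, e]
        ring

/-- Replaces the product rule ∇(a v²) = 2a v∇v, which is never proved: the derivative of φ is
approximated by difference quotients, these are moved onto v², and the L¹ bound for translates of v²
is linear in the step. -/
theorem HasWeakGrad.integral_grad_sq_le {d : ℕ} {Ω : Set (Sp d)} (hΩ : IsOpen Ω)
    {v : Sp d → ℝ} {B H : Sp d → Sp d} {a : ℝ} (ha : 0 ≤ a) (h : HasWeakGrad Ω v B)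
    (h' : HasWeakGrad Ω (fun x => a * v x ^ 2) H) (hv : Measurable v)
    (hB : StronglyMeasurable B) {b w : ℝ} (hb : 0 ≤ b) (hw : 0 ≤ w)
    (hb2 : (∫⁻ x in Ω, ‖B x‖ₑ ^ 2) ^ (1 / 2 : ℝ) ≤ ENNReal.ofReal b)
    (hw2 : (∫⁻ x in Ω, ‖v x‖ₑ ^ 2) ^ (1 / 2 : ℝ) ≤ ENNReal.ofReal w)
    (z : Sp d) {φ : Sp d → ℝ} (hφ : ContDiff ℝ ∞ φ) (hφc : HasCompactSupport φ)
    (hφs : tsupport φ ⊆ Ω) (hφ1 : ∀ x, ‖φ x‖ ≤ 1) :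
    ∫ x, φ x * ⟪H x, z⟫_ℝ ≤ a * (‖z‖ * (2 * (b * w))) := by
  set W : Sp d → ℝ := Ω.indicator fun x => v x ^ 2 with hW
  have hWm : Measurable W := (hv.pow_const 2).indicator hΩ.measurableSet
  have hWi : Integrable W := by
    refine ⟨hWm.aestronglyMeasurable, ?_⟩
    have h1 : ∫⁻ x in Ω, ‖v x‖ₑ ^ 2 < ⊤ := by
      by_contra hcon
      rw [not_lt, top_le_iff] at hcon
      rw [hcon, ENNReal.top_rpow_of_pos (by norm_num)] at hw2
      exact ENNReal.ofReal_ne_top (top_le_iff.1 hw2)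
    rw [hasFiniteIntegral_iff_enorm]
    refine lt_of_eq_of_lt ?_ h1
    rw [← lintegral_indicator hΩ.measurableSet]
    congr 1
    ext x
    by_cases hx : x ∈ Ω <;> simp [hW, hx, enorm_pow]
  have hφ0 : ∀ x, x ∉ tsupport φ → φ x = 0 := fun x hx => image_eq_zero_of_notMem_tsupport hx
  obtain ⟨C, hC⟩ : ∃ C, ∀ x, ‖fderiv ℝ φ x‖ ≤ C :=
    (hφ.continuous_fderiv (by simp)).bounded_above_of_compact_support (hφc.fderiv ℝ)
  have hd : ∀ x, HasFDerivAt φ (fderiv ℝ φ x) x := fun x =>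
    (hφ.differentiable (by simp) x).hasFDerivAt
  have hLHS : ∫ x, φ x * ⟪H x, z⟫_ℝ = a * -∫ x, W x * fderiv ℝ φ x z := by
    have h1 := h'.integral_fderiv hφ hφc hφs z
    have e1 : ∫ x in Ω, φ x * ⟪H x, z⟫_ℝ = ∫ x, φ x * ⟪H x, z⟫_ℝ :=
      setIntegral_eq_integral_of_forall_compl_eq_zero fun x hx => by
        simp [hφ0 x (fun h => hx (hφs h))]
    have e2 : ∫ x in Ω, a * v x ^ 2 * fderiv ℝ φ x z = a * ∫ x, W x * fderiv ℝ φ x z := by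
      rw [← integral_const_mul, ← integral_indicator hΩ.measurableSet]
      congr 1
      ext x
      by_cases hx : x ∈ Ω
      · simp [hW, hx, mul_assoc]
      · simp [hW, hx]
    rw [← e1, mul_neg, ← e2, h1, neg_neg]
  rw [hLHS]
  gcongr
  -- The quotient is taken backwards, so that the change of variables produces the forward increment
  -- of v², which is the one estimated above.
  have hlim : Tendsto (fun s : ℝ => -∫ x, W x * ((φ x - φ (x - s • z)) / s)) (𝓝[>] 0)
      (𝓝 (-∫ x, W x * fderiv ℝ φ x z)) := by
    refine (tendsto_integral_filter_of_dominated_convergence (fun x => ‖W x‖ * (C * ‖z‖))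
      ?_ ?_ ?_ ?_).neg
    · refine Eventually.of_forall fun s => hWm.aestronglyMeasurable.mul ?_
      have := hφ.continuous
      exact (by fun_prop : Continuous fun x => (φ x - φ (x - s • z)) / s).aestronglyMeasurable
    · filter_upwards [self_mem_nhdsWithin] with s hs
      refine Eventually.of_forall fun x => ?_
      rw [norm_mul]
      gcongr
      have h1 : ‖φ x - φ (x - s • z)‖ ≤ C * ‖x - (x - s • z)‖ :=
        convex_univ.norm_image_sub_le_of_norm_fderiv_le (𝕜 := ℝ)
          (fun y _ => (hd y).differentiableAt) (fun y _ => hC y) (mem_univ _) (mem_univ _)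
      have hs0 : (0 : ℝ) < s := hs
      rw [sub_sub_cancel, norm_smul, Real.norm_of_nonneg hs0.le] at h1
      rw [norm_div, Real.norm_of_nonneg hs0.le, div_le_iff₀ hs0]
      linarith
    · exact hWi.norm.mul_const _
    · refine Eventually.of_forall fun x => Tendsto.const_mul _ ?_
      have h1 : HasDerivAt (fun s : ℝ => -φ (x - s • z)) (fderiv ℝ φ x z) 0 := by
        have h2 : HasDerivAt (fun s : ℝ => x - s • z) (-z) 0 := by
          simpa using ((hasDerivAt_id (0 : ℝ)).smul_const z).const_sub x
        have h3 : HasFDerivAt φ (fderiv ℝ φ x) (x - (0 : ℝ) • z) := by simpa using hd x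
        have h4 := (h3.comp_hasDerivAt (0 : ℝ) h2).neg
        rw [map_neg, neg_neg] at h4
        exact h4
      have h4 := h1.tendsto_slope_zero_right
      refine h4.congr fun s => ?_
      simp only [zero_add, zero_smul, sub_zero, smul_eq_mul]
      rw [div_eq_inv_mul]
      ring
  have hev : ∀ᶠ z' : Sp d in 𝓝 0, ∀ x ∈ tsupport φ, x ∈ starSet Ω z' := by
    refine IsCompact.eventually_forall_of_forall_eventually hφc fun x hx => ?_
    have hc : Continuous fun p : Sp d × Sp d => (p.2, p.1) := by fun_prop
    refine hc.continuousAt.eventually ((isOpen_starSet_prod hΩ).mem_nhds ?_)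
    intro s _
    simpa using hφs hx
  -- For small s the segments starting in the support of φ stay in Ω, so the translation estimate
  -- applies on that support.
  have hev2 : ∀ᶠ s : ℝ in 𝓝[>] 0, ∀ x ∈ tsupport φ, x ∈ starSet Ω (s • z) := by
    have hc : Continuous fun s : ℝ => s • z := by fun_prop
    have := (hc.tendsto 0).mono_left (nhdsWithin_le_nhds (s := Ioi 0))
    rw [zero_smul] at this
    exact this.eventually hev
  refine le_of_tendsto hlim ?_
  filter_upwards [hev2, self_mem_nhdsWithin] with s hs hs0
  have hs0 : (0 : ℝ) < s := hs0
  have i1 : Integrable fun x => W x * φ x :=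
    hWi.mul_bdd (c := 1) hφ.continuous.aestronglyMeasurable (Eventually.of_forall hφ1)
  have i2 : Integrable fun x => W (x + s • z) * φ x :=
    (hWi.comp_add_right (s • z)).mul_bdd (c := 1) hφ.continuous.aestronglyMeasurable
      (Eventually.of_forall hφ1)
  have i3 : Integrable fun x => W x * φ (x - s • z) := by
    have := i2.comp_sub_right (s • z)
    simpa using this
  have e1 : -∫ x, W x * ((φ x - φ (x - s • z)) / s)
      = s⁻¹ * ∫ x, (W (x + s • z) - W x) * φ x := by
    have e2 : ∫ x, W x * φ (x - s • z) = ∫ x, W (x + s • z) * φ x := by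
      rw [← integral_sub_right_eq_self (fun x => W (x + s • z) * φ x) (s • z)]
      simp
    have e3 : ∀ x, W x * ((φ x - φ (x - s • z)) / s)
        = s⁻¹ * (W x * φ x - W x * φ (x - s • z)) := fun x => by
      rw [div_eq_inv_mul]; ring
    simp only [e3, sub_mul]
    rw [integral_const_mul, integral_sub i1 i3, integral_sub i2 i1, e2]
    ring
  have hle : ∫⁻ x, ‖(W (x + s • z) - W x) * φ x‖ₑ
      ≤ ENNReal.ofReal (s * ‖z‖ * (2 * (b * w))) := by
    calc _ ≤ ∫⁻ x, (starSet Ω (s • z)).indicator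
          (fun x => ‖v (x + s • z) ^ 2 - v x ^ 2‖ₑ) x := by
          refine lintegral_mono fun x => ?_
          by_cases hx : x ∈ tsupport φ
          · have hx' := hs x hx
            have m1 : x + s • z ∈ Ω := by simpa using hx' 1 (right_mem_Icc.2 zero_le_one)
            rw [indicator_of_mem hx', enorm_mul]
            simp only [hW, indicator_of_mem m1, indicator_of_mem (hφs hx)]
            refine mul_le_of_le_one_right zero_le ?_
            rw [← ofReal_norm]
            exact ENNReal.ofReal_le_one.2 (hφ1 x)
          · simp [hφ0 x hx]
      _ ≤ ‖s • z‖ₑ * (2 * ((∫⁻ x in Ω, ‖B x‖ₑ ^ 2) ^ (1 / 2 : ℝ)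
        * (∫⁻ x in Ω, ‖v x‖ₑ ^ 2) ^ (1 / 2 : ℝ))) := by
          rw [lintegral_indicator (isOpen_starSet hΩ _).measurableSet]
          exact h.lintegral_translate_sq_sub_sq_le hΩ hv hB _
      _ ≤ ENNReal.ofReal (s * ‖z‖) * (2 * (ENNReal.ofReal b * ENNReal.ofReal w)) := by
          gcongr
          rw [← ofReal_norm, norm_smul, Real.norm_of_nonneg hs0.le]
      _ = _ := by
          rw [ENNReal.ofReal_mul (p := s * ‖z‖) (by positivity),
            ENNReal.ofReal_mul (p := 2) (by norm_num), ENNReal.ofReal_mul hb]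
          simp
  rw [e1]
  have h5 : ∫ x, (W (x + s • z) - W x) * φ x ≤ s * ‖z‖ * (2 * (b * w)) := by
    refine (le_abs_self _).trans ?_
    rw [← Real.norm_eq_abs]
    refine (norm_integral_le_lintegral_norm _).trans ?_
    refine ENNReal.toReal_le_of_le_ofReal (by positivity) ?_
    simpa only [ofReal_norm] using hle
  calc _ ≤ s⁻¹ * (s * ‖z‖ * (2 * (b * w))) := by gcongr
    _ = _ := by field_simp

/-- Duality in each coordinate direction; summing the coordinates costs the factor d. -/
theorem HasWeakGrad.lintegral_grad_sq_le {d : ℕ} {Ω : Set (Sp d)} (hΩ : IsOpen Ω)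
    {v : Sp d → ℝ} {B H : Sp d → Sp d} {a : ℝ} (ha : 0 ≤ a) (h : HasWeakGrad Ω v B)
    (h' : HasWeakGrad Ω (fun x => a * v x ^ 2) H) (hv : Measurable v)
    (hB : StronglyMeasurable B) (hH : StronglyMeasurable H) {b w : ℝ} (hb : 0 ≤ b) (hw : 0 ≤ w)
    (hb2 : (∫⁻ x in Ω, ‖B x‖ₑ ^ 2) ^ (1 / 2 : ℝ) ≤ ENNReal.ofReal b)
    (hw2 : (∫⁻ x in Ω, ‖v x‖ₑ ^ 2) ^ (1 / 2 : ℝ) ≤ ENNReal.ofReal w) :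
    ∫⁻ x in Ω, ‖H x‖ₑ ≤ ENNReal.ofReal (d * (a * (2 * (b * w)))) := by
  have hcoord : ∀ i : Fin d, ∫⁻ x in Ω, ‖⟪H x, EuclideanSpace.single i (1 : ℝ)⟫_ℝ‖ₑ
      ≤ ENNReal.ofReal (a * (2 * (b * w))) := fun i => by
    refine lintegral_enorm_le_of_test hΩ (hH.inner stronglyMeasurable_const).measurable ?_
      fun φ h1 h2 h3 h4 => ?_
    · rw [locallyIntegrableOn_iff hΩ.isLocallyClosed]
      intro S hS hSc
      exact (h'.2.1.integrableOn_compact_subset hS hSc).inner_const _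
    · simpa using h.integral_grad_sq_le hΩ ha h' hv hB hb hw hb2 hw2
        (EuclideanSpace.single i (1 : ℝ)) h1 h2 h3 h4
  calc ∫⁻ x in Ω, ‖H x‖ₑ ≤ ∫⁻ x in Ω, ∑ i : Fin d, ‖⟪H x, EuclideanSpace.single i (1 : ℝ)⟫_ℝ‖ₑ := by
        refine lintegral_mono fun x => ?_
        have e : H x = ∑ i : Fin d, EuclideanSpace.single i (H x i) := by
          ext j
          simp [Finset.sum_apply]
        conv_lhs => rw [e]
        refine (enorm_sum_le _ _).trans (le_of_eq ?_)
        refine Finset.sum_congr rfl fun i _ => ?_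
        rw [← ofReal_norm, ← ofReal_norm, PiLp.norm_single, EuclideanSpace.inner_single_right]
        simp
    _ = ∑ i : Fin d, ∫⁻ x in Ω, ‖⟪H x, EuclideanSpace.single i (1 : ℝ)⟫_ℝ‖ₑ :=
        lintegral_finsetSum _ fun i _ => (hH.inner stronglyMeasurable_const).measurable.enorm
    _ ≤ ∑ i : Fin d, ENNReal.ofReal (a * (2 * (b * w))) := Finset.sum_le_sum fun i _ => hcoord i
    _ = _ := by
        rw [Finset.sum_const, Finset.card_univ, Fintype.card_fin, nsmul_eq_mul,
          ENNReal.ofReal_mul (p := (d : ℝ)) (by positivity), ENNReal.ofReal_natCast]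

/-! ### Smallness of the capillary flux -/

/-- For the power law capillarity, ∇K is the gradient of a multiple of β², which is what makes the
energy bound on ∇β usable. -/
theorem capK_eq {c α s : ℝ} (hc : 0 < c) (hα : -1 ≤ α) (hs : 0 ≤ s) :
    capK c α s = (2 + α) / 4 * capBeta c α s ^ 2 := by
  have h2 : (2 + α) ≠ 0 := by linarith
  rw [capK, capBeta, mul_pow, ← Real.rpow_natCast (s ^ (1 + α / 2)), ← Real.rpow_mul hs, div_pow,
    mul_pow, Real.sq_sqrt hc.le]
  rw [show (1 + α / 2) * ((2 : ℕ) : ℝ) = 2 + α by push_cast; ring]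
  field_simp
  ring

theorem capBeta_nonneg {c α s : ℝ} (hα : -1 ≤ α) (hs : 0 ≤ s) : 0 ≤ capBeta c α s := by
  have : 0 < 2 + α := by linarith
  unfold capBeta
  positivity

theorem capBeta_lt_capBeta {c α s t : ℝ} (hc : 0 < c) (hα : -1 ≤ α) (hs : 0 ≤ s) (h : s < t) :
    capBeta c α s < capBeta c α t := by
  have : 0 < 2 + α := by linarith
  have : 0 < √c := Real.sqrt_pos.2 hc
  unfold capBeta
  gcongr
  linarith

/-- The square of β is a constant times s^(1+α)·s. The hypothesis forces s ≤ 4L, and s^(1+α) is then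
bounded because 1+α ≥ 0. A factor s is kept for the mass. -/
theorem capBeta_sq_le {c α s L : ℝ} (hc : 0 < c) (hα : -1 ≤ α) (hs : 0 ≤ s) (hL : 0 ≤ L)
    (h : capBeta c α s ≤ 2 * capBeta c α L) :
    capBeta c α s ^ 2 ≤ 4 * c / (2 + α) ^ 2 * (4 * L) ^ (1 + α) * s := by
  have h2 : 0 < 2 + α := by linarith
  have hsL : s ≤ 4 * L := by
    by_contra hcon
    have h1 := capBeta_lt_capBeta hc hα (by positivity) (not_le.1 hcon)
    -- β(4L) = 4^(1+α/2) β(L), and the exponent is at least 1/2.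
    have h3 : 2 * capBeta c α L ≤ capBeta c α (4 * L) := by
      unfold capBeta
      rw [Real.mul_rpow (by norm_num) hL, mul_left_comm]
      have : (2 : ℝ) ≤ 4 ^ (1 + α / 2) := by
        calc (2 : ℝ) = 4 ^ (1 / 2 : ℝ) := by
              rw [show (4 : ℝ) = 2 ^ (2 : ℝ) by norm_num, ← Real.rpow_mul (by norm_num)]
              norm_num
          _ ≤ _ := Real.rpow_le_rpow_of_exponent_le (by norm_num) (by linarith)
      rw [show (2 * √c / (2 + α)) * (4 ^ (1 + α / 2) * L ^ (1 + α / 2))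
        = 4 ^ (1 + α / 2) * (2 * √c / (2 + α) * L ^ (1 + α / 2)) by ring,
        show 2 * √c / (2 + α) * (2 * L ^ (1 + α / 2))
        = 2 * (2 * √c / (2 + α) * L ^ (1 + α / 2)) by ring]
      gcongr
    linarith
  have e : capBeta c α s ^ 2 = 4 * c / (2 + α) ^ 2 * (s ^ (1 + α) * s) := by
    rcases hs.eq_or_lt with rfl | hs'
    · simp [capBeta, Real.zero_rpow (by linarith : 1 + α / 2 ≠ 0)]
    rw [capBeta, mul_pow, ← Real.rpow_natCast (s ^ (1 + α / 2)), ← Real.rpow_mul hs, div_pow,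
      mul_pow, Real.sq_sqrt hc.le, ← Real.rpow_add_one hs'.ne']
    norm_num
    left
    ring_nf
  rw [e, mul_assoc]
  have : s ^ (1 + α) ≤ (4 * L) ^ (1 + α) := Real.rpow_le_rpow hs hsL (by linarith)
  gcongr

theorem measurable_capBeta {c α : ℝ} : Measurable (capBeta c α) := by
  unfold capBeta
  fun_prop

/-- It suffices that ε²‖β(ρ)‖₂² ≤ τ for a suitable τ. Low densities contribute at most ε² C_L m and
high densities at most a constant times r²E. The constants are chosen in the order r, then L, then
ε₀: r absorbs the gradient, L makes the high level set small compared with the cone volume at scale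
r, and ε₀ absorbs C_L. -/
theorem C3Domain.capillary_small_of_measurable {d : ℕ} (Ω : C3Domain d) {c α : ℝ} (hc : 0 < c)
    (hα : -1 ≤ α) {m E η : ℝ} (hm : 0 ≤ m) (hE : 0 ≤ E) (hη : 0 < η) :
    ∃ ε₀ : ℝ, 0 < ε₀ ∧ ∀ ε, 0 < ε → ε ≤ ε₀ → ∀ (ρ : Sp d → ℝ) (B H : Sp d → Sp d),
      Measurable ρ → (∀ x, 0 ≤ ρ x) → StronglyMeasurable B → StronglyMeasurable H →
      ∫⁻ x in Ω.carrier, ENNReal.ofReal (ρ x) ≤ ENNReal.ofReal m →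
      HasWeakGrad Ω.carrier (fun x => capBeta c α (ρ x)) B →
      HasWeakGrad Ω.carrier (fun x => capK c α (ρ x)) H →
      ∫⁻ x in Ω.carrier, ‖B x‖ₑ ^ 2 ≤ ENNReal.ofReal (E / ε ^ 2) →
      ∫⁻ x in Ω.carrier, ‖H x‖ₑ ≤ ENNReal.ofReal (η / ε ^ 2) := by
  have h2 : 0 < 2 + α := by linarith
  obtain ⟨h₀, hh₀, hcone⟩ := Ω.exists_cone
  set D : ℝ := d * ((2 + α) / 4 * (2 * √E)) with hD
  have hD0 : 0 ≤ D := by positivity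
  -- The final bound is D√τ/ε², and this choice makes D√τ = Dη/(D+1) ≤ η.
  set τ : ℝ := (η / (D + 1)) ^ 2 with hτ
  have hτ0 : 0 < τ := by positivity
  -- Three requirements: the cone property at scale r, r² ≤ r, and the share τ/2 for high densities.
  -- The factor 8·8^d comes from comparing the ball of radius r with the cone volume κ, a ball of
  -- radius r/8.
  set r : ℝ := min h₀ (min 1 (τ / (2 * (8 * 8 ^ d * E + 1)))) with hr
  have hr0 : 0 < r := by positivity
  have hrτ : 8 * 8 ^ d * r ^ 2 * E ≤ τ / 2 := by
    have r1 : r ≤ 1 := (min_le_right _ _).trans (min_le_left _ _)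
    have r2 : r ≤ τ / (2 * (8 * 8 ^ d * E + 1)) := (min_le_right _ _).trans (min_le_right _ _)
    rw [le_div_iff₀ (by positivity)] at r2
    have : (0 : ℝ) ≤ 8 * 8 ^ d * E := by positivity
    nlinarith
  set κ : ℝ≥0∞ := volume (Metric.ball (0 : Sp d) (r / 8)) with hκ
  have hκ0 : κ ≠ 0 := (Metric.measure_ball_pos _ _ (by positivity)).ne'
  have hκt : κ ≠ ⊤ := measure_ball_lt_top.ne
  have hκr : 0 < κ.toReal := ENNReal.toReal_pos hκ0 hκt
  have hball : volume (Metric.ball (0 : Sp d) r) = 8 ^ d * κ := by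
    have := Measure.addHaar_ball_mul_of_pos (volume : Measure (Sp d)) 0 (r := 8) (by norm_num)
      (r / 8)
    rw [show 8 * (r / 8) = r by ring, finrank_euclideanSpace_fin, ENNReal.ofReal_pow (by norm_num)]
      at this
    simpa using this
  -- By Chebyshev's inequality {ρ ≥ L} has measure at most m/L ≤ κ/2; m + 1 keeps L positive when m
  -- = 0.
  set L : ℝ := 2 * (m + 1) / κ.toReal with hL
  have hL0 : 0 < L := by positivity
  set CL : ℝ := 4 * c / (2 + α) ^ 2 * (4 * L) ^ (1 + α) with hCL
  have hCL0 : 0 ≤ CL := by positivity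
  -- With ε² ≤ ε this leaves the share τ/2 for low densities.
  refine ⟨min 1 (τ / (2 * (CL * m + 1))), by positivity, fun ε hε hε0 ρ B H hρ hρ0 hB hH hρm hβ hK hBE => ?_⟩
  have hετ : ε ^ 2 * (CL * m) ≤ τ / 2 := by
    have r1 : ε ≤ 1 := hε0.trans (min_le_left _ _)
    have r2 : ε ≤ τ / (2 * (CL * m + 1)) := hε0.trans (min_le_right _ _)
    rw [le_div_iff₀ (by positivity)] at r2
    have : (0 : ℝ) ≤ CL * m := by positivity
    nlinarith
  set v : Sp d → ℝ := fun x => capBeta c α (ρ x) with hv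
  have hvm : Measurable v := measurable_capBeta.comp hρ
  have hv0 : ∀ x, 0 ≤ v x := fun x => capBeta_nonneg hα (hρ0 x)
  have hM0 : 0 ≤ capBeta c α L := capBeta_nonneg hα hL0.le
  have hΩm := Ω.isOpen.measurableSet
  have hsmall : volume {x ∈ Ω.carrier | capBeta c α L < v x} ≤ κ / 2 := by
    have hsub : {x ∈ Ω.carrier | capBeta c α L < v x}
        ⊆ {x | ENNReal.ofReal L ≤ ENNReal.ofReal (ρ x)} ∩ Ω.carrier := by
      rintro x ⟨hx, hxv⟩
      refine ⟨ENNReal.ofReal_le_ofReal ?_, hx⟩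
      by_contra hcon
      exact (capBeta_lt_capBeta hc hα (hρ0 x) (not_le.1 hcon)).not_gt hxv
    have h1 := mul_meas_ge_le_lintegral₀ (μ := volume.restrict Ω.carrier)
      hρ.ennreal_ofReal.aemeasurable (ENNReal.ofReal L)
    rw [Measure.restrict_apply' hΩm] at h1
    have h3 : ENNReal.ofReal L * volume {x ∈ Ω.carrier | capBeta c α L < v x} ≤ ENNReal.ofReal m :=
      (mul_le_mul_right (measure_mono hsub) _).trans (h1.trans hρm)
    have h4 : ENNReal.ofReal m ≤ ENNReal.ofReal L * (κ / 2) := by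
      have e : κ / 2 = ENNReal.ofReal (κ.toReal / 2) := by
        rw [ENNReal.ofReal_div_of_pos (by norm_num), ENNReal.ofReal_toReal hκt]
        simp
      rw [e, ← ENNReal.ofReal_mul hL0.le]
      refine ENNReal.ofReal_le_ofReal ?_
      rw [hL]
      field_simp
      linarith
    refine (ENNReal.mul_le_mul_iff_right (a := ENNReal.ofReal L) ?_ ENNReal.ofReal_ne_top).1 (h3.trans h4)
    simpa using hL0
  have hsup := hβ.lintegral_sq_superlevel_le Ω.isOpen hvm hB hκt hM0
    (hcone r hr0 (min_le_left _ _)) hsmall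
  have hsup2 : ∫⁻ x in {x ∈ Ω.carrier | 2 * capBeta c α L < v x}, ‖v x‖ₑ ^ 2
      ≤ ENNReal.ofReal (8 * 8 ^ d * r ^ 2 * (E / ε ^ 2)) := by
    have hk2 : κ / 2 ≠ 0 := by simp [hκ0]
    have hk3 : κ / 2 ≠ ⊤ := ENNReal.div_ne_top hκt (by norm_num)
    refine (ENNReal.mul_le_mul_iff_right hk2 hk3).1 (hsup.trans ?_)
    have e : ENNReal.ofReal (8 * 8 ^ d * r ^ 2 * (E / ε ^ 2))
        = 8 * 8 ^ d * ENNReal.ofReal r ^ 2 * ENNReal.ofReal (E / ε ^ 2) := by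
      rw [ENNReal.ofReal_mul (by positivity), ENNReal.ofReal_mul (by positivity),
        ENNReal.ofReal_mul (by positivity), ENNReal.ofReal_pow (by positivity),
        ENNReal.ofReal_pow hr0.le]
      simp
    have e2 : κ = κ / 2 * 2 := (ENNReal.div_mul_cancel (by norm_num) (by norm_num)).symm
    rw [e, hball]
    calc _ ≤ 4 * (8 ^ d * κ * ENNReal.ofReal r ^ 2) * ENNReal.ofReal (E / ε ^ 2) := by gcongr
      _ = 4 * (8 ^ d * (κ / 2 * 2) * ENNReal.ofReal r ^ 2) * ENNReal.ofReal (E / ε ^ 2) := by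
          rw [← e2]
      _ = _ := by ring
  have hlow : ∫⁻ x in {x ∈ Ω.carrier | v x ≤ 2 * capBeta c α L}, ‖v x‖ₑ ^ 2
      ≤ ENNReal.ofReal (CL * m) := by
    have hpt : ∀ x ∈ {x ∈ Ω.carrier | v x ≤ 2 * capBeta c α L},
        ‖v x‖ₑ ^ 2 ≤ ENNReal.ofReal CL * ENNReal.ofReal (ρ x) := by
      rintro x ⟨-, hx⟩
      rw [← ENNReal.ofReal_mul hCL0, ← ofReal_norm, ← ENNReal.ofReal_pow (norm_nonneg _)]
      refine ENNReal.ofReal_le_ofReal ?_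
      rw [Real.norm_eq_abs, sq_abs]
      exact capBeta_sq_le hc hα (hρ0 x) hL0.le hx
    calc _ ≤ ∫⁻ x in {x ∈ Ω.carrier | v x ≤ 2 * capBeta c α L},
          ENNReal.ofReal CL * ENNReal.ofReal (ρ x) :=
          setLIntegral_mono' (hΩm.inter (measurableSet_le hvm measurable_const)) hpt
      _ ≤ ∫⁻ x in Ω.carrier, ENNReal.ofReal CL * ENNReal.ofReal (ρ x) :=
          lintegral_mono_set fun x hx => hx.1
      _ = ENNReal.ofReal CL * ∫⁻ x in Ω.carrier, ENNReal.ofReal (ρ x) :=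
          lintegral_const_mul _ hρ.ennreal_ofReal
      _ ≤ _ := by rw [ENNReal.ofReal_mul hCL0]; gcongr
  have hV : ∫⁻ x in Ω.carrier, ‖v x‖ₑ ^ 2 ≤ ENNReal.ofReal (τ / ε ^ 2) := by
    have hsplit : Ω.carrier ⊆ {x ∈ Ω.carrier | v x ≤ 2 * capBeta c α L}
        ∪ {x ∈ Ω.carrier | 2 * capBeta c α L < v x} := fun x hx => by
      rcases le_or_gt (v x) (2 * capBeta c α L) with h | h
      · exact Or.inl ⟨hx, h⟩
      · exact Or.inr ⟨hx, h⟩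
    calc _ ≤ _ := lintegral_mono_set hsplit
      _ ≤ _ := lintegral_union_le _ _ _
      _ ≤ _ := add_le_add hlow hsup2
      _ = _ := (ENNReal.ofReal_add (by positivity) (by positivity)).symm
      _ ≤ _ := by
          refine ENNReal.ofReal_le_ofReal ?_
          rw [le_div_iff₀ (by positivity), add_mul]
          have : 8 * 8 ^ d * r ^ 2 * (E / ε ^ 2) * ε ^ 2 = 8 * 8 ^ d * r ^ 2 * E := by
            field_simp
          linarith
  have hsqrt : ∀ a : ℝ, 0 ≤ a → ENNReal.ofReal (a / ε ^ 2) ^ (1 / 2 : ℝ) = ENNReal.ofReal (√a / ε) := by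
    intro a ha
    rw [ENNReal.ofReal_rpow_of_nonneg (by positivity) (by norm_num), ← Real.sqrt_eq_rpow,
      Real.sqrt_div ha, Real.sqrt_sq hε.le]
  have hK' : HasWeakGrad Ω.carrier (fun x => (2 + α) / 4 * v x ^ 2) H := by
    refine hK.congr (Eventually.of_forall fun x => ?_) EventuallyEq.rfl
    exact capK_eq hc hα (hρ0 x)
  refine (hβ.lintegral_grad_sq_le Ω.isOpen (by positivity) hK' hvm hB hH
    (b := √E / ε) (w := √τ / ε) (by positivity) (by positivity) ?_ ?_).trans ?_
  · rw [← hsqrt E hE]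
    gcongr
  · rw [← hsqrt τ hτ0.le]
    gcongr
  · refine ENNReal.ofReal_le_ofReal ?_
    have e : √τ = η / (D + 1) := by rw [hτ, Real.sqrt_sq (by positivity)]
    have e2 : (d : ℝ) * ((2 + α) / 4 * (2 * (√E / ε * (√τ / ε)))) = D * √τ / ε ^ 2 := by
      rw [hD]; field_simp
    rw [e2, e]
    gcongr
    rw [mul_div_assoc', div_le_iff₀ (by positivity)]
    nlinarith

theorem C3Domain.capillary_small {d : ℕ} (Ω : C3Domain d) {c α : ℝ} (hc : 0 < c)
    (hα : -1 ≤ α) {m E η : ℝ} (hm : 0 ≤ m) (hE : 0 ≤ E) (hη : 0 < η) :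
    ∃ ε₀ : ℝ, 0 < ε₀ ∧ ∀ ε, 0 < ε → ε ≤ ε₀ → ∀ (ρ : Sp d → ℝ) (B H : Sp d → Sp d),
      AEStronglyMeasurable ρ (volume.restrict Ω.carrier) →
      (∀ᵐ x ∂volume.restrict Ω.carrier, 0 ≤ ρ x) →
      ∫⁻ x in Ω.carrier, ENNReal.ofReal (ρ x) ≤ ENNReal.ofReal m →
      HasWeakGrad Ω.carrier (fun x => capBeta c α (ρ x)) B →
      HasWeakGrad Ω.carrier (fun x => capK c α (ρ x)) H →
      ∫⁻ x in Ω.carrier, ‖B x‖ₑ ^ 2 ≤ ENNReal.ofReal (E / ε ^ 2) →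
      ∫⁻ x in Ω.carrier, ‖H x‖ₑ ≤ ENNReal.ofReal (η / ε ^ 2) := by
  obtain ⟨ε₀, h0, hε₀⟩ := Ω.capillary_small_of_measurable hc hα hm hE hη
  refine ⟨ε₀, h0, fun ε hε hεε ρ B H hρ hρ0 hρm hβ hK hBE => ?_⟩
  have hBm := hβ.2.1.aestronglyMeasurable
  have hHm := hK.2.1.aestronglyMeasurable
  set ρ' : Sp d → ℝ := fun x => max 0 (hρ.mk ρ x) with hρ'
  have hρρ' : ρ =ᵐ[volume.restrict Ω.carrier] ρ' := by
    filter_upwards [hρ.ae_eq_mk, hρ0] with x hx hx0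
    rw [hρ']
    simp only
    rw [← hx, max_eq_right hx0]
  have eB := hBm.ae_eq_mk
  have eH := hHm.ae_eq_mk
  rw [lintegral_congr_ae (g := fun x => ‖hHm.mk H x‖ₑ) (by filter_upwards [eH] with x hx; rw [hx])]
  refine hε₀ ε hε hεε ρ' (hBm.mk B) (hHm.mk H)
    (measurable_const.max hρ.stronglyMeasurable_mk.measurable) (fun x => le_max_left _ _)
    hBm.stronglyMeasurable_mk hHm.stronglyMeasurable_mk ?_ ?_ ?_ ?_
  · rwa [← lintegral_congr_ae (f := fun x => ENNReal.ofReal (ρ x))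
      (by filter_upwards [hρρ'] with x hx; rw [hx])]
  · exact hβ.congr (by filter_upwards [hρρ'] with x hx; rw [hx]) eB
  · exact hK.congr (by filter_upwards [hρρ'] with x hx; rw [hx]) eH
  · rwa [← lintegral_congr_ae (f := fun x => ‖B x‖ₑ ^ 2)
      (by filter_upwards [eB] with x hx; rw [hx])]

/-! ### Integral inequalities in time -/

/-- Mollifications of the indicator of {k < 0} are admissible weights and converge boundedly almost
everywhere, so the integral of k over {k < 0} is nonnegative, hence zero. -/
theorem ae_nonneg_of_forall_continuous {k : ℝ → ℝ} (hk : Integrable k)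
    (h : ∀ w : ℝ → ℝ, Continuous w → (∀ t, 0 ≤ w t) → 0 ≤ ∫ t, w t * k t) :
    ∀ᵐ t, 0 ≤ k t := by
  have hkm := hk.aestronglyMeasurable
  set k' := hkm.mk k with hk'
  have hkk' : k =ᵐ[volume] k' := hkm.ae_eq_mk
  have hk'm : Measurable k' := hkm.stronglyMeasurable_mk.measurable
  set σ : ℝ → ℝ := {t | k' t < 0}.indicator fun _ => 1 with hσ
  have hσs : MeasurableSet {t | k' t < 0} := measurableSet_lt hk'm measurable_const
  have hσm : Measurable σ := measurable_const.indicator hσs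
  have hσ0 : ∀ t, 0 ≤ σ t := fun t => indicator_nonneg (fun _ _ => zero_le_one) t
  have hσ1 : ∀ t, ‖σ t‖ ≤ 1 := fun t => by
    by_cases ht : k' t < 0 <;> simp [hσ, ht]
  have hσi : LocallyIntegrable σ := by
    refine (locallyIntegrable_const (1 : ℝ)).mono hσm.aestronglyMeasurable
      (Eventually.of_forall fun t => ?_)
    simpa using hσ1 t
  let B : ℕ → ContDiffBump (0 : ℝ) := fun n =>
    { rIn := 1 / (2 * (n + 1)), rOut := 1 / (n + 1), rIn_pos := by positivity,
      rIn_lt_rOut := by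
        apply div_lt_div_of_pos_left one_pos (by positivity)
        have : (0 : ℝ) ≤ n := n.cast_nonneg
        linarith }
  have hB0 : Tendsto (fun n => (B n).rOut) atTop (𝓝 0) := tendsto_one_div_add_atTop_nhds_zero_nat
  have hBK : ∀ᶠ n in atTop, (B n).rOut ≤ 2 * (B n).rIn := Eventually.of_forall fun n => by
    simp only [B]
    apply le_of_eq
    field_simp
  set f : ℕ → ℝ → ℝ := fun n =>
    convolution ((B n).normed volume) σ (ContinuousLinearMap.lsmul ℝ ℝ) volume with hf
  have hlim := ContDiffBump.ae_convolution_tendsto_right_of_locallyIntegrable (μ := volume)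
    hB0 hBK hσi
  have hfs : ∀ n, Continuous (f n) := fun n =>
    ((B n).hasCompactSupport_normed.contDiff_convolution_left (n := 0) _ (B n).contDiff_normed
      hσi).continuous
  have hf0 : ∀ n t, 0 ≤ f n t := fun n t =>
    integral_nonneg fun s => mul_nonneg ((B n).nonneg_normed s) (hσ0 _)
  have hf1 : ∀ n x, ‖f n x‖ ≤ 1 := by
    intro n x
    rw [← (B n).integral_normed (μ := volume)]
    refine norm_integral_le_of_norm_le (B n).integrable_normed (Eventually.of_forall fun t => ?_)
    simp only [ContinuousLinearMap.lsmul_apply, norm_smul]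
    rw [Real.norm_of_nonneg ((B n).nonneg_normed t)]
    exact mul_le_of_le_one_right ((B n).nonneg_normed t) (hσ1 _)
  have hconv : Tendsto (fun n => ∫ x, f n x * k x) atTop (𝓝 (∫ x, σ x * k x)) := by
    refine tendsto_integral_of_dominated_convergence (fun x => ‖k x‖)
      (fun n => (hfs n).aestronglyMeasurable.mul hkm) hk.norm ?_ ?_
    · refine fun n => Eventually.of_forall fun x => ?_
      rw [norm_mul]
      exact mul_le_of_le_one_left (norm_nonneg _) (hf1 n x)
    · filter_upwards [hlim] with x hx
      exact hx.mul_const _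
  have hge : 0 ≤ ∫ x, σ x * k x :=
    ge_of_tendsto hconv (Eventually.of_forall fun n => h _ (hfs n) (hf0 n))
  have hσk : Integrable fun x => σ x * k x :=
    hk.bdd_mul (c := 1) hσm.aestronglyMeasurable (Eventually.of_forall hσ1)
  have hle : ∀ᵐ x, 0 ≤ -(σ x * k x) := by
    filter_upwards [hkk'] with x hx
    by_cases hx0 : k' x < 0
    · simp only [hσ, indicator_of_mem (show x ∈ {t | k' t < 0} from hx0), one_mul]
      linarith
    · simp [hσ, hx0]
  have hz : ∫ x, -(σ x * k x) = 0 := by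
    apply le_antisymm
    · rw [integral_neg]; linarith
    · exact integral_nonneg_of_ae hle
  have := (integral_eq_zero_iff_of_nonneg_ae hle hσk.neg).1 hz
  filter_upwards [this, hkk'] with x hx hxk
  by_contra hneg
  rw [not_le] at hneg
  have hx0 : k' x < 0 := hxk ▸ hneg
  simp only [hσ, indicator_of_mem (show x ∈ {t | k' t < 0} from hx0), one_mul, Pi.zero_apply] at hx
  linarith

/-- Grönwall's lemma for m' ≤ Cm + e with initial value m₀, all in the distributional sense: `m` is
merely integrable and has no pointwise values. An arbitrary weight w ≥ 0 is turned into a test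
function θ solving the adjoint equation, and the inequality becomes ∫ w(m₀ + Te - e^(-Ct)m) ≥ 0. -/
theorem ae_le_exp_of_weak_inequality {T C e m₀ : ℝ} (hT : 0 < T) (he : 0 ≤ e) {m : ℝ → ℝ}
    (hm : IntegrableOn m (Icc 0 T))
    (h : ∀ θ : ℝ → ℝ, ContDiff ℝ 1 θ → (∀ t ∈ Icc 0 T, 0 ≤ θ t) → θ T = 0 →
      -∫ t in Icc 0 T, deriv θ t * m t ≤ θ 0 * m₀ + ∫ t in Icc 0 T, θ t * (C * m t + e))
    (hC : 0 ≤ C) :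
    ∀ᵐ t ∂volume.restrict (Icc 0 T), m t ≤ Real.exp (C * t) * (m₀ + T * e) := by
  set k : ℝ → ℝ := (Icc 0 T).indicator fun t => m₀ + T * e - Real.exp (-(C * t)) * m t with hk
  have hexp : Continuous fun t : ℝ => Real.exp (-(C * t)) := by fun_prop
  have hem : ∀ w : ℝ → ℝ, Continuous w → IntegrableOn (fun t => w t * m t) (Icc 0 T) :=
    fun w hw => hm.continuousOn_mul hw.continuousOn isCompact_Icc
  have hki : Integrable k := by
    refine (integrable_indicator_iff measurableSet_Icc).2 ?_
    exact (integrableOn_const (by simp)).sub (hem _ hexp)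
  have hnonneg := ae_nonneg_of_forall_continuous hki ?_
  · rw [ae_restrict_iff' measurableSet_Icc]
    filter_upwards [hnonneg] with t ht htT
    simp only [hk, indicator_of_mem htT] at ht
    have h1 : Real.exp (-(C * t)) * m t ≤ m₀ + T * e := by linarith
    calc m t = Real.exp (C * t) * (Real.exp (-(C * t)) * m t) := by
          rw [← mul_assoc, ← Real.exp_add]; simp
      _ ≤ _ := by gcongr
  · intro w hw hw0
    set I : ℝ → ℝ := fun t => ∫ s in t..T, w s with hI
    have hId : ∀ t, HasDerivAt I (-w t) t := fun t =>
      intervalIntegral.integral_hasDerivAt_left (hw.intervalIntegrable _ _)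
        hw.aestronglyMeasurable.stronglyMeasurableAtFilter hw.continuousAt
    have hIc : Continuous I := continuous_iff_continuousAt.2 fun t => (hId t).continuousAt
    -- The solution of -θ' - Cθ = e^(-Ct)w with θ(T) = 0; the terms containing Cm then cancel.
    set θ : ℝ → ℝ := fun t => Real.exp (-(C * t)) * I t with hθ
    have hθd : ∀ t, HasDerivAt θ (-(C * θ t) - Real.exp (-(C * t)) * w t) t := fun t => by
      have h1 : HasDerivAt (fun t : ℝ => Real.exp (-(C * t))) (Real.exp (-(C * t)) * -C) t := by
        have : HasDerivAt (fun t : ℝ => -(C * t)) (-C) t := by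
          simp only [← neg_mul]
          simpa using (hasDerivAt_id t).const_mul (-C)
        exact this.exp
      have h2 := h1.mul (hId t)
      convert! h2 using 1
      simp only [hθ]
      ring
    have hθc : Continuous θ := hexp.mul hIc
    have hderiv : deriv θ = fun t => -(C * θ t) - Real.exp (-(C * t)) * w t :=
      funext fun t => (hθd t).deriv
    have hθ1 : ContDiff ℝ 1 θ := by
      rw [contDiff_one_iff_deriv]
      refine ⟨fun t => (hθd t).differentiableAt, ?_⟩
      rw [hderiv]
      fun_prop
    have hI0 : ∀ t ∈ Icc 0 T, 0 ≤ I t := fun t ht =>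
      intervalIntegral.integral_nonneg ht.2 fun s _ => hw0 s
    have hIle : ∀ t ∈ Icc 0 T, I t ≤ I 0 := fun t ht => by
      have : I 0 = (∫ s in (0 : ℝ)..t, w s) + I t :=
        (intervalIntegral.integral_add_adjacent_intervals (hw.intervalIntegrable _ _)
          (hw.intervalIntegrable _ _)).symm
      have h2 : 0 ≤ ∫ s in (0 : ℝ)..t, w s :=
        intervalIntegral.integral_nonneg ht.1 fun s _ => hw0 s
      linarith
    have hθle : ∀ t ∈ Icc 0 T, θ t ≤ I 0 := fun t ht => by
      have h1 : Real.exp (-(C * t)) ≤ 1 := Real.exp_le_one_iff.2 (by nlinarith [ht.1])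
      calc θ t ≤ 1 * I t := mul_le_mul_of_nonneg_right h1 (hI0 t ht)
        _ ≤ _ := by rw [one_mul]; exact hIle t ht
    have key := h θ hθ1 (fun t ht => mul_nonneg (Real.exp_pos _).le (hI0 t ht))
      (by simp [hθ, hI])
    have i1 : IntegrableOn (fun t => θ t * m t) (Icc 0 T) := hem θ hθc
    have i2 : IntegrableOn (fun t => Real.exp (-(C * t)) * w t * m t) (Icc 0 T) :=
      hem _ (hexp.mul hw)
    have i3 : IntegrableOn θ (Icc 0 T) := hθc.continuousOn.integrableOn_Icc
    have e1 : -∫ t in Icc 0 T, deriv θ t * m t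
        = C * (∫ t in Icc 0 T, θ t * m t) + ∫ t in Icc 0 T, Real.exp (-(C * t)) * w t * m t := by
      rw [hderiv, ← integral_neg, ← integral_const_mul, ← integral_add (i1.const_mul C) i2]
      congr 1
      ext t
      ring
    have e2 : ∫ t in Icc 0 T, θ t * (C * m t + e)
        = C * (∫ t in Icc 0 T, θ t * m t) + e * ∫ t in Icc 0 T, θ t := by
      rw [← integral_const_mul, ← integral_const_mul, ← integral_add (i1.const_mul C) (i3.const_mul e)]
      congr 1
      ext t
      ring
    have h0 : θ 0 = I 0 := by simp [hθ]
    rw [e1, e2, h0] at key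
    have h3 : ∫ t in Icc 0 T, θ t ≤ T * I 0 := by
      calc ∫ t in Icc 0 T, θ t ≤ ∫ t in Icc 0 T, I 0 :=
            setIntegral_mono_on i3 (integrableOn_const (by simp)) measurableSet_Icc hθle
        _ = _ := by simp [hT.le]
    have e3 : ∫ t, w t * k t
        = (m₀ + T * e) * I 0 - ∫ t in Icc 0 T, Real.exp (-(C * t)) * w t * m t := by
      have i4 : IntegrableOn w (Icc 0 T) := hw.continuousOn.integrableOn_Icc
      have e4 : I 0 = ∫ t in Icc 0 T, w t := by
        rw [integral_Icc_eq_integral_Ioc, ← intervalIntegral.integral_of_le hT.le]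
      rw [e4, ← integral_const_mul, ← integral_sub (i4.const_mul _) i2,
        ← integral_indicator measurableSet_Icc]
      congr 1
      ext t
      by_cases ht : t ∈ Icc 0 T
      · simp only [hk, indicator_of_mem ht]
        ring
      · simp [hk, ht]
    rw [e3]
    nlinarith

/-! ### The divergence theorem for tangential fields -/

theorem integral_fderiv_apply_eq_zero {d : ℕ} {F : Sp d → Sp d} (hF : ContDiff ℝ 1 F)
    (hc : HasCompactSupport F) (e : Sp d) (i : Fin d) : ∫ x, (fderiv ℝ F x e) i = 0 := by
  have hd : ∀ x, HasFDerivAt F (fderiv ℝ F x) x := fun x =>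
    (hF.differentiable (by simp) x).hasFDerivAt
  set L : Sp d →L[ℝ] ℝ := EuclideanSpace.proj i with hL
  have hg : ∀ x, HasFDerivAt (fun x => F x i) (L ∘L fderiv ℝ F x) x := fun x =>
    L.hasFDerivAt.comp x (hd x)
  have hcf : Continuous fun x => (fderiv ℝ F x e) i := by
    have := hF.continuous_fderiv (by simp)
    exact L.continuous.comp (by fun_prop : Continuous fun x => fderiv ℝ F x e)
  have hi : Integrable fun x => (fderiv ℝ F x e) i :=
    hcf.integrable_of_hasCompactSupport ((hc.fderiv_apply ℝ e).comp_left (g := fun y : Sp d => y i) rfl)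
  have hi2 : Integrable fun x => F x i :=
    (L.continuous.comp hF.continuous).integrable_of_hasCompactSupport
      (hc.comp_left (g := fun y : Sp d => y i) rfl)
  have := integral_bilinear_hasFDerivAt_right_eq_neg_left_of_integrable (μ := (volume : Measure (Sp d)))
    (f := fun _ => (1 : ℝ)) (f' := fun _ => 0) (g := fun x => F x i)
    (g' := fun x => L ∘L fderiv ℝ F x) (v := e) (B := ContinuousLinearMap.mul ℝ ℝ)
    (by simp) (by simpa [hL] using hi) (by simpa using hi2) (fun x _ => hasFDerivAt_const _ _)
    (fun x _ => hg x)
  simpa [hL] using this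

theorem frontier_subset_g_eq_zero {d : ℕ} (Ω : C3Domain d) {x : Sp d}
    (hx : x ∈ frontier Ω.carrier) : Ω.g x = 0 := by
  have h := frontier_lt_subset_eq Ω.contDiff_g.continuous continuous_const (g := fun _ => (0 : ℝ))
    (f := Ω.g)
  rw [Ω.carrier_eq] at hx
  exact h hx

theorem fderiv_g_apply_eq_zero {d : ℕ} (Ω : C3Domain d) {x v : Sp d}
    (hx : x ∈ frontier Ω.carrier) (h : ⟪v, Ω.normal x⟫_ℝ = 0) : fderiv ℝ Ω.g x v = 0 := by
  obtain ⟨c, hc, hg⟩ := Ω.grad_lower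
  have h0 : 0 < ‖gradient Ω.g x‖ := hc.trans_le (hg x (frontier_subset_g_eq_zero Ω hx))
  rw [C3Domain.normal, inner_smul_right, mul_eq_zero] at h
  rcases h with h | h
  · exact absurd h (inv_ne_zero h0.ne')
  · rw [← inner_gradient, real_inner_comm]
    exact h

/-- The function Dg(V) vanishes on the boundary because V is tangential there, and has bounded
derivative inside. Hence it is bounded by the length of a segment from x to the boundary, and
following the gradient of `g` such a segment has length at most (4/c)|g(x)|. -/
theorem C3Domain.exists_tangential_bound {d : ℕ} (Ω : C3Domain d) {V : Sp d → Sp d} {C C' R : ℝ}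
    (hV : DifferentiableOn ℝ V Ω.carrier) (hVc : ContinuousOn V (closure Ω.carrier))
    (hC : ∀ x ∈ Ω.carrier, ‖fderiv ℝ V x‖ ≤ C) (hC' : ∀ x ∈ closure Ω.carrier, ‖V x‖ ≤ C')
    (htan : ∀ x ∈ frontier Ω.carrier, ⟪V x, Ω.normal x⟫_ℝ = 0) :
    ∃ L δ : ℝ, 0 ≤ L ∧ 0 < δ ∧ ∀ x ∈ Ω.carrier, ‖x‖ ≤ R → -δ < Ω.g x →
      |fderiv ℝ Ω.g x (V x)| ≤ L * |Ω.g x| := by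
  rcases Ω.carrier.eq_empty_or_nonempty with hemp | ⟨x₀, hx₀⟩
  · exact ⟨0, 1, le_rfl, one_pos, fun x hx => by simp [hemp] at hx⟩
  have hC0 : 0 ≤ C := (norm_nonneg _).trans (hC x₀ hx₀)
  have hC'0 : 0 ≤ C' := (norm_nonneg _).trans (hC' x₀ (subset_closure hx₀))
  obtain ⟨c, hc, hgrad⟩ := Ω.grad_lower
  obtain ⟨M, hM, hlip⟩ := Ω.exists_fderiv_lipschitz
  obtain ⟨M₁, hM₁⟩ := Ω.deriv_bound
  have hM₁' : ∀ x, ‖fderiv ℝ Ω.g x‖ ≤ M₁ := fun x => by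
    have := hM₁ 1 le_rfl (by norm_num) x
    rwa [norm_iteratedFDeriv_one] at this
  have hM₁0 : 0 ≤ M₁ := (norm_nonneg _).trans (hM₁' 0)
  have hgC := Ω.contDiff_g.continuous
  have hgdC : Continuous (fderiv ℝ Ω.g) := Ω.contDiff_g.continuous_fderiv (by norm_num)
  -- a neighbourhood of the boundary with nonvanishing gradient
  obtain ⟨δ₁, hδ₁, hgδ⟩ : ∃ δ₁ : ℝ, 0 < δ₁ ∧ ∀ x, ‖x‖ ≤ R → -δ₁ < Ω.g x → Ω.g x ≤ 0 →
      c / 2 ≤ ‖fderiv ℝ Ω.g x‖ := by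
    set K := {x : Sp d | ‖x‖ ≤ R ∧ Ω.g x ≤ 0 ∧ ‖fderiv ℝ Ω.g x‖ ≤ c / 2} with hK
    have hKc : IsCompact K := by
      refine (isCompact_closedBall (0 : Sp d) R).of_isClosed_subset ?_ ?_
      · refine (isClosed_le continuous_norm continuous_const).inter
          ((isClosed_le hgC continuous_const).inter (isClosed_le hgdC.norm continuous_const))
      · intro x hx
        simpa using hx.1
    rcases K.eq_empty_or_nonempty with hKe | hKn
    · refine ⟨1, one_pos, fun x h1 _ h3 => ?_⟩
      by_contra hcon
      have : x ∈ K := ⟨h1, h3, (not_le.1 hcon).le⟩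
      simp [hKe] at this
    -- On the compact set where the gradient is small, `g` attains its maximum, which is negative
    -- since the gradient is at least c on {g = 0}. Above that value the gradient is not small.
    · obtain ⟨y, hy, hmax⟩ := hKc.exists_isMaxOn hKn hgC.continuousOn
      have hy0 : Ω.g y < 0 := by
        rcases hy.2.1.lt_or_eq with h | h
        · exact h
        · have h1 := hgrad y h
          rw [norm_gradient] at h1
          linarith [hy.2.2]
      refine ⟨-Ω.g y, by linarith, fun x h1 h2 h3 => ?_⟩
      by_contra hcon
      have hxK : x ∈ K := ⟨h1, h3, (not_le.1 hcon).le⟩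
      have : Ω.g x ≤ Ω.g y := hmax hxK
      linarith
  -- Over this length the derivative of `g` in the direction N drops from c/2 to no less than c/4.
  set s₀ : ℝ := c / (4 * M) with hs₀
  have hs₀0 : 0 < s₀ := by positivity
  refine ⟨(M * C' + M₁ * C) * (4 / c), min δ₁ (c / 4 * s₀), by positivity, by positivity,
    fun x hx hxR hxg => ?_⟩
  have hxg0 : Ω.g x < 0 := by rw [Ω.carrier_eq] at hx; exact hx
  have hcx := hgδ x hxR (by linarith [min_le_left δ₁ (c / 4 * s₀)]) hxg0.le
  have hgx : -Ω.g x < c / 4 * s₀ := by linarith [min_le_right δ₁ (c / 4 * s₀)]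
  set n := gradient Ω.g x with hn
  have hn0 : 0 < ‖n‖ := by
    rw [hn, norm_gradient]
    linarith
  set N := ‖n‖⁻¹ • n with hN
  have hN1 : ‖N‖ = 1 := by
    rw [hN, norm_smul, norm_inv, norm_norm, inv_mul_cancel₀ hn0.ne']
  have hxN : c / 2 ≤ fderiv ℝ Ω.g x N := by
    rw [← inner_gradient, ← hn, hN, inner_smul_right, real_inner_self_eq_norm_sq, sq,
      inv_mul_cancel_left₀ hn0.ne', hn, norm_gradient]
    exact hcx
  have hline : ∀ s : ℝ, HasDerivAt (fun s : ℝ => x + s • N) N s := fun s => by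
    simpa using ((hasDerivAt_id s).smul_const N).const_add x
  have hder : ∀ s : ℝ, HasDerivAt (fun s : ℝ => Ω.g (x + s • N)) (fderiv ℝ Ω.g (x + s • N) N) s :=
    fun s => (Ω.hasFDerivAt_g _).comp_hasDerivAt s (hline s)
  have hder_ge : ∀ s ∈ Icc 0 s₀, c / 4 ≤ fderiv ℝ Ω.g (x + s • N) N := by
    intro s hs
    have h1 := (neg_abs_le _).trans' (neg_le_neg ((fderiv ℝ Ω.g (x + s • N) - fderiv ℝ Ω.g x).le_opNorm N))
    have h2 := hlip (x + s • N) x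
    rw [add_sub_cancel_left, norm_smul, hN1, Real.norm_of_nonneg hs.1, mul_one] at h2
    rw [hN1, mul_one, sub_apply] at h1
    have h3 : M * s ≤ c / 4 := by
      have := hs.2
      rw [hs₀, le_div_iff₀ (by positivity)] at this
      linarith
    linarith
  have hmono : StrictMonoOn (fun s : ℝ => Ω.g (x + s • N)) (Icc 0 s₀) := by
    refine strictMonoOn_of_deriv_pos (convex_Icc _ _) (by fun_prop) fun s hs => ?_
    rw [interior_Icc] at hs
    rw [(hder s).deriv]
    have := hder_ge s (Ioo_subset_Icc_self hs)
    linarith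
  -- Growing at rate at least c/4, `g` reaches zero no later than at parameter s₁; the condition -δ
  -- < g(x) guarantees s₁ ≤ s₀.
  set s₁ : ℝ := -Ω.g x * (4 / c) with hs₁
  have hs₁0 : 0 < s₁ := by
    have : 0 < -Ω.g x := by linarith
    positivity
  have hs₁s₀ : s₁ ≤ s₀ := by
    rw [hs₁, mul_div_assoc', div_le_iff₀ hc]
    linarith
  have hgs₁ : 0 ≤ Ω.g (x + s₁ • N) := by
    have := (convex_Icc 0 s₁).mul_sub_le_image_sub_of_le_deriv (f := fun s : ℝ => Ω.g (x + s • N))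
      (by fun_prop) (fun s _ => (hder s).differentiableAt.differentiableWithinAt) (C := c / 4)
      (fun s hs => by
        rw [interior_Icc] at hs
        rw [(hder s).deriv]
        exact hder_ge s ⟨hs.1.le, hs.2.le.trans hs₁s₀⟩)
      0 (left_mem_Icc.2 hs₁0.le) s₁ (right_mem_Icc.2 hs₁0.le) hs₁0.le
    simp only [zero_smul, add_zero, sub_zero] at this
    have e : c / 4 * s₁ = -Ω.g x := by rw [hs₁]; field_simp
    linarith
  obtain ⟨s, hs, hsg⟩ : ∃ s ∈ Icc (0 : ℝ) s₁, Ω.g (x + s • N) = 0 := by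
    have := intermediate_value_Icc hs₁0.le (f := fun s : ℝ => Ω.g (x + s • N)) (by fun_prop)
    obtain ⟨s, hs, h⟩ := this ⟨by simpa using hxg0.le, hgs₁⟩
    exact ⟨s, hs, h⟩
  have hin : ∀ t ∈ Ico 0 s, x + t • N ∈ Ω.carrier := by
    intro t ht
    rw [Ω.carrier_eq]
    have := hmono ⟨ht.1, ht.2.le.trans (hs.2.trans hs₁s₀)⟩ ⟨hs.1, hs.2.trans hs₁s₀⟩ ht.2
    simp only [hsg] at this
    exact this
  have hs0 : 0 < s := by
    rcases hs.1.eq_or_lt with h | h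
    · rw [← h] at hsg
      simp at hsg
      linarith
    · exact h
  have hcl : ∀ t ∈ Icc 0 s, x + t • N ∈ closure Ω.carrier := by
    intro t ht
    have hc : Continuous fun t : ℝ => x + t • N := by fun_prop
    have h1 : t ∈ closure (Ico 0 s) := by rwa [closure_Ico hs0.ne]
    exact map_mem_closure (f := fun t : ℝ => x + t • N) hc h1 hin
  have hfr : x + s • N ∈ frontier Ω.carrier := by
    rw [frontier, Ω.isOpen.interior_eq]
    refine ⟨hcl s (right_mem_Icc.2 hs0.le), fun hmem => ?_⟩
    rw [Ω.carrier_eq] at hmem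
    rw [mem_ofPred_eq, hsg] at hmem
    exact lt_irrefl _ hmem
  have hg2 : ∀ y, HasFDerivAt (fderiv ℝ Ω.g) (fderiv ℝ (fderiv ℝ Ω.g) y) y := fun y =>
    (((Ω.contDiff_g.fderiv_right (m := 2) (by norm_num)).differentiable (by simp)) y).hasFDerivAt
  have hg2b : ∀ y, ‖fderiv ℝ (fderiv ℝ Ω.g) y‖ ≤ M := fun y =>
    norm_fderiv_le_of_lip' ℝ hM.le (Eventually.of_forall fun z => hlip z y)
  -- The mean value inequality with right derivatives asks for differentiability only on [0, s): at
  -- the endpoint, on the boundary, V is merely continuous.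
  have hq := norm_image_sub_le_of_norm_deriv_right_le_segment
    (f := fun t : ℝ => fderiv ℝ Ω.g (x + t • N) (V (x + t • N)))
    (f' := fun t : ℝ => fderiv ℝ (fderiv ℝ Ω.g) (x + t • N) N (V (x + t • N))
      + fderiv ℝ Ω.g (x + t • N) (fderiv ℝ V (x + t • N) N)) (a := 0) (b := s)
    (C := M * C' + M₁ * C) ?_ ?_ ?_ s (right_mem_Icc.2 hs0.le)
  · rw [fderiv_g_apply_eq_zero Ω hfr (htan _ hfr)] at hq
    simp only [zero_smul, add_zero, zero_sub, norm_neg, sub_zero, Real.norm_eq_abs] at hq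
    refine hq.trans ?_
    rw [abs_of_neg hxg0, mul_assoc]
    have : s ≤ 4 / c * -Ω.g x := by
      have := hs.2
      rw [hs₁] at this
      linarith
    gcongr
  · have hc1 : ContinuousOn (fun t : ℝ => V (x + t • N)) (Icc 0 s) :=
      hVc.comp (by fun_prop) hcl
    exact (hgdC.comp (by fun_prop)).continuousOn.clm_apply hc1
  · intro t ht
    have hΩt := hin t ht
    have h1 : HasDerivAt (fun t : ℝ => V (x + t • N)) (fderiv ℝ V (x + t • N) N) t :=
      ((hV _ hΩt).differentiableAt (Ω.isOpen.mem_nhds hΩt)).hasFDerivAt.comp_hasDerivAt t (hline t)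
    have h2 : HasDerivAt (fun t : ℝ => fderiv ℝ Ω.g (x + t • N))
        (fderiv ℝ (fderiv ℝ Ω.g) (x + t • N) N) t := (hg2 _).comp_hasDerivAt t (hline t)
    exact (h2.clm_apply h1).hasDerivWithinAt
  · intro t ht
    have hΩt := hin t ht
    refine (norm_add_le _ _).trans (add_le_add ?_ ?_)
    · refine (ContinuousLinearMap.le_opNorm₂ _ _ _).trans ?_
      rw [hN1, mul_one]
      exact mul_le_mul (hg2b _) (hC' _ (subset_closure hΩt)) (norm_nonneg _) hM.le
    · refine (ContinuousLinearMap.le_opNorm _ _).trans ?_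
      refine mul_le_mul (hM₁' _) ?_ (norm_nonneg _) hM₁0
      refine (ContinuousLinearMap.le_opNorm _ _).trans ?_
      rw [hN1, mul_one]
      exact hC _ hΩt

theorem abs_trace_le {d : ℕ} (A : Sp d →L[ℝ] Sp d) :
    |∑ i : Fin d, (A (EuclideanSpace.single i 1)) i| ≤ d * ‖A‖ := by
  refine (Finset.abs_sum_le_sum_abs _ _).trans ?_
  calc ∑ i : Fin d, |(A (EuclideanSpace.single i 1)) i| ≤ ∑ i : Fin d, ‖A‖ := by
        refine Finset.sum_le_sum fun i _ => ?_
        rw [← Real.norm_eq_abs]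
        refine (PiLp.norm_apply_le _ i).trans ((A.le_opNorm _).trans ?_)
        simp
    _ = _ := by simp

theorem abs_divg_le {d : ℕ} (V : Sp d → Sp d) (x : Sp d) : |divg V x| ≤ d * ‖fderiv ℝ V x‖ :=
  abs_trace_le _

theorem divg_smul {d : ℕ} {w : Sp d → ℝ} {V : Sp d → Sp d} {x : Sp d}
    (hw : DifferentiableAt ℝ w x) (hV : DifferentiableAt ℝ V x) :
    divg (fun y => w y • V y) x = w x * divg V x + fderiv ℝ w x (V x) := by
  have h := fderiv_fun_smul hw hV
  have e : fderiv ℝ w x (V x) = ∑ i : Fin d, fderiv ℝ w x (EuclideanSpace.single i 1) * V x i := by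
    have e1 : V x = ∑ i : Fin d, V x i • EuclideanSpace.single i (1 : ℝ) := by
      ext j
      simp [Finset.sum_apply, Pi.single_apply]
    conv_lhs => rw [e1]
    rw [map_sum]
    refine Finset.sum_congr rfl fun i _ => ?_
    rw [map_smul, smul_eq_mul, mul_comm]
  rw [e]
  unfold divg
  rw [h, Finset.mul_sum, ← Finset.sum_add_distrib]
  refine Finset.sum_congr rfl fun i _ => ?_
  simp

theorem divg_contDiff_compactSupport {d : ℕ} {F : Sp d → Sp d} (hF : ContDiff ℝ 1 F)
    (hc : HasCompactSupport F) : ∫ x, divg F x = 0 := by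
  unfold divg
  rw [integral_finsetSum]
  · exact Finset.sum_eq_zero fun i _ => integral_fderiv_apply_eq_zero hF hc _ i
  · intro i _
    have hcf : Continuous fun x => (fderiv ℝ F x (EuclideanSpace.single i 1)) i := by
      have := hF.continuous_fderiv (by simp)
      exact (EuclideanSpace.proj (𝕜 := ℝ) i).continuous.comp
        (by fun_prop : Continuous fun x => fderiv ℝ F x (EuclideanSpace.single i 1))
    exact hcf.integrable_of_hasCompactSupport
      ((hc.fderiv_apply ℝ _).comp_left (g := fun y : Sp d => y i) rfl)

/-- A smooth transition from `1` on `(-∞, -2]` to `0` on `[-1, ∞)`. -/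
def downStep (s : ℝ) : ℝ := Real.smoothTransition (-s - 1)

theorem contDiff_downStep {n : ℕ∞} : ContDiff ℝ n downStep :=
  Real.smoothTransition.contDiff.comp (by fun_prop)

theorem downStep_of_ge {s : ℝ} (h : -1 ≤ s) : downStep s = 0 :=
  Real.smoothTransition.zero_of_nonpos (by linarith)

theorem downStep_of_le {s : ℝ} (h : s ≤ -2) : downStep s = 1 :=
  Real.smoothTransition.one_of_one_le (by linarith)

theorem downStep_nonneg (s : ℝ) : 0 ≤ downStep s := Real.smoothTransition.nonneg _

theorem downStep_le_one (s : ℝ) : downStep s ≤ 1 := Real.smoothTransition.le_one _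

theorem deriv_downStep_of_lt {s : ℝ} (h : s < -2) : deriv downStep s = 0 := by
  have : downStep =ᶠ[𝓝 s] fun _ => 1 := by
    filter_upwards [eventually_lt_nhds h] with t ht using downStep_of_le ht.le
  rw [this.deriv_eq, deriv_const]

theorem deriv_downStep_of_gt {s : ℝ} (h : -1 < s) : deriv downStep s = 0 := by
  have : downStep =ᶠ[𝓝 s] fun _ => 0 := by
    filter_upwards [eventually_gt_nhds h] with t ht using downStep_of_ge ht.le
  rw [this.deriv_eq, deriv_const]

theorem exists_deriv_downStep_bound : ∃ C : ℝ, 0 ≤ C ∧ ∀ s, |deriv downStep s| ≤ C := by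
  have hc : Continuous (deriv downStep) := (contDiff_downStep (n := 1)).continuous_deriv le_rfl
  have hs : HasCompactSupport (deriv downStep) := by
    refine HasCompactSupport.of_support_subset_isCompact (isCompact_Icc (a := (-2 : ℝ)) (b := -1)) ?_
    intro s hs
    by_contra hcon
    rw [mem_Icc, not_and_or, not_le, not_le] at hcon
    rcases hcon with h | h
    · exact hs (deriv_downStep_of_lt h)
    · exact hs (deriv_downStep_of_gt h)
  obtain ⟨C, hC⟩ := hc.bounded_above_of_compact_support hs
  exact ⟨C, (norm_nonneg _).trans (hC 0), hC⟩

theorem hasDerivAt_downStep (s : ℝ) : HasDerivAt downStep (deriv downStep s) s :=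
  ((contDiff_downStep (n := 1)).differentiable (by simp) s).hasDerivAt

/-- The weight downStep(g/δ) vanishes where g ≥ -δ, so weight times V is C¹ with compact support in
Ω and its divergence has integral zero over ℝᵈ; the integrand is the product rule. -/
theorem C3Domain.integral_divg_cutoff {d : ℕ} (Ω : C3Domain d) {V : Sp d → Sp d} {R δ : ℝ}
    (hδ : 0 < δ) (hV : ContDiffOn ℝ 1 V Ω.carrier)
    (hR : ∀ x ∈ closure Ω.carrier, R < ‖x‖ → V x = 0) :
    ∫ x in Ω.carrier, (downStep (Ω.g x / δ) * divg V x
      + δ⁻¹ * deriv downStep (Ω.g x / δ) * fderiv ℝ Ω.g x (V x)) = 0 := by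
  set w : Sp d → ℝ := fun x => downStep (Ω.g x / δ) with hw
  have hwd : ∀ x, HasFDerivAt w ((δ⁻¹ * deriv downStep (Ω.g x / δ)) • fderiv ℝ Ω.g x) x := fun x => by
    have h1 : HasFDerivAt (fun y => Ω.g y / δ) (δ⁻¹ • fderiv ℝ Ω.g x) x := by
      simpa [div_eq_inv_mul] using (Ω.hasFDerivAt_g x).const_mul δ⁻¹
    have h2 := (hasDerivAt_downStep (Ω.g x / δ)).comp_hasFDerivAt x h1
    rw [smul_smul, mul_comm] at h2
    exact h2
  have hw1 : ContDiff ℝ 1 w :=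
    (contDiff_downStep (n := 1)).comp ((Ω.contDiff_g.of_le (by norm_num)).div_const δ)
  set K : Set (Sp d) := {x | Ω.g x ≤ -δ ∧ ‖x‖ ≤ R} with hK
  have hgC := Ω.contDiff_g.continuous
  have hKc : IsCompact K := by
    refine (isCompact_closedBall (0 : Sp d) R).of_isClosed_subset ?_ ?_
    · exact (isClosed_le hgC continuous_const).inter (isClosed_le continuous_norm continuous_const)
    · intro x hx
      simpa using hx.2
  have hKΩ : K ⊆ Ω.carrier := fun x hx => by
    rw [Ω.carrier_eq]
    have := hx.1
    simp only [mem_ofPred_eq]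
    linarith
  have hsupp : ∀ x, x ∉ K → w x • V x = 0 := by
    intro x hx
    by_cases h1 : Ω.g x ≤ -δ
    · have hxΩ : x ∈ Ω.carrier := by
        rw [Ω.carrier_eq]
        simp only [mem_ofPred_eq]
        linarith
      have h2 : R < ‖x‖ := by
        by_contra h
        exact hx ⟨h1, not_lt.1 h⟩
      rw [hR x (subset_closure hxΩ) h2, smul_zero]
    · have : w x = 0 := by
        refine downStep_of_ge ?_
        rw [le_div_iff₀ hδ]
        linarith
      rw [this, zero_smul]
  have htsupp : tsupport (fun x => w x • V x) ⊆ K := by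
    refine closure_minimal ?_ hKc.isClosed
    intro x hx
    by_contra h
    exact hx (hsupp x h)
  have hFc : HasCompactSupport fun x => w x • V x :=
    hKc.of_isClosed_subset (isClosed_tsupport _) htsupp
  have hF1 : ContDiff ℝ 1 fun x => w x • V x := by
    rw [contDiff_iff_contDiffAt]
    intro x
    by_cases hx : x ∈ Ω.carrier
    · exact hw1.contDiffAt.smul (hV.contDiffAt (Ω.isOpen.mem_nhds hx))
    · have : (fun x => w x • V x) =ᶠ[𝓝 x] fun _ => 0 := by
        filter_upwards [hKc.isClosed.isOpen_compl.mem_nhds (fun h => hx (hKΩ h))] with y hy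
        exact hsupp y hy
      exact contDiffAt_const.congr_of_eventuallyEq this
  have h0 := divg_contDiff_compactSupport hF1 hFc
  have h1 : ∫ x in Ω.carrier, divg (fun x => w x • V x) x = ∫ x, divg (fun x => w x • V x) x := by
    refine setIntegral_eq_integral_of_forall_compl_eq_zero fun x hx => ?_
    have : fderiv ℝ (fun x => w x • V x) x = 0 := by
      by_contra h
      exact hx (hKΩ (htsupp (support_fderiv_subset ℝ h)))
    simp [divg, this]
  rw [← h0, ← h1]
  refine setIntegral_congr_fun Ω.isOpen.measurableSet fun x hx => ?_
  have hVx : DifferentiableAt ℝ V x :=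
    (hV.contDiffAt (Ω.isOpen.mem_nhds hx)).differentiableAt (by simp)
  rw [divg_smul (hwd x).differentiableAt hVx, (hwd x).fderiv]
  simp [hw]

theorem continuousOn_divg {d : ℕ} {S : Set (Sp d)} (hS : IsOpen S) {V : Sp d → Sp d}
    (hV : ContDiffOn ℝ 1 V S) : ContinuousOn (divg V) S := by
  have h := hV.continuousOn_fderiv_of_isOpen hS le_rfl
  unfold divg
  refine continuousOn_finsetSum _ fun i _ => ?_
  exact (EuclideanSpace.proj (𝕜 := ℝ) i).continuous.comp_continuousOn
    (h.clm_apply continuousOn_const)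

/-- The divergence theorem without a surface measure. The boundary layer term lives in -2δ ≤ g ≤ -δ,
where its factor 1/δ is compensated by |Dg(V)| ≤ L|g| ≤ 2Lδ. It is therefore bounded uniformly in δ
and vanishes pointwise as δ → 0, so dominated convergence applies. -/
theorem C3Domain.integral_divg_eq_zero {d : ℕ} (Ω : C3Domain d) {V : Sp d → Sp d}
    (hV : ContDiffOn ℝ 1 V Ω.carrier) (hVc : ContinuousOn V (closure Ω.carrier))
    (hC : ∃ C, ∀ x ∈ Ω.carrier, ‖fderiv ℝ V x‖ ≤ C)
    (hsupp : ∃ R, ∀ x ∈ closure Ω.carrier, R < ‖x‖ → V x = 0)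
    (htan : ∀ x ∈ frontier Ω.carrier, ⟪V x, Ω.normal x⟫_ℝ = 0) :
    ∫ x in Ω.carrier, divg V x = 0 := by
  obtain ⟨C, hC⟩ := hC
  obtain ⟨R, hR⟩ := hsupp
  obtain ⟨C', hC'0, hC'⟩ : ∃ C', 0 ≤ C' ∧ ∀ x ∈ closure Ω.carrier, ‖V x‖ ≤ C' := by
    have hK : IsCompact (closure Ω.carrier ∩ Metric.closedBall 0 R) :=
      (isCompact_closedBall _ _).inter_left isClosed_closure
    obtain ⟨C', hC'⟩ := hK.exists_bound_of_continuousOn (hVc.mono inter_subset_left)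
    refine ⟨max C' 0, le_max_right _ _, fun x hx => ?_⟩
    by_cases h : ‖x‖ ≤ R
    · exact (hC' x ⟨hx, by simpa using h⟩).trans (le_max_left _ _)
    · simp [hR x hx (not_le.1 h)]
  obtain ⟨L, δ₀, hL, hδ₀, hbd⟩ := Ω.exists_tangential_bound (R := R)
    (hV.differentiableOn (by simp)) hVc hC hC' htan
  obtain ⟨C₁, hC₁, hstep⟩ := exists_deriv_downStep_bound
  have hC0 : ∀ x ∈ Ω.carrier, 0 ≤ C := fun x hx => (norm_nonneg _).trans (hC x hx)
  set F : ℕ → Sp d → ℝ := fun n x => downStep (Ω.g x / (1 / ((n : ℝ) + 1))) * divg V x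
      + (1 / ((n : ℝ) + 1))⁻¹ * deriv downStep (Ω.g x / (1 / ((n : ℝ) + 1))) * fderiv ℝ Ω.g x (V x) with hF
  have hF0 : ∀ n : ℕ, ∫ x in Ω.carrier, F n x = 0 := fun n =>
    Ω.integral_divg_cutoff (by positivity) hV hR
  have hδn : Tendsto (fun n : ℕ => 1 / ((n : ℝ) + 1)) atTop (𝓝 0) :=
    tendsto_one_div_add_atTop_nhds_zero_nat
  have hdiv0 : ∀ x ∈ Ω.carrier, R < ‖x‖ → divg V x = 0 := by
    intro x hx hxR
    have : V =ᶠ[𝓝 x] fun _ => 0 := by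
      filter_upwards [Ω.isOpen.mem_nhds hx,
        (isOpen_lt continuous_const continuous_norm).mem_nhds hxR] with y hy hyR
      exact hR y (subset_closure hy) hyR
    simp [divg, this.fderiv_eq]
  have hlim : Tendsto (fun n => ∫ x in Ω.carrier, F n x) atTop
      (𝓝 (∫ x in Ω.carrier, divg V x)) := by
    have hdc := continuousOn_divg Ω.isOpen hV
    have hgdC : Continuous (fderiv ℝ Ω.g) := Ω.contDiff_g.continuous_fderiv (by norm_num)
    have hgC := Ω.contDiff_g.continuous
    have hds : Continuous downStep := (contDiff_downStep (n := 1)).continuous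
    have hdds : Continuous (deriv downStep) :=
      (contDiff_downStep (n := 1)).continuous_deriv le_rfl
    refine tendsto_integral_filter_of_dominated_convergence
      ((Metric.closedBall (0 : Sp d) R).indicator fun _ => d * C + 2 * C₁ * L) ?_ ?_ ?_ ?_
    · refine Eventually.of_forall fun n => ContinuousOn.aestronglyMeasurable ?_ Ω.isOpen.measurableSet
      refine ((hds.comp (by fun_prop)).continuousOn.mul hdc).add ?_
      refine (Continuous.continuousOn ?_).mul
        (hgdC.continuousOn.clm_apply (hVc.mono subset_closure))
      exact continuous_const.mul (hdds.comp (by fun_prop))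
    · have hev : ∀ᶠ n : ℕ in atTop, 2 * (1 / ((n : ℝ) + 1)) < δ₀ := by
        have := hδn.const_mul 2
        rw [mul_zero] at this
        exact this.eventually (eventually_lt_nhds hδ₀)
      filter_upwards [hev] with n hn
      rw [ae_restrict_iff' Ω.isOpen.measurableSet]
      refine Eventually.of_forall fun x hx => ?_
      by_cases hxR : ‖x‖ ≤ R
      · rw [indicator_of_mem (by simpa using hxR)]
        set δ : ℝ := 1 / ((n : ℝ) + 1) with hδ
        have hδ0 : 0 < δ := by positivity
        refine (norm_add_le _ _).trans (add_le_add ?_ ?_)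
        · rw [norm_mul, Real.norm_of_nonneg (downStep_nonneg _), Real.norm_eq_abs]
          have h1 : |divg V x| ≤ d * C := (abs_divg_le V x).trans (by gcongr; exact hC x hx)
          calc _ ≤ 1 * |divg V x| := by gcongr; exact downStep_le_one _
            _ ≤ _ := by rwa [one_mul]
        · by_cases h2 : Ω.g x / δ < -2
          · rw [deriv_downStep_of_lt h2]
            simp only [mul_zero, zero_mul, norm_zero]
            positivity
          by_cases h3 : -1 < Ω.g x / δ
          · rw [deriv_downStep_of_gt h3]
            simp only [mul_zero, zero_mul, norm_zero]
            positivity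
          rw [not_lt, le_div_iff₀ hδ0] at h2
          rw [not_lt, div_le_iff₀ hδ0] at h3
          have h4 := hbd x hx hxR (by linarith)
          rw [abs_of_neg (by linarith : Ω.g x < 0)] at h4
          rw [norm_mul, norm_mul, norm_inv, Real.norm_of_nonneg hδ0.le, Real.norm_eq_abs,
            Real.norm_eq_abs]
          calc δ⁻¹ * |deriv downStep (Ω.g x / δ)| * |fderiv ℝ Ω.g x (V x)|
              ≤ δ⁻¹ * C₁ * (L * (2 * δ)) := by
                gcongr
                · exact hstep _
                · exact h4.trans (by gcongr; linarith)
            _ = _ := by field_simp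
      · have hxR' := not_le.1 hxR
        rw [indicator_of_notMem (by simpa using hxR')]
        simp [hF, hdiv0 x hx hxR', hR x (subset_closure hx) hxR']
    · refine (integrable_indicator_iff Metric.isClosed_closedBall.measurableSet).2 ?_
      refine integrableOn_const ?_
      refine ne_of_lt (lt_of_le_of_lt (Measure.restrict_apply_le _ _) ?_)
      exact measure_closedBall_lt_top
    · rw [ae_restrict_iff' Ω.isOpen.measurableSet]
      refine Eventually.of_forall fun x hx => ?_
      have hgx : Ω.g x < 0 := by rw [Ω.carrier_eq] at hx; exact hx
      have hev : ∀ᶠ n : ℕ in atTop, 2 * (1 / ((n : ℝ) + 1)) < -Ω.g x := by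
        have := hδn.const_mul 2
        rw [mul_zero] at this
        exact this.eventually (eventually_lt_nhds (by linarith))
      refine tendsto_const_nhds.congr' ?_
      filter_upwards [hev] with n hn
      have h1 : Ω.g x / (1 / ((n : ℝ) + 1)) < -2 := by
        rw [div_lt_iff₀ (by positivity)]
        linarith
      simp only [hF]
      rw [downStep_of_le h1.le, deriv_downStep_of_lt h1]
      simp
  simp only [hF0] at hlim
  exact (tendsto_nhds_unique hlim tendsto_const_nhds)

/-! ### Bounded functions with continuous extensions -/

section Classes

set_option linter.unusedSectionVars false

variable {d : ℕ} {E F G : Type} [NormedAddCommGroup E] [NormedSpace ℝ E]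
  [NormedAddCommGroup F] [NormedSpace ℝ F] [NormedAddCommGroup G] [NormedSpace ℝ G]
  {T : ℝ} {Ω : Set (Sp d)}

theorem ExtendsCont.congr {u v : ℝ → Sp d → F} (h : ExtendsCont T Ω u)
    (huv : ∀ t ∈ Icc 0 T, ∀ x ∈ Ω, u t x = v t x) : ExtendsCont T Ω v := by
  obtain ⟨f, hf, hb, he⟩ := h
  exact ⟨f, hf, hb, fun t ht x hx => (he t ht x hx).trans (huv t ht x hx)⟩

theorem ExtendsCont.bilin (B : E →L[ℝ] F →L[ℝ] G) {u : ℝ → Sp d → E} {v : ℝ → Sp d → F}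
    (hu : ExtendsCont T Ω u) (hv : ExtendsCont T Ω v) :
    ExtendsCont T Ω fun t x => B (u t x) (v t x) := by
  obtain ⟨f, hf, ⟨C, hC⟩, he⟩ := hu
  obtain ⟨f', hf', ⟨C', hC'⟩, he'⟩ := hv
  refine ⟨fun t x => B (f t x) (f' t x), ?_, ⟨‖B‖ * C * C', fun t ht x hx => ?_⟩,
    fun t ht x hx => by simp only [he t ht x hx, he' t ht x hx]⟩
  · exact (B.continuous.comp_continuousOn hf).clm_apply hf'
  · have h0 : 0 ≤ C := (norm_nonneg _).trans (hC t ht x hx)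
    refine (B.le_opNorm₂ _ _).trans ?_
    have := hC t ht x hx
    have := hC' t ht x hx
    gcongr

theorem ExtendsCont.clm (L : E →L[ℝ] F) {u : ℝ → Sp d → E} (hu : ExtendsCont T Ω u) :
    ExtendsCont T Ω fun t x => L (u t x) := by
  obtain ⟨f, hf, ⟨C, hC⟩, he⟩ := hu
  refine ⟨fun t x => L (f t x), L.continuous.comp_continuousOn hf, ⟨‖L‖ * C, fun t ht x hx => ?_⟩,
    fun t ht x hx => by simp only [he t ht x hx]⟩
  exact (L.le_opNorm _).trans (by gcongr; exact hC t ht x hx)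

theorem ExtendsCont.add {u v : ℝ → Sp d → F} (hu : ExtendsCont T Ω u) (hv : ExtendsCont T Ω v) :
    ExtendsCont T Ω fun t x => u t x + v t x := by
  obtain ⟨f, hf, ⟨C, hC⟩, he⟩ := hu
  obtain ⟨f', hf', ⟨C', hC'⟩, he'⟩ := hv
  exact ⟨fun t x => f t x + f' t x, hf.add hf', ⟨C + C', fun t ht x hx =>
    (norm_add_le _ _).trans (add_le_add (hC t ht x hx) (hC' t ht x hx))⟩,
    fun t ht x hx => by simp only [he t ht x hx, he' t ht x hx]⟩

theorem ExtendsCont.neg {u : ℝ → Sp d → F} (hu : ExtendsCont T Ω u) :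
    ExtendsCont T Ω fun t x => -u t x := by
  simpa using hu.clm (-ContinuousLinearMap.id ℝ F)

theorem ExtendsCont.mul {u v : ℝ → Sp d → ℝ} (hu : ExtendsCont T Ω u) (hv : ExtendsCont T Ω v) :
    ExtendsCont T Ω fun t x => u t x * v t x :=
  hu.bilin (ContinuousLinearMap.mul ℝ ℝ) hv

theorem ExtendsCont.const (c : F) : ExtendsCont T Ω fun _ _ => c :=
  ⟨fun _ _ => c, continuousOn_const, ⟨‖c‖, fun _ _ _ _ => le_rfl⟩, fun _ _ _ _ => rfl⟩

theorem ExtendsCont.of_continuousOn_time {θ : ℝ → F} (h : ContinuousOn θ (Icc 0 T)) :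
    ExtendsCont T Ω fun t _ => θ t := by
  obtain ⟨C, hC⟩ := isCompact_Icc.exists_bound_of_continuousOn h
  exact ⟨fun t _ => θ t, h.comp continuousOn_fst fun p hp => hp.1, ⟨C, fun t ht _ _ => hC t ht⟩,
    fun _ _ _ _ => rfl⟩

theorem ExtendsCont.of_compact {u : ℝ → Sp d → F} (h : Continuous (Function.uncurry u)) {R : ℝ}
    (hR : ∀ t ∈ Icc 0 T, ∀ x, R < ‖x‖ → u t x = 0) : ExtendsCont T Ω u := by
  obtain ⟨C, hC⟩ := (isCompact_Icc.prod (isCompact_closedBall (0 : Sp d) R)).exists_bound_of_continuousOn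
    (f := Function.uncurry u) (s := Icc (0 : ℝ) T ×ˢ Metric.closedBall (0 : Sp d) R) h.continuousOn
  refine ⟨u, h.continuousOn, ⟨max C 0, fun t ht x _ => ?_⟩, fun _ _ _ _ => rfl⟩
  by_cases hx : ‖x‖ ≤ R
  · exact (hC (t, x) ⟨ht, by simpa using hx⟩).trans (le_max_left _ _)
  · simp [hR t ht x (not_le.1 hx)]

theorem ExtendsCont.continuousOn_slice {u : ℝ → Sp d → F} (h : ExtendsCont T Ω u) {t : ℝ}
    (ht : t ∈ Icc 0 T) : ContinuousOn (u t) Ω := by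
  obtain ⟨f, hf, -, he⟩ := h
  have h1 : ContinuousOn (f t) Ω :=
    hf.comp (by fun_prop : ContinuousOn (fun x : Sp d => (t, x)) Ω) fun x hx =>
      ⟨ht, subset_closure hx⟩
  exact h1.congr fun x hx => (he t ht x hx).symm

theorem ExtendsCont.continuousOn {u : ℝ → Sp d → F} (h : ExtendsCont T Ω u) :
    ContinuousOn (Function.uncurry u) (Icc 0 T ×ˢ Ω) := by
  obtain ⟨f, hf, -, he⟩ := h
  exact (hf.mono (prod_mono le_rfl subset_closure)).congr fun p hp => (he p.1 hp.1 p.2 hp.2).symm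

theorem ExtendsCont.exists_bound {u : ℝ → Sp d → F} (h : ExtendsCont T Ω u) :
    ∃ C, 0 ≤ C ∧ ∀ t ∈ Icc 0 T, ∀ x ∈ Ω, ‖u t x‖ ≤ C := by
  obtain ⟨f, -, ⟨C, hC⟩, he⟩ := h
  exact ⟨max C 0, le_max_right _ _, fun t ht x hx =>
    he t ht x hx ▸ (hC t ht x (subset_closure hx)).trans (le_max_left _ _)⟩

/-! ### Spatial regularity -/

/-- The slices are `Cᵏ` in `Ω`, with bounded derivatives that extend continuously. -/
structure SpaceReg (T : ℝ) (Ω : Set (Sp d)) (k : ℕ) (u : ℝ → Sp d → F) : Prop where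
  contDiffOn : ∀ t ∈ Icc 0 T, ContDiffOn ℝ k (u t) Ω
  extends_deriv : ∀ j : ℕ, j ≤ k → ExtendsCont T Ω (fun t x => iteratedFDeriv ℝ j (u t) x)

theorem IsSpaceCk.spaceReg {k : ℕ} {u : ℝ → Sp d → F} (h : IsSpaceCk T Ω k u) :
    SpaceReg T Ω k u := ⟨h.contDiffOn, h.extends_deriv⟩

theorem SpaceReg.isSpaceCk {k : ℕ} {u : ℝ → Sp d → F} (h : SpaceReg T Ω k u)
    (hc : ContinuousOn (Function.uncurry u) (Icc 0 T ×ˢ closure Ω)) : IsSpaceCk T Ω k u :=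
  ⟨hc, h.contDiffOn, h.extends_deriv⟩

theorem SpaceReg.mono {k l : ℕ} {u : ℝ → Sp d → F} (h : SpaceReg T Ω k u) (hl : l ≤ k) :
    SpaceReg T Ω l u :=
  ⟨fun t ht => (h.contDiffOn t ht).of_le (by exact_mod_cast hl),
    fun j hj => h.extends_deriv j (hj.trans hl)⟩

theorem extendsCont_iteratedFDeriv_zero {u : ℝ → Sp d → F} :
    ExtendsCont T Ω (fun t x => iteratedFDeriv ℝ 0 (u t) x) ↔ ExtendsCont T Ω u := by
  constructor
  · intro h
    refine (h.clm ((continuousMultilinearCurryFin0 ℝ (Sp d) F).toContinuousLinearEquiv :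
      _ →L[ℝ] F)).congr fun t _ x _ => ?_
    simp [iteratedFDeriv_zero_eq_comp]
  · intro h
    refine (h.clm ((continuousMultilinearCurryFin0 ℝ (Sp d) F).symm.toContinuousLinearEquiv :
      F →L[ℝ] _)).congr fun t _ x _ => ?_
    simp [iteratedFDeriv_zero_eq_comp]

theorem extendsCont_iteratedFDeriv_succ {u : ℝ → Sp d → F} {j : ℕ} :
    ExtendsCont T Ω (fun t x => iteratedFDeriv ℝ (j + 1) (u t) x) ↔
      ExtendsCont T Ω (fun t x => iteratedFDeriv ℝ j (fderiv ℝ (u t)) x) := by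
  constructor
  · intro h
    refine (h.clm ((continuousMultilinearCurryRightEquiv' ℝ j (Sp d) F).toContinuousLinearEquiv :
      _ →L[ℝ] _)).congr fun t _ x _ => ?_
    rw [iteratedFDeriv_succ_eq_comp_right]
    simp
  · intro h
    refine (h.clm ((continuousMultilinearCurryRightEquiv' ℝ j (Sp d) F).symm.toContinuousLinearEquiv :
      _ →L[ℝ] _)).congr fun t _ x _ => ?_
    rw [iteratedFDeriv_succ_eq_comp_right]
    simp

theorem spaceReg_zero {u : ℝ → Sp d → F} : SpaceReg T Ω 0 u ↔ ExtendsCont T Ω u := by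
  constructor
  · exact fun h => extendsCont_iteratedFDeriv_zero.1 (h.extends_deriv 0 le_rfl)
  · intro h
    refine ⟨fun t ht => contDiffOn_zero.2 (h.continuousOn_slice ht), fun j hj => ?_⟩
    obtain rfl : j = 0 := by omega
    exact extendsCont_iteratedFDeriv_zero.2 h

/-- Reduces order k+1 to order k for the derivative, so that products and cutoffs are handled by
induction on k instead of a Leibniz formula for iterated derivatives. -/
theorem spaceReg_succ (hΩ : IsOpen Ω) {k : ℕ} {u : ℝ → Sp d → F} :
    SpaceReg T Ω (k + 1) u ↔ ExtendsCont T Ω u ∧ (∀ t ∈ Icc 0 T, DifferentiableOn ℝ (u t) Ω) ∧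
      SpaceReg T Ω k (fun t => fderiv ℝ (u t)) := by
  constructor
  · intro h
    refine ⟨extendsCont_iteratedFDeriv_zero.1 (h.extends_deriv 0 (by omega)), fun t ht => ?_, ?_, ?_⟩
    · exact (h.contDiffOn t ht).differentiableOn (by simp)
    · intro t ht
      exact ((contDiffOn_succ_iff_fderiv_of_isOpen hΩ).1 (by exact_mod_cast h.contDiffOn t ht)).2.2
    · intro j hj
      exact extendsCont_iteratedFDeriv_succ.1 (h.extends_deriv (j + 1) (by omega))
  · rintro ⟨h1, h2, h3⟩
    refine ⟨fun t ht => ?_, fun j hj => ?_⟩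
    · have := (contDiffOn_succ_iff_fderiv_of_isOpen (n := k) hΩ).2
        ⟨h2 t ht, by simp, h3.contDiffOn t ht⟩
      exact_mod_cast this
    · rcases j with _ | j
      · exact extendsCont_iteratedFDeriv_zero.2 h1
      · exact extendsCont_iteratedFDeriv_succ.2 (h3.extends_deriv j (by omega))

theorem SpaceReg.extendsCont {k : ℕ} {u : ℝ → Sp d → F} (h : SpaceReg T Ω k u) :
    ExtendsCont T Ω u := extendsCont_iteratedFDeriv_zero.1 (h.extends_deriv 0 (by omega))

theorem SpaceReg.congr (hΩ : IsOpen Ω) {k : ℕ} {u v : ℝ → Sp d → F} (h : SpaceReg T Ω k u)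
    (huv : ∀ t ∈ Icc 0 T, ∀ x ∈ Ω, u t x = v t x) : SpaceReg T Ω k v := by
  refine ⟨fun t ht => (h.contDiffOn t ht).congr fun x hx => (huv t ht x hx).symm,
    fun j hj => (h.extends_deriv j hj).congr fun t ht x hx => ?_⟩
  have : u t =ᶠ[𝓝 x] v t := by
    filter_upwards [hΩ.mem_nhds hx] with y hy using huv t ht y hy
  exact (this.iteratedFDeriv ℝ j).eq_of_nhds

theorem SpaceReg.add (hΩ : IsOpen Ω) {k : ℕ} {u v : ℝ → Sp d → F} (hu : SpaceReg T Ω k u)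
    (hv : SpaceReg T Ω k v) : SpaceReg T Ω k fun t x => u t x + v t x := by
  refine ⟨fun t ht => (hu.contDiffOn t ht).add (hv.contDiffOn t ht), fun j hj =>
    ((hu.extends_deriv j hj).add (hv.extends_deriv j hj)).congr fun t ht x hx => ?_⟩
  have h1 := ((hu.contDiffOn t ht).contDiffAt (hΩ.mem_nhds hx)).of_le
    (by exact_mod_cast hj : (j : WithTop ℕ∞) ≤ k)
  have h2 := ((hv.contDiffOn t ht).contDiffAt (hΩ.mem_nhds hx)).of_le
    (by exact_mod_cast hj : (j : WithTop ℕ∞) ≤ k)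
  exact (iteratedFDeriv_add_apply h1 h2).symm

end Classes

/-- The spaces are quantified inside the induction: the derivative of a bilinear expression is a sum
of two bilinear expressions with values in spaces of operators. -/
theorem SpaceReg.bilin {d : ℕ} {T : ℝ} {Ω : Set (Sp d)} (hΩ : IsOpen Ω) {k : ℕ} :
    ∀ {E F G : Type} [NormedAddCommGroup E] [NormedSpace ℝ E]
    [NormedAddCommGroup F] [NormedSpace ℝ F] [NormedAddCommGroup G] [NormedSpace ℝ G]
    (B : E →L[ℝ] F →L[ℝ] G) {u : ℝ → Sp d → E} {v : ℝ → Sp d → F},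
    SpaceReg T Ω k u → SpaceReg T Ω k v → SpaceReg T Ω k fun t x => B (u t x) (v t x) := by
  induction k with
  | zero =>
    intro E F G _ _ _ _ _ _ B u v hu hv
    exact spaceReg_zero.2 ((spaceReg_zero.1 hu).bilin B (spaceReg_zero.1 hv))
  | succ k ih =>
    intro E F G _ _ _ _ _ _ B u v hu hv
    obtain ⟨hu1, hu2, hu3⟩ := (spaceReg_succ hΩ).1 hu
    obtain ⟨hv1, hv2, hv3⟩ := (spaceReg_succ hΩ).1 hv
    refine (spaceReg_succ hΩ).2 ⟨hu1.bilin B hv1, fun t ht => ?_, ?_⟩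
    · exact (B.isBoundedBilinearMap.differentiable).comp_differentiableOn
        ((hu2 t ht).prodMk (hv2 t ht))
    · refine ((ih (B.precompR (Sp d)) (hu.mono (Nat.le_succ k)) hv3).add hΩ
        (ih (B.precompL (Sp d)) hu3 (hv.mono (Nat.le_succ k)))).congr hΩ fun t ht x hx => ?_
      exact (B.fderiv_of_bilinear ((hu2 t ht).differentiableAt (hΩ.mem_nhds hx))
        ((hv2 t ht).differentiableAt (hΩ.mem_nhds hx))).symm

theorem SpaceReg.zero {d : ℕ} {T : ℝ} {Ω : Set (Sp d)} (hΩ : IsOpen Ω) {k : ℕ} :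
    ∀ {F : Type} [NormedAddCommGroup F] [NormedSpace ℝ F],
    SpaceReg T Ω k fun (_ : ℝ) (_ : Sp d) => (0 : F) := by
  induction k with
  | zero => intro F _ _; exact spaceReg_zero.2 (ExtendsCont.const 0)
  | succ k ih =>
    intro F _ _
    refine (spaceReg_succ hΩ).2 ⟨ExtendsCont.const 0, fun t _ => differentiableOn_const 0, ?_⟩
    refine ih.congr hΩ fun t _ x _ => ?_
    simp

theorem SpaceReg.time {d : ℕ} {T : ℝ} {Ω : Set (Sp d)} (hΩ : IsOpen Ω) {k : ℕ} {F : Type}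
    [NormedAddCommGroup F] [NormedSpace ℝ F] {θ : ℝ → F} (h : ContinuousOn θ (Icc 0 T)) :
    SpaceReg T Ω k fun t _ => θ t := by
  rcases k with _ | k
  · exact spaceReg_zero.2 (ExtendsCont.of_continuousOn_time h)
  · refine (spaceReg_succ hΩ).2 ⟨ExtendsCont.of_continuousOn_time h,
      fun t _ => differentiableOn_const _, ?_⟩
    refine (SpaceReg.zero hΩ).congr hΩ fun t _ x _ => ?_
    simp

theorem SpaceReg.of_contDiff {d : ℕ} {T : ℝ} {Ω : Set (Sp d)} (hΩ : IsOpen Ω) {R : ℝ} {k : ℕ} :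
    ∀ {F : Type} [NormedAddCommGroup F] [NormedSpace ℝ F] {u : ℝ → Sp d → F},
    ContDiff ℝ k (Function.uncurry u) → (∀ t ∈ Icc 0 T, ∀ x, R < ‖x‖ → u t x = 0) →
    SpaceReg T Ω k u := by
  induction k with
  | zero => intro F _ _ u hu hR; exact spaceReg_zero.2 (ExtendsCont.of_compact hu.continuous hR)
  | succ k ih =>
    intro F _ _ u hu hR
    have hd : Differentiable ℝ (Function.uncurry u) := hu.differentiable (by simp)
    have hi : ∀ t x, HasFDerivAt (fun x : Sp d => (t, x)) (ContinuousLinearMap.inr ℝ ℝ (Sp d)) x :=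
      fun t x => (hasFDerivAt_const t x).prodMk (hasFDerivAt_id x)
    have hf : ∀ t x, HasFDerivAt (u t)
        ((fderiv ℝ (Function.uncurry u) (t, x)).comp (ContinuousLinearMap.inr ℝ ℝ (Sp d))) x :=
      fun t x => (hd (t, x)).hasFDerivAt.comp x (hi t x)
    refine (spaceReg_succ hΩ).2 ⟨ExtendsCont.of_compact hu.continuous hR,
      fun t _ x _ => (hf t x).differentiableAt.differentiableWithinAt, ih ?_ ?_⟩
    · have e : (Function.uncurry fun t => fderiv ℝ (u t)) = fun p : ℝ × Sp d =>
          (fderiv ℝ (Function.uncurry u) p).comp (ContinuousLinearMap.inr ℝ ℝ (Sp d)) :=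
        funext fun p => (hf p.1 p.2).fderiv
      rw [e]
      exact (hu.fderiv_right (m := k) (by simp)).clm_comp contDiff_const
    · intro t ht x hx
      have : u t =ᶠ[𝓝 x] fun _ => 0 := by
        filter_upwards [(isOpen_lt continuous_const continuous_norm).mem_nhds hx] with y hy
        exact hR t ht y hy
      rw [this.fderiv_eq]
      simp

/-! ### Regularity in time -/

section Time

variable {d : ℕ} {E F G : Type} [NormedAddCommGroup E] [NormedSpace ℝ E]
  [NormedAddCommGroup F] [NormedSpace ℝ F] [NormedAddCommGroup G] [NormedSpace ℝ G]
  {T : ℝ} {Ω : Set (Sp d)}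

theorem IsTimeC1.hasDerivWithinAt {u : ℝ → Sp d → F} (h : IsTimeC1 T Ω u) {t : ℝ} {x : Sp d}
    (ht : t ∈ Icc 0 T) (hx : x ∈ Ω) :
    HasDerivWithinAt (fun s => u s x) (dt T u t x) (Icc 0 T) t :=
  (h.differentiableOn x hx t ht).hasDerivWithinAt

theorem dt_eq (hT : 0 < T) {u : ℝ → Sp d → F} {u' : F} {t : ℝ} {x : Sp d} (ht : t ∈ Icc 0 T)
    (h : HasDerivWithinAt (fun s => u s x) u' (Icc 0 T) t) : dt T u t x = u' :=
  h.derivWithin (uniqueDiffOn_Icc hT t ht)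

theorem IsTimeC1.of_hasDerivWithinAt (hT : 0 < T) {u u' : ℝ → Sp d → F}
    (h : ∀ t ∈ Icc 0 T, ∀ x ∈ Ω, HasDerivWithinAt (fun s => u s x) (u' t x) (Icc 0 T) t)
    (he : ExtendsCont T Ω u') : IsTimeC1 T Ω u :=
  ⟨fun x hx t ht => (h t ht x hx).differentiableWithinAt,
    he.congr fun t ht x hx => (dt_eq hT ht (h t ht x hx)).symm⟩

theorem HasDerivWithinAt.bilin' (B : E →L[ℝ] F →L[ℝ] G) {u : ℝ → E} {v : ℝ → F} {u' : E} {v' : F}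
    {s : Set ℝ} {t : ℝ} (hu : HasDerivWithinAt u u' s t) (hv : HasDerivWithinAt v v' s t) :
    HasDerivWithinAt (fun t => B (u t) (v t)) (B (u t) v' + B u' (v t)) s t := by
  have h1 := (B.hasFDerivAt (x := u t)).comp_hasDerivWithinAt t hu
  have := HasDerivWithinAt.clm_apply h1 hv
  rw [add_comm]
  exact this

theorem dt_bilin (hT : 0 < T) (B : E →L[ℝ] F →L[ℝ] G) {u : ℝ → Sp d → E} {v : ℝ → Sp d → F}
    (hu : IsTimeC1 T Ω u) (hv : IsTimeC1 T Ω v) {t : ℝ} {x : Sp d} (ht : t ∈ Icc 0 T)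
    (hx : x ∈ Ω) :
    dt T (fun t x => B (u t x) (v t x)) t x = B (u t x) (dt T v t x) + B (dt T u t x) (v t x) :=
  dt_eq hT ht (HasDerivWithinAt.bilin' B (hu.hasDerivWithinAt ht hx) (hv.hasDerivWithinAt ht hx))

theorem IsTimeC1.bilin (hT : 0 < T) (B : E →L[ℝ] F →L[ℝ] G) {u : ℝ → Sp d → E} {v : ℝ → Sp d → F}
    (hu : IsTimeC1 T Ω u) (hv : IsTimeC1 T Ω v) (hu' : ExtendsCont T Ω u)
    (hv' : ExtendsCont T Ω v) : IsTimeC1 T Ω fun t x => B (u t x) (v t x) :=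
  IsTimeC1.of_hasDerivWithinAt hT (fun _ ht _ hx =>
    HasDerivWithinAt.bilin' B (hu.hasDerivWithinAt ht hx) (hv.hasDerivWithinAt ht hx))
    ((hu'.bilin B hv.extends_dt).add (hu.extends_dt.bilin B hv'))

theorem IsTimeC1.add (hT : 0 < T) {u v : ℝ → Sp d → F} (hu : IsTimeC1 T Ω u) (hv : IsTimeC1 T Ω v) :
    IsTimeC1 T Ω fun t x => u t x + v t x :=
  IsTimeC1.of_hasDerivWithinAt hT (fun _ ht _ hx =>
    (hu.hasDerivWithinAt ht hx).add (hv.hasDerivWithinAt ht hx)) (hu.extends_dt.add hv.extends_dt)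

theorem IsTimeC1.time (hT : 0 < T) {θ : ℝ → F} (h : ContDiff ℝ 1 θ) :
    IsTimeC1 T Ω fun t _ => θ t :=
  IsTimeC1.of_hasDerivWithinAt (u' := fun t _ => deriv θ t) hT (fun t _ _ _ =>
    (h.differentiable (by simp) t).hasDerivAt.hasDerivWithinAt)
    (ExtendsCont.of_continuousOn_time (h.continuous_deriv le_rfl).continuousOn)

theorem dt_time (hT : 0 < T) {θ : ℝ → F} (h : ContDiff ℝ 1 θ) {t : ℝ} (ht : t ∈ Icc 0 T)
    (x : Sp d) : dt T (fun t _ => θ t) t x = deriv θ t :=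
  dt_eq hT ht (h.differentiable (by simp) t).hasDerivAt.hasDerivWithinAt

theorem hasDerivAt_uncurry_left {u : ℝ → Sp d → F} (h : ContDiff ℝ 1 (Function.uncurry u))
    (t : ℝ) (x : Sp d) : HasDerivAt (fun s => u s x) (fderiv ℝ (Function.uncurry u) (t, x) (1, 0)) t := by
  have h1 : HasFDerivAt (Function.uncurry u) (fderiv ℝ (Function.uncurry u) (t, x)) (t, x) :=
    (h.differentiable (by simp) (t, x)).hasFDerivAt
  have h2 : HasDerivAt (fun s : ℝ => (s, x)) (1, 0) t :=
    (hasDerivAt_id t).prodMk (hasDerivAt_const t x)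
  exact h1.comp_hasDerivAt t h2

theorem IsTimeC1.of_contDiff (hT : 0 < T) {u : ℝ → Sp d → F}
    (h : ContDiff ℝ 1 (Function.uncurry u)) {R : ℝ}
    (hR : ∀ t ∈ Icc 0 T, ∀ x, R < ‖x‖ → u t x = 0) : IsTimeC1 T Ω u := by
  have hc : Continuous fun p : ℝ × Sp d => fderiv ℝ (Function.uncurry u) p (1, 0) := by
    have := h.continuous_fderiv (by simp)
    fun_prop
  have hd := fun t (_ : t ∈ Icc 0 T) x (_ : x ∈ Ω) =>
    (hasDerivAt_uncurry_left h t x).hasDerivWithinAt (s := Icc 0 T)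
  refine IsTimeC1.of_hasDerivWithinAt hT hd (ExtendsCont.of_compact (R := R) hc ?_)
  intro t ht x hx
  have h1 := (hasDerivAt_uncurry_left h t x).hasDerivWithinAt (s := Icc 0 T)
  have h2 : HasDerivWithinAt (fun s => u s x) 0 (Icc 0 T) t :=
    (hasDerivWithinAt_const t (Icc 0 T) (0 : F)).congr (fun s hs => hR s hs x hx) (hR t ht x hx)
  exact (uniqueDiffOn_Icc hT t ht).eq_deriv _ h1 h2

end Time

/-! ### Strong solutions of the Euler system -/

/-- The specific enthalpy `f'(ρ) = γ / (γ - 1) ρ^(γ - 1)`. -/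
def enthalpy (γ ρ : ℝ) : ℝ := γ / (γ - 1) * ρ ^ (γ - 1)

theorem hasDerivAt_internalEnergy {γ s : ℝ} (hγ : 1 < γ) :
    HasDerivAt (internalEnergy γ) (enthalpy γ s) s := by
  have := (Real.hasDerivAt_rpow_const (x := s) (p := γ) (Or.inr hγ.le)).div_const (γ - 1)
  unfold enthalpy
  rw [div_mul_eq_mul_div]
  exact this

theorem hasDerivAt_enthalpy {γ s : ℝ} (hγ : 1 < γ) (hs : 0 < s) :
    HasDerivAt (enthalpy γ) (γ * s ^ (γ - 2)) s := by
  have := (Real.hasDerivAt_rpow_const (x := s) (p := γ - 1) (Or.inl hs.ne')).const_mul (γ / (γ - 1))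
  have h1 : γ - 1 ≠ 0 := by linarith
  have e : γ / (γ - 1) * ((γ - 1) * s ^ (γ - 1 - 1)) = γ * s ^ (γ - 2) := by
    rw [show γ - 1 - 1 = γ - 2 by ring]
    field_simp
  rw [e] at this
  exact this

theorem hasDerivAt_pressure {γ s : ℝ} (hγ : 1 < γ) :
    HasDerivAt (pressure γ) (γ * s ^ (γ - 1)) s :=
  Real.hasDerivAt_rpow_const (Or.inr hγ.le)

theorem mul_rpow_sub_two {γ s : ℝ} (hs : 0 < s) : s * (γ * s ^ (γ - 2)) = γ * s ^ (γ - 1) := by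
  have : s ^ (γ - 1) = s ^ (γ - 2) * s := by
    rw [← Real.rpow_add_one hs.ne']; congr 1; ring
  rw [this]; ring

theorem mul_rpow_sub_one {γ s : ℝ} (hs : 0 < s) : s * (γ * s ^ (γ - 1)) = γ * s ^ γ := by
  have : s ^ γ = s ^ (γ - 1) * s := by
    rw [← Real.rpow_add_one hs.ne']; congr 1; ring
  rw [this]; ring

theorem ExtendsCont.rpow {d : ℕ} {T : ℝ} {Ω : Set (Sp d)} {u : ℝ → Sp d → ℝ}
    (h : ExtendsCont T Ω u) (h0 : ∀ t ∈ Icc 0 T, ∀ x ∈ Ω, 0 ≤ u t x) {q : ℝ} (hq : 0 ≤ q) :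
    ExtendsCont T Ω fun t x => u t x ^ q := by
  obtain ⟨f, hf, ⟨C, hC⟩, he⟩ := h
  refine ⟨fun t x => |f t x| ^ q, ?_, ⟨C ^ q, fun t ht x hx => ?_⟩, fun t ht x hx => ?_⟩
  · exact hf.abs.rpow_const fun _ _ => Or.inr hq
  · rw [Real.norm_of_nonneg (by positivity)]
    exact Real.rpow_le_rpow (abs_nonneg _) (hC t ht x hx) hq
  · simp only [he t ht x hx, abs_of_nonneg (h0 t ht x hx)]

namespace IsStrongEulerSolution

variable {d : ℕ} {Ω : C3Domain d} {γ T : ℝ} {r : ℝ → Sp d → ℝ} {u : ℝ → Sp d → Sp d}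

theorem pos (hE : IsStrongEulerSolution Ω γ T r u) {t : ℝ} {x : Sp d} (ht : t ∈ Icc 0 T)
    (hx : x ∈ Ω.carrier) : 0 < r t x := hE.rho_pos t ht x (subset_closure hx)

theorem rho_diff (hE : IsStrongEulerSolution Ω γ T r u) {t : ℝ} {x : Sp d} (ht : t ∈ Icc 0 T)
    (hx : x ∈ Ω.carrier) : HasFDerivAt (r t) (fderiv ℝ (r t) x) x :=
  (((hE.rho_space.contDiffOn t ht).contDiffAt (Ω.isOpen.mem_nhds hx)).differentiableAt
    (by simp)).hasFDerivAt

theorem u_diff (hE : IsStrongEulerSolution Ω γ T r u) {t : ℝ} {x : Sp d} (ht : t ∈ Icc 0 T)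
    (hx : x ∈ Ω.carrier) : HasFDerivAt (u t) (fderiv ℝ (u t) x) x :=
  (((hE.u_space.contDiffOn t ht).contDiffAt (Ω.isOpen.mem_nhds hx)).differentiableAt
    (by simp)).hasFDerivAt

theorem mass_expand (hE : IsStrongEulerSolution Ω γ T r u) {t : ℝ} {x : Sp d} (ht : t ∈ Icc 0 T)
    (hx : x ∈ Ω.carrier) :
    dt T r t x = -(r t x * divg (u t) x + fderiv ℝ (r t) x (u t x)) := by
  have h := hE.mass t ht x hx
  rw [divg_smul (hE.rho_diff ht hx).differentiableAt (hE.u_diff ht hx).differentiableAt] at h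
  linarith

theorem hasFDerivAt_comp (hE : IsStrongEulerSolution Ω γ T r u) {φ : ℝ → ℝ} {φ' : ℝ} {t : ℝ}
    {x : Sp d} (ht : t ∈ Icc 0 T) (hx : x ∈ Ω.carrier) (h : HasDerivAt φ φ' (r t x)) :
    HasFDerivAt (fun y => φ (r t y)) (φ' • fderiv ℝ (r t) x) x :=
  h.comp_hasFDerivAt x (hE.rho_diff ht hx)

theorem hasDerivWithinAt_comp (hE : IsStrongEulerSolution Ω γ T r u) {φ : ℝ → ℝ} {φ' : ℝ} {t : ℝ}
    {x : Sp d} (ht : t ∈ Icc 0 T) (hx : x ∈ Ω.carrier) (h : HasDerivAt φ φ' (r t x)) :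
    HasDerivWithinAt (fun s => φ (r s x)) (φ' * dt T r t x) (Icc 0 T) t :=
  h.comp_hasDerivWithinAt t (hE.rho_time.hasDerivWithinAt ht hx)

theorem gradient_of_hasFDerivAt_smul {f g : Sp d → ℝ} {a : ℝ} {x : Sp d}
    (h : HasFDerivAt f (a • fderiv ℝ g x) x) : gradient f x = a • gradient g x := by
  rw [gradient, h.fderiv, map_smul]
  rfl

/-- Subtract u times the continuity equation from the momentum equation, use ∇p(r) = r∇h(r) and
divide by r > 0. Besides its role in the entropy computation, the identity bounds ∇h(r) by
derivatives of u alone. -/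
theorem velocity_eq (hE : IsStrongEulerSolution Ω γ T r u) (hT : 0 < T) (hγ : 1 < γ) {t : ℝ}
    {x : Sp d} (ht : t ∈ Icc 0 T) (hx : x ∈ Ω.carrier) :
    gradient (fun y => enthalpy γ (r t y)) x = -(dt T u t x + fderiv ℝ (u t) x (u t x)) := by
  have hr := hE.pos ht hx
  have hrd := hE.rho_diff ht hx
  have hud := hE.u_diff ht hx
  have h := hE.momentum t ht x hx
  have e1 : dt T (fun s y => r s y • u s y) t x = r t x • dt T u t x + dt T r t x • u t x :=
    dt_eq hT ht ((hE.rho_time.hasDerivWithinAt ht hx).smul (hE.u_time.hasDerivWithinAt ht hx))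
  have hj : ∀ j : Fin d, HasFDerivAt (fun y => u t y j)
      ((EuclideanSpace.proj (𝕜 := ℝ) j).comp (fderiv ℝ (u t) x)) x := fun j =>
    (EuclideanSpace.proj j : Sp d →L[ℝ] ℝ).hasFDerivAt.comp x hud
  have eu : u t x = ∑ j : Fin d, u t x j • EuclideanSpace.single j (1 : ℝ) := by
    ext i
    simp [Finset.sum_apply, Pi.single_apply]
  have e2 : ∑ j : Fin d, fderiv ℝ (fun y => (r t y * u t y j) • u t y) x (EuclideanSpace.single j 1)
      = r t x • fderiv ℝ (u t) x (u t x) + divg (fun y => r t y • u t y) x • u t x := by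
    have h1 : ∀ j : Fin d, fderiv ℝ (fun y => (r t y * u t y j) • u t y) x (EuclideanSpace.single j 1)
        = r t x • (u t x j • fderiv ℝ (u t) x (EuclideanSpace.single j 1))
          + (fderiv ℝ (fun y => r t y • u t y) x (EuclideanSpace.single j 1)) j • u t x := by
      intro j
      have h5 : HasFDerivAt (fun y => (r t y * u t y j) • u t y) _ x := (hrd.mul (hj j)).smul hud
      have h6 : HasFDerivAt (fun y => r t y • u t y) _ x := hrd.smul hud
      rw [h5.fderiv, h6.fderiv]
      simp [smul_smul]
      congr 1
      ring
    rw [Finset.sum_congr rfl fun j _ => h1 j, Finset.sum_add_distrib, ← Finset.smul_sum,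
      ← Finset.sum_smul]
    congr 2
    conv_rhs => rw [eu]
    rw [map_sum]
    refine Finset.sum_congr rfl fun j _ => ?_
    rw [map_smul]
  have hm := hE.mass t ht x hx
  have hm' : divg (fun y => r t y • u t y) x = -dt T r t x := by linarith
  have e3 : gradient (fun y => pressure γ (r t y)) x
      = r t x • gradient (fun y => enthalpy γ (r t y)) x := by
    rw [gradient_of_hasFDerivAt_smul (hE.hasFDerivAt_comp ht hx (hasDerivAt_pressure hγ)),
      gradient_of_hasFDerivAt_smul (hE.hasFDerivAt_comp ht hx (hasDerivAt_enthalpy hγ hr)), smul_smul,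
      mul_rpow_sub_two hr]
  rw [e1, e2, e3, hm'] at h
  have h2 : r t x • (dt T u t x + fderiv ℝ (u t) x (u t x)
      + gradient (fun y => enthalpy γ (r t y)) x) = 0 := by
    rw [← h]
    module
  rcases smul_eq_zero.1 h2 with h3 | h3
  · exact absurd h3 hr.ne'
  · rw [eq_neg_iff_add_eq_zero, add_comm]
    exact h3

theorem fderiv_u_extends (hE : IsStrongEulerSolution Ω γ T r u) :
    ExtendsCont T Ω.carrier fun t x => fderiv ℝ (u t) x :=
  ((spaceReg_succ Ω.isOpen).1 hE.u_space.spaceReg).2.2.extendsCont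

theorem fderiv_rho_extends (hE : IsStrongEulerSolution Ω γ T r u) :
    ExtendsCont T Ω.carrier fun t x => fderiv ℝ (r t) x :=
  ((spaceReg_succ Ω.isOpen).1 hE.rho_space.spaceReg).2.2.extendsCont

theorem rpow_extends (hE : IsStrongEulerSolution Ω γ T r u) {q : ℝ} (hq : 0 ≤ q) :
    ExtendsCont T Ω.carrier fun t x => r t x ^ q :=
  hE.rho_space.spaceReg.extendsCont.rpow (fun _ ht _ hx => (hE.pos ht hx).le) hq

theorem apply_extends {A : ℝ → Sp d → Sp d →L[ℝ] Sp d} {v : ℝ → Sp d → Sp d}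
    {S : Set (Sp d)} (hA : ExtendsCont T S A) (hv : ExtendsCont T S v) :
    ExtendsCont T S fun t x => A t x (v t x) :=
  hA.bilin (ContinuousLinearMap.id ℝ (Sp d →L[ℝ] Sp d)) hv

/-- The trace of an endomorphism of `ℝᵈ`. -/
def traceCLM (d : ℕ) : (Sp d →L[ℝ] Sp d) →L[ℝ] ℝ :=
  ∑ i : Fin d, (EuclideanSpace.proj i : Sp d →L[ℝ] ℝ).comp
    (ContinuousLinearMap.apply ℝ (Sp d) (EuclideanSpace.single i (1 : ℝ)))

theorem divg_eq_traceCLM (v : Sp d → Sp d) (x : Sp d) : divg v x = traceCLM d (fderiv ℝ v x) := by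
  simp [divg, traceCLM]

theorem divg_u_extends (hE : IsStrongEulerSolution Ω γ T r u) :
    ExtendsCont T Ω.carrier fun t x => divg (u t) x :=
  (hE.fderiv_u_extends.clm (traceCLM d)).congr fun _ _ _ _ => (divg_eq_traceCLM _ _).symm

theorem rpow_continuousOn (hE : IsStrongEulerSolution Ω γ T r u) (q : ℝ) :
    ContinuousOn (fun p : ℝ × Sp d => r p.1 p.2 ^ q) (Icc 0 T ×ˢ closure Ω.carrier) :=
  hE.rho_space.continuousOn.rpow_const fun p hp => Or.inl (hE.rho_pos p.1 hp.1 p.2 hp.2).ne'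

theorem enthalpy_space (hE : IsStrongEulerSolution Ω γ T r u) (hT : 0 < T) (hγ : 1 < γ) :
    IsSpaceCk T Ω.carrier 1 fun t x => enthalpy γ (r t x) := by
  refine SpaceReg.isSpaceCk ((spaceReg_succ Ω.isOpen).2 ⟨?_, ?_, spaceReg_zero.2 ?_⟩)
    ((hE.rpow_continuousOn (γ - 1)).const_smul (γ / (γ - 1)))
  · exact (ExtendsCont.const (γ / (γ - 1))).mul (hE.rpow_extends (by linarith))
  · intro t ht x hx
    exact (hE.hasFDerivAt_comp ht hx
      (hasDerivAt_enthalpy hγ (hE.pos ht hx))).differentiableAt.differentiableWithinAt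
  -- The chain rule would give γ r^(γ-2)∇r, which for γ < 2 has no evident bound where r tends to
  -- zero at infinity; the equation of motion supplies the bounded continuous extension.
  · have h := (hE.u_time.extends_dt.add
      (apply_extends hE.fderiv_u_extends hE.u_space.spaceReg.extendsCont)).neg
    refine (h.clm (innerSL ℝ)).congr fun t ht x hx => ?_
    rw [← hE.velocity_eq hT hγ ht hx]
    ext z
    rw [innerSL_apply_apply, inner_gradient]

/-- The continuity equation multiplied by h'(r), arranged so that only r^(γ-1) and ∇h(r) appear,
both of which are bounded. -/
theorem dt_enthalpy (hE : IsStrongEulerSolution Ω γ T r u) (hγ : 1 < γ) {t : ℝ}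
    {x : Sp d} (ht : t ∈ Icc 0 T) (hx : x ∈ Ω.carrier) :
    HasDerivWithinAt (fun s => enthalpy γ (r s x))
      (-(γ * r t x ^ (γ - 1) * divg (u t) x + ⟪gradient (fun y => enthalpy γ (r t y)) x, u t x⟫_ℝ))
      (Icc 0 T) t := by
  have hr := hE.pos ht hx
  have h := hE.hasDerivWithinAt_comp ht hx (hasDerivAt_enthalpy hγ hr)
  convert! h using 1
  rw [inner_gradient, (hE.hasFDerivAt_comp ht hx (hasDerivAt_enthalpy hγ hr)).fderiv,
    hE.mass_expand ht hx, ← mul_rpow_sub_two hr]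
  simp only [smul_apply, smul_eq_mul]
  ring

theorem enthalpy_time (hE : IsStrongEulerSolution Ω γ T r u) (hT : 0 < T) (hγ : 1 < γ) :
    IsTimeC1 T Ω.carrier fun t x => enthalpy γ (r t x) := by
  refine IsTimeC1.of_hasDerivWithinAt hT (fun t ht x hx => hE.dt_enthalpy hγ ht hx) ?_
  refine ExtendsCont.neg (ExtendsCont.add ?_ ?_)
  · exact ((ExtendsCont.const γ).mul (hE.rpow_extends (by linarith))).mul hE.divg_u_extends
  · have h := (hE.u_time.extends_dt.add
      (apply_extends hE.fderiv_u_extends hE.u_space.spaceReg.extendsCont)).neg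
    refine (h.bilin (innerSL ℝ) hE.u_space.spaceReg.extendsCont).congr fun t ht x hx => ?_
    rw [← hE.velocity_eq hT hγ ht hx]
    rfl

theorem pressure_space (hE : IsStrongEulerSolution Ω γ T r u) (hγ : 1 < γ) :
    IsSpaceCk T Ω.carrier 1 fun t x => pressure γ (r t x) := by
  refine SpaceReg.isSpaceCk ((spaceReg_succ Ω.isOpen).2 ⟨?_, ?_, spaceReg_zero.2 ?_⟩)
    (hE.rpow_continuousOn γ)
  · exact hE.rpow_extends (by linarith)
  · intro t ht x hx
    exact (hE.hasFDerivAt_comp ht hx (hasDerivAt_pressure hγ)).differentiableAt.differentiableWithinAt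
  · refine (((ExtendsCont.const γ).mul (hE.rpow_extends (q := γ - 1) (by linarith))).bilin
      (ContinuousLinearMap.lsmul ℝ ℝ) hE.fderiv_rho_extends).congr fun t ht x hx => ?_
    exact (hE.hasFDerivAt_comp ht hx (hasDerivAt_pressure hγ)).fderiv.symm

/-- Equivalent to ∂ₜp + div(pu) = (1-γ) p div u; this form is used to replace the time derivative of
the pressure integral. -/
theorem dt_pressure (hE : IsStrongEulerSolution Ω γ T r u) (hγ : 1 < γ) {t : ℝ}
    {x : Sp d} (ht : t ∈ Icc 0 T) (hx : x ∈ Ω.carrier) :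
    HasDerivWithinAt (fun s => pressure γ (r s x))
      (-(γ * r t x ^ γ * divg (u t) x + fderiv ℝ (fun y => pressure γ (r t y)) x (u t x)))
      (Icc 0 T) t := by
  have hr := hE.pos ht hx
  have h := hE.hasDerivWithinAt_comp ht hx (hasDerivAt_pressure hγ)
  convert! h using 1
  rw [(hE.hasFDerivAt_comp ht hx (hasDerivAt_pressure hγ)).fderiv,
    hE.mass_expand ht hx, ← mul_rpow_sub_one hr]
  simp only [smul_apply, smul_eq_mul]
  ring

theorem pressure_time (hE : IsStrongEulerSolution Ω γ T r u) (hT : 0 < T) (hγ : 1 < γ) :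
    IsTimeC1 T Ω.carrier fun t x => pressure γ (r t x) := by
  refine IsTimeC1.of_hasDerivWithinAt hT
    (fun t ht x hx => hE.hasDerivWithinAt_comp ht hx (hasDerivAt_pressure hγ)) ?_
  exact ((ExtendsCont.const γ).mul (hE.rpow_extends (q := γ - 1) (by linarith))).mul
    hE.rho_time.extends_dt

end IsStrongEulerSolution

/-! ### Integrals of compactly supported functions on `[0,T] × Ω` -/

theorem ExtendsCont.integrable_prod {d : ℕ} {T R : ℝ} {Ω : Set (Sp d)} (hΩ : IsOpen Ω)
    {f : ℝ → Sp d → ℝ} (h : ExtendsCont T Ω f)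
    (hR : ∀ t ∈ Icc 0 T, ∀ x ∈ Ω, R < ‖x‖ → f t x = 0) :
    Integrable (Function.uncurry f) ((volume.restrict (Icc 0 T)).prod (volume.restrict Ω)) := by
  obtain ⟨C, hC0, hC⟩ := h.exists_bound
  have hm : MeasurableSet (Icc (0 : ℝ) T ×ˢ Ω) := measurableSet_Icc.prod hΩ.measurableSet
  rw [Measure.prod_restrict]
  have hb : Integrable (fun p : ℝ × Sp d => (Metric.closedBall (0 : Sp d) R).indicator (fun _ => C) p.2)
      ((volume.prod volume).restrict (Icc 0 T ×ˢ Ω)) := by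
    rw [← Measure.prod_restrict]
    have h1 : Integrable ((Metric.closedBall (0 : Sp d) R).indicator fun _ => C)
        (volume.restrict Ω) := by
      refine (integrable_indicator_iff Metric.isClosed_closedBall.measurableSet).2 ?_
      refine integrableOn_const (ne_of_lt (lt_of_le_of_lt (Measure.restrict_apply_le _ _) ?_))
      exact measure_closedBall_lt_top
    exact h1.comp_snd _
  refine hb.mono' (h.continuousOn.aestronglyMeasurable hm) ?_
  rw [ae_restrict_iff' hm]
  refine Eventually.of_forall fun p hp => ?_
  by_cases hx : ‖p.2‖ ≤ R
  · rw [indicator_of_mem (by simpa using hx)]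
    exact hC p.1 hp.1 p.2 hp.2
  · rw [indicator_of_notMem (by simpa using hx)]
    simp [Function.uncurry, hR p.1 hp.1 p.2 hp.2 (not_le.1 hx)]

theorem ExtendsCont.integrable_slice {d : ℕ} {T R : ℝ} {Ω : Set (Sp d)} (hΩ : IsOpen Ω)
    {f : ℝ → Sp d → ℝ} (h : ExtendsCont T Ω f)
    (hR : ∀ t ∈ Icc 0 T, ∀ x ∈ Ω, R < ‖x‖ → f t x = 0) {t : ℝ} (ht : t ∈ Icc 0 T) :
    IntegrableOn (f t) Ω := by
  obtain ⟨C, hC0, hC⟩ := h.exists_bound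
  have hb : IntegrableOn ((Metric.closedBall (0 : Sp d) R).indicator fun _ => C) Ω := by
    refine (integrable_indicator_iff Metric.isClosed_closedBall.measurableSet).2 ?_
    refine integrableOn_const (ne_of_lt (lt_of_le_of_lt (Measure.restrict_apply_le _ _) ?_))
    exact measure_closedBall_lt_top
  refine hb.mono' ((h.continuousOn_slice ht).aestronglyMeasurable hΩ.measurableSet) ?_
  rw [ae_restrict_iff' hΩ.measurableSet]
  refine Eventually.of_forall fun x hx => ?_
  by_cases hxR : ‖x‖ ≤ R
  · rw [indicator_of_mem (by simpa using hxR)]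
    exact hC t ht x hx
  · simp [hR t ht x hx (not_le.1 hxR), hC0, indicator_nonneg]

theorem dt_eq_zero {d : ℕ} {F : Type*} [NormedAddCommGroup F] [NormedSpace ℝ F] {T : ℝ}
    {P : ℝ → Sp d → F} {x : Sp d} (h : ∀ t ∈ Icc 0 T, P t x = 0) {t : ℝ} (ht : t ∈ Icc 0 T) :
    dt T P t x = 0 := by
  unfold dt
  rw [derivWithin_congr (f := fun _ => (0 : F)) h (h t ht)]
  simp

theorem IsTimeC1.integral_sub {d : ℕ} {T R : ℝ} {Ω : Set (Sp d)} (hΩ : IsOpen Ω)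
    {P : ℝ → Sp d → ℝ} (hP : IsTimeC1 T Ω P) (hP' : ExtendsCont T Ω P)
    (hR : ∀ t ∈ Icc 0 T, ∀ x ∈ Ω, R < ‖x‖ → P t x = 0) {t : ℝ} (ht : t ∈ Icc 0 T) :
    (∫ x in Ω, P t x) - ∫ x in Ω, P 0 x = ∫ s in Icc 0 t, ∫ x in Ω, dt T P s x := by
  have hRd : ∀ t ∈ Icc 0 T, ∀ x ∈ Ω, R < ‖x‖ → dt T P t x = 0 := fun t ht x hx hxR =>
    dt_eq_zero (fun s hs => hR s hs x hx hxR) ht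
  have h0T : (0 : ℝ) ∈ Icc 0 T := ⟨le_rfl, ht.1.trans ht.2⟩
  have hsub : Icc (0 : ℝ) t ⊆ Icc 0 T := Icc_subset_Icc le_rfl ht.2
  have hpt : ∀ x ∈ Ω, P t x - P 0 x = ∫ s in Icc 0 t, dt T P s x := by
    intro x hx
    have hc1 : ContinuousOn (fun s => P s x) (Icc 0 t) :=
      (hP.differentiableOn x hx).continuousOn.mono hsub
    have hc2 : ContinuousOn (fun s => dt T P s x) (Icc 0 t) := by
      have := hP.extends_dt.continuousOn
      exact this.comp (by fun_prop : ContinuousOn (fun s : ℝ => (s, x)) (Icc 0 t))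
        fun s hs => ⟨hsub hs, hx⟩
    rw [integral_Icc_eq_integral_Ioc, ← intervalIntegral.integral_of_le ht.1,
      intervalIntegral.integral_eq_sub_of_hasDerivAt_of_le ht.1 hc1 (fun s hs => ?_)
      (hc2.intervalIntegrable_of_Icc ht.1)]
    refine (hP.hasDerivWithinAt (hsub (Ioo_subset_Icc_self hs)) hx).hasDerivAt ?_
    exact Icc_mem_nhds hs.1 (hs.2.trans_le ht.2)
  rw [← MeasureTheory.integral_sub (hP'.integrable_slice hΩ hR ht) (hP'.integrable_slice hΩ hR h0T),
    setIntegral_congr_fun hΩ.measurableSet hpt]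
  refine integral_integral_swap (f := fun x s => dt T P s x) ?_
  have h1 := (hP.extends_dt.integrable_prod hΩ hRd).mono_measure
    (Measure.prod_mono (Measure.restrict_mono hsub le_rfl) (le_refl (volume.restrict Ω)))
  exact h1.swap

/-! ### Cutoff functions -/

/-- The smooth function `√(1 + |x|²)`. -/
def bracket {d : ℕ} (x : Sp d) : ℝ := √(1 + ‖x‖ ^ 2)

theorem contDiff_bracket {d : ℕ} {n : WithTop ℕ∞} : ContDiff ℝ n (bracket (d := d)) := by
  unfold bracket
  exact (contDiff_const.add (contDiff_norm_sq ℝ)).sqrt fun x => by positivity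

theorem one_le_bracket {d : ℕ} (x : Sp d) : 1 ≤ bracket x :=
  Real.one_le_sqrt.2 (by nlinarith [norm_nonneg x])

theorem norm_le_bracket {d : ℕ} (x : Sp d) : ‖x‖ ≤ bracket x :=
  Real.le_sqrt_of_sq_le (by linarith)

theorem bracket_lipschitz {d : ℕ} (x y : Sp d) : |bracket x - bracket y| ≤ ‖x - y‖ := by
  have h1 := one_le_bracket x
  have h2 := one_le_bracket y
  have e : (bracket x - bracket y) * (bracket x + bracket y) = (‖x‖ - ‖y‖) * (‖x‖ + ‖y‖) := by
    have a : bracket x ^ 2 = 1 + ‖x‖ ^ 2 := Real.sq_sqrt (by positivity)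
    have b : bracket y ^ 2 = 1 + ‖y‖ ^ 2 := Real.sq_sqrt (by positivity)
    nlinarith
  have h3 := abs_norm_sub_norm_le x y
  have h4 := norm_le_bracket x
  have h5 := norm_le_bracket y
  have e2 : |bracket x - bracket y| * (bracket x + bracket y) = |‖x‖ - ‖y‖| * (‖x‖ + ‖y‖) := by
    rw [← abs_of_pos (by linarith : 0 < bracket x + bracket y), ← abs_mul, e, abs_mul,
      abs_of_nonneg (by positivity : 0 ≤ ‖x‖ + ‖y‖)]
  have h6 : |‖x‖ - ‖y‖| * (‖x‖ + ‖y‖) ≤ ‖x - y‖ * (bracket x + bracket y) := by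
    gcongr
  rw [← e2] at h6
  exact le_of_mul_le_mul_right h6 (by linarith)

theorem abs_fderiv_bracket_le {d : ℕ} (x v : Sp d) : |fderiv ℝ bracket x v| ≤ ‖v‖ := by
  have h : ‖fderiv ℝ (bracket (d := d)) x‖ ≤ 1 :=
    norm_fderiv_le_of_lip' ℝ zero_le_one (Eventually.of_forall fun y => by
      rw [one_mul]; exact bracket_lipschitz y x)
  exact ((fderiv ℝ bracket x).le_opNorm v).trans (by nlinarith [norm_nonneg v])

theorem deriv_downStep_nonpos (s : ℝ) : deriv downStep s ≤ 0 := by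
  have : Antitone downStep := fun a b hab => Real.smoothTransition.monotone (by linarith)
  exact this.deriv_nonpos

/-- A moving cutoff, supported between spheres that recede from each other with speed `U`. -/
def annulus {d : ℕ} (U m n t : ℝ) (x : Sp d) : ℝ :=
  (1 - downStep (bracket x - U * t - m)) * downStep (bracket x + U * t - n)

theorem annulus_nonneg {d : ℕ} (U m n t : ℝ) (x : Sp d) : 0 ≤ annulus U m n t x :=
  mul_nonneg (by linarith [downStep_le_one (bracket x - U * t - m)]) (downStep_nonneg _)

theorem annulus_le_one {d : ℕ} (U m n t : ℝ) (x : Sp d) : annulus U m n t x ≤ 1 := by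
  have h1 := downStep_le_one (bracket x + U * t - n)
  have h2 := downStep_nonneg (bracket x + U * t - n)
  have h3 := downStep_nonneg (bracket x - U * t - m)
  have h4 := downStep_le_one (bracket x - U * t - m)
  unfold annulus
  nlinarith

theorem contDiff_annulus {d : ℕ} (U m n : ℝ) {k : ℕ} :
    ContDiff ℝ k (Function.uncurry (annulus (d := d) U m n)) := by
  have h : ContDiff ℝ k fun p : ℝ × Sp d => bracket p.2 := contDiff_bracket.comp contDiff_snd
  have h1 : ContDiff ℝ k fun p : ℝ × Sp d => downStep (bracket p.2 - U * p.1 - m) :=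
    (contDiff_downStep (n := k)).comp ((h.sub (contDiff_const.mul contDiff_fst)).sub contDiff_const)
  have h2 : ContDiff ℝ k fun p : ℝ × Sp d => downStep (bracket p.2 + U * p.1 - n) :=
    (contDiff_downStep (n := k)).comp ((h.add (contDiff_const.mul contDiff_fst)).sub contDiff_const)
  exact (contDiff_const.sub h1).mul h2

theorem annulus_eq_zero {d : ℕ} {U m n t : ℝ} (hU : 0 ≤ U) (ht : 0 ≤ t) {x : Sp d}
    (hx : n < ‖x‖) : annulus U m n t x = 0 := by
  have h : downStep (bracket x + U * t - n) = 0 := by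
    refine downStep_of_ge ?_
    have := norm_le_bracket x
    have : 0 ≤ U * t := mul_nonneg hU ht
    linarith
  rw [annulus, h, mul_zero]

/-- The inner edge of the cutoff moves outwards and the outer edge inwards, both with speed U, while
the gradient of `bracket` has norm at most one; so no velocity bounded by U lets the cutoff grow
along its path. -/
theorem annulus_transport {d : ℕ} {U m n t : ℝ} {x v : Sp d} (hv : ‖v‖ ≤ U) :
    ∃ a b : ℝ, (∀ s : Set ℝ, HasDerivWithinAt (fun t => annulus U m n t x) a s t) ∧
      fderiv ℝ (annulus U m n t) x v = b ∧ a + b ≤ 0 := by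
  set p := bracket x - U * t - m with hp
  set q := bracket x + U * t - n with hq
  have hb : HasFDerivAt bracket (fderiv ℝ bracket x) x :=
    ((contDiff_bracket (n := 1)).differentiable (by simp) x).hasFDerivAt
  have t1 : HasDerivAt (fun t => bracket x - U * t - m) (-U) t := by
    have := (((hasDerivAt_id t).const_mul U).const_sub (bracket x)).sub_const m
    simpa using this
  have t2 : HasDerivAt (fun t => bracket x + U * t - n) U t := by
    have := (((hasDerivAt_id t).const_mul U).const_add (bracket x)).sub_const n
    simpa using this
  have x1 : HasFDerivAt (fun y => bracket y - U * t - m) (fderiv ℝ bracket x) x :=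
    (hb.sub_const (U * t)).sub_const m
  have x2 : HasFDerivAt (fun y => bracket y + U * t - n) (fderiv ℝ bracket x) x :=
    (hb.add_const (U * t)).sub_const n
  have T1 := ((hasDerivAt_downStep p).comp t t1).const_sub 1
  have T2 := (hasDerivAt_downStep q).comp t t2
  have X1 := ((hasDerivAt_downStep p).comp_hasFDerivAt x x1).const_sub 1
  have X2 := (hasDerivAt_downStep q).comp_hasFDerivAt x x2
  refine ⟨_, _, fun s => (T1.mul T2).hasDerivWithinAt, rfl, ?_⟩
  have e : fderiv ℝ (annulus U m n t) x = _ := (X1.mul X2).fderiv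
  rw [e]
  have hvb := abs_le.1 ((abs_fderiv_bracket_le x v).trans hv)
  have d1 := deriv_downStep_nonpos p
  have d2 := deriv_downStep_nonpos q
  have s1 : 0 ≤ 1 - downStep p := by linarith [downStep_le_one p]
  have s2 := downStep_nonneg q
  simp only [Function.comp, add_apply, smul_apply, neg_apply, smul_eq_mul, ← hp, ← hq]
  have k1 : 0 ≤ (1 - downStep p) * (-deriv downStep q * (U + fderiv ℝ bracket x v)) :=
    mul_nonneg s1 (mul_nonneg (by linarith) (by linarith))
  have k2 : 0 ≤ downStep q * (-deriv downStep p * (U - fderiv ℝ bracket x v)) :=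
    mul_nonneg s2 (mul_nonneg (by linarith) (by linarith))
  linarith

/-! ### Propagation of mass and decay for strong Euler solutions -/

theorem IsSpaceCk.continuousOn_slice {d : ℕ} {F : Type} [NormedAddCommGroup F] [NormedSpace ℝ F]
    {T : ℝ} {Ω : Set (Sp d)} {k : ℕ} {V : ℝ → Sp d → F} (hV : IsSpaceCk T Ω k V) {s : ℝ}
    (hs : s ∈ Icc 0 T) : ContinuousOn (V s) (closure Ω) :=
  hV.continuousOn.comp (by fun_prop : ContinuousOn (fun y : Sp d => (s, y)) _) fun _ hy => ⟨hs, hy⟩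

theorem SpaceReg.divg_extends {d : ℕ} {T : ℝ} {Ω : Set (Sp d)} (hΩ : IsOpen Ω)
    {V : ℝ → Sp d → Sp d} (hV : SpaceReg T Ω 1 V) : ExtendsCont T Ω fun t => divg (V t) :=
  (((spaceReg_succ hΩ).1 hV).2.2.extendsCont.clm (IsStrongEulerSolution.traceCLM d)).congr fun t _ x _ =>
    (IsStrongEulerSolution.divg_eq_traceCLM (V t) x).symm

theorem IsSpaceCk.integral_divg {d : ℕ} {T R : ℝ} {Ω : C3Domain d} {V : ℝ → Sp d → Sp d}
    (hV : IsSpaceCk T Ω.carrier 1 V)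
    (hR : ∀ t ∈ Icc 0 T, ∀ x ∈ closure Ω.carrier, R < ‖x‖ → V t x = 0)
    (htan : ∀ t ∈ Icc 0 T, ∀ x ∈ frontier Ω.carrier, ⟪V t x, Ω.normal x⟫_ℝ = 0) {s : ℝ}
    (hs : s ∈ Icc 0 T) :
    IntegrableOn (divg (V s)) Ω.carrier ∧ ∫ x in Ω.carrier, divg (V s) x = 0 := by
  have hΩ := Ω.isOpen
  obtain ⟨C, -, hC⟩ := ((spaceReg_succ hΩ).1 hV.spaceReg).2.2.extendsCont.exists_bound
  refine ⟨(hV.spaceReg.divg_extends hΩ).integrable_slice hΩ (R := R) ?_ hs,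
    Ω.integral_divg_eq_zero (hV.contDiffOn s hs) (hV.continuousOn_slice hs)
      ⟨C, fun x hx => hC s hs x hx⟩ ⟨R, hR s hs⟩ (htan s hs)⟩
  intro t ht x hx hxR
  have : V t =ᶠ[𝓝 x] fun _ => 0 := by
    filter_upwards [(isOpen_lt continuous_const continuous_norm).mem_nhds hxR,
      hΩ.mem_nhds hx] with y hy hyΩ
    exact hR t ht y (subset_closure hyΩ) hy
  simp [divg, this.fderiv_eq]

namespace IsStrongEulerSolution

variable {d : ℕ} {Ω : C3Domain d} {γ T : ℝ} {r : ℝ → Sp d → ℝ} {u : ℝ → Sp d → Sp d}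

/-- The integral of `ρ` against a cutoff receding with at least the fluid speed does not increase. -/
theorem integral_annulus_le (hE : IsStrongEulerSolution Ω γ T r u) (hT : 0 < T) {U : ℝ} (hU : 0 ≤ U)
    (hu : ∀ t ∈ Icc 0 T, ∀ x ∈ Ω.carrier, ‖u t x‖ ≤ U) (m n : ℝ) {t : ℝ} (ht : t ∈ Icc 0 T) :
    IntegrableOn (fun x => annulus U m n t x * r t x) Ω.carrier ∧
    ∫ x in Ω.carrier, annulus U m n t x * r t x ≤
      ∫ x in Ω.carrier, annulus U m n 0 x * r 0 x := by
  have hΩ := Ω.isOpen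
  have hη1 : ContDiff ℝ 1 (Function.uncurry (annulus (d := d) U m n)) := by
    exact_mod_cast contDiff_annulus (d := d) U m n (k := 1)
  have hηR : ∀ t ∈ Icc 0 T, ∀ x : Sp d, n < ‖x‖ → annulus U m n t x = 0 := fun t ht x hx =>
    annulus_eq_zero hU ht.1 hx
  have sη : SpaceReg T Ω.carrier 1 (annulus U m n) :=
    SpaceReg.of_contDiff hΩ (by exact_mod_cast hη1) hηR
  have tη : IsTimeC1 T Ω.carrier (annulus U m n) := IsTimeC1.of_contDiff hT hη1 hηR
  have sr : SpaceReg T Ω.carrier 1 r := hE.rho_space.spaceReg.mono (by norm_num)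
  have su : SpaceReg T Ω.carrier 1 u := hE.u_space.spaceReg.mono (by norm_num)
  set P : ℝ → Sp d → ℝ := fun t x => annulus U m n t x * r t x with hP
  have sP : SpaceReg T Ω.carrier 1 P := sη.bilin hΩ (ContinuousLinearMap.mul ℝ ℝ) sr
  have tP : IsTimeC1 T Ω.carrier P :=
    tη.bilin hT (ContinuousLinearMap.mul ℝ ℝ) hE.rho_time sη.extendsCont sr.extendsCont
  have sV : SpaceReg T Ω.carrier 1 fun t x => P t x • u t x :=
    sP.bilin hΩ (ContinuousLinearMap.lsmul ℝ ℝ) su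
  have cV : IsSpaceCk T Ω.carrier 1 fun t x => P t x • u t x :=
    sV.isSpaceCk ((hη1.continuous.continuousOn.mul hE.rho_space.continuousOn).smul
      hE.u_space.continuousOn)
  have hPR : ∀ t ∈ Icc 0 T, ∀ x, n < ‖x‖ → P t x = 0 := fun t ht x hx => by
    simp [hP, hηR t ht x hx]
  refine ⟨sP.extendsCont.integrable_slice hΩ (fun t ht x _ => hPR t ht x) ht, ?_⟩
  have key := tP.integral_sub hΩ sP.extendsCont (fun t ht x _ => hPR t ht x) ht
  -- After adding the divergence of Pu, whose integral vanishes by the no-flux condition, the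
  -- continuity equation leaves r times the transport derivative of the cutoff, which is not
  -- positive.
  have hneg : ∀ s ∈ Icc 0 T, ∫ x in Ω.carrier, dt T P s x ≤ 0 := by
    intro s hs
    obtain ⟨iV, hdiv⟩ := cV.integral_divg (R := n) (fun t ht x _ hx => by simp [hPR t ht x hx])
      (fun t ht x hx => by rw [real_inner_smul_left, hE.no_flux t ht x hx, mul_zero]) hs
    have h0 : ∫ x in Ω.carrier, -divg (fun y => P s y • u s y) x = 0 := by
      rw [integral_neg, hdiv, neg_zero]
    rw [← h0]
    refine setIntegral_mono_on ?_ iV.neg hΩ.measurableSet ?_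
    · exact tP.extends_dt.integrable_slice hΩ (R := n)
        (fun t ht x _ hx => dt_eq_zero (fun s hs => hPR s hs x hx) ht) hs
    · intro x hx
      obtain ⟨a, b, ha, hb, hab⟩ := annulus_transport (m := m) (n := n) (t := s) (hu s hs x hx)
      have e1 : dt T P s x = annulus U m n s x * dt T r s x + a * r s x := by
        have := ((ha (Icc 0 T)).mul (hE.rho_time.hasDerivWithinAt hs hx))
        rw [hP, dt_eq hT hs this]
        ring
      have hηd : DifferentiableAt ℝ (annulus U m n s) x :=
        ((sη.contDiffOn s hs).differentiableOn (by norm_num)).differentiableAt (hΩ.mem_nhds hx)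
      have hrd := hE.rho_diff hs hx
      have e2 : divg (fun y => P s y • u s y) x = P s x * divg (u s) x +
          (annulus U m n s x * fderiv ℝ (r s) x (u s x) + r s x * b) := by
        have hf : HasFDerivAt (P s) (annulus U m n s x • fderiv ℝ (r s) x +
            r s x • fderiv ℝ (annulus U m n s) x) x := hηd.hasFDerivAt.mul hrd
        rw [divg_smul (w := P s) hf.differentiableAt (hE.u_diff hs hx).differentiableAt, hf.fderiv]
        simp [hb]
      rw [e1, e2, hE.mass_expand hs hx]
      have := mul_nonneg (hE.pos hs hx).le (neg_nonneg.2 hab)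
      simp only [hP]
      linarith
  have : ∫ s in Icc 0 t, ∫ x in Ω.carrier, dt T P s x ≤ 0 := by
    refine setIntegral_nonpos measurableSet_Icc fun s hs => hneg s ⟨hs.1, hs.2.trans ht.2⟩
  linarith

/-- Finite speed of propagation. At time t the cutoff equals 1 wherever UT + m ≤ bracket ≤ n - 2 -
UT, at time 0 it vanishes where bracket < m - 2; the outer radius n is sent to infinity by monotone
convergence. -/
theorem lintegral_outside_le (hE : IsStrongEulerSolution Ω γ T r u) (hT : 0 < T) {U : ℝ}
    (hU : 0 ≤ U) (hu : ∀ t ∈ Icc 0 T, ∀ x ∈ Ω.carrier, ‖u t x‖ ≤ U) (m : ℝ) {t : ℝ}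
    (ht : t ∈ Icc 0 T) :
    ∫⁻ x in Ω.carrier ∩ {x | U * T + m ≤ bracket x}, ENNReal.ofReal (r t x) ≤
      ∫⁻ x in Ω.carrier ∩ {x | m - 2 ≤ bracket x}, ENNReal.ofReal (r 0 x) := by
  have hΩ := Ω.isOpen
  have cb : Continuous (bracket (d := d)) := (contDiff_bracket (n := 0)).continuous
  have hUt : U * t ≤ U * T := mul_le_mul_of_nonneg_left ht.2 hU
  have h0T : (0 : ℝ) ∈ Icc 0 T := ⟨le_rfl, hT.le⟩
  have hset : Ω.carrier ∩ {x | U * T + m ≤ bracket x} =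
      ⋃ n : ℕ, Ω.carrier ∩ {x | U * T + m ≤ bracket x ∧ bracket x + U * T ≤ n - 2} := by
    ext x
    simp only [mem_inter_iff, mem_ofPred_eq, mem_iUnion]
    constructor
    · rintro ⟨hx, h1⟩
      obtain ⟨n, hn⟩ := exists_nat_ge (bracket x + U * T + 2)
      exact ⟨n, hx, h1, by linarith⟩
    · rintro ⟨n, hx, h1, -⟩
      exact ⟨hx, h1⟩
  rw [hset, setLIntegral_iUnion_of_directed]
  · refine iSup_le fun n => ?_
    have hmeas : MeasurableSet {x : Sp d | U * T + m ≤ bracket x ∧ bracket x + U * T ≤ n - 2} :=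
      ((isClosed_le continuous_const cb).inter
        (isClosed_le (cb.add continuous_const) continuous_const)).measurableSet
    have hmeas2 : MeasurableSet {x : Sp d | m - 2 ≤ bracket x} :=
      (isClosed_le continuous_const cb).measurableSet
    obtain ⟨i1, h1⟩ := hE.integral_annulus_le hT hU hu m n ht
    obtain ⟨i0, -⟩ := hE.integral_annulus_le hT hU hu m n h0T
    have n1 : ∀ s ∈ Icc 0 T, 0 ≤ᵐ[volume.restrict Ω.carrier] fun x => annulus U m n s x * r s x :=
      fun s hs => (ae_restrict_iff' hΩ.measurableSet).2 (Eventually.of_forall fun x hx =>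
        mul_nonneg (annulus_nonneg _ _ _ _ _) (hE.pos hs hx).le)
    have h2 := ENNReal.ofReal_le_ofReal h1
    rw [ofReal_integral_eq_lintegral_ofReal i1 (n1 t ht),
      ofReal_integral_eq_lintegral_ofReal i0 (n1 0 h0T)] at h2
    refine le_trans ?_ (h2.trans ?_)
    · rw [inter_comm, ← Measure.restrict_restrict hmeas, ← lintegral_indicator hmeas] 
      refine lintegral_mono fun x => ?_
      by_cases hx : x ∈ {x : Sp d | U * T + m ≤ bracket x ∧ bracket x + U * T ≤ n - 2}
      · rw [indicator_of_mem hx]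
        have : annulus U m n t x = 1 := by
          rw [annulus, downStep_of_ge (by linarith [hx.1]), downStep_of_le (by linarith [hx.2])]
          norm_num
        rw [this, one_mul]
      · rw [indicator_of_notMem hx]
        exact zero_le
    · rw [inter_comm, ← Measure.restrict_restrict hmeas2, ← lintegral_indicator hmeas2]
      refine lintegral_mono_ae ((ae_restrict_iff' hΩ.measurableSet).2
        (Eventually.of_forall fun x hx => ?_))
      by_cases hx2 : x ∈ {x : Sp d | m - 2 ≤ bracket x}
      · rw [indicator_of_mem hx2]
        refine ENNReal.ofReal_le_ofReal ?_
        have := annulus_le_one U m n 0 x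
        nlinarith [hE.pos h0T hx]
      · rw [indicator_of_notMem hx2]
        have : annulus U m n 0 x = 0 := by
          have : bracket x < m - 2 := not_le.1 hx2
          rw [annulus, downStep_of_le (by linarith)]
          simp
        simp [this]
  · refine directed_of_isDirected_le fun a b hab x hx => ⟨hx.1, hx.2.1, hx.2.2.trans ?_⟩
    have : (a : ℝ) ≤ b := by exact_mod_cast hab
    linarith

theorem integrableOn_zero (hE : IsStrongEulerSolution Ω γ T r u) (hT : 0 < T)
    (h : ¬ Bornology.IsBounded Ω.carrier → IntegrableOn (r 0) Ω.carrier) :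
    IntegrableOn (r 0) Ω.carrier := by
  by_cases hb : Bornology.IsBounded Ω.carrier
  · obtain ⟨R, hR⟩ := hb.exists_norm_le
    exact hE.rho_space.spaceReg.extendsCont.integrable_slice (R := R) Ω.isOpen
      (fun t _ x hx hxR => absurd (hR x hx) (not_le.2 hxR)) ⟨le_rfl, hT.le⟩
  · exact h hb

theorem lintegral_le (hE : IsStrongEulerSolution Ω γ T r u) (hT : 0 < T) {t : ℝ}
    (ht : t ∈ Icc 0 T) :
    ∫⁻ x in Ω.carrier, ENNReal.ofReal (r t x) ≤ ∫⁻ x in Ω.carrier, ENNReal.ofReal (r 0 x) := by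
  obtain ⟨U, hU, hu⟩ := hE.u_space.spaceReg.extendsCont.exists_bound
  -- With m = -UT the region at time t is all of Ω, since `bracket` is at least one.
  have := hE.lintegral_outside_le hT hU hu (-(U * T)) ht
  have e : Ω.carrier ∩ {x | U * T + -(U * T) ≤ bracket x} = Ω.carrier :=
    inter_eq_left.2 fun x _ => by
      have := one_le_bracket x
      simp only [mem_ofPred_eq]
      linarith
  rw [e] at this
  exact this.trans (lintegral_mono_set inter_subset_left)

theorem integrableOn (hE : IsStrongEulerSolution Ω γ T r u) (hT : 0 < T)
    (h : IntegrableOn (r 0) Ω.carrier) {t : ℝ} (ht : t ∈ Icc 0 T) :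
    IntegrableOn (r t) Ω.carrier := by
  have hm := Ω.isOpen.measurableSet
  refine ⟨(hE.rho_space.spaceReg.extendsCont.continuousOn_slice ht).aestronglyMeasurable hm, ?_⟩
  rw [hasFiniteIntegral_iff_ofReal ((ae_restrict_iff' hm).2
    (Eventually.of_forall fun x hx => (hE.pos ht hx).le))]
  refine (hE.lintegral_le hT ht).trans_lt ?_
  rw [← hasFiniteIntegral_iff_ofReal ((ae_restrict_iff' hm).2
    (Eventually.of_forall fun x hx => (hE.pos ⟨le_rfl, hT.le⟩ hx).le))]
  exact h.2

/-- The initial tail is small by dominated convergence, and finite speed shifts it outwards by at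
most UT, uniformly in time. -/
theorem exists_tail (hE : IsStrongEulerSolution Ω γ T r u) (hT : 0 < T)
    (h : IntegrableOn (r 0) Ω.carrier) {η : ℝ} (hη : 0 < η) :
    ∃ R : ℝ, ∀ t ∈ Icc 0 T,
      ∫⁻ x in Ω.carrier ∩ {x | R < ‖x‖}, ENNReal.ofReal (r t x) ≤ ENNReal.ofReal η := by
  obtain ⟨U, hU, hu⟩ := hE.u_space.spaceReg.extendsCont.exists_bound
  have cb : Continuous (bracket (d := d)) := (contDiff_bracket (n := 0)).continuous
  have hfin : ∫⁻ x in Ω.carrier, ENNReal.ofReal (r 0 x) < ⊤ :=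
    lt_of_le_of_lt (lintegral_mono fun x => ENNReal.ofReal_le_ofReal (le_abs_self _))
      (by simpa [HasFiniteIntegral, Real.enorm_eq_ofReal_abs] using h.2)
  have htend : Tendsto (fun k : ℕ => ∫⁻ x in Ω.carrier ∩ {x | (k : ℝ) - 2 ≤ bracket x},
      ENNReal.ofReal (r 0 x)) atTop (𝓝 0) := by
    have h1 : ∀ k : ℕ, MeasurableSet {x : Sp d | (k : ℝ) - 2 ≤ bracket x} := fun k =>
      (isClosed_le continuous_const cb).measurableSet
    have := tendsto_lintegral_of_dominated_convergence' (μ := volume.restrict Ω.carrier)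
      (F := fun (k : ℕ) x => {x : Sp d | (k : ℝ) - 2 ≤ bracket x}.indicator
        (fun x => ENNReal.ofReal (r 0 x)) x) (f := fun _ => 0)
      (fun x => ENNReal.ofReal (r 0 x)) (fun k => (h.1.aemeasurable.ennreal_ofReal).indicator (h1 k))
      (fun k => Eventually.of_forall fun x => indicator_le_self _ _ x) hfin.ne
      (Eventually.of_forall fun x => by
        obtain ⟨N, hN⟩ := exists_nat_gt (bracket x + 2)
        refine tendsto_const_nhds.congr' ?_
        filter_upwards [eventually_ge_atTop N] with k hk
        have : (N : ℝ) ≤ k := by exact_mod_cast hk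
        rw [indicator_of_notMem]
        simp only [mem_ofPred_eq, not_le]
        linarith)
    rw [lintegral_zero] at this
    refine this.congr fun k => ?_
    rw [inter_comm, ← Measure.restrict_restrict (h1 k), ← lintegral_indicator (h1 k)]
  obtain ⟨k, hk⟩ := ((ENNReal.tendsto_nhds_zero.1 htend) (ENNReal.ofReal η)
    (ENNReal.ofReal_pos.2 hη)).exists
  refine ⟨U * T + k, fun t ht => le_trans (lintegral_mono_set ?_)
    ((hE.lintegral_outside_le hT hU hu k ht).trans hk)⟩
  rintro x ⟨hx, hxR⟩
  exact ⟨hx, hxR.le.trans (norm_le_bracket x)⟩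

end IsStrongEulerSolution

/-! ### Measurability and integrability on `[0,T] × Ω` -/

theorem LpLoc.aestronglyMeasurable {d : ℕ} {F : Type*} [NormedAddCommGroup F] {T : ℝ}
    {Ω : Set (Sp d)} (hΩ : IsOpen Ω) {p : ℝ≥0∞} {u : ℝ → Sp d → F} (h : LpLoc T Ω p u) :
    AEStronglyMeasurable (Function.uncurry u)
      ((volume.restrict (Icc 0 T)).prod (volume.restrict Ω)) := by
  obtain ⟨F, hF, hFs, hFU, -⟩ := hΩ.exists_iUnion_isClosed
  have e : Icc (0 : ℝ) T ×ˢ Ω = ⋃ n : ℕ × ℕ,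
      Icc (0 : ℝ) T ×ˢ (F n.1 ∩ Metric.closedBall (0 : Sp d) n.2) := by
    rw [← prod_iUnion]
    congr 1
    ext x
    simp only [mem_iUnion, mem_inter_iff, Prod.exists, exists_and_left, exists_and_right]
    obtain ⟨n, hn⟩ := exists_nat_ge ‖x‖
    constructor
    · intro hx
      rw [← hFU] at hx
      obtain ⟨i, hi⟩ := mem_iUnion.1 hx
      exact ⟨⟨i, hi⟩, ⟨n, by simpa using hn⟩⟩
    · rintro ⟨⟨i, hi⟩, -⟩
      exact hFs i hi
  rw [Measure.prod_restrict, e, aestronglyMeasurable_iUnion_iff]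
  intro n
  refine (h _ ((isCompact_closedBall (0 : Sp d) n.2).inter_left (hF n.1)) ?_).1
  exact inter_subset_left.trans (hFs n.1)

theorem integrable_of_lintegral_ofReal_le {X : Type*} [MeasurableSpace X] {μ : Measure X}
    {f : X → ℝ} {C : ℝ} (hC : 0 ≤ C) (hm : AEStronglyMeasurable f μ) (h0 : 0 ≤ᵐ[μ] f)
    (h : ∫⁻ x, ENNReal.ofReal (f x) ∂μ ≤ ENNReal.ofReal C) :
    Integrable f μ ∧ ∫ x, f x ∂μ ≤ C := by
  refine ⟨⟨hm, (hasFiniteIntegral_iff_ofReal h0).2 (h.trans_lt ENNReal.ofReal_lt_top)⟩, ?_⟩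
  rw [integral_eq_lintegral_of_nonneg_ae h0 hm]
  exact ENNReal.toReal_le_of_le_ofReal hC h

theorem integrable_prod_of_ae_slice {X Y : Type*} [MeasurableSpace X] [MeasurableSpace Y]
    {μ : Measure X} {ν : Measure Y} [IsFiniteMeasure μ] [SFinite ν] {f : X × Y → ℝ} {C : ℝ}
    (hm : AEStronglyMeasurable f (μ.prod ν))
    (h : ∀ᵐ x ∂μ, Integrable (fun y => f (x, y)) ν ∧ ∫ y, ‖f (x, y)‖ ∂ν ≤ C) :
    Integrable f (μ.prod ν) := by
  refine (integrable_prod_iff hm).2 ⟨h.mono fun x hx => hx.1, ?_⟩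
  refine (integrable_const C).mono' hm.norm.integral_prod_right' ?_
  filter_upwards [h] with x hx
  rw [Real.norm_of_nonneg (integral_nonneg fun y => norm_nonneg _)]
  exact hx.2

/-! ### Products of test functions with functions of time -/

theorem IsTestScalar.time_smul {d : ℕ} {T : ℝ} (hT : 0 < T) {Ω : Set (Sp d)} (hΩ : IsOpen Ω)
    {Ψ : ℝ → Sp d → ℝ} (h : IsTestScalar T Ω Ψ) {θ : ℝ → ℝ} (hθ : ContDiff ℝ 1 θ) :
    IsTestScalar T Ω fun t x => θ t * Ψ t x where
  space := by
    refine SpaceReg.isSpaceCk ((SpaceReg.time hΩ hθ.continuous.continuousOn).bilin hΩ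
      (ContinuousLinearMap.mul ℝ ℝ) h.space.spaceReg) ?_
    exact (hθ.continuous.comp continuous_fst).continuousOn.mul h.space.continuousOn
  time := (IsTimeC1.time hT hθ).bilin hT (ContinuousLinearMap.mul ℝ ℝ) h.time
      (ExtendsCont.of_continuousOn_time hθ.continuous.continuousOn) h.space.spaceReg.extendsCont
  support := by
    obtain ⟨R, hR⟩ := h.support
    exact ⟨R, fun t ht x hx hxR => by rw [hR t ht x hx hxR, mul_zero]⟩

theorem IsTestField.time_smul {d : ℕ} {T : ℝ} (hT : 0 < T) {Ω : C3Domain d}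
    {Φ : ℝ → Sp d → Sp d} (h : IsTestField T Ω Φ) {θ : ℝ → ℝ} (hθ : ContDiff ℝ 1 θ) :
    IsTestField T Ω fun t x => θ t • Φ t x where
  space := by
    refine SpaceReg.isSpaceCk ((SpaceReg.time Ω.isOpen hθ.continuous.continuousOn).bilin Ω.isOpen
      (ContinuousLinearMap.lsmul ℝ ℝ) h.space.spaceReg) ?_
    exact (hθ.continuous.comp continuous_fst).continuousOn.smul h.space.continuousOn
  time := (IsTimeC1.time hT hθ).bilin hT (ContinuousLinearMap.lsmul ℝ ℝ) h.time
      (ExtendsCont.of_continuousOn_time hθ.continuous.continuousOn) h.space.spaceReg.extendsCont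
  support := by
    obtain ⟨R, hR⟩ := h.support
    exact ⟨R, fun t ht x hx hxR => by rw [hR t ht x hx hxR, smul_zero]⟩
  tangent := fun t ht x hx => by rw [real_inner_smul_left, h.tangent t ht x hx, mul_zero]

theorem gradient_const_mul_fun {d : ℕ} (a : ℝ) (f : Sp d → ℝ) (x : Sp d) :
    gradient (fun y => a * f y) x = a • gradient f x := by
  have : (fun y => a * f y) = a • f := rfl
  rw [this, gradient, fderiv_const_smul_field, Pi.smul_apply, map_smul]
  rfl

theorem divg_const_smul {d : ℕ} (a : ℝ) (f : Sp d → Sp d) :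
    divg (fun y => a • f y) = fun x => a * divg f x := by
  funext x
  have : (fun y => a • f y) = a • f := rfl
  simp [divg, this, fderiv_const_smul_field, Finset.mul_sum]

theorem massIntegrand_time_smul {d : ℕ} {T : ℝ} (hT : 0 < T) {Ω : Set (Sp d)}
    {ρ Ψ : ℝ → Sp d → ℝ} {J : ℝ → Sp d → Sp d} (h : IsTimeC1 T Ω Ψ) {θ : ℝ → ℝ}
    (hθ : ContDiff ℝ 1 θ) {t : ℝ} (ht : t ∈ Icc 0 T) {x : Sp d} (hx : x ∈ Ω) :
    massIntegrand T ρ J (fun t x => θ t * Ψ t x) t x =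
      deriv θ t * (ρ t x * Ψ t x) + θ t * massIntegrand T ρ J Ψ t x := by
  have e : dt T (fun t x => θ t * Ψ t x) t x = θ t * dt T Ψ t x + deriv θ t * Ψ t x := by
    have := dt_bilin hT (ContinuousLinearMap.mul ℝ ℝ) (IsTimeC1.time hT hθ) h ht hx
    rw [dt_time hT hθ ht] at this
    exact this
  rw [massIntegrand, massIntegrand, e, gradient_const_mul_fun, real_inner_smul_right]
  ring

theorem momentumIntegrand_time_smul {d : ℕ} {T γ α ε : ℝ} (hT : 0 < T) {Ω : Set (Sp d)}
    {ρ : ℝ → Sp d → ℝ} {J Λ B H Φ : ℝ → Sp d → Sp d} (h : IsTimeC1 T Ω Φ) {θ : ℝ → ℝ}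
    (hθ : ContDiff ℝ 1 θ) {t : ℝ} (ht : t ∈ Icc 0 T) {x : Sp d} (hx : x ∈ Ω) :
    momentumIntegrand T γ α ε ρ J Λ B H (fun t x => θ t • Φ t x) t x =
      deriv θ t * ⟪J t x, Φ t x⟫_ℝ + θ t * momentumIntegrand T γ α ε ρ J Λ B H Φ t x := by
  have e : dt T (fun t x => θ t • Φ t x) t x = θ t • dt T Φ t x + deriv θ t • Φ t x := by
    have := dt_bilin hT (ContinuousLinearMap.lsmul ℝ ℝ) (IsTimeC1.time hT hθ) h ht hx
    rw [dt_time hT hθ ht] at this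
    exact this
  have e2 : fderiv ℝ (fun x => θ t • Φ t x) x = θ t • fderiv ℝ (Φ t) x := by
    rw [show (fun x => θ t • Φ t x) = θ t • Φ t from rfl, fderiv_const_smul_field, Pi.smul_apply]
  rw [momentumIntegrand, momentumIntegrand, e, divg_const_smul, gradient_const_mul_fun, e2]
  simp only [inner_add_right, real_inner_smul_right, smul_apply]
  ring

/-! ### Consequences of the energy inequality -/

namespace IsWeakSolutionWith

variable {d : ℕ} {Ω : C3Domain d} {γ c α ε T : ℝ} {ρ₀ : Sp d → ℝ} {J₀ : Sp d → Sp d}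
  {ρ : ℝ → Sp d → ℝ} {J Λ B H : ℝ → Sp d → Sp d}

theorem ae_eq_sq (h : IsWeakSolutionWith Ω γ c α ε T ρ₀ J₀ ρ J Λ B H) {t : ℝ}
    (ht : t ∈ Icc 0 T) : ∀ᵐ x ∂volume.restrict Ω.carrier, √(ρ t x) ^ 2 = ρ t x :=
  (h.nonneg t ht).mono fun _ hx => Real.sq_sqrt hx

theorem ae_measurable_slices (h : IsWeakSolutionWith Ω γ c α ε T ρ₀ J₀ ρ J Λ B H) :
    ∀ᵐ t ∂volume.restrict (Icc 0 T),
      AEStronglyMeasurable (ρ t) (volume.restrict Ω.carrier) ∧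
      AEStronglyMeasurable (Λ t) (volume.restrict Ω.carrier) ∧
      AEStronglyMeasurable (B t) (volume.restrict Ω.carrier) ∧
      AEStronglyMeasurable (H t) (volume.restrict Ω.carrier) := by
  filter_upwards [(h.sqrt_rho_mem.aestronglyMeasurable Ω.isOpen).prodMk_left,
    (h.Λ_mem.aestronglyMeasurable Ω.isOpen).prodMk_left,
    (h.grad_beta_mem.aestronglyMeasurable Ω.isOpen).prodMk_left,
    (h.grad_K_mem.aestronglyMeasurable Ω.isOpen).prodMk_left,
    ae_restrict_mem measurableSet_Icc] with t h1 h2 h3 h4 ht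
  exact ⟨(h1.pow 2).congr (h.ae_eq_sq ht), h2, h3, h4⟩

theorem ae_energy (h : IsWeakSolutionWith Ω γ c α ε T ρ₀ J₀ ρ J Λ B H) (hγ : 1 < γ) (hε : 0 < ε)
    {E : ℝ} (hE0 : 0 ≤ E) (hE : totalEnergy Ω.carrier γ c α ε ρ₀ J₀ ≤ ENNReal.ofReal E) :
    ∀ᵐ t ∂volume.restrict (Icc 0 T),
      IntegrableOn (fun x => ‖Λ t x‖ ^ 2) Ω.carrier ∧
      IntegrableOn (fun x => ρ t x ^ γ) Ω.carrier ∧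
      IntegrableOn (fun x => ‖B t x‖ ^ 2) Ω.carrier ∧
      ∫ x in Ω.carrier, (‖Λ t x‖ ^ 2 / 2 + ρ t x ^ γ / (γ - 1) + ε ^ 2 / 2 * ‖B t x‖ ^ 2) ≤ E := by
  filter_upwards [h.ae_measurable_slices, h.energy_ineq, h.grad_beta,
    ae_restrict_mem measurableSet_Icc] with t ⟨mρ, mΛ, mB, _⟩ he hB ht
  have hγ1 : 0 < γ - 1 := by linarith
  have mΛ2 : AEStronglyMeasurable (fun x => ‖Λ t x‖ ^ 2) (volume.restrict Ω.carrier) :=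
    mΛ.norm.pow 2
  have mB2 : AEStronglyMeasurable (fun x => ‖B t x‖ ^ 2) (volume.restrict Ω.carrier) :=
    mB.norm.pow 2
  have mργ : AEStronglyMeasurable (fun x => ρ t x ^ γ) (volume.restrict Ω.carrier) :=
    (mρ.aemeasurable.pow_const γ).aestronglyMeasurable
  have h0 := h.nonneg t ht
  have m1 : AEStronglyMeasurable (fun x => ‖Λ t x‖ ^ 2 / 2 + ρ t x ^ γ / (γ - 1))
      (volume.restrict Ω.carrier) :=
    (mΛ2.mul_const (2⁻¹)).add (mργ.mul_const (γ - 1)⁻¹)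
  have key : ∫⁻ x in Ω.carrier, ENNReal.ofReal
      (‖Λ t x‖ ^ 2 / 2 + ρ t x ^ γ / (γ - 1) + ε ^ 2 / 2 * ‖B t x‖ ^ 2) ≤ ENNReal.ofReal E := by
    refine le_trans ?_ (he.trans hE)
    simp only [totalEnergyPseudo, internalEnergy]
    refine le_trans ?_ (add_le_add_right (mul_le_mul_right
      (hB.lintegral_le_dirichletEnergy Ω.isOpen) _) _)
    rw [← lintegral_const_mul'' _ mB2.aemeasurable.ennreal_ofReal,
      ← lintegral_add_left' m1.aemeasurable.ennreal_ofReal]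
    refine lintegral_mono_ae ?_
    filter_upwards [h0] with x hx
    rw [← ENNReal.ofReal_mul (by positivity), ← ENNReal.ofReal_add]
    · have := Real.rpow_nonneg hx γ
      positivity
    · positivity
  obtain ⟨hi, hle⟩ := integrable_of_lintegral_ofReal_le hE0
    (m1.add (mB2.const_mul (ε ^ 2 / 2))) (by
      filter_upwards [h0] with x hx
      have := Real.rpow_nonneg hx γ
      simp only [Pi.zero_apply, Pi.add_apply]
      positivity) key
  refine ⟨?_, ?_, ?_, hle⟩
  · refine (hi.const_mul 2).mono' mΛ2 ?_
    filter_upwards [h0] with x hx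
    rw [Real.norm_of_nonneg (by positivity)]
    have h1 : 0 ≤ ρ t x ^ γ / (γ - 1) := div_nonneg (Real.rpow_nonneg hx γ) hγ1.le
    have h2 : 0 ≤ ε ^ 2 / 2 * ‖B t x‖ ^ 2 := by positivity
    simp only [Pi.add_apply]
    linarith
  · refine (hi.const_mul (γ - 1)).mono' mργ ?_
    filter_upwards [h0] with x hx
    rw [Real.norm_of_nonneg (Real.rpow_nonneg hx γ)]
    have h1 : ρ t x ^ γ = (γ - 1) * (ρ t x ^ γ / (γ - 1)) := by field_simp
    have h2 : 0 ≤ ε ^ 2 / 2 * ‖B t x‖ ^ 2 := by positivity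
    have h3 : 0 ≤ ‖Λ t x‖ ^ 2 / 2 := by positivity
    calc ρ t x ^ γ = (γ - 1) * (ρ t x ^ γ / (γ - 1)) := h1
      _ ≤ _ := mul_le_mul_of_nonneg_left (by simp only [Pi.add_apply]; linarith) hγ1.le
  · refine (hi.const_mul (2 / ε ^ 2)).mono' mB2 ?_
    filter_upwards [h0] with x hx
    rw [Real.norm_of_nonneg (by positivity)]
    have h1 : ‖B t x‖ ^ 2 = 2 / ε ^ 2 * (ε ^ 2 / 2 * ‖B t x‖ ^ 2) := by field_simp
    have h2 : 0 ≤ ρ t x ^ γ / (γ - 1) := div_nonneg (Real.rpow_nonneg hx γ) hγ1.le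
    have h3 : 0 ≤ ‖Λ t x‖ ^ 2 / 2 := by positivity
    calc ‖B t x‖ ^ 2 = 2 / ε ^ 2 * (ε ^ 2 / 2 * ‖B t x‖ ^ 2) := h1
      _ ≤ _ := mul_le_mul_of_nonneg_left (by simp only [Pi.add_apply]; linarith) (by positivity)

end IsWeakSolutionWith

/-! ### The weak formulation, tested with products -/

theorem le_one_add_rpow {γ s : ℝ} (hγ : 1 < γ) (hs : 0 ≤ s) : s ≤ 1 + s ^ γ := by
  have h0 := Real.rpow_nonneg hs γ
  rcases le_total s 1 with h | h
  · linarith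
  · have := Real.self_le_rpow_of_one_le h hγ.le
    linarith

theorem integral_linear_comb₂ {X : Type*} [MeasurableSpace X] {μ : Measure X} {f g : X → ℝ}
    (hf : Integrable f μ) (hg : Integrable g μ) (a b : ℝ) :
    Integrable (fun x => a * f x + b * g x) μ ∧
      ∫ x, (a * f x + b * g x) ∂μ = a * ∫ x, f x ∂μ + b * ∫ x, g x ∂μ := by
  refine ⟨(hf.const_mul a).add (hg.const_mul b), ?_⟩
  rw [integral_add (hf.const_mul a) (hg.const_mul b), integral_const_mul, integral_const_mul]

theorem integral_linear_comb₃ {X : Type*} [MeasurableSpace X] {μ : Measure X} {f g k : X → ℝ}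
    (hf : Integrable f μ) (hg : Integrable g μ) (hk : Integrable k μ) (a b c : ℝ) :
    Integrable (fun x => a * f x + b * g x + c * k x) μ ∧
      ∫ x, (a * f x + b * g x + c * k x) ∂μ =
        a * ∫ x, f x ∂μ + b * ∫ x, g x ∂μ + c * ∫ x, k x ∂μ := by
  obtain ⟨i, e⟩ := integral_linear_comb₂ hf hg a b
  obtain ⟨i', e'⟩ := integral_linear_comb₂ i hk 1 c
  simp only [one_mul] at i' e'
  exact ⟨i', by rw [e', e]⟩

namespace IsWeakSolutionWith

variable {d : ℕ} {Ω : C3Domain d} {γ c α ε T : ℝ} {ρ₀ : Sp d → ℝ} {J₀ : Sp d → Sp d}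
  {ρ : ℝ → Sp d → ℝ} {J Λ B H : ℝ → Sp d → Sp d}

theorem ae_energy_bounds (h : IsWeakSolutionWith Ω γ c α ε T ρ₀ J₀ ρ J Λ B H) (hγ : 1 < γ)
    (hε : 0 < ε) {E : ℝ} (hE0 : 0 ≤ E)
    (hE : totalEnergy Ω.carrier γ c α ε ρ₀ J₀ ≤ ENNReal.ofReal E) :
    ∀ᵐ t ∂volume.restrict (Icc 0 T),
      ∫ x in Ω.carrier, ‖Λ t x‖ ^ 2 ≤ 2 * E ∧
      ∫ x in Ω.carrier, ρ t x ^ γ ≤ (γ - 1) * E ∧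
      ε ^ 2 * ∫ x in Ω.carrier, ‖B t x‖ ^ 2 ≤ 2 * E := by
  filter_upwards [h.ae_energy hγ hε hE0 hE, ae_restrict_mem measurableSet_Icc] with t
    ⟨i1, i2, i3, hle⟩ ht
  have hγ1 : 0 < γ - 1 := by linarith
  have e := (integral_linear_comb₃ i1 i2 i3 2⁻¹ (γ - 1)⁻¹ (ε ^ 2 / 2)).2
  have e' : ∫ x in Ω.carrier, (‖Λ t x‖ ^ 2 / 2 + ρ t x ^ γ / (γ - 1) + ε ^ 2 / 2 * ‖B t x‖ ^ 2) =
      2⁻¹ * (∫ x in Ω.carrier, ‖Λ t x‖ ^ 2) + (γ - 1)⁻¹ * (∫ x in Ω.carrier, ρ t x ^ γ) +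
        ε ^ 2 / 2 * ∫ x in Ω.carrier, ‖B t x‖ ^ 2 := by
    rw [← e]
    congr 1
    funext x
    ring
  rw [e'] at hle
  have n1 : 0 ≤ ∫ x in Ω.carrier, ‖Λ t x‖ ^ 2 := integral_nonneg fun x => by positivity
  have n2 : 0 ≤ ∫ x in Ω.carrier, ρ t x ^ γ :=
    integral_nonneg_of_ae ((h.nonneg t ht).mono fun x hx => Real.rpow_nonneg hx γ)
  have n3 : 0 ≤ ε ^ 2 * ∫ x in Ω.carrier, ‖B t x‖ ^ 2 :=
    mul_nonneg (by positivity) (integral_nonneg fun x => by positivity)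
  have n2' : 0 ≤ (γ - 1)⁻¹ * ∫ x in Ω.carrier, ρ t x ^ γ := mul_nonneg (inv_nonneg.2 hγ1.le) n2
  refine ⟨by linarith, ?_, by linarith⟩
  have : (γ - 1)⁻¹ * ∫ x in Ω.carrier, ρ t x ^ γ ≤ E := by linarith
  rwa [inv_mul_le_iff₀ hγ1] at this

/-- Products of `ρ` and `J` with bounded functions of bounded support are integrable. -/
theorem integrable_pairing (h : IsWeakSolutionWith Ω γ c α ε T ρ₀ J₀ ρ J Λ B H) (hγ : 1 < γ)
    (hε : 0 < ε) {Ψ : ℝ → Sp d → ℝ} {Φ : ℝ → Sp d → Sp d} (hΨ : ExtendsCont T Ω.carrier Ψ)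
    (hΦ : ExtendsCont T Ω.carrier Φ) {R : ℝ}
    (hR : ∀ t ∈ Icc 0 T, ∀ x ∈ Ω.carrier, R < ‖x‖ → Ψ t x = 0 ∧ Φ t x = 0) :
    IntegrableOn (fun t => ∫ x in Ω.carrier, (ρ t x * Ψ t x + ⟪J t x, Φ t x⟫_ℝ)) (Icc 0 T) ∧
    ∀ᵐ t ∂volume.restrict (Icc 0 T),
      IntegrableOn (fun x => ρ t x * Ψ t x + ⟪J t x, Φ t x⟫_ℝ) Ω.carrier := by
  have hΩ := Ω.isOpen
  have hprod : MeasurableSet (Icc (0 : ℝ) T ×ˢ Ω.carrier) :=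
    measurableSet_Icc.prod hΩ.measurableSet
  obtain ⟨C₁, hC₁, hb₁⟩ := hΨ.exists_bound
  obtain ⟨C₂, hC₂, hb₂⟩ := hΦ.exists_bound
  have hE : totalEnergy Ω.carrier γ c α ε ρ₀ J₀ ≤
      ENNReal.ofReal (totalEnergy Ω.carrier γ c α ε ρ₀ J₀).toReal :=
    (ENNReal.ofReal_toReal h.initial_energy.ne).ge
  set E := (totalEnergy Ω.carrier γ c α ε ρ₀ J₀).toReal
  have hE0 : 0 ≤ E := ENNReal.toReal_nonneg
  set f : ℝ → Sp d → ℝ := fun t x => √(ρ t x) ^ 2 * Ψ t x + ⟪√(ρ t x) • Λ t x, Φ t x⟫_ℝ with hf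
  have hfe : ∀ t ∈ Icc 0 T, ∀ᵐ x ∂volume.restrict Ω.carrier,
      f t x = ρ t x * Ψ t x + ⟪J t x, Φ t x⟫_ℝ := by
    intro t ht
    filter_upwards [h.ae_eq_sq ht, h.J_eq t ht] with x h1 h2
    simp only [hf, h1, h2]
  have m1 := h.sqrt_rho_mem.aestronglyMeasurable hΩ
  have m2 := h.Λ_mem.aestronglyMeasurable hΩ
  have m3 : AEStronglyMeasurable (Function.uncurry Ψ)
      ((volume.restrict (Icc 0 T)).prod (volume.restrict Ω.carrier)) := by
    rw [Measure.prod_restrict]; exact hΨ.continuousOn.aestronglyMeasurable hprod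
  have m4 : AEStronglyMeasurable (Function.uncurry Φ)
      ((volume.restrict (Icc 0 T)).prod (volume.restrict Ω.carrier)) := by
    rw [Measure.prod_restrict]; exact hΦ.continuousOn.aestronglyMeasurable hprod
  have mf : AEStronglyMeasurable (Function.uncurry f)
      ((volume.restrict (Icc 0 T)).prod (volume.restrict Ω.carrier)) :=
    ((m1.pow 2).mul m3).add ((m1.smul m2).inner m4)
  set b : Sp d → ℝ := (Metric.closedBall (0 : Sp d) R).indicator fun _ => C₁ + C₂ with hbdef
  have ib : IntegrableOn b Ω.carrier := by
    refine (integrable_indicator_iff Metric.isClosed_closedBall.measurableSet).2 ?_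
    refine integrableOn_const (ne_of_lt (lt_of_le_of_lt (Measure.restrict_apply_le _ _) ?_))
    exact measure_closedBall_lt_top
  have hfb : ∀ t ∈ Icc 0 T, ∀ᵐ x ∂volume.restrict Ω.carrier,
      ‖f t x‖ ≤ b x + (C₁ + C₂) * ρ t x ^ γ + C₂ * ‖Λ t x‖ ^ 2 := by
    intro t ht
    filter_upwards [h.nonneg t ht, ae_restrict_mem hΩ.measurableSet] with x hx hxΩ
    have hp := Real.rpow_nonneg hx γ
    by_cases hxR : ‖x‖ ≤ R
    · rw [hbdef, indicator_of_mem (by simpa using hxR)]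
      have h1 := hb₁ t ht x hxΩ
      have h2 := hb₂ t ht x hxΩ
      have h3 := le_one_add_rpow hγ hx
      have hs := Real.sq_sqrt hx
      have e1 : ‖√(ρ t x) ^ 2 * Ψ t x‖ ≤ ρ t x * C₁ := by
        rw [hs, norm_mul, Real.norm_of_nonneg hx]
        exact mul_le_mul_of_nonneg_left h1 hx
      have e2 : ‖⟪√(ρ t x) • Λ t x, Φ t x⟫_ℝ‖ ≤ (ρ t x + ‖Λ t x‖ ^ 2) * C₂ := by
        refine (norm_inner_le_norm _ _).trans (mul_le_mul ?_ h2 (norm_nonneg _) (by positivity))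
        rw [norm_smul, Real.norm_of_nonneg (Real.sqrt_nonneg _)]
        nlinarith [sq_nonneg (√(ρ t x) - ‖Λ t x‖), sq_nonneg (√(ρ t x) + ‖Λ t x‖)]
      have e3 := mul_le_mul_of_nonneg_right h3 hC₁
      have e4 := mul_le_mul_of_nonneg_right h3 hC₂
      refine (norm_add_le _ _).trans ((add_le_add e1 e2).trans ?_)
      linarith
    · obtain ⟨h1, h2⟩ := hR t ht x hxΩ (not_le.1 hxR)
      have hb0 : 0 ≤ b x := indicator_nonneg (fun _ _ => by positivity) x
      simp only [hf, h1, h2, mul_zero, inner_zero_right, add_zero, norm_zero]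
      positivity
  have hslice : ∀ᵐ t ∂volume.restrict (Icc 0 T),
      Integrable (fun x => Function.uncurry f (t, x)) (volume.restrict Ω.carrier) ∧
      ∫ x in Ω.carrier, ‖Function.uncurry f (t, x)‖ ≤
        (∫ x in Ω.carrier, b x) + (C₁ + C₂) * ((γ - 1) * E) + C₂ * (2 * E) := by
    filter_upwards [mf.prodMk_left, h.ae_energy hγ hε hE0 hE, h.ae_energy_bounds hγ hε hE0 hE,
      ae_restrict_mem measurableSet_Icc] with t hm ⟨i1, i2, _, _⟩ ⟨b1, b2, _⟩ ht
    obtain ⟨ig, eg⟩ := integral_linear_comb₃ ib i2 i1 1 (C₁ + C₂) C₂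
    simp only [one_mul] at ig eg
    have ii := ig.mono' hm (hfb t ht)
    refine ⟨ii, (integral_mono_ae ii.norm ig (hfb t ht)).trans ?_⟩
    rw [eg]
    gcongr
  refine ⟨?_, ?_⟩
  · refine (integrable_prod_of_ae_slice mf hslice).integral_prod_left.congr ?_
    filter_upwards [ae_restrict_mem measurableSet_Icc] with t ht
    exact integral_congr_ae (hfe t ht)
  · filter_upwards [hslice, ae_restrict_mem measurableSet_Icc] with t h1 ht
    exact h1.1.congr (hfe t ht)

/-- Testing with θ(t)Ψ and θ(T) = 0 removes the value at time T, about which an almost everywhere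
energy bound says nothing. What remains is the distributional time derivative of ∫ ρΨ together with
its initial value. -/
theorem mass_time (h : IsWeakSolutionWith Ω γ c α ε T ρ₀ J₀ ρ J Λ B H) (hγ : 1 < γ)
    (hε : 0 < ε) (hT : 0 < T) {Ψ : ℝ → Sp d → ℝ} (hΨ : IsTestScalar T Ω.carrier Ψ) :
    IntegrableOn (fun t => ∫ x in Ω.carrier, ρ t x * Ψ t x) (Icc 0 T) ∧
    IntegrableOn (fun t => ∫ x in Ω.carrier, massIntegrand T ρ J Ψ t x) (Icc 0 T) ∧
    (∀ᵐ t ∂volume.restrict (Icc 0 T), IntegrableOn (fun x => ρ t x * Ψ t x) Ω.carrier ∧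
      IntegrableOn (massIntegrand T ρ J Ψ t) Ω.carrier) ∧
    ∀ θ : ℝ → ℝ, ContDiff ℝ 1 θ → θ T = 0 →
      -∫ t in Icc 0 T, deriv θ t * ∫ x in Ω.carrier, ρ t x * Ψ t x =
        θ 0 * (∫ x in Ω.carrier, ρ₀ x * Ψ 0 x) +
          ∫ t in Icc 0 T, θ t * ∫ x in Ω.carrier, massIntegrand T ρ J Ψ t x := by
  obtain ⟨R, hR⟩ := hΨ.support
  obtain ⟨i1, s1⟩ := h.integrable_pairing hγ hε hΨ.space.spaceReg.extendsCont
    (ExtendsCont.const (0 : Sp d)) (R := R)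
    fun t ht x hx hxR => ⟨hR t ht x (subset_closure hx) hxR, rfl⟩
  simp only [inner_zero_right, add_zero] at i1 s1
  have iD := (h.weak_mass Ψ hΨ).2.1
  rw [IntegrableOn, Measure.volume_eq_prod, ← Measure.prod_restrict] at iD
  have s2 := iD.prod_right_ae
  have i2 := iD.integral_prod_left
  refine ⟨i1, i2, s1.and s2, fun θ hθ hθT => ?_⟩
  have key := (h.weak_mass _ (hΨ.time_smul hT Ω.isOpen hθ)).2.2
  simp only [hθT, zero_mul, mul_zero, integral_zero, zero_sub] at key
  rw [intervalIntegral.integral_of_le hT.le, ← integral_Icc_eq_integral_Ioc] at key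
  have e1 : ∀ t ∈ Icc 0 T, ∫ x in Ω.carrier, massIntegrand T ρ J (fun t x => θ t * Ψ t x) t x =
      ∫ x in Ω.carrier, (deriv θ t * (ρ t x * Ψ t x) + θ t * massIntegrand T ρ J Ψ t x) :=
    fun t ht => setIntegral_congr_fun Ω.isOpen.measurableSet fun x hx =>
      massIntegrand_time_smul hT hΨ.time hθ ht hx
  have e2 : ∀ᵐ t ∂volume.restrict (Icc 0 T),
      ∫ x in Ω.carrier, massIntegrand T ρ J (fun t x => θ t * Ψ t x) t x =
      deriv θ t * (∫ x in Ω.carrier, ρ t x * Ψ t x) +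
        θ t * ∫ x in Ω.carrier, massIntegrand T ρ J Ψ t x := by
    filter_upwards [ae_restrict_mem measurableSet_Icc, s1, s2] with t ht h1 h2
    exact (e1 t ht).trans (integral_linear_comb₂ h1 h2 _ _).2
  have j1 : IntegrableOn (fun t => deriv θ t * ∫ x in Ω.carrier, ρ t x * Ψ t x) (Icc 0 T) :=
    IntegrableOn.continuousOn_mul (hθ.continuous_deriv le_rfl).continuousOn i1 isCompact_Icc
  have j2 : IntegrableOn (fun t => θ t * ∫ x in Ω.carrier, massIntegrand T ρ J Ψ t x) (Icc 0 T) :=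
    IntegrableOn.continuousOn_mul hθ.continuous.continuousOn i2 isCompact_Icc
  rw [integral_congr_ae e2, integral_add j1 j2] at key
  have e3 : ∫ x in Ω.carrier, ρ₀ x * (θ 0 * Ψ 0 x) = θ 0 * ∫ x in Ω.carrier, ρ₀ x * Ψ 0 x := by
    rw [← integral_const_mul]
    congr 1
    funext x
    ring
  rw [e3] at key
  linarith

theorem momentum_time (h : IsWeakSolutionWith Ω γ c α ε T ρ₀ J₀ ρ J Λ B H) (hγ : 1 < γ)
    (hε : 0 < ε) (hT : 0 < T) {Φ : ℝ → Sp d → Sp d} (hΦ : IsTestField T Ω Φ) :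
    IntegrableOn (fun t => ∫ x in Ω.carrier, ⟪J t x, Φ t x⟫_ℝ) (Icc 0 T) ∧
    IntegrableOn (fun t => ∫ x in Ω.carrier, momentumIntegrand T γ α ε ρ J Λ B H Φ t x)
      (Icc 0 T) ∧
    (∀ᵐ t ∂volume.restrict (Icc 0 T), IntegrableOn (fun x => ⟪J t x, Φ t x⟫_ℝ) Ω.carrier ∧
      IntegrableOn (momentumIntegrand T γ α ε ρ J Λ B H Φ t) Ω.carrier) ∧
    ∀ θ : ℝ → ℝ, ContDiff ℝ 1 θ → θ T = 0 →
      -∫ t in Icc 0 T, deriv θ t * ∫ x in Ω.carrier, ⟪J t x, Φ t x⟫_ℝ =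
        θ 0 * (∫ x in Ω.carrier, ⟪J₀ x, Φ 0 x⟫_ℝ) +
          ∫ t in Icc 0 T, θ t * ∫ x in Ω.carrier,
            momentumIntegrand T γ α ε ρ J Λ B H Φ t x := by
  obtain ⟨R, hR⟩ := hΦ.support
  obtain ⟨i1, s1⟩ := h.integrable_pairing hγ hε (ExtendsCont.const (0 : ℝ))
    hΦ.space.spaceReg.extendsCont (R := R)
    fun t ht x hx hxR => ⟨rfl, hR t ht x (subset_closure hx) hxR⟩
  simp only [mul_zero, zero_add] at i1 s1
  have iD := (h.weak_momentum Φ hΦ).2.1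
  rw [IntegrableOn, Measure.volume_eq_prod, ← Measure.prod_restrict] at iD
  have s2 := iD.prod_right_ae
  have i2 := iD.integral_prod_left
  refine ⟨i1, i2, s1.and s2, fun θ hθ hθT => ?_⟩
  have key := (h.weak_momentum _ (hΦ.time_smul hT hθ)).2.2
  simp only [hθT, zero_smul, inner_zero_right, integral_zero, zero_sub] at key
  rw [intervalIntegral.integral_of_le hT.le, ← integral_Icc_eq_integral_Ioc] at key
  have e1 : ∀ t ∈ Icc 0 T,
      ∫ x in Ω.carrier, momentumIntegrand T γ α ε ρ J Λ B H (fun t x => θ t • Φ t x) t x =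
      ∫ x in Ω.carrier, (deriv θ t * ⟪J t x, Φ t x⟫_ℝ +
        θ t * momentumIntegrand T γ α ε ρ J Λ B H Φ t x) :=
    fun t ht => setIntegral_congr_fun Ω.isOpen.measurableSet fun x hx =>
      momentumIntegrand_time_smul hT hΦ.time hθ ht hx
  have e2 : ∀ᵐ t ∂volume.restrict (Icc 0 T),
      ∫ x in Ω.carrier, momentumIntegrand T γ α ε ρ J Λ B H (fun t x => θ t • Φ t x) t x =
      deriv θ t * (∫ x in Ω.carrier, ⟪J t x, Φ t x⟫_ℝ) +
        θ t * ∫ x in Ω.carrier, momentumIntegrand T γ α ε ρ J Λ B H Φ t x := by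
    filter_upwards [ae_restrict_mem measurableSet_Icc, s1, s2] with t ht h1 h2
    exact (e1 t ht).trans (integral_linear_comb₂ h1 h2 _ _).2
  have j1 : IntegrableOn (fun t => deriv θ t * ∫ x in Ω.carrier, ⟪J t x, Φ t x⟫_ℝ) (Icc 0 T) :=
    IntegrableOn.continuousOn_mul (hθ.continuous_deriv le_rfl).continuousOn i1 isCompact_Icc
  have j2 : IntegrableOn (fun t => θ t * ∫ x in Ω.carrier,
      momentumIntegrand T γ α ε ρ J Λ B H Φ t x) (Icc 0 T) :=
    IntegrableOn.continuousOn_mul hθ.continuous.continuousOn i2 isCompact_Icc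
  rw [integral_congr_ae e2, integral_add j1 j2] at key
  have e3 : ∫ x in Ω.carrier, ⟪J₀ x, θ 0 • Φ 0 x⟫_ℝ =
      θ 0 * ∫ x in Ω.carrier, ⟪J₀ x, Φ 0 x⟫_ℝ := by
    simp only [real_inner_smul_right, integral_const_mul]
  rw [e3] at key
  linarith

end IsWeakSolutionWith

/-! ### Cutoff functions at a fixed scale -/

/-- A smooth cutoff at scale `R`. -/
def cutoff {d : ℕ} (R : ℝ) (x : Sp d) : ℝ := downStep (‖R⁻¹ • x‖ ^ 2 - 3)

theorem contDiff_cutoff {d : ℕ} (R : ℝ) {n : ℕ∞} : ContDiff ℝ n (cutoff (d := d) R) :=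
  (contDiff_downStep (n := n)).comp
    (((contDiff_norm_sq ℝ).comp (contDiff_const_smul R⁻¹)).sub contDiff_const)

theorem cutoff_nonneg {d : ℕ} (R : ℝ) (x : Sp d) : 0 ≤ cutoff R x := downStep_nonneg _

theorem cutoff_le_one {d : ℕ} (R : ℝ) (x : Sp d) : cutoff R x ≤ 1 := downStep_le_one _

theorem cutoff_eq_one {d : ℕ} {R : ℝ} (hR : 0 < R) {x : Sp d} (hx : ‖x‖ ≤ R) : cutoff R x = 1 := by
  refine downStep_of_le ?_
  rw [norm_smul, norm_inv, Real.norm_of_nonneg hR.le]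
  have h1 : R⁻¹ * ‖x‖ ≤ 1 := by rwa [inv_mul_le_iff₀ hR, mul_one]
  have h2 : 0 ≤ R⁻¹ * ‖x‖ := by positivity
  nlinarith

theorem cutoff_eq_zero {d : ℕ} {R : ℝ} (hR : 0 < R) {x : Sp d} (hx : 2 * R < ‖x‖) :
    cutoff R x = 0 := by
  refine downStep_of_ge ?_
  rw [norm_smul, norm_inv, Real.norm_of_nonneg hR.le]
  have h1 : 2 < R⁻¹ * ‖x‖ := by rwa [lt_inv_mul_iff₀ hR, mul_comm]
  nlinarith

theorem cutoff_eq_comp {d : ℕ} (R : ℝ) : cutoff (d := d) R = fun x => cutoff 1 (R⁻¹ • x) := by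
  funext x
  simp [cutoff]

theorem fderiv_cutoff {d : ℕ} (R : ℝ) :
    fderiv ℝ (cutoff (d := d) R) = fun x => R⁻¹ • fderiv ℝ (cutoff 1) (R⁻¹ • x) := by
  funext x
  rw [cutoff_eq_comp]
  exact fderiv_comp_smul _

theorem hasCompactSupport_cutoff_one {d : ℕ} : HasCompactSupport (cutoff (d := d) 1) := by
  refine HasCompactSupport.of_support_subset_isCompact (isCompact_closedBall (0 : Sp d) 2) ?_
  intro x hx
  by_contra h
  refine hx (cutoff_eq_zero one_pos ?_)
  simpa using h

theorem HasCompactSupport.exists_fderiv_bound {E F : Type*} [NormedAddCommGroup E]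
    [NormedSpace ℝ E] [NormedAddCommGroup F] [NormedSpace ℝ F] {f : E → F}
    (hc : HasCompactSupport f) (hf : ContDiff ℝ 1 f) : ∃ C : ℝ, 0 ≤ C ∧ ∀ x, ‖fderiv ℝ f x‖ ≤ C := by
  obtain ⟨C, hC⟩ := (hc.fderiv (𝕜 := ℝ)).exists_bound_of_continuous
    (hf.continuous_fderiv (by norm_num))
  exact ⟨C, (norm_nonneg _).trans (hC 0), hC⟩

theorem norm_fderiv_smul_comp_smul_le {E F : Type*} [NormedAddCommGroup E]
    [NormedSpace ℝ E] [NormedAddCommGroup F] [NormedSpace ℝ F] {f : E → F} {C a b : ℝ}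
    (hC : ∀ x, ‖fderiv ℝ f x‖ ≤ C) (ha : 0 ≤ a) (hb : 0 ≤ b) (x : E) :
    ‖fderiv ℝ (fun y => b • f (a • y)) x‖ ≤ b * (a * C) := by
  rw [show (fun y => b • f (a • y)) = b • fun y => f (a • y) from rfl, fderiv_const_smul_field,
    Pi.smul_apply, fderiv_comp_smul, norm_smul, norm_smul, Real.norm_of_nonneg ha,
    Real.norm_of_nonneg hb]
  exact mul_le_mul_of_nonneg_left (mul_le_mul_of_nonneg_left (hC _) ha) hb

/-- The cutoff at scale `R` has derivatives of order `j ≤ 2` of size `R⁻ʲ`. -/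
theorem exists_cutoff_bounds (d : ℕ) : ∃ C : ℝ, 0 ≤ C ∧ ∀ R : ℝ, 0 < R → ∀ x : Sp d,
    ‖fderiv ℝ (cutoff R) x‖ ≤ C / R ∧ ‖fderiv ℝ (fderiv ℝ (cutoff R)) x‖ ≤ C / R ^ 2 := by
  have hs : ContDiff ℝ 2 (cutoff (d := d) 1) := contDiff_cutoff (n := 2) 1
  have h1 : ContDiff ℝ 1 (fderiv ℝ (cutoff (d := d) 1)) := hs.fderiv_right (by norm_num)
  obtain ⟨C₁, p1, hC₁⟩ := HasCompactSupport.exists_fderiv_bound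
    (hasCompactSupport_cutoff_one (d := d)) (hs.of_le (by norm_num))
  obtain ⟨C₂, p2, hC₂⟩ := HasCompactSupport.exists_fderiv_bound
    ((hasCompactSupport_cutoff_one (d := d)).fderiv (𝕜 := ℝ)) h1
  refine ⟨C₁ + C₂, add_nonneg p1 p2, fun R hR x => ⟨?_, ?_⟩⟩
  · have := norm_fderiv_smul_comp_smul_le (b := 1) hC₁ (inv_nonneg.2 hR.le) zero_le_one x
    simp only [one_smul, one_mul] at this
    rw [cutoff_eq_comp R, div_eq_inv_mul]
    refine this.trans (mul_le_mul_of_nonneg_left (by linarith) (inv_nonneg.2 hR.le))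
  · have := norm_fderiv_smul_comp_smul_le hC₂ (inv_nonneg.2 hR.le) (inv_nonneg.2 hR.le) x
    rw [fderiv_cutoff R, div_eq_inv_mul, sq, mul_inv, mul_assoc]
    exact this.trans (mul_le_mul_of_nonneg_left (mul_le_mul_of_nonneg_left (by linarith)
      (inv_nonneg.2 hR.le)) (inv_nonneg.2 hR.le))

theorem lintegral_le_of_tendsto {X : Type*} [MeasurableSpace X] {μ : Measure X}
    {F : ℕ → X → ℝ≥0∞} {f : X → ℝ≥0∞} (hm : ∀ n, AEMeasurable (F n) μ)
    (hlim : ∀ᵐ x ∂μ, Tendsto (fun n => F n x) atTop (𝓝 (f x))) {b : ℕ → ℝ≥0∞} {B : ℝ≥0∞}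
    (hb : ∀ᶠ n in atTop, ∫⁻ x, F n x ∂μ ≤ b n) (hB : Tendsto b atTop (𝓝 B)) :
    ∫⁻ x, f x ∂μ ≤ B := by
  calc ∫⁻ x, f x ∂μ = ∫⁻ x, liminf (fun n => F n x) atTop ∂μ :=
        lintegral_congr_ae (hlim.mono fun x hx => hx.liminf_eq.symm)
    _ ≤ liminf (fun n => ∫⁻ x, F n x ∂μ) atTop := lintegral_liminf_le' hm
    _ ≤ liminf b atTop := liminf_le_liminf hb
    _ = B := hB.liminf_eq

/-! ### Propagation of mass and decay for weak solutions -/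

namespace IsWeakSolutionWith

variable {d : ℕ} {Ω : C3Domain d} {γ c α ε T : ℝ} {ρ₀ : Sp d → ℝ} {J₀ : Sp d → Sp d}
  {ρ : ℝ → Sp d → ℝ} {J Λ B H : ℝ → Sp d → Sp d}

/-- Testing with a square closes the estimate: J·∇(w²) = 2w√ρ Λ·∇w ≤ a(ρw² + |Λ|²). The first part
goes into Grönwall's lemma, the second is bounded by 2aE. -/
theorem ae_weighted_mass_le (h : IsWeakSolutionWith Ω γ c α ε T ρ₀ J₀ ρ J Λ B H) (hγ : 1 < γ)
    (hε : 0 < ε) (hT : 0 < T) {E : ℝ} (hE0 : 0 ≤ E)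
    (hE : totalEnergy Ω.carrier γ c α ε ρ₀ J₀ ≤ ENNReal.ofReal E) {w : Sp d → ℝ}
    (hw : ContDiff ℝ 1 w) {R a : ℝ} (hR : ∀ x, R < ‖x‖ → w x = 0) (ha : 0 ≤ a)
    (hwa : ∀ x, ‖fderiv ℝ w x‖ ≤ a) :
    ∀ᵐ t ∂volume.restrict (Icc 0 T), IntegrableOn (fun x => ρ t x * w x ^ 2) Ω.carrier ∧
      ∫ x in Ω.carrier, ρ t x * w x ^ 2 ≤
        Real.exp (a * t) * ((∫ x in Ω.carrier, ρ₀ x * w x ^ 2) + T * (a * (2 * E))) := by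
  have hΩ := Ω.isOpen
  have hu : ContDiff ℝ 1 (Function.uncurry fun (_ : ℝ) (x : Sp d) => w x ^ 2) :=
    (hw.comp contDiff_snd).pow 2
  have hRu : ∀ t ∈ Icc 0 T, ∀ x, R < ‖x‖ → w x ^ 2 = 0 := fun t _ x hx => by simp [hR x hx]
  have hΨ : IsTestScalar T Ω.carrier fun _ x => w x ^ 2 :=
    { space := (SpaceReg.of_contDiff hΩ (R := R) (by exact_mod_cast hu) hRu).isSpaceCk
        hu.continuous.continuousOn
      time := IsTimeC1.of_contDiff hT hu hRu
      support := ⟨R, fun t ht x _ hx => hRu t ht x hx⟩ }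
  obtain ⟨i1, i2, s, hθ⟩ := h.mass_time hγ hε hT hΨ
  have hD : ∀ᵐ t ∂volume.restrict (Icc 0 T),
      ∫ x in Ω.carrier, massIntegrand T ρ J (fun _ x => w x ^ 2) t x ≤
        a * (∫ x in Ω.carrier, ρ t x * w x ^ 2) + a * (2 * E) := by
    filter_upwards [s, h.ae_energy hγ hε hE0 hE, h.ae_energy_bounds hγ hε hE0 hE,
      ae_restrict_mem measurableSet_Icc] with t ⟨s1, s2⟩ ⟨iΛ, _⟩ ⟨bΛ, _⟩ ht
    obtain ⟨ig, eg⟩ := integral_linear_comb₂ s1 iΛ a a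
    calc ∫ x in Ω.carrier, massIntegrand T ρ J (fun _ x => w x ^ 2) t x
        ≤ ∫ x in Ω.carrier, (a * (ρ t x * w x ^ 2) + a * ‖Λ t x‖ ^ 2) := by
          refine integral_mono_ae s2 ig ?_
          filter_upwards [h.nonneg t ht, h.J_eq t ht] with x hx hJ
          have e1 : dt T (fun _ x => w x ^ 2) t x = 0 := by
            rw [dt]; simp
          have e2 : ⟪J t x, gradient (fun x => w x ^ 2) x⟫_ℝ =
              2 * w x * √(ρ t x) * fderiv ℝ w x (Λ t x) := by
            rw [real_inner_comm, inner_gradient, hJ,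
              ((hw.differentiable (by norm_num) x).hasFDerivAt.pow 2).fderiv]
            simp
            ring
          rw [massIntegrand, e1, e2, mul_zero, zero_add]
          have e3 : |fderiv ℝ w x (Λ t x)| ≤ a * ‖Λ t x‖ :=
            ((fderiv ℝ w x).le_opNorm _).trans
              (mul_le_mul_of_nonneg_right (hwa x) (norm_nonneg _))
          have hs := Real.sq_sqrt hx
          have e4 : w x * √(ρ t x) * fderiv ℝ w x (Λ t x) ≤
              |w x| * √(ρ t x) * (a * ‖Λ t x‖) := by
            refine (le_abs_self _).trans ?_
            rw [abs_mul, abs_mul, abs_of_nonneg (Real.sqrt_nonneg _)]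
            gcongr
          have e5 : ρ t x * w x ^ 2 = (|w x| * √(ρ t x)) ^ 2 := by
            rw [mul_pow, sq_abs, hs, mul_comm]
          rw [e5]
          nlinarith [mul_nonneg ha (sq_nonneg (|w x| * √(ρ t x) - ‖Λ t x‖))]
      _ ≤ _ := by
          rw [eg]
          gcongr
  have key := ae_le_exp_of_weak_inequality (C := a) (e := a * (2 * E)) hT (by positivity) i1
    (m₀ := ∫ x in Ω.carrier, ρ₀ x * w x ^ 2) (fun θ hθ1 hθ0 hθT => ?_) ha
  · filter_upwards [key, s] with t ht s1
    exact ⟨s1.1, ht⟩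
  · rw [hθ θ hθ1 hθT]
    refine add_le_add le_rfl ?_
    refine integral_mono_ae
      (IntegrableOn.continuousOn_mul hθ1.continuous.continuousOn i2 isCompact_Icc)
      (IntegrableOn.continuousOn_mul hθ1.continuous.continuousOn
        (Integrable.add (i1.const_mul a) (integrable_const (a * (2 * E))))
        isCompact_Icc) ?_
    filter_upwards [hD, ae_restrict_mem measurableSet_Icc] with t h1 ht
    exact mul_le_mul_of_nonneg_left h1 (hθ0 t ht)

/-- Bound for `∫ s² ρ(t)`, for a weight `s` that need not have compact support. -/
theorem ae_lintegral_weighted_le (h : IsWeakSolutionWith Ω γ c α ε T ρ₀ J₀ ρ J Λ B H) (hγ : 1 < γ)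
    (hε : 0 < ε) (hT : 0 < T) {E : ℝ} (hE0 : 0 ≤ E)
    (hE : totalEnergy Ω.carrier γ c α ε ρ₀ J₀ ≤ ENNReal.ofReal E) {s : Sp d → ℝ}
    (hs : ContDiff ℝ 1 s) {b : ℝ} (hs0 : ∀ x, 0 ≤ s x) (hs1 : ∀ x, s x ≤ 1) (hb : 0 ≤ b)
    (hsb : ∀ x, ‖fderiv ℝ s x‖ ≤ b) :
    ∀ᵐ t ∂volume.restrict (Icc 0 T), ∫⁻ x in Ω.carrier, ENNReal.ofReal (ρ t x * s x ^ 2) ≤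
      ENNReal.ofReal (Real.exp (b * T) *
        ((∫ x in Ω.carrier, ρ₀ x * s x ^ 2) + T * (b * (2 * E)))) := by
  have hΩ := Ω.isOpen
  obtain ⟨C, hC0, hC⟩ := exists_cutoff_bounds d
  -- The weight s is multiplied by cutoffs at scale n+1, which changes its gradient bound to b +
  -- C/(n+1); Fatou's lemma then removes the cutoff.
  have hall : ∀ᵐ t ∂volume.restrict (Icc 0 T), ∀ n : ℕ,
      IntegrableOn (fun x => ρ t x * (cutoff (n + 1) x * s x) ^ 2) Ω.carrier ∧
      ∫ x in Ω.carrier, ρ t x * (cutoff (n + 1) x * s x) ^ 2 ≤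
        Real.exp ((C / (n + 1) + b) * t) * ((∫ x in Ω.carrier,
          ρ₀ x * (cutoff (n + 1) x * s x) ^ 2) + T * ((C / (n + 1) + b) * (2 * E))) := by
    rw [ae_all_iff]
    intro n
    have hn : (0 : ℝ) < n + 1 := by positivity
    have hcd : ContDiff ℝ 1 (cutoff (d := d) (n + 1)) := contDiff_cutoff (n := 1) _
    refine h.ae_weighted_mass_le hγ hε hT hE0 hE (hcd.mul hs) (R := 2 * (n + 1))
      (fun x hx => by simp [cutoff_eq_zero hn hx]) (by positivity) fun x => ?_
    have hd := ((hcd.differentiable (by norm_num) x).hasFDerivAt.mul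
      (hs.differentiable (by norm_num) x).hasFDerivAt).fderiv
    rw [show (fun x => cutoff (n + 1 : ℝ) x * s x) = cutoff (d := d) (n + 1) * s from rfl, hd]
    refine (norm_add_le _ _).trans ?_
    rw [norm_smul, norm_smul, Real.norm_of_nonneg (cutoff_nonneg _ _),
      Real.norm_of_nonneg (hs0 x), add_comm]
    have h1 := (hC (n + 1) hn x).1
    have h2 := hsb x
    refine add_le_add ?_ ?_
    · exact (mul_le_of_le_one_left (norm_nonneg _) (hs1 x)).trans h1
    · exact (mul_le_of_le_one_left (norm_nonneg _) (cutoff_le_one _ _)).trans h2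
  filter_upwards [hall, h.ae_measurable_slices, ae_restrict_mem measurableSet_Icc] with t ht
    ⟨mρ, _⟩ htT
  have h0 := h.nonneg t htT
  have hlim : Tendsto (fun n : ℕ => C / ((n : ℝ) + 1) + b) atTop (𝓝 b) := by
    have := (tendsto_const_div_atTop_nhds_zero_nat C).comp (tendsto_add_atTop_nat 1)
    have h2 := this.add_const b
    simp only [zero_add] at h2
    refine h2.congr fun n => ?_
    simp
  have hI0 : IntegrableOn (fun x => ρ₀ x * s x ^ 2) Ω.carrier := by
    refine h.initial_rho.mono' (h.initial_rho.1.mul (hs.continuous.pow 2).aestronglyMeasurable) ?_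
    filter_upwards [h.initial_nonneg] with x hx
    rw [Real.norm_of_nonneg (by positivity)]
    exact mul_le_of_le_one_right hx (pow_le_one₀ (hs0 x) (hs1 x))
  refine lintegral_le_of_tendsto
    (F := fun (n : ℕ) x => ENNReal.ofReal (ρ t x * (cutoff (n + 1) x * s x) ^ 2))
    (fun n => (ht n).1.aemeasurable.ennreal_ofReal) (Eventually.of_forall fun x => ?_)
    (b := fun n : ℕ => ENNReal.ofReal (Real.exp ((C / (n + 1) + b) * T) *
      ((∫ x in Ω.carrier, ρ₀ x * s x ^ 2) + T * ((C / (n + 1) + b) * (2 * E)))))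
    (Eventually.of_forall fun n => ?_) ?_
  · refine tendsto_const_nhds.congr' ?_
    obtain ⟨N, hN⟩ := exists_nat_ge ‖x‖
    filter_upwards [eventually_ge_atTop N] with n hn
    have : (N : ℝ) ≤ n := by exact_mod_cast hn
    rw [cutoff_eq_one (by positivity) (by linarith), one_mul]
  · rw [← ofReal_integral_eq_lintegral_ofReal (ht n).1 (h0.mono fun x hx => by
      simp only [Pi.zero_apply]; positivity)]
    refine ENNReal.ofReal_le_ofReal ((ht n).2.trans ?_)
    have hI : ∫ x in Ω.carrier, ρ₀ x * (cutoff ((n : ℝ) + 1) x * s x) ^ 2 ≤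
        ∫ x in Ω.carrier, ρ₀ x * s x ^ 2 := by
      refine integral_mono_of_nonneg (h.initial_nonneg.mono fun x hx => by
        simp only [Pi.zero_apply]; positivity) hI0 ?_
      filter_upwards [h.initial_nonneg] with x hx
      refine mul_le_mul_of_nonneg_left ?_ hx
      rw [mul_pow]
      exact mul_le_of_le_one_left (by positivity)
        (pow_le_one₀ (cutoff_nonneg _ _) (cutoff_le_one _ _))
    have hI00 : 0 ≤ ∫ x in Ω.carrier, ρ₀ x * (cutoff ((n : ℝ) + 1) x * s x) ^ 2 :=
      integral_nonneg_of_ae (h.initial_nonneg.mono fun x hx => by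
        simp only [Pi.zero_apply]; positivity)
    have htT2 := htT.2
    gcongr
  · refine ENNReal.tendsto_ofReal ?_
    refine Tendsto.mul ?_ ?_
    · exact (Real.continuous_exp.tendsto _).comp (hlim.mul_const T)
    · exact tendsto_const_nhds.add ((hlim.mul_const (2 * E)).const_mul T)

/-- The constant weight 1 has gradient bound b = 0, so both the exponential factor and the energy
term disappear. Conservation of mass is not needed. -/
theorem ae_integrable_mass_le (h : IsWeakSolutionWith Ω γ c α ε T ρ₀ J₀ ρ J Λ B H) (hγ : 1 < γ)
    (hε : 0 < ε) (hT : 0 < T) :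
    ∀ᵐ t ∂volume.restrict (Icc 0 T), IntegrableOn (ρ t) Ω.carrier ∧
      ∫ x in Ω.carrier, ρ t x ≤ ∫ x in Ω.carrier, ρ₀ x := by
  have := h.ae_lintegral_weighted_le hγ hε hT ENNReal.toReal_nonneg
    (ENNReal.ofReal_toReal h.initial_energy.ne).ge (s := fun _ => 1) contDiff_const (b := 0)
    (by simp) (by simp) le_rfl (by simp)
  filter_upwards [this, h.ae_measurable_slices, ae_restrict_mem measurableSet_Icc] with t ht
    ⟨mρ, _⟩ htT
  simp only [one_pow, mul_one, zero_mul, mul_zero, add_zero, Real.exp_zero, one_mul] at ht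
  exact integrable_of_lintegral_ofReal_le (integral_nonneg_of_ae h.initial_nonneg) mρ
    (h.nonneg t htT) ht

end IsWeakSolutionWith

/-- Uniform decay of the mass at infinity. -/
theorem exists_tail_bound (d : ℕ) : ∃ C : ℝ, 0 ≤ C ∧ ∀ {Ω : C3Domain d} {γ c α ε T : ℝ}
    {ρ₀ : Sp d → ℝ} {J₀ : Sp d → Sp d} {ρ : ℝ → Sp d → ℝ} {J Λ B H : ℝ → Sp d → Sp d},
    IsWeakSolutionWith Ω γ c α ε T ρ₀ J₀ ρ J Λ B H → 1 < γ → 0 < ε → 0 < T → ∀ {E : ℝ}, 0 ≤ E →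
    totalEnergy Ω.carrier γ c α ε ρ₀ J₀ ≤ ENNReal.ofReal E → ∀ {R : ℝ}, 0 < R →
    ∀ᵐ t ∂volume.restrict (Icc 0 T),
      ∫⁻ x in Ω.carrier ∩ {x | 2 * R < ‖x‖}, ENNReal.ofReal (ρ t x) ≤
      ENNReal.ofReal (Real.exp (C / R * T) *
        ((∫ x in Ω.carrier ∩ {x | R < ‖x‖}, ρ₀ x) + T * (C / R * (2 * E)))) := by
  obtain ⟨C, hC0, hC⟩ := exists_cutoff_bounds d
  refine ⟨C, hC0, fun {Ω γ c α ε T ρ₀ J₀ ρ J Λ B H} h hγ hε hT {E} hE0 hE {R} hR => ?_⟩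
  have hcd : ContDiff ℝ 1 (cutoff (d := d) R) := contDiff_cutoff (n := 1) _
  -- This weight vanishes for |x| ≤ R, equals 1 for |x| > 2R and has gradient at most C/R.
  have key := h.ae_lintegral_weighted_le hγ hε hT hE0 hE (s := fun x => 1 - cutoff R x)
    (contDiff_const.sub hcd) (b := C / R) (fun x => by linarith [cutoff_le_one R x])
    (fun x => by linarith [cutoff_nonneg R x]) (by positivity) fun x => by
      rw [fderiv_const_sub, norm_neg]
      exact (hC R hR x).1
  have m2 : MeasurableSet {x : Sp d | 2 * R < ‖x‖} :=
    (isOpen_lt continuous_const continuous_norm).measurableSet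
  have m1 : MeasurableSet {x : Sp d | R < ‖x‖} :=
    (isOpen_lt continuous_const continuous_norm).measurableSet
  filter_upwards [key] with t ht
  refine le_trans ?_ (ht.trans (ENNReal.ofReal_le_ofReal ?_))
  · rw [inter_comm, ← Measure.restrict_restrict m2, ← lintegral_indicator m2]
    refine lintegral_mono fun x => ?_
    by_cases hx : x ∈ {x : Sp d | 2 * R < ‖x‖}
    · rw [indicator_of_mem hx, cutoff_eq_zero hR hx]
      simp
    · rw [indicator_of_notMem hx]
      exact zero_le
  · have : ∫ x in Ω.carrier, ρ₀ x * (1 - cutoff R x) ^ 2 ≤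
        ∫ x in Ω.carrier ∩ {x | R < ‖x‖}, ρ₀ x := by
      rw [inter_comm, ← Measure.restrict_restrict m1, ← integral_indicator m1]
      refine integral_mono_of_nonneg (h.initial_nonneg.mono fun x hx => by
        simp only [Pi.zero_apply]; positivity) (h.initial_rho.indicator m1) ?_
      filter_upwards [h.initial_nonneg] with x hx
      by_cases hxR : x ∈ {x : Sp d | R < ‖x‖}
      · rw [indicator_of_mem hxR]
        refine mul_le_of_le_one_right hx (pow_le_one₀ ?_ ?_)
        · linarith [cutoff_le_one R x]
        · linarith [cutoff_nonneg R x]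
      · rw [indicator_of_notMem hxR, cutoff_eq_one hR (not_lt.1 hxR)]
        simp
    gcongr

/-! ### The relative entropy production, pointwise -/

/-- Algebra at one point of space-time, with s = √ρ, w = ∂ₜu, A = Du, τ = div u, g = ∇h(r), κ the
cutoff with derivative ℓ, q the potential, a = r^(γ-1), b = r^γ, π = ρ^γ, fr = f(ρ|r), and Z the
gradient of div(κu). Inserting the equation of motion for g leaves a quadratic form in Λ - √ρ u, the
relative pressure (γ-1) f(ρ|r), the capillary terms, and terms containing ℓ. -/
theorem entropy_production_identity {d : ℕ} (Λ u w g B H Z : Sp d) (A : Sp d →L[ℝ] Sp d)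
    (ℓ : Sp d →L[ℝ] ℝ) {s κ τ q a b π fr γ α ε : ℝ} (hg : g = -(w + A u))
    (hfr : (γ - 1) * fr = π - γ * a * s ^ 2 + (γ - 1) * b) :
    (s ^ 2 * (κ * (⟪u, w⟫_ℝ + (γ * a * τ + ⟪g, u⟫_ℝ)))
        + (κ * (⟪u, A (s • Λ)⟫_ℝ - ⟪g, s • Λ⟫_ℝ) + q * ℓ (s • Λ)))
      - (⟪s • Λ, κ • w⟫_ℝ + ⟪Λ, κ • A Λ + ℓ Λ • u⟫_ℝ + π * (κ * τ + ℓ u)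
        + ε ^ 2 * ⟪B, κ • A B + ℓ B • u⟫_ℝ + ε ^ 2 / 2 * ((1 + α) * ‖B‖ ^ 2) * (κ * τ + ℓ u)
        + ε ^ 2 * ⟪H, Z⟫_ℝ)
      + ((1 - γ) * κ * b * τ + b * ℓ u) =
    κ * (-⟪Λ - s • u, A (Λ - s • u)⟫_ℝ - τ * ((γ - 1) * fr) - ε ^ 2 * ⟪B, A B⟫_ℝ
        - ε ^ 2 / 2 * ((1 + α) * ‖B‖ ^ 2) * τ)
      + (q * (s * ℓ Λ) - ℓ Λ * ⟪Λ, u⟫_ℝ - π * ℓ u - ε ^ 2 * (ℓ B * ⟪B, u⟫_ℝ)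
        - ε ^ 2 / 2 * ((1 + α) * ‖B‖ ^ 2) * ℓ u + b * ℓ u) - ε ^ 2 * ⟪H, Z⟫_ℝ := by
  rw [hg, hfr]
  simp only [map_sub, map_smul, inner_sub_left, inner_sub_right, inner_add_left, inner_add_right,
    inner_neg_left, real_inner_smul_left, real_inner_smul_right, smul_eq_mul]
  rw [real_inner_comm w u, real_inner_comm (A u) u, real_inner_comm Λ w, real_inner_comm Λ (A u)]
  ring

theorem neg_mul_le_of_abs_le {m x y : ℝ} (hx : |x| ≤ m) (hy : 0 ≤ y) : -(y * x) ≤ m * y := by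
  have := mul_le_mul_of_nonneg_left (neg_le.1 (abs_le.1 hx).1) hy
  linarith

theorem neg_inner_apply_le {d : ℕ} {A : Sp d →L[ℝ] Sp d} {K : ℝ} (hA : ‖A‖ ≤ K) (v : Sp d) :
    -⟪v, A v⟫_ℝ ≤ K * ‖v‖ ^ 2 := by
  have h1 := (abs_le.1 (abs_real_inner_le_norm v (A v))).1
  have h2 := (A.le_opNorm v).trans (mul_le_mul_of_nonneg_right hA (norm_nonneg v))
  have h3 := mul_le_mul_of_nonneg_left h2 (norm_nonneg v)
  have h4 : ‖v‖ * (K * ‖v‖) = K * ‖v‖ ^ 2 := by ring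
  linarith

theorem neg_apply_mul_inner_le {d : ℕ} {ℓ : Sp d →L[ℝ] ℝ} {K m : ℝ} {u : Sp d} (hu : ‖u‖ ≤ K)
    (hℓ : ‖ℓ‖ ≤ m) (v : Sp d) : -(ℓ v * ⟪v, u⟫_ℝ) ≤ K * m * ‖v‖ ^ 2 := by
  have h0 := (norm_nonneg ℓ).trans hℓ
  have h1 : |ℓ v * ⟪v, u⟫_ℝ| ≤ (m * ‖v‖) * (‖v‖ * K) := by
    rw [abs_mul]
    exact mul_le_mul ((ℓ.le_opNorm v).trans (mul_le_mul_of_nonneg_right hℓ (norm_nonneg v)))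
      ((abs_real_inner_le_norm v u).trans
      (mul_le_mul_of_nonneg_left hu (norm_nonneg v))) (abs_nonneg _) (by positivity)
  have h2 : (m * ‖v‖) * (‖v‖ * K) = K * m * ‖v‖ ^ 2 := by ring
  linarith [(abs_le.1 h1).1]

/-- The four coefficients arising below, dominated by one constant so that a single Grönwall rate
results. -/
theorem entropy_coefficients {K γ α : ℝ} (hK : 0 ≤ K) (hγ : 1 < γ) (hα : -1 ≤ α) :
    2 * K ≤ (K + K ^ 2) * (γ + α + 4) ∧ K * (γ - 1) ≤ (K + K ^ 2) * (γ + α + 4) ∧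
    2 * K + K * (1 + α) ≤ (K + K ^ 2) * (γ + α + 4) ∧
    K ^ 2 * (2 + (1 + α) / 2) ≤ (K + K ^ 2) * (γ + α + 4) := by
  have h1 : ∀ y, y ≤ γ + α + 4 → K * y ≤ (K + K ^ 2) * (γ + α + 4) := fun y hy =>
    (mul_le_mul_of_nonneg_left hy hK).trans (mul_le_mul_of_nonneg_right
      (by linarith [sq_nonneg K]) (by linarith))
  have h2 : ∀ y, y ≤ γ + α + 4 → K ^ 2 * y ≤ (K + K ^ 2) * (γ + α + 4) := fun y hy =>
    (mul_le_mul_of_nonneg_left hy (sq_nonneg K)).trans (mul_le_mul_of_nonneg_right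
      (by linarith) (by linarith))
  refine ⟨?_, h1 _ (by linarith), ?_, h2 _ (by linarith)⟩
  · linarith [h1 2 (by linarith)]
  · linarith [h1 (3 + α) (by linarith)]

/-- Terms with the cutoff κ ≤ 1 are bounded by the relative entropy density, terms with its
derivative carry ‖ℓ‖ ≤ K/R and are bounded by the full energy and mass densities, and the term in H
is kept because the relative entropy does not control it. -/
theorem entropy_production_le {d : ℕ} (Λ u B H Z : Sp d) (A : Sp d →L[ℝ] Sp d)
    (ℓ : Sp d →L[ℝ] ℝ) {s κ τ q b π fr γ α ε K R : ℝ} (hR : 0 < R) (hγ : 1 < γ) (hα : -1 ≤ α)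
    (hs : 0 ≤ s) (hκ0 : 0 ≤ κ) (hκ1 : κ ≤ 1) (hτ : |τ| ≤ K) (hA : ‖A‖ ≤ K) (hu : ‖u‖ ≤ K)
    (hq : |q| ≤ K) (hℓ : ‖ℓ‖ ≤ K / R) (hZ : ‖Z‖ ≤ K) (hb : 0 ≤ b) (hπ : 0 ≤ π) (hfr : 0 ≤ fr) :
    κ * (-⟪Λ - s • u, A (Λ - s • u)⟫_ℝ - τ * ((γ - 1) * fr) - ε ^ 2 * ⟪B, A B⟫_ℝ
        - ε ^ 2 / 2 * ((1 + α) * ‖B‖ ^ 2) * τ)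
      + (q * (s * ℓ Λ) - ℓ Λ * ⟪Λ, u⟫_ℝ - π * ℓ u - ε ^ 2 * (ℓ B * ⟪B, u⟫_ℝ)
        - ε ^ 2 / 2 * ((1 + α) * ‖B‖ ^ 2) * ℓ u + b * ℓ u) - ε ^ 2 * ⟪H, Z⟫_ℝ ≤
    (K + K ^ 2) * (γ + α + 4) *
      ((‖Λ - s • u‖ ^ 2 / 2 + fr + ε ^ 2 / 2 * ‖B‖ ^ 2)
        + R⁻¹ * (s ^ 2 + ‖Λ‖ ^ 2 + π + ε ^ 2 * ‖B‖ ^ 2 + b) + ε ^ 2 * ‖H‖) := by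
  have hK : 0 ≤ K := (norm_nonneg _).trans hA
  have hγ1 : 0 ≤ γ - 1 := by linarith
  have hα1 : 0 ≤ 1 + α := by linarith
  have quad := neg_inner_apply_le hA
  have k1 : κ * -⟪Λ - s • u, A (Λ - s • u)⟫_ℝ ≤ K * ‖Λ - s • u‖ ^ 2 :=
    (mul_le_mul_of_nonneg_left (quad _) hκ0).trans
      (mul_le_of_le_one_left (by positivity) hκ1)
  have ktau : ∀ y : ℝ, 0 ≤ y → κ * (-(τ * y)) ≤ K * y := fun y hy => by
    have h1 : -(τ * y) ≤ K * y := mul_comm y τ ▸ neg_mul_le_of_abs_le hτ hy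
    exact (mul_le_mul_of_nonneg_left h1 hκ0).trans (mul_le_of_le_one_left (by positivity) hκ1)
  have k2 := ktau ((γ - 1) * fr) (by positivity)
  have k3 : κ * (ε ^ 2 * -⟪B, A B⟫_ℝ) ≤ K * (ε ^ 2 * ‖B‖ ^ 2) := by
    have h1 : ε ^ 2 * -⟪B, A B⟫_ℝ ≤ ε ^ 2 * (K * ‖B‖ ^ 2) :=
      mul_le_mul_of_nonneg_left (quad B) (sq_nonneg ε)
    refine (mul_le_mul_of_nonneg_left h1 hκ0).trans
      ((mul_le_of_le_one_left (by positivity) hκ1).trans (le_of_eq (by ring)))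
  have k4 := ktau (ε ^ 2 / 2 * ((1 + α) * ‖B‖ ^ 2)) (by positivity)
  set M := K * (K * R⁻¹) with hM
  have hM0 : 0 ≤ M := by positivity
  have lv : ∀ v : Sp d, |ℓ v| ≤ K * R⁻¹ * ‖v‖ := fun v =>
    (ℓ.le_opNorm v).trans (mul_le_mul_of_nonneg_right (by rwa [← div_eq_mul_inv])
      (norm_nonneg v))
  have lu : |ℓ u| ≤ M := by
    refine (lv u).trans ?_
    rw [hM, mul_comm]
    exact mul_le_mul_of_nonneg_right hu (by positivity)
  have lq : ∀ v : Sp d, -(ℓ v * ⟪v, u⟫_ℝ) ≤ M * ‖v‖ ^ 2 :=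
    neg_apply_mul_inner_le hu (by rwa [← div_eq_mul_inv])
  have k5 : q * (s * ℓ Λ) ≤ M * (s ^ 2 + ‖Λ‖ ^ 2) := by
    have h1 : |q * (s * ℓ Λ)| ≤ K * (s * (K * R⁻¹ * ‖Λ‖)) := by
      rw [abs_mul, abs_mul, abs_of_nonneg hs]
      exact mul_le_mul hq (mul_le_mul_of_nonneg_left (lv Λ) hs) (by positivity) hK
    have h2 : K * (s * (K * R⁻¹ * ‖Λ‖)) = M * (s * ‖Λ‖) := by rw [hM]; ring
    have h3 : s * ‖Λ‖ ≤ s ^ 2 + ‖Λ‖ ^ 2 := by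
      linarith [two_mul_le_add_sq s ‖Λ‖, sq_nonneg s, sq_nonneg ‖Λ‖]
    exact (le_abs_self _).trans (h1.trans (h2.le.trans (mul_le_mul_of_nonneg_left h3 hM0)))
  have k6 := lq Λ
  have k7 : -(π * ℓ u) ≤ M * π := neg_mul_le_of_abs_le lu hπ
  have k8 : ε ^ 2 * -(ℓ B * ⟪B, u⟫_ℝ) ≤ ε ^ 2 * (M * ‖B‖ ^ 2) :=
    mul_le_mul_of_nonneg_left (lq B) (sq_nonneg ε)
  have k9 : -(ε ^ 2 / 2 * ((1 + α) * ‖B‖ ^ 2) * ℓ u) ≤ M * (ε ^ 2 / 2 * ((1 + α) * ‖B‖ ^ 2)) :=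
    neg_mul_le_of_abs_le lu (by positivity)
  have k10 : b * ℓ u ≤ M * b := by
    linarith [mul_le_mul_of_nonneg_left (abs_le.1 lu).2 hb]
  have k11 : -(ε ^ 2 * ⟪H, Z⟫_ℝ) ≤ K * (ε ^ 2 * ‖H‖) := by
    have h1 := (abs_real_inner_le_norm H Z).trans
      (mul_le_mul_of_nonneg_left hZ (norm_nonneg H))
    have h2 := mul_le_mul_of_nonneg_left (neg_le.1 (abs_le.1 h1).1) (sq_nonneg ε)
    linarith
  obtain ⟨c1, c2, c3, c4⟩ := entropy_coefficients hK hγ hα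
  set C := (K + K ^ 2) * (γ + α + 4) with hC
  have c5 : K ≤ C := by linarith
  have t1 := mul_le_mul_of_nonneg_right c1 (by positivity : 0 ≤ ‖Λ - s • u‖ ^ 2 / 2)
  have t2 := mul_le_mul_of_nonneg_right c2 hfr
  have t3 := mul_le_mul_of_nonneg_right c3 (by positivity : 0 ≤ ε ^ 2 / 2 * ‖B‖ ^ 2)
  have t4 := mul_le_mul_of_nonneg_right c4
    (by positivity : 0 ≤ R⁻¹ * (s ^ 2 + ‖Λ‖ ^ 2 + π + ε ^ 2 * ‖B‖ ^ 2 + b))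
  have t5 := mul_le_mul_of_nonneg_right c5 (by positivity : 0 ≤ ε ^ 2 * ‖H‖)
  have e4 : K ^ 2 * (2 + (1 + α) / 2) * (R⁻¹ * (s ^ 2 + ‖Λ‖ ^ 2 + π + ε ^ 2 * ‖B‖ ^ 2 + b)) =
      M * ((2 + (1 + α) / 2) * (s ^ 2 + ‖Λ‖ ^ 2 + π + ε ^ 2 * ‖B‖ ^ 2 + b)) := by
    rw [hM]; ring
  have t6 : M * (s ^ 2 + ‖Λ‖ ^ 2) + M * ‖Λ‖ ^ 2 + M * π + ε ^ 2 * (M * ‖B‖ ^ 2) +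
      M * (ε ^ 2 / 2 * ((1 + α) * ‖B‖ ^ 2)) + M * b ≤
      M * ((2 + (1 + α) / 2) * (s ^ 2 + ‖Λ‖ ^ 2 + π + ε ^ 2 * ‖B‖ ^ 2 + b)) := by
    have p1 : 0 ≤ (1 + α) / 2 * (s ^ 2 + ‖Λ‖ ^ 2 + π + b) + s ^ 2 + π + b + ε ^ 2 * ‖B‖ ^ 2 := by
      positivity
    have p2 := mul_nonneg hM0 p1
    linarith
  rw [e4] at t4
  rw [mul_add C, mul_add C, mul_add C, mul_add C]
  linarith

/-! ### Test functions built from a strong Euler solution -/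

theorem cutoff_spaceReg {d : ℕ} {T : ℝ} {Ω : Set (Sp d)} (hΩ : IsOpen Ω) {R : ℝ} (hR : 0 < R)
    (k : ℕ) : SpaceReg T Ω k fun _ x => cutoff R x :=
  SpaceReg.of_contDiff hΩ (R := 2 * R)
    ((contDiff_cutoff (n := (k : ℕ∞)) R).comp contDiff_snd) fun _ _ _ hx => cutoff_eq_zero hR hx

theorem cutoff_isTimeC1 {d : ℕ} {T : ℝ} (hT : 0 < T) {Ω : Set (Sp d)} {R : ℝ} (hR : 0 < R) :
    IsTimeC1 T Ω fun _ x => cutoff R x :=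
  IsTimeC1.of_contDiff hT (R := 2 * R) ((contDiff_cutoff (n := 1) R).comp contDiff_snd)
    fun _ _ _ hx => cutoff_eq_zero hR hx

theorem continuous_cutoff_snd {d : ℕ} (R : ℝ) : Continuous fun p : ℝ × Sp d => cutoff R p.2 :=
  (contDiff_cutoff (n := 0) R).continuous.comp continuous_snd

theorem dt_const {d : ℕ} {F : Type*} [NormedAddCommGroup F] [NormedSpace ℝ F] (T : ℝ)
    (w : Sp d → F) (t : ℝ) (x : Sp d) : dt T (fun _ => w) t x = 0 := by
  simp [dt]

theorem dt_cutoff_mul {d : ℕ} {T : ℝ} (hT : 0 < T) {Ω : Set (Sp d)} {R : ℝ} (hR : 0 < R)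
    {v : ℝ → Sp d → ℝ} (hv : IsTimeC1 T Ω v) {t : ℝ} (ht : t ∈ Icc 0 T) {x : Sp d} (hx : x ∈ Ω) :
    dt T (fun t x => cutoff R x * v t x) t x = cutoff R x * dt T v t x := by
  have := dt_bilin hT (ContinuousLinearMap.mul ℝ ℝ) (cutoff_isTimeC1 hT hR) hv ht hx
  rw [dt_const] at this
  simpa using this

theorem dt_cutoff_smul {d : ℕ} {T : ℝ} (hT : 0 < T) {Ω : Set (Sp d)} {R : ℝ} (hR : 0 < R)
    {v : ℝ → Sp d → Sp d} (hv : IsTimeC1 T Ω v) {t : ℝ} (ht : t ∈ Icc 0 T) {x : Sp d}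
    (hx : x ∈ Ω) :
    dt T (fun t x => cutoff R x • v t x) t x = cutoff R x • dt T v t x := by
  have := dt_bilin hT (ContinuousLinearMap.lsmul ℝ ℝ) (cutoff_isTimeC1 hT hR) hv ht hx
  rw [dt_const] at this
  simpa using this

theorem cutoff_differentiableAt {d : ℕ} (R : ℝ) (x : Sp d) : DifferentiableAt ℝ (cutoff R) x :=
  (contDiff_cutoff (n := 1) R).differentiable (by norm_num) x

theorem fderiv_cutoff_smul {d : ℕ} (R : ℝ) {v : Sp d → Sp d} {x : Sp d}
    (hv : DifferentiableAt ℝ v x) (z : Sp d) :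
    fderiv ℝ (fun y => cutoff R y • v y) x z =
      cutoff R x • fderiv ℝ v x z + fderiv ℝ (cutoff R) x z • v x := by
  rw [fderiv_fun_smul (cutoff_differentiableAt R x) hv]
  simp

theorem fderiv_cutoff_mul {d : ℕ} (R : ℝ) {v : Sp d → ℝ} {x : Sp d}
    (hv : DifferentiableAt ℝ v x) (z : Sp d) :
    fderiv ℝ (fun y => cutoff R y * v y) x z =
      cutoff R x * fderiv ℝ v x z + v x * fderiv ℝ (cutoff R) x z := by
  have := ((cutoff_differentiableAt R x).hasFDerivAt.mul hv.hasFDerivAt).fderiv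
  rw [show (fun y => cutoff R y * v y) = cutoff R * v from rfl, this]
  simp

theorem norm_fderiv_clm_apply_le {E F : Type*} [NormedAddCommGroup E] [NormedSpace ℝ E]
    [NormedAddCommGroup F] [NormedSpace ℝ F] {c : E → F →L[ℝ] ℝ} {v : E → F} {x : E}
    (hc : DifferentiableAt ℝ c x) (hv : DifferentiableAt ℝ v x) :
    ‖fderiv ℝ (fun y => c y (v y)) x‖ ≤ ‖c x‖ * ‖fderiv ℝ v x‖ + ‖fderiv ℝ c x‖ * ‖v x‖ := by
  rw [(hc.hasFDerivAt.clm_apply hv.hasFDerivAt).fderiv]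
  refine (norm_add_le _ _).trans (add_le_add (ContinuousLinearMap.opNorm_comp_le _ _) ?_)
  refine ContinuousLinearMap.opNorm_le_bound _ (by positivity) fun z => ?_
  rw [ContinuousLinearMap.flip_apply]
  refine (((fderiv ℝ c x) z).le_opNorm (v x)).trans ?_
  have := mul_le_mul_of_nonneg_right ((fderiv ℝ c x).le_opNorm z) (norm_nonneg (v x))
  linarith

/-- The multiplier `|u|²/2 - h(ρ)` of the continuity equation. -/
def potential {d : ℕ} (γ : ℝ) (r : ℝ → Sp d → ℝ) (u : ℝ → Sp d → Sp d) (t : ℝ) (x : Sp d) : ℝ :=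
  2⁻¹ * ⟪u t x, u t x⟫_ℝ + -enthalpy γ (r t x)

theorem SpaceReg.const_mul {d : ℕ} {T : ℝ} {Ω : Set (Sp d)} (hΩ : IsOpen Ω) {k : ℕ}
    {v : ℝ → Sp d → ℝ} (hv : SpaceReg T Ω k v) (a : ℝ) : SpaceReg T Ω k fun t x => a * v t x :=
  (SpaceReg.time hΩ (continuous_const (y := a)).continuousOn).bilin hΩ
    (ContinuousLinearMap.mul ℝ ℝ) hv

namespace IsStrongEulerSolution

variable {d : ℕ} {Ω : C3Domain d} {γ T : ℝ} {r : ℝ → Sp d → ℝ} {u : ℝ → Sp d → Sp d}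

theorem potential_space (hE : IsStrongEulerSolution Ω γ T r u) (hT : 0 < T) (hγ : 1 < γ) :
    IsSpaceCk T Ω.carrier 1 (potential γ r u) := by
  have hΩ := Ω.isOpen
  have su : SpaceReg T Ω.carrier 1 u := hE.u_space.spaceReg.mono (by norm_num)
  have h1 : SpaceReg T Ω.carrier 1 fun t x => 2⁻¹ * ⟪u t x, u t x⟫_ℝ :=
    SpaceReg.const_mul hΩ (su.bilin hΩ (innerSL ℝ) su) 2⁻¹
  have h2 : SpaceReg T Ω.carrier 1 fun t x => -enthalpy γ (r t x) :=
    (SpaceReg.const_mul hΩ (hE.enthalpy_space hT hγ).spaceReg (-1)).congr hΩ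
      fun t _ x _ => by ring
  refine (h1.add hΩ h2).isSpaceCk ?_
  exact (continuousOn_const.mul (hE.u_space.continuousOn.inner (𝕜 := ℝ) hE.u_space.continuousOn)).add
    (hE.enthalpy_space hT hγ).continuousOn.neg

theorem potential_hasDerivWithinAt (hE : IsStrongEulerSolution Ω γ T r u) (hγ : 1 < γ) {t : ℝ}
    {x : Sp d} (ht : t ∈ Icc 0 T) (hx : x ∈ Ω.carrier) :
    HasDerivWithinAt (fun s => potential γ r u s x)
      (⟪u t x, dt T u t x⟫_ℝ + (γ * r t x ^ (γ - 1) * divg (u t) x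
        + ⟪gradient (fun y => enthalpy γ (r t y)) x, u t x⟫_ℝ)) (Icc 0 T) t := by
  have h1 := hE.u_time.hasDerivWithinAt ht hx
  have h2 := ((h1.inner ℝ h1).const_mul (2⁻¹ : ℝ)).add (hE.dt_enthalpy hγ ht hx).neg
  refine h2.congr_deriv ?_
  rw [real_inner_comm (u t x) (dt T u t x)]
  ring

theorem potential_time (hE : IsStrongEulerSolution Ω γ T r u) (hT : 0 < T) (hγ : 1 < γ) :
    IsTimeC1 T Ω.carrier (potential γ r u) := by
  have hu : ExtendsCont T Ω.carrier u := hE.u_space.spaceReg.extendsCont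
  have h1 : IsTimeC1 T Ω.carrier fun t x => ⟪u t x, u t x⟫_ℝ :=
    hE.u_time.bilin hT (innerSL ℝ) hE.u_time hu hu
  have h2 : IsTimeC1 T Ω.carrier fun t x => 2⁻¹ * ⟪u t x, u t x⟫_ℝ :=
    (IsTimeC1.time hT contDiff_const).bilin hT (ContinuousLinearMap.mul ℝ ℝ) h1
      (ExtendsCont.const _) (hu.bilin (innerSL ℝ) hu)
  have h3 : IsTimeC1 T Ω.carrier fun t x => (-1) * enthalpy γ (r t x) :=
    (IsTimeC1.time hT contDiff_const).bilin hT (ContinuousLinearMap.mul ℝ ℝ)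
      (hE.enthalpy_time hT hγ) (ExtendsCont.const _)
      (hE.enthalpy_space hT hγ).spaceReg.extendsCont
  have h4 := h2.add hT h3
  have e : (fun t x => 2⁻¹ * ⟪u t x, u t x⟫_ℝ + (-1) * enthalpy γ (r t x)) = potential γ r u := by
    funext t x
    rw [potential]
    ring
  rwa [e] at h4

theorem potential_hasFDerivAt (hE : IsStrongEulerSolution Ω γ T r u) (hT : 0 < T) (hγ : 1 < γ)
    {t : ℝ} {x : Sp d} (ht : t ∈ Icc 0 T) (hx : x ∈ Ω.carrier) :
    DifferentiableAt ℝ (potential γ r u t) x ∧ ∀ z, fderiv ℝ (potential γ r u t) x z =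
      ⟪u t x, fderiv ℝ (u t) x z⟫_ℝ - ⟪gradient (fun y => enthalpy γ (r t y)) x, z⟫_ℝ := by
  have h1 := hE.u_diff ht hx
  have h0 : DifferentiableAt ℝ (fun y => enthalpy γ (r t y)) x :=
    (((hE.enthalpy_space hT hγ).contDiffOn t ht).differentiableOn
      (by norm_num)).differentiableAt (Ω.isOpen.mem_nhds hx)
  have h2 := ((h1.inner ℝ h1).const_mul (2⁻¹ : ℝ)).add h0.hasFDerivAt.neg
  have h3 : HasFDerivAt (potential γ r u t) _ x := h2
  refine ⟨h3.differentiableAt, fun z => ?_⟩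
  rw [h3.fderiv, inner_gradient]
  simp [fderivInnerCLM_apply, real_inner_comm (u t x) (fderiv ℝ (u t) x z)]
  ring

theorem isTestScalar_potential (hE : IsStrongEulerSolution Ω γ T r u) (hT : 0 < T) (hγ : 1 < γ)
    {R : ℝ} (hR : 0 < R) :
    IsTestScalar T Ω.carrier fun t x => cutoff R x * potential γ r u t x where
  space := ((cutoff_spaceReg Ω.isOpen hR 1).bilin Ω.isOpen (ContinuousLinearMap.mul ℝ ℝ)
      (hE.potential_space hT hγ).spaceReg).isSpaceCk
    ((continuous_cutoff_snd R).continuousOn.mul (hE.potential_space hT hγ).continuousOn)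
  time := (cutoff_isTimeC1 hT hR).bilin hT (ContinuousLinearMap.mul ℝ ℝ) (hE.potential_time hT hγ)
    (cutoff_spaceReg Ω.isOpen hR 1).extendsCont (hE.potential_space hT hγ).spaceReg.extendsCont
  support := ⟨2 * R, fun t _ x _ hx => by rw [cutoff_eq_zero hR hx, zero_mul]⟩

theorem isTestField_velocity (hE : IsStrongEulerSolution Ω γ T r u) (hT : 0 < T)
    {R : ℝ} (hR : 0 < R) :
    IsTestField T Ω fun t x => cutoff R x • u t x where
  space := ((cutoff_spaceReg Ω.isOpen hR 2).bilin Ω.isOpen (ContinuousLinearMap.lsmul ℝ ℝ)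
      hE.u_space.spaceReg).isSpaceCk
    ((continuous_cutoff_snd R).continuousOn.smul hE.u_space.continuousOn)
  time := (cutoff_isTimeC1 hT hR).bilin hT (ContinuousLinearMap.lsmul ℝ ℝ) hE.u_time
    (cutoff_spaceReg Ω.isOpen hR 1).extendsCont hE.u_space.spaceReg.extendsCont
  support := ⟨2 * R, fun t _ x _ hx => by rw [cutoff_eq_zero hR hx, zero_smul]⟩
  tangent := fun t ht x hx => by rw [real_inner_smul_left, hE.no_flux t ht x hx, mul_zero]

theorem divg_spaceReg (hE : IsStrongEulerSolution Ω γ T r u) :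
    SpaceReg T Ω.carrier 1 fun t => divg (u t) := by
  have hΩ := Ω.isOpen
  have h1 := ((spaceReg_succ hΩ).1 hE.u_space.spaceReg).2.2
  exact ((SpaceReg.time hΩ (continuous_const (y := (1 : ℝ))).continuousOn).bilin hΩ
    ((ContinuousLinearMap.mul ℝ ℝ).bilinearComp (ContinuousLinearMap.id ℝ ℝ) (traceCLM d))
    h1).congr hΩ fun t _ x _ => by simp [divg_eq_traceCLM]

theorem divg_cutoff_smul (hE : IsStrongEulerSolution Ω γ T r u) (R : ℝ) {t : ℝ} {x : Sp d}
    (ht : t ∈ Icc 0 T) (hx : x ∈ Ω.carrier) :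
    divg (fun y => cutoff R y • u t y) x =
      cutoff R x * divg (u t) x + fderiv ℝ (cutoff R) x (u t x) :=
  divg_smul (cutoff_differentiableAt R x) (hE.u_diff ht hx).differentiableAt

/-- `∇ div (χ_R u)` is bounded uniformly in `R ≥ 1`. -/
theorem exists_gradient_divg_bound (hE : IsStrongEulerSolution Ω γ T r u) :
    ∃ K : ℝ, 0 ≤ K ∧ ∀ R : ℝ, 1 ≤ R → ∀ t ∈ Icc 0 T, ∀ x ∈ Ω.carrier,
      ‖gradient (divg fun y => cutoff R y • u t y) x‖ ≤ K := by
  have hΩ := Ω.isOpen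
  obtain ⟨C, hC0, hC⟩ := exists_cutoff_bounds d
  obtain ⟨U, hU0, hU⟩ := hE.u_space.spaceReg.extendsCont.exists_bound
  obtain ⟨D, hD0, hD⟩ := hE.fderiv_u_extends.exists_bound
  obtain ⟨V, hV0, hV⟩ := hE.divg_spaceReg.extendsCont.exists_bound
  have hs := ((spaceReg_succ hΩ).1 hE.divg_spaceReg).2
  obtain ⟨W, hW0, hW⟩ := hs.2.extendsCont.exists_bound
  refine ⟨W + V * C + (C * D + C * U), by positivity, fun R hR t ht x hx => ?_⟩
  have hR0 : 0 < R := by linarith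
  have hcR : C / R ≤ C := div_le_self hC0 hR
  have hcR2 : C / R ^ 2 ≤ C := div_le_self hC0 (one_le_pow₀ hR)
  have hdiv : DifferentiableAt ℝ (divg (u t)) x :=
    (hs.1 t ht).differentiableAt (hΩ.mem_nhds hx)
  have hcd : DifferentiableAt ℝ (fderiv ℝ (cutoff (d := d) R)) x :=
    ((contDiff_cutoff (n := 2) R).fderiv_right (m := 1) (by norm_num)).differentiable
      (by norm_num) x
  have hud := (hE.u_diff ht hx).differentiableAt
  have e : (divg fun y => cutoff R y • u t y) =ᶠ[𝓝 x]
      fun y => cutoff R y * divg (u t) y + fderiv ℝ (cutoff R) y (u t y) := by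
    filter_upwards [hΩ.mem_nhds hx] with y hy
    exact hE.divg_cutoff_smul R ht hy
  rw [norm_gradient, e.fderiv_eq]
  have hd1 : DifferentiableAt ℝ (fun y => cutoff R y * divg (u t) y) x :=
    (cutoff_differentiableAt R x).mul hdiv
  have hd2 : DifferentiableAt ℝ (fun y => fderiv ℝ (cutoff R) y (u t y)) x := hcd.clm_apply hud
  rw [fderiv_fun_add hd1 hd2]
  refine (norm_add_le _ _).trans (add_le_add ?_ ?_)
  · rw [fderiv_fun_mul (cutoff_differentiableAt R x) hdiv]
    refine (norm_add_le _ _).trans ?_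
    rw [norm_smul, norm_smul, Real.norm_of_nonneg (cutoff_nonneg R x)]
    refine add_le_add ?_ ?_
    · exact (mul_le_of_le_one_left (norm_nonneg _) (cutoff_le_one R x)).trans (hW t ht x hx)
    · exact mul_le_mul (hV t ht x hx) (((hC R hR0 x).1).trans hcR) (norm_nonneg _) hV0
  · refine (norm_fderiv_clm_apply_le hcd hud).trans (add_le_add ?_ ?_)
    · exact mul_le_mul (((hC R hR0 x).1).trans hcR) (hD t ht x hx) (norm_nonneg _) hC0
    · exact mul_le_mul (((hC R hR0 x).2).trans hcR2) (hU t ht x hx) (norm_nonneg _) hC0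

end IsStrongEulerSolution

/-! ### The relative internal energy -/

theorem relInternalEnergy_eq {γ s r : ℝ} (hγ : 1 < γ) (hr : 0 < r) :
    (γ - 1) * relInternalEnergy γ s r =
      s ^ γ - γ * r ^ (γ - 1) * s + (γ - 1) * r ^ γ := by
  have h1 : γ - 1 ≠ 0 := by linarith
  have h2 : r ^ γ = r ^ (γ - 1) * r := by
    rw [← Real.rpow_add_one hr.ne', sub_add_cancel]
  rw [relInternalEnergy, (hasDerivAt_internalEnergy hγ).deriv, internalEnergy, internalEnergy,
    enthalpy, h2]
  field_simp
  ring

/-- Bernoulli's inequality for (s/r)^γ, multiplied by r^γ; it includes the vacuum s = 0. -/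
theorem relInternalEnergy_nonneg {γ s r : ℝ} (hγ : 1 < γ) (hr : 0 < r) (hs : 0 ≤ s) :
    0 ≤ relInternalEnergy γ s r := by
  have h1 : 0 < γ - 1 := by linarith
  refine nonneg_of_mul_nonneg_right ?_ h1
  rw [relInternalEnergy_eq hγ hr]
  have h2 : -1 ≤ s / r - 1 := by linarith [div_nonneg hs hr.le]
  have h3 := one_add_mul_self_le_rpow_one_add h2 hγ.le
  rw [add_sub_cancel, Real.div_rpow hs hr.le] at h3
  have h4 : 0 < r ^ γ := Real.rpow_pos_of_pos hr γ
  have h5 : r ^ γ = r ^ (γ - 1) * r := by rw [← Real.rpow_add_one hr.ne', sub_add_cancel]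
  have h6 := mul_le_mul_of_nonneg_left h3 h4.le
  have h7 : r ^ γ * (s ^ γ / r ^ γ) = s ^ γ := by field_simp
  have h8 : r ^ γ * (1 + γ * (s / r - 1)) = r ^ γ + γ * r ^ (γ - 1) * s - γ * r ^ γ := by
    have : r ^ γ * (s / r) = r ^ (γ - 1) * s := by rw [h5]; field_simp
    linear_combination γ * this
  rw [h7, h8] at h6
  linarith

/-- The energy density, corrected by the multipliers, is the relative entropy density. -/
theorem relative_entropy_density_eq {d : ℕ} {γ r a : ℝ} (hγ : 1 < γ) (hr : 0 < r) (ha : 0 ≤ a)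
    (Λ u : Sp d) :
    ‖Λ - √a • u‖ ^ 2 / 2 + relInternalEnergy γ a r =
      ‖Λ‖ ^ 2 / 2 + a ^ γ / (γ - 1) +
        (a * (2⁻¹ * ⟪u, u⟫_ℝ + -enthalpy γ r) - ⟪√a • Λ, u⟫_ℝ + r ^ γ) := by
  have h1 : γ - 1 ≠ 0 := by linarith
  have h2 : relInternalEnergy γ a r = a ^ γ / (γ - 1) - enthalpy γ r * a + r ^ γ := by
    have := relInternalEnergy_eq (s := a) hγ hr
    rw [enthalpy]
    field_simp
    linear_combination this
  have h3 := Real.sq_sqrt ha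
  rw [h2, norm_sub_sq_real, norm_smul, mul_pow, Real.norm_of_nonneg (Real.sqrt_nonneg _), h3,
    real_inner_smul_right, real_inner_smul_left, real_inner_self_eq_norm_sq]
  ring

namespace IsStrongEulerSolution

variable {d : ℕ} {Ω : C3Domain d} {γ T : ℝ} {r : ℝ → Sp d → ℝ} {u : ℝ → Sp d → Sp d}

theorem massIntegrand_potential (hE : IsStrongEulerSolution Ω γ T r u) (hT : 0 < T) (hγ : 1 < γ)
    {R : ℝ} (hR : 0 < R) {t : ℝ} (ht : t ∈ Icc 0 T) {x : Sp d} (hx : x ∈ Ω.carrier)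
    (ρ : ℝ → Sp d → ℝ) (J : ℝ → Sp d → Sp d) :
    massIntegrand T ρ J (fun t x => cutoff R x * potential γ r u t x) t x =
      ρ t x * (cutoff R x * (⟪u t x, dt T u t x⟫_ℝ + (γ * r t x ^ (γ - 1) * divg (u t) x
        + ⟪gradient (fun y => enthalpy γ (r t y)) x, u t x⟫_ℝ)))
      + (cutoff R x * (⟪u t x, fderiv ℝ (u t) x (J t x)⟫_ℝ
          - ⟪gradient (fun y => enthalpy γ (r t y)) x, J t x⟫_ℝ)
        + potential γ r u t x * fderiv ℝ (cutoff R) x (J t x)) := by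
  obtain ⟨hd, hf⟩ := hE.potential_hasFDerivAt hT hγ ht hx
  have e : ⟪J t x, gradient (fun x => cutoff R x * potential γ r u t x) x⟫_ℝ =
      cutoff R x * fderiv ℝ (potential γ r u t) x (J t x)
        + potential γ r u t x * fderiv ℝ (cutoff R) x (J t x) := by
    rw [real_inner_comm, inner_gradient, fderiv_cutoff_mul R hd]
  rw [massIntegrand, dt_cutoff_mul hT hR (hE.potential_time hT hγ) ht hx,
    dt_eq hT ht (hE.potential_hasDerivWithinAt hγ ht hx), e, hf]

theorem momentumIntegrand_velocity (hE : IsStrongEulerSolution Ω γ T r u) (hT : 0 < T)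
    {R : ℝ} (hR : 0 < R) {t : ℝ} (ht : t ∈ Icc 0 T) {x : Sp d} (hx : x ∈ Ω.carrier) (α ε : ℝ)
    (ρ : ℝ → Sp d → ℝ) (J Λ B H : ℝ → Sp d → Sp d) :
    momentumIntegrand T γ α ε ρ J Λ B H (fun t x => cutoff R x • u t x) t x =
      ⟪J t x, cutoff R x • dt T u t x⟫_ℝ
        + ⟪Λ t x, cutoff R x • fderiv ℝ (u t) x (Λ t x)
            + fderiv ℝ (cutoff R) x (Λ t x) • u t x⟫_ℝ
        + ρ t x ^ γ * (cutoff R x * divg (u t) x + fderiv ℝ (cutoff R) x (u t x))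
        + ε ^ 2 * ⟪B t x, cutoff R x • fderiv ℝ (u t) x (B t x)
            + fderiv ℝ (cutoff R) x (B t x) • u t x⟫_ℝ
        + ε ^ 2 / 2 * ((1 + α) * ‖B t x‖ ^ 2)
            * (cutoff R x * divg (u t) x + fderiv ℝ (cutoff R) x (u t x))
        + ε ^ 2 * ⟪H t x, gradient (divg fun y => cutoff R y • u t y) x⟫_ℝ := by
  have hd := (hE.u_diff ht hx).differentiableAt
  rw [momentumIntegrand, dt_cutoff_smul hT hR hE.u_time ht hx, fderiv_cutoff_smul R hd,
    fderiv_cutoff_smul R hd, hE.divg_cutoff_smul R ht hx, pressure]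

/-- The two pressure terms are the rate of change of the cut-off pressure up to a divergence. It
matters that C depends on the Euler solution, γ and α only, not on R, ε or the weak solution. -/
theorem exists_production_bound (hE : IsStrongEulerSolution Ω γ T r u) (hT : 0 < T) (hγ : 1 < γ)
    {α : ℝ} (hα : -1 ≤ α) :
    ∃ C : ℝ, 0 ≤ C ∧ ∀ R : ℝ, 1 ≤ R → ∀ t ∈ Icc 0 T, ∀ x ∈ Ω.carrier, ∀ (ε : ℝ)
      (ρ : ℝ → Sp d → ℝ) (J Λ B H : ℝ → Sp d → Sp d), 0 ≤ ρ t x → J t x = √(ρ t x) • Λ t x →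
      massIntegrand T ρ J (fun t x => cutoff R x * potential γ r u t x) t x
        - momentumIntegrand T γ α ε ρ J Λ B H (fun t x => cutoff R x • u t x) t x
        + ((1 - γ) * cutoff R x * r t x ^ γ * divg (u t) x
          + r t x ^ γ * fderiv ℝ (cutoff R) x (u t x)) ≤
      C * ((‖Λ t x - √(ρ t x) • u t x‖ ^ 2 / 2 + relInternalEnergy γ (ρ t x) (r t x)
            + ε ^ 2 / 2 * ‖B t x‖ ^ 2)
          + R⁻¹ * (ρ t x + ‖Λ t x‖ ^ 2 + ρ t x ^ γ + ε ^ 2 * ‖B t x‖ ^ 2 + r t x ^ γ)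
          + ε ^ 2 * ‖H t x‖) := by
  obtain ⟨K₀, p0, hK₀⟩ := hE.exists_gradient_divg_bound
  obtain ⟨K₁, p1, hK₁⟩ := exists_cutoff_bounds d
  obtain ⟨K₂, p2, hK₂⟩ := hE.u_space.spaceReg.extendsCont.exists_bound
  obtain ⟨K₃, p3, hK₃⟩ := hE.fderiv_u_extends.exists_bound
  obtain ⟨K₄, p4, hK₄⟩ := hE.divg_spaceReg.extendsCont.exists_bound
  obtain ⟨K₅, p5, hK₅⟩ := (hE.potential_space hT hγ).spaceReg.extendsCont.exists_bound
  set K := K₀ + K₁ + K₂ + K₃ + K₄ + K₅ with hK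
  refine ⟨(K + K ^ 2) * (γ + α + 4), mul_nonneg (by positivity) (by linarith), ?_⟩
  intro R hR t ht x hx ε ρ J Λ B H hρ hJ
  have hR0 : 0 < R := by linarith
  rw [hE.massIntegrand_potential hT hγ hR0 ht hx, hE.momentumIntegrand_velocity hT hR0 ht hx, hJ]
  have hs := Real.sq_sqrt hρ
  have hr := hE.pos ht hx
  have id := entropy_production_identity (Λ t x) (u t x) (dt T u t x)
    (gradient (fun y => enthalpy γ (r t y)) x) (B t x) (H t x)
    (gradient (divg fun y => cutoff R y • u t y) x) (fderiv ℝ (u t) x) (fderiv ℝ (cutoff R) x)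
    (s := √(ρ t x)) (κ := cutoff R x) (τ := divg (u t) x) (q := potential γ r u t x)
    (a := r t x ^ (γ - 1)) (b := r t x ^ γ) (π := ρ t x ^ γ)
    (fr := relInternalEnergy γ (ρ t x) (r t x)) (γ := γ) (α := α) (ε := ε)
    (hE.velocity_eq hT hγ ht hx) (by rw [hs]; exact relInternalEnergy_eq hγ hr)
  have le := entropy_production_le (Λ t x) (u t x) (B t x) (H t x)
    (gradient (divg fun y => cutoff R y • u t y) x) (fderiv ℝ (u t) x) (fderiv ℝ (cutoff R) x)
    (s := √(ρ t x)) (κ := cutoff R x) (τ := divg (u t) x) (q := potential γ r u t x)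
    (b := r t x ^ γ) (π := ρ t x ^ γ)
    (fr := relInternalEnergy γ (ρ t x) (r t x)) (γ := γ) (α := α) (ε := ε) (K := K) hR0 hγ hα
    (Real.sqrt_nonneg _) (cutoff_nonneg _ _) (cutoff_le_one _ _)
    ((hK₄ t ht x hx).trans (by linarith)) ((hK₃ t ht x hx).trans (by linarith))
    ((hK₂ t ht x hx).trans (by linarith)) ((hK₅ t ht x hx).trans (by linarith))
    (((hK₁ R hR0 x).1).trans (div_le_div_of_nonneg_right (by linarith) hR0.le))
    ((hK₀ R hR t ht x hx).trans (by linarith)) (Real.rpow_nonneg hr.le _)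
    (Real.rpow_nonneg hρ _) (relInternalEnergy_nonneg hγ hr hρ)
  rw [hs] at id le
  rw [id]
  exact le

end IsStrongEulerSolution

/-! ### The pressure of the Euler solution in weak form -/

theorem IsTimeC1.weak_time {d : ℕ} {T R : ℝ} (hT : 0 < T) {Ω : Set (Sp d)} (hΩ : IsOpen Ω)
    {P : ℝ → Sp d → ℝ} (hP : IsTimeC1 T Ω P) (hP' : ExtendsCont T Ω P)
    (hR : ∀ t ∈ Icc 0 T, ∀ x ∈ Ω, R < ‖x‖ → P t x = 0) :
    IntegrableOn (fun t => ∫ x in Ω, P t x) (Icc 0 T) ∧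
    IntegrableOn (fun t => ∫ x in Ω, dt T P t x) (Icc 0 T) ∧
    ∀ θ : ℝ → ℝ, ContDiff ℝ 1 θ → θ T = 0 →
      -∫ t in Icc 0 T, deriv θ t * ∫ x in Ω, P t x =
        θ 0 * (∫ x in Ω, P 0 x) + ∫ t in Icc 0 T, θ t * ∫ x in Ω, dt T P t x := by
  have hRd : ∀ t ∈ Icc 0 T, ∀ x ∈ Ω, R < ‖x‖ → dt T P t x = 0 := fun t ht x hx hxR =>
    dt_eq_zero (fun s hs => hR s hs x hx hxR) ht
  have i1 : IntegrableOn (fun t => ∫ x in Ω, P t x) (Icc 0 T) :=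
    (hP'.integrable_prod hΩ hR).integral_prod_left
  have i2 : IntegrableOn (fun t => ∫ x in Ω, dt T P t x) (Icc 0 T) :=
    (hP.extends_dt.integrable_prod hΩ hRd).integral_prod_left
  refine ⟨i1, i2, fun θ hθ hθT => ?_⟩
  have hTT : T ∈ Icc 0 T := ⟨hT.le, le_rfl⟩
  have hQ : IsTimeC1 T Ω fun t x => θ t * P t x :=
    (IsTimeC1.time hT hθ).bilin hT (ContinuousLinearMap.mul ℝ ℝ) hP
      (ExtendsCont.of_continuousOn_time hθ.continuous.continuousOn) hP'
  have key := hQ.integral_sub hΩ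
    ((ExtendsCont.of_continuousOn_time hθ.continuous.continuousOn).mul hP')
    (R := R) (fun t ht x hx hxR => by rw [hR t ht x hx hxR, mul_zero]) hTT
  simp only [hθT, zero_mul, integral_zero, zero_sub, integral_const_mul] at key
  have e1 : ∀ t ∈ Icc 0 T, ∫ x in Ω, dt T (fun t x => θ t * P t x) t x =
      deriv θ t * (∫ x in Ω, P t x) + θ t * ∫ x in Ω, dt T P t x := by
    intro t ht
    rw [← (integral_linear_comb₂ (hP'.integrable_slice hΩ hR ht)
      (hP.extends_dt.integrable_slice hΩ hRd ht) _ _).2]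
    refine setIntegral_congr_fun hΩ.measurableSet fun x hx => ?_
    have := dt_bilin hT (ContinuousLinearMap.mul ℝ ℝ) (IsTimeC1.time hT hθ) hP ht hx
    rw [dt_time hT hθ ht] at this
    simp only [ContinuousLinearMap.mul_apply'] at this
    simp only [this]
    ring
  have j1 : IntegrableOn (fun t => deriv θ t * ∫ x in Ω, P t x) (Icc 0 T) :=
    IntegrableOn.continuousOn_mul (hθ.continuous_deriv le_rfl).continuousOn i1 isCompact_Icc
  have j2 : IntegrableOn (fun t => θ t * ∫ x in Ω, dt T P t x) (Icc 0 T) :=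
    IntegrableOn.continuousOn_mul hθ.continuous.continuousOn i2 isCompact_Icc
  rw [setIntegral_congr_fun measurableSet_Icc e1, integral_add j1 j2] at key
  linarith

namespace IsStrongEulerSolution

variable {d : ℕ} {Ω : C3Domain d} {γ T : ℝ} {r : ℝ → Sp d → ℝ} {u : ℝ → Sp d → Sp d}

/-- The density whose integral is the rate of change of `∫ χ_R p(ρ)`. -/
def pressureRate (γ : ℝ) (r : ℝ → Sp d → ℝ) (u : ℝ → Sp d → Sp d) (R t : ℝ) (x : Sp d) : ℝ :=
  (1 - γ) * cutoff R x * r t x ^ γ * divg (u t) x + r t x ^ γ * fderiv ℝ (cutoff R) x (u t x)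

/-- The divergence of cutoff times p(r)u integrates to zero by the no-flux condition; adding it
removes the gradient of the pressure. -/
theorem integral_dt_pressure (hE : IsStrongEulerSolution Ω γ T r u) (hT : 0 < T) (hγ : 1 < γ)
    {R : ℝ} (hR : 0 < R) {t : ℝ} (ht : t ∈ Icc 0 T) :
    IntegrableOn (pressureRate γ r u R t) Ω.carrier ∧
    ∫ x in Ω.carrier, dt T (fun t x => cutoff R x * pressure γ (r t x)) t x =
      ∫ x in Ω.carrier, pressureRate γ r u R t x := by
  have hΩ := Ω.isOpen
  have sP : SpaceReg T Ω.carrier 1 fun t x => cutoff R x * pressure γ (r t x) :=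
    (cutoff_spaceReg hΩ hR 1).bilin hΩ (ContinuousLinearMap.mul ℝ ℝ)
      (hE.pressure_space hγ).spaceReg
  have tP : IsTimeC1 T Ω.carrier fun t x => cutoff R x * pressure γ (r t x) :=
    (cutoff_isTimeC1 hT hR).bilin hT (ContinuousLinearMap.mul ℝ ℝ) (hE.pressure_time hT hγ)
      (cutoff_spaceReg hΩ hR 1).extendsCont (hE.pressure_space hγ).spaceReg.extendsCont
  have cV : IsSpaceCk T Ω.carrier 1 fun t x => (cutoff R x * pressure γ (r t x)) • u t x :=
    (sP.bilin hΩ (ContinuousLinearMap.lsmul ℝ ℝ)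
      (hE.u_space.spaceReg.mono (by norm_num))).isSpaceCk
    (((continuous_cutoff_snd R).continuousOn.mul (hE.pressure_space hγ).continuousOn).smul
      hE.u_space.continuousOn)
  obtain ⟨iV, hV⟩ := cV.integral_divg (R := 2 * R)
    (fun t _ x _ hx => by rw [cutoff_eq_zero hR hx, zero_mul, zero_smul])
    (fun t ht x hx => by rw [real_inner_smul_left, hE.no_flux t ht x hx, mul_zero]) ht
  have iP : IntegrableOn (dt T (fun t x => cutoff R x * pressure γ (r t x)) t) Ω.carrier :=
    tP.extends_dt.integrable_slice hΩ (R := 2 * R) (fun t ht x _ hxR =>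
      dt_eq_zero (fun s _ => by rw [cutoff_eq_zero hR hxR, zero_mul]) ht) ht
  have hpt : ∀ x ∈ Ω.carrier, dt T (fun t x => cutoff R x * pressure γ (r t x)) t x
      + divg (fun y => (cutoff R y * pressure γ (r t y)) • u t y) x = pressureRate γ r u R t x := by
    intro x hx
    have hp : DifferentiableAt ℝ (fun y => pressure γ (r t y)) x :=
      (((hE.pressure_space hγ).contDiffOn t ht).differentiableOn
        (by norm_num)).differentiableAt (hΩ.mem_nhds hx)
    rw [dt_cutoff_mul hT hR (hE.pressure_time hT hγ) ht hx, dt_eq hT ht (hE.dt_pressure hγ ht hx),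
      divg_smul (w := fun y => cutoff R y * pressure γ (r t y))
        ((cutoff_differentiableAt R x).mul hp) (hE.u_diff ht hx).differentiableAt,
      fderiv_cutoff_mul R hp, pressureRate, pressure]
    ring
  refine ⟨(iP.add iV).congr ?_, ?_⟩
  · exact (ae_restrict_iff' hΩ.measurableSet).2 (Eventually.of_forall hpt)
  · rw [← setIntegral_congr_fun hΩ.measurableSet hpt, integral_add iP iV, hV, add_zero]

theorem pressure_weak (hE : IsStrongEulerSolution Ω γ T r u) (hT : 0 < T) (hγ : 1 < γ)
    {R : ℝ} (hR : 0 < R) :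
    IntegrableOn (fun t => ∫ x in Ω.carrier, cutoff R x * pressure γ (r t x)) (Icc 0 T) ∧
    IntegrableOn (fun t => ∫ x in Ω.carrier, pressureRate γ r u R t x) (Icc 0 T) ∧
    (∀ t ∈ Icc 0 T, IntegrableOn (fun x => cutoff R x * pressure γ (r t x)) Ω.carrier) ∧
    ∀ θ : ℝ → ℝ, ContDiff ℝ 1 θ → θ T = 0 →
      -∫ t in Icc 0 T, deriv θ t * ∫ x in Ω.carrier, cutoff R x * pressure γ (r t x) =
        θ 0 * (∫ x in Ω.carrier, cutoff R x * pressure γ (r 0 x)) +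
          ∫ t in Icc 0 T, θ t * ∫ x in Ω.carrier, pressureRate γ r u R t x := by
  have hΩ := Ω.isOpen
  have sP : ExtendsCont T Ω.carrier fun t x => cutoff R x * pressure γ (r t x) :=
    (cutoff_spaceReg hΩ hR 1).extendsCont.mul (hE.pressure_space hγ).spaceReg.extendsCont
  have tP : IsTimeC1 T Ω.carrier fun t x => cutoff R x * pressure γ (r t x) :=
    (cutoff_isTimeC1 hT hR).bilin hT (ContinuousLinearMap.mul ℝ ℝ) (hE.pressure_time hT hγ)
      (cutoff_spaceReg hΩ hR 1).extendsCont (hE.pressure_space hγ).spaceReg.extendsCont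
  have hz : ∀ t ∈ Icc 0 T, ∀ x ∈ Ω.carrier, 2 * R < ‖x‖ → cutoff R x * pressure γ (r t x) = 0 :=
    fun t _ x _ hx => by rw [cutoff_eq_zero hR hx, zero_mul]
  obtain ⟨i1, i2, h⟩ := tP.weak_time hT hΩ sP hz
  refine ⟨i1, ?_, fun t ht => sP.integrable_slice hΩ hz ht, fun θ hθ hθT => ?_⟩
  · refine i2.congr ?_
    filter_upwards [ae_restrict_mem measurableSet_Icc] with t ht
    exact (hE.integral_dt_pressure hT hγ hR ht).2
  · rw [h θ hθ hθT]
    congr 1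
    refine setIntegral_congr_fun measurableSet_Icc fun t ht => ?_
    simp only [(hE.integral_dt_pressure hT hγ hR ht).2]

end IsStrongEulerSolution

/-! ### Time slices of weak solutions -/

/-- Regularity and bounds, by the energy `E`, the mass `m` and the size `η` of the capillary term,
that hold for almost every time slice of a weak solution. -/
structure SliceBounds {d : ℕ} (Ω : Set (Sp d)) (γ ε E m η : ℝ) (ρ : Sp d → ℝ)
    (J Λ B H : Sp d → Sp d) : Prop where
  nonneg : ∀ᵐ x ∂volume.restrict Ω, 0 ≤ ρ x
  J_eq : ∀ᵐ x ∂volume.restrict Ω, J x = √(ρ x) • Λ x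
  meas_Λ : AEStronglyMeasurable Λ (volume.restrict Ω)
  int_rho : IntegrableOn ρ Ω
  int_Λ : IntegrableOn (fun x => ‖Λ x‖ ^ 2) Ω
  int_rpow : IntegrableOn (fun x => ρ x ^ γ) Ω
  int_B : IntegrableOn (fun x => ‖B x‖ ^ 2) Ω
  int_H : IntegrableOn (fun x => ‖H x‖) Ω
  rho_le : ∫ x in Ω, ρ x ≤ m
  Λ_le : ∫ x in Ω, ‖Λ x‖ ^ 2 ≤ 2 * E
  rpow_le : ∫ x in Ω, ρ x ^ γ ≤ (γ - 1) * E
  B_le : ε ^ 2 * ∫ x in Ω, ‖B x‖ ^ 2 ≤ 2 * E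
  H_le : ε ^ 2 * ∫ x in Ω, ‖H x‖ ≤ η
  energy_le : ∫ x in Ω, (‖Λ x‖ ^ 2 / 2 + ρ x ^ γ / (γ - 1) + ε ^ 2 / 2 * ‖B x‖ ^ 2) ≤ E

theorem IsWeakSolutionWith.ae_sliceBounds {d : ℕ} {Ω : C3Domain d} {γ c α ε T : ℝ}
    {ρ₀ : Sp d → ℝ} {J₀ : Sp d → Sp d} {ρ : ℝ → Sp d → ℝ} {J Λ B H : ℝ → Sp d → Sp d}
    (h : IsWeakSolutionWith Ω γ c α ε T ρ₀ J₀ ρ J Λ B H) (hγ : 1 < γ) (hε : 0 < ε) (hT : 0 < T)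
    {E η : ℝ} (hE0 : 0 ≤ E) (hE : totalEnergy Ω.carrier γ c α ε ρ₀ J₀ ≤ ENNReal.ofReal E)
    (hη : 0 ≤ η) (hH : ∀ᵐ t ∂volume.restrict (Icc 0 T),
      ∫⁻ x in Ω.carrier, ‖H t x‖ₑ ≤ ENNReal.ofReal (η / ε ^ 2)) :
    ∀ᵐ t ∂volume.restrict (Icc 0 T), SliceBounds Ω.carrier γ ε E (∫ x in Ω.carrier, ρ₀ x) η
      (ρ t) (J t) (Λ t) (B t) (H t) := by
  filter_upwards [h.ae_measurable_slices, h.ae_energy hγ hε hE0 hE,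
    h.ae_energy_bounds hγ hε hE0 hE, h.ae_integrable_mass_le hγ hε hT, hH,
    ae_restrict_mem measurableSet_Icc] with t ⟨_, m2, _, m4⟩ ⟨i1, i2, i3, i4⟩ ⟨b1, b2, b3⟩
    ⟨j1, j2⟩ hHt ht
  have e : ∀ x, ENNReal.ofReal ‖H t x‖ = ‖H t x‖ₑ := fun x => ofReal_norm _
  obtain ⟨iH, bH⟩ := integrable_of_lintegral_ofReal_le (f := fun x => ‖H t x‖)
    (by positivity : 0 ≤ η / ε ^ 2) m4.norm (Eventually.of_forall fun x => norm_nonneg _)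
    (by simpa only [e] using hHt)
  refine ⟨h.nonneg t ht, h.J_eq t ht, m2, j1, i1, i2, i3, iH, j2, b1, b2, b3, ?_, i4⟩
  rw [le_div_iff₀ (by positivity)] at bH
  linarith

namespace SliceBounds

variable {d : ℕ} {Ω : Set (Sp d)} {γ ε E m η : ℝ} {ρ : Sp d → ℝ} {J Λ B H : Sp d → Sp d}

theorem J_meas (h : SliceBounds Ω γ ε E m η ρ J Λ B H) :
    AEStronglyMeasurable J (volume.restrict Ω) := by
  refine AEStronglyMeasurable.congr ?_ (EventuallyEq.symm h.J_eq)
  exact (Real.continuous_sqrt.comp_aestronglyMeasurable h.int_rho.1).smul h.meas_Λ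

theorem ae_norm_J_le (h : SliceBounds Ω γ ε E m η ρ J Λ B H) :
    ∀ᵐ x ∂volume.restrict Ω, ‖J x‖ ≤ ρ x + ‖Λ x‖ ^ 2 := by
  filter_upwards [h.nonneg, h.J_eq] with x hx hJ
  rw [hJ, norm_smul, Real.norm_of_nonneg (Real.sqrt_nonneg _)]
  have := Real.sq_sqrt hx
  nlinarith [two_mul_le_add_sq √(ρ x) ‖Λ x‖, sq_nonneg ‖Λ x‖]

theorem integrable_action (h : SliceBounds Ω γ ε E m η ρ J Λ B H) (hΩ : MeasurableSet Ω)
    {q p : Sp d → ℝ} {v : Sp d → Sp d} {K M : ℝ}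
    (hq : AEStronglyMeasurable q (volume.restrict Ω))
    (hv : AEStronglyMeasurable v (volume.restrict Ω)) (hqK : ∀ x ∈ Ω, ‖q x‖ ≤ K)
    (hvK : ∀ x ∈ Ω, ‖v x‖ ≤ K) (hK : 0 ≤ K) (hp : IntegrableOn p Ω) (hp0 : ∀ x ∈ Ω, 0 ≤ p x)
    (hpM : ∫ x in Ω, p x ≤ M) :
    IntegrableOn (fun x => ρ x * q x - ⟪J x, v x⟫_ℝ + p x) Ω ∧
    ∫ x in Ω, ‖ρ x * q x - ⟪J x, v x⟫_ℝ + p x‖ ≤ 2 * K * m + K * (2 * E) + M := by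
  have hm : AEStronglyMeasurable (fun x => ρ x * q x - ⟪J x, v x⟫_ℝ + p x) (volume.restrict Ω) :=
    ((h.int_rho.1.mul hq).sub (h.J_meas.inner hv)).add hp.1
  obtain ⟨ig, eg⟩ := integral_linear_comb₃ h.int_rho h.int_Λ hp (2 * K) K 1
  have hb : ∀ᵐ x ∂volume.restrict Ω, ‖ρ x * q x - ⟪J x, v x⟫_ℝ + p x‖ ≤
      2 * K * ρ x + K * ‖Λ x‖ ^ 2 + 1 * p x := by
    filter_upwards [h.nonneg, h.ae_norm_J_le, ae_restrict_mem hΩ] with x hx hJ hxΩ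
    have h1 : ‖ρ x * q x‖ ≤ ρ x * K := by
      rw [norm_mul, Real.norm_of_nonneg hx]
      exact mul_le_mul_of_nonneg_left (hqK x hxΩ) hx
    have h2 : ‖⟪J x, v x⟫_ℝ‖ ≤ (ρ x + ‖Λ x‖ ^ 2) * K :=
      (norm_inner_le_norm _ _).trans (mul_le_mul hJ (hvK x hxΩ) (norm_nonneg _) (by positivity))
    have h3 := norm_add_le (ρ x * q x - ⟪J x, v x⟫_ℝ) (p x)
    have h4 := norm_sub_le (ρ x * q x) ⟪J x, v x⟫_ℝ
    rw [Real.norm_of_nonneg (hp0 x hxΩ)] at h3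
    linarith
  have hi : IntegrableOn (fun x => ρ x * q x - ⟪J x, v x⟫_ℝ + p x) Ω := ig.mono' hm hb
  refine ⟨hi, (integral_mono_ae hi.norm ig hb).trans ?_⟩
  rw [eg]
  have h1 := mul_le_mul_of_nonneg_left h.rho_le (by positivity : 0 ≤ 2 * K)
  have h2 := mul_le_mul_of_nonneg_left h.Λ_le hK
  linarith

end SliceBounds

/-- The density of the relative entropy of a weak solution. -/
def entropyDensity {d : ℕ} (γ ε : ℝ) (ρ : Sp d → ℝ) (Λ B : Sp d → Sp d) (r : Sp d → ℝ)
    (u : Sp d → Sp d) (x : Sp d) : ℝ :=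
  ‖Λ x - √(ρ x) • u x‖ ^ 2 / 2 + relInternalEnergy γ (ρ x) (r x) + ε ^ 2 / 2 * ‖B x‖ ^ 2

/-- The correction to the energy density that gives the relative entropy density. -/
def actionDensity {d : ℕ} (γ : ℝ) (ρ : Sp d → ℝ) (J : Sp d → Sp d) (r : ℝ → Sp d → ℝ)
    (u : ℝ → Sp d → Sp d) (t : ℝ) (x : Sp d) : ℝ :=
  ρ x * potential γ r u t x - ⟪J x, u t x⟫_ℝ + r t x ^ γ

namespace IsStrongEulerSolution

variable {d : ℕ} {Ω : C3Domain d} {γ T : ℝ} {r : ℝ → Sp d → ℝ} {u : ℝ → Sp d → Sp d}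
  {ε E m η : ℝ} {ρ : Sp d → ℝ} {J Λ B H : Sp d → Sp d}

/-- As r is bounded by K, r^γ ≤ K^(γ-1) r, and the mass does not exceed the initial mass. -/
theorem exists_rpow_bound (hE : IsStrongEulerSolution Ω γ T r u) (hT : 0 < T) (hγ : 1 < γ)
    (hr0 : IntegrableOn (r 0) Ω.carrier) :
    ∃ M : ℝ, 0 ≤ M ∧ ∀ t ∈ Icc 0 T, IntegrableOn (fun x => r t x ^ γ) Ω.carrier ∧
      ∫ x in Ω.carrier, r t x ^ γ ≤ M := by
  have hm := Ω.isOpen.measurableSet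
  obtain ⟨K, hK0, hK⟩ := hE.rho_space.spaceReg.extendsCont.exists_bound
  have h0T : (0 : ℝ) ∈ Icc 0 T := ⟨le_rfl, hT.le⟩
  have hi0 : 0 ≤ ∫ x in Ω.carrier, r 0 x :=
    setIntegral_nonneg hm fun x hx => (hE.pos h0T hx).le
  refine ⟨K ^ (γ - 1) * ∫ x in Ω.carrier, r 0 x, mul_nonneg (by positivity) hi0, fun t ht => ?_⟩
  have hi := hE.integrableOn hT hr0 ht
  have hle : ∫ x in Ω.carrier, r t x ≤ ∫ x in Ω.carrier, r 0 x := by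
    refine (integrable_of_lintegral_ofReal_le hi0 hi.1 ((ae_restrict_iff' hm).2
      (Eventually.of_forall fun x hx => (hE.pos ht hx).le)) ?_).2
    rw [ofReal_integral_eq_lintegral_ofReal hr0 ((ae_restrict_iff' hm).2
      (Eventually.of_forall fun x hx => (hE.pos h0T hx).le))]
    exact hE.lintegral_le hT ht
  have hb : ∀ x ∈ Ω.carrier, r t x ^ γ ≤ K ^ (γ - 1) * r t x := by
    intro x hx
    have hp := hE.pos ht hx
    have h1 : r t x ^ γ = r t x ^ (γ - 1) * r t x := by
      rw [← Real.rpow_add_one hp.ne', sub_add_cancel]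
    rw [h1]
    refine mul_le_mul_of_nonneg_right (Real.rpow_le_rpow hp.le ?_ (by linarith)) hp.le
    exact (le_abs_self _).trans (hK t ht x hx)
  have hi2 : IntegrableOn (fun x => r t x ^ γ) Ω.carrier := by
    refine (hi.const_mul (K ^ (γ - 1))).mono' (hi.1.aemeasurable.pow_const γ).aestronglyMeasurable ?_
    refine (ae_restrict_iff' hm).2 (Eventually.of_forall fun x hx => ?_)
    rw [Real.norm_of_nonneg (Real.rpow_nonneg (hE.pos ht hx).le γ)]
    exact hb x hx
  refine ⟨hi2, (setIntegral_mono_on hi2 (hi.const_mul _) hm hb).trans ?_⟩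
  rw [integral_const_mul]
  exact mul_le_mul_of_nonneg_left hle (by positivity)

theorem entropyDensity_integral_le (hE : IsStrongEulerSolution Ω γ T r u) (hγ : 1 < γ) {t : ℝ}
    (ht : t ∈ Icc 0 T) (h : SliceBounds Ω.carrier γ ε E m η ρ J Λ B H)
    (hi : IntegrableOn (actionDensity γ ρ J r u t) Ω.carrier) :
    IntegrableOn (entropyDensity γ ε ρ Λ B (r t) (u t)) Ω.carrier ∧
    ∫ x in Ω.carrier, entropyDensity γ ε ρ Λ B (r t) (u t) x ≤
      E + ∫ x in Ω.carrier, actionDensity γ ρ J r u t x := by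
  have hm := Ω.isOpen.measurableSet
  have e : (fun x => (‖Λ x‖ ^ 2 / 2 + ρ x ^ γ / (γ - 1) + ε ^ 2 / 2 * ‖B x‖ ^ 2)
      + actionDensity γ ρ J r u t x) =ᵐ[volume.restrict Ω.carrier]
      entropyDensity γ ε ρ Λ B (r t) (u t) := by
    filter_upwards [h.nonneg, h.J_eq, ae_restrict_mem hm] with x hx hJ hxΩ
    rw [entropyDensity, relative_entropy_density_eq hγ (hE.pos ht hxΩ) hx, actionDensity, hJ,
      potential]
    ring
  have i1 : IntegrableOn
      (fun x => ‖Λ x‖ ^ 2 / 2 + ρ x ^ γ / (γ - 1) + ε ^ 2 / 2 * ‖B x‖ ^ 2) Ω.carrier :=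
    ((h.int_Λ.div_const 2).add (h.int_rpow.div_const (γ - 1))).add (h.int_B.const_mul _)
  refine ⟨(i1.add hi).congr e, ?_⟩
  rw [← integral_congr_ae e, integral_add i1 hi]
  exact add_le_add h.energy_le le_rfl

theorem action_integrable (hE : IsStrongEulerSolution Ω γ T r u) {K M : ℝ} (hK : 0 ≤ K)
    (hq : ExtendsCont T Ω.carrier (potential γ r u))
    (hqK : ∀ t ∈ Icc 0 T, ∀ x ∈ Ω.carrier, ‖potential γ r u t x‖ ≤ K)
    (huK : ∀ t ∈ Icc 0 T, ∀ x ∈ Ω.carrier, ‖u t x‖ ≤ K) {t : ℝ} (ht : t ∈ Icc 0 T)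
    (hr : IntegrableOn (fun x => r t x ^ γ) Ω.carrier) (hrM : ∫ x in Ω.carrier, r t x ^ γ ≤ M)
    (h : SliceBounds Ω.carrier γ ε E m η ρ J Λ B H) :
    IntegrableOn (actionDensity γ ρ J r u t) Ω.carrier ∧
    ∫ x in Ω.carrier, ‖actionDensity γ ρ J r u t x‖ ≤ 2 * K * m + K * (2 * E) + M := by
  have hm := Ω.isOpen.measurableSet
  exact h.integrable_action hm ((hq.continuousOn_slice ht).aestronglyMeasurable hm)
    ((hE.u_space.spaceReg.extendsCont.continuousOn_slice ht).aestronglyMeasurable hm)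
    (hqK t ht) (huK t ht) hK hr (fun x hx => Real.rpow_nonneg (hE.pos ht hx).le γ) hrM

end IsStrongEulerSolution

/-! ### The relative entropy inequality -/

theorem SliceBounds.integral_le_of_production {d : ℕ} {Ω : Set (Sp d)} {γ ε E m η : ℝ}
    {ρ : Sp d → ℝ} {J Λ B H : Sp d → Sp d} (h : SliceBounds Ω γ ε E m η ρ J Λ B H)
    {f₁ f₂ f₃ D p : Sp d → ℝ} {C R M : ℝ} (hC : 0 ≤ C) (hR : 0 < R) (i₁ : IntegrableOn f₁ Ω)
    (i₂ : IntegrableOn f₂ Ω) (i₃ : IntegrableOn f₃ Ω) (iD : IntegrableOn D Ω)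
    (ip : IntegrableOn p Ω) (hpM : ∫ x in Ω, p x ≤ M)
    (hb : ∀ᵐ x ∂volume.restrict Ω, f₁ x - f₂ x + f₃ x ≤ C * (D x
      + R⁻¹ * (ρ x + ‖Λ x‖ ^ 2 + ρ x ^ γ + ε ^ 2 * ‖B x‖ ^ 2 + p x) + ε ^ 2 * ‖H x‖)) :
    (∫ x in Ω, f₁ x) - (∫ x in Ω, f₂ x) + (∫ x in Ω, f₃ x) ≤
      C * ((∫ x in Ω, D x) + R⁻¹ * (m + 2 * E + (γ - 1) * E + 2 * E + M) + η) := by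
  obtain ⟨ia, ea⟩ := integral_linear_comb₃ h.int_rho h.int_Λ h.int_rpow 1 1 1
  obtain ⟨ib, eb⟩ := integral_linear_comb₃ ia h.int_B ip 1 (ε ^ 2) 1
  obtain ⟨ic, ec⟩ := integral_linear_comb₃ iD ib h.int_H C (C * R⁻¹) (C * ε ^ 2)
  obtain ⟨ie, ee⟩ := integral_linear_comb₃ i₁ i₂ i₃ 1 (-1) 1
  have key := integral_mono_ae ie ic (hb.mono fun x hx => by
    simp only
    linarith)
  rw [ee, ec, eb, ea] at key
  have h1 : (∫ x in Ω, ρ x) + (∫ x in Ω, ‖Λ x‖ ^ 2) + (∫ x in Ω, ρ x ^ γ)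
      + ε ^ 2 * (∫ x in Ω, ‖B x‖ ^ 2) + (∫ x in Ω, p x) ≤
      m + 2 * E + (γ - 1) * E + 2 * E + M := by
    linarith [h.rho_le, h.Λ_le, h.rpow_le, h.B_le]
  have h2 := mul_le_mul_of_nonneg_left h1 (by positivity : 0 ≤ C * R⁻¹)
  have h3 := mul_le_mul_of_nonneg_left h.H_le hC
  linarith

theorem tendsto_integral_cutoff_mul {d : ℕ} {Ω : Set (Sp d)} {f : Sp d → ℝ}
    (hf : IntegrableOn f Ω) :
    Tendsto (fun n : ℕ => ∫ x in Ω, cutoff (n + 1) x * f x) atTop (𝓝 (∫ x in Ω, f x)) := by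
  refine tendsto_integral_of_dominated_convergence (fun x => ‖f x‖) (fun n => ?_) hf.norm
    (fun n => Eventually.of_forall fun x => ?_) (Eventually.of_forall fun x => ?_)
  · exact (contDiff_cutoff (n := 0) _).continuous.aestronglyMeasurable.mul hf.1
  · rw [norm_mul, Real.norm_of_nonneg (cutoff_nonneg _ _)]
    exact mul_le_of_le_one_left (norm_nonneg _) (cutoff_le_one _ _)
  · refine tendsto_const_nhds.congr' ?_
    obtain ⟨N, hN⟩ := exists_nat_ge ‖x‖
    filter_upwards [eventually_ge_atTop N] with n hn
    have : (N : ℝ) ≤ n := by exact_mod_cast hn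
    rw [cutoff_eq_one (by positivity) (by linarith), one_mul]

theorem norm_integral_cutoff_mul_le {d : ℕ} {Ω : Set (Sp d)} {f : Sp d → ℝ}
    (hf : IntegrableOn f Ω) (R : ℝ) :
    ‖∫ x in Ω, cutoff R x * f x‖ ≤ ∫ x in Ω, ‖f x‖ := by
  refine norm_integral_le_of_norm_le hf.norm (Eventually.of_forall fun x => ?_)
  rw [norm_mul, Real.norm_of_nonneg (cutoff_nonneg _ _)]
  exact mul_le_of_le_one_left (norm_nonneg _) (cutoff_le_one _ _)

theorem integral_cutoff_action {d : ℕ} {Ω : Set (Sp d)} {γ R : ℝ} {ρ : Sp d → ℝ}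
    {J : Sp d → Sp d} {r : ℝ → Sp d → ℝ} {u : ℝ → Sp d → Sp d} {t : ℝ}
    (h₁ : IntegrableOn (fun x => ρ x * (cutoff R x * potential γ r u t x)) Ω)
    (h₂ : IntegrableOn (fun x => ⟪J x, cutoff R x • u t x⟫_ℝ) Ω)
    (h₃ : IntegrableOn (fun x => cutoff R x * pressure γ (r t x)) Ω) :
    ∫ x in Ω, cutoff R x * actionDensity γ ρ J r u t x =
      (∫ x in Ω, ρ x * (cutoff R x * potential γ r u t x))
        - (∫ x in Ω, ⟪J x, cutoff R x • u t x⟫_ℝ)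
        + ∫ x in Ω, cutoff R x * pressure γ (r t x) := by
  have := (integral_linear_comb₃ h₁ h₂ h₃ 1 (-1) 1).2
  have e : ∀ x, cutoff R x * actionDensity γ ρ J r u t x =
      1 * (ρ x * (cutoff R x * potential γ r u t x)) + (-1) * ⟪J x, cutoff R x • u t x⟫_ℝ
        + 1 * (cutoff R x * pressure γ (r t x)) := fun x => by
    rw [actionDensity, real_inner_smul_right, pressure]
    ring
  simp only [e]
  rw [this]
  ring

/-- Passage to the limit in a family of weak differential inequalities in time. -/
theorem weak_inequality_of_tendsto {T C M MA e : ℝ} {θ : ℝ → ℝ}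
    (hθ : ContDiff ℝ 1 θ) (hθ0 : ∀ t ∈ Icc 0 T, 0 ≤ θ t) {mn : ℕ → ℝ → ℝ} {D : ℕ → ℝ → ℝ}
    {ml : ℝ → ℝ} {mn0 : ℕ → ℝ} {m0 : ℝ}
    (hmn : ∀ n, IntegrableOn (mn n) (Icc 0 T)) (hD : ∀ n, IntegrableOn (D n) (Icc 0 T))
    (hlim : ∀ᵐ t ∂volume.restrict (Icc 0 T), Tendsto (fun n => mn n t) atTop (𝓝 (ml t)))
    (hbd : ∀ᵐ t ∂volume.restrict (Icc 0 T), ∀ n, ‖mn n t‖ ≤ MA)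
    (hml : IntegrableOn ml (Icc 0 T)) (h0 : Tendsto mn0 atTop (𝓝 m0))
    (hDle : ∀ᵐ t ∂volume.restrict (Icc 0 T), ∀ n : ℕ,
      D n t ≤ C * (ml t + ((n : ℝ) + 1)⁻¹ * M + e))
    (hw : ∀ n, -∫ t in Icc 0 T, deriv θ t * mn n t =
      θ 0 * mn0 n + ∫ t in Icc 0 T, θ t * D n t) :
    -∫ t in Icc 0 T, deriv θ t * ml t ≤
      θ 0 * m0 + ∫ t in Icc 0 T, θ t * (C * ml t + C * e) := by
  have cθ : ContinuousOn θ (Icc 0 T) := hθ.continuous.continuousOn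
  have cθ' : ContinuousOn (deriv θ) (Icc 0 T) := (hθ.continuous_deriv le_rfl).continuousOn
  have iθ : IntegrableOn θ (Icc 0 T) := cθ.integrableOn_compact isCompact_Icc
  have i1 : IntegrableOn (fun t => θ t * (C * ml t + C * e)) (Icc 0 T) :=
    IntegrableOn.continuousOn_mul cθ (Integrable.add (hml.const_mul C) (integrable_const (C * e)))
      isCompact_Icc
  have lhs : Tendsto (fun n => -∫ t in Icc 0 T, deriv θ t * mn n t) atTop
      (𝓝 (-∫ t in Icc 0 T, deriv θ t * ml t)) := by
    refine (tendsto_integral_of_dominated_convergence (fun t => ‖deriv θ t‖ * MA) (fun n => ?_)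
      ?_ (fun n => ?_) ?_).neg
    · exact (IntegrableOn.continuousOn_mul cθ' (hmn n) isCompact_Icc).1
    · exact (cθ'.norm.integrableOn_compact isCompact_Icc).mul_const MA
    · filter_upwards [hbd] with t ht
      rw [norm_mul]
      exact mul_le_mul_of_nonneg_left (ht n) (norm_nonneg _)
    · filter_upwards [hlim] with t ht
      exact ht.const_mul _
  have hinv : Tendsto (fun n : ℕ => ((n : ℝ) + 1)⁻¹) atTop (𝓝 0) := by
    simpa using tendsto_one_div_add_atTop_nhds_zero_nat (𝕜 := ℝ)
  have rhs : Tendsto (fun n : ℕ => θ 0 * mn0 n + ((∫ t in Icc 0 T, θ t * (C * ml t + C * e))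
      + ((n : ℝ) + 1)⁻¹ * (C * M * ∫ t in Icc 0 T, θ t))) atTop
      (𝓝 (θ 0 * m0 + ∫ t in Icc 0 T, θ t * (C * ml t + C * e))) := by
    have := (h0.const_mul (θ 0)).add ((hinv.mul_const (C * M * ∫ t in Icc 0 T, θ t)).const_add
      (∫ t in Icc 0 T, θ t * (C * ml t + C * e)))
    simpa using this
  refine le_of_tendsto_of_tendsto' lhs rhs fun n => ?_
  rw [hw n]
  refine add_le_add le_rfl ?_
  obtain ⟨i2, e2⟩ := integral_linear_comb₂ i1 iθ 1 (((n : ℝ) + 1)⁻¹ * (C * M))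
  have e3 : (∫ t in Icc 0 T, θ t * (C * ml t + C * e))
      + ((n : ℝ) + 1)⁻¹ * (C * M * ∫ t in Icc 0 T, θ t) =
      ∫ t in Icc 0 T, (1 * (θ t * (C * ml t + C * e)) + ((n : ℝ) + 1)⁻¹ * (C * M) * θ t) := by
    rw [e2]
    ring
  rw [e3]
  refine integral_mono_ae (IntegrableOn.continuousOn_mul cθ (hD n) isCompact_Icc) i2 ?_
  filter_upwards [hDle, ae_restrict_mem measurableSet_Icc] with t h1 ht
  have := mul_le_mul_of_nonneg_left (h1 n) (hθ0 t ht)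
  linarith

/-- **Relative entropy inequality.** The relative entropy of a weak solution with respect to a strong
Euler solution is controlled by its initial value and by the size `η` of the capillary term. -/
theorem IsStrongEulerSolution.exists_relative_entropy_bound {d : ℕ} {Ω : C3Domain d} {γ α T : ℝ}
    {r : ℝ → Sp d → ℝ} {u : ℝ → Sp d → Sp d} (hE : IsStrongEulerSolution Ω γ T r u) (hT : 0 < T)
    (hγ : 1 < γ) (hα : -1 ≤ α) (hr0 : IntegrableOn (r 0) Ω.carrier) :
    ∃ C : ℝ, 0 ≤ C ∧ ∀ {c ε : ℝ} {ρ₀ : Sp d → ℝ} {J₀ : Sp d → Sp d} {ρ : ℝ → Sp d → ℝ}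
      {J Λ B H : ℝ → Sp d → Sp d}, IsWeakSolutionWith Ω γ c α ε T ρ₀ J₀ ρ J Λ B H → 0 < ε →
      ∀ {E η : ℝ}, 0 ≤ η → totalEnergy Ω.carrier γ c α ε ρ₀ J₀ ≤ ENNReal.ofReal E → 0 ≤ E →
      (∀ᵐ t ∂volume.restrict (Icc 0 T),
        ∫⁻ x in Ω.carrier, ‖H t x‖ₑ ≤ ENNReal.ofReal (η / ε ^ 2)) →
      IntegrableOn (actionDensity γ ρ₀ J₀ r u 0) Ω.carrier ∧
      ∀ᵐ t ∂volume.restrict (Icc 0 T),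
        IntegrableOn (entropyDensity γ ε (ρ t) (Λ t) (B t) (r t) (u t)) Ω.carrier ∧
        ∫ x in Ω.carrier, entropyDensity γ ε (ρ t) (Λ t) (B t) (r t) (u t) x ≤
          Real.exp (C * t) *
            (E + (∫ x in Ω.carrier, actionDensity γ ρ₀ J₀ r u 0 x) + T * (C * η)) := by
  have hΩ := Ω.isOpen
  have hm := hΩ.measurableSet
  have h0T : (0 : ℝ) ∈ Icc 0 T := ⟨le_rfl, hT.le⟩
  obtain ⟨C, hC0, hC⟩ := hE.exists_production_bound hT hγ hα
  obtain ⟨M, hM0, hM⟩ := hE.exists_rpow_bound hT hγ hr0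
  have xq := (hE.potential_space hT hγ).spaceReg.extendsCont
  have xu := hE.u_space.spaceReg.extendsCont
  obtain ⟨K₁, hK₁, hqK⟩ := xq.exists_bound
  obtain ⟨K₂, hK₂, huK⟩ := xu.exists_bound
  refine ⟨C, hC0, fun {c ε ρ₀ J₀ ρ J Λ B H} h hε {E η} hη hEE hE0 hH => ?_⟩
  have slices := h.ae_sliceBounds hγ hε hT hE0 hEE hη hH
  set m := ∫ x in Ω.carrier, ρ₀ x with hmdef
  set K := K₁ + K₂ with hK
  set MA := 2 * K * m + K * (2 * E) + M with hMA
  have act : ∀ᵐ t ∂volume.restrict (Icc 0 T),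
      IntegrableOn (actionDensity γ (ρ t) (J t) r u t) Ω.carrier ∧
      ∫ x in Ω.carrier, ‖actionDensity γ (ρ t) (J t) r u t x‖ ≤ MA := by
    filter_upwards [slices, ae_restrict_mem measurableSet_Icc] with t hs ht
    exact hE.action_integrable (by positivity) xq
      (fun t ht x hx => (hqK t ht x hx).trans (by linarith))
      (fun t ht x hx => (huK t ht x hx).trans (by linarith)) ht (hM t ht).1 (hM t ht).2 hs
  -- initial data
  have mq0 : AEStronglyMeasurable (potential γ r u 0) (volume.restrict Ω.carrier) :=
    (xq.continuousOn_slice h0T).aestronglyMeasurable hm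
  have mu0 : AEStronglyMeasurable (u 0) (volume.restrict Ω.carrier) :=
    (xu.continuousOn_slice h0T).aestronglyMeasurable hm
  have init : ∀ κ : Sp d → ℝ, Continuous κ → (∀ x, ‖κ x‖ ≤ 1) →
      IntegrableOn (fun x => ρ₀ x * (κ x * potential γ r u 0 x)) Ω.carrier ∧
      IntegrableOn (fun x => ⟪J₀ x, κ x • u 0 x⟫_ℝ) Ω.carrier := by
    intro κ hκ hκ1
    refine ⟨(h.initial_rho.norm.mul_const K₁).mono'
      (h.initial_rho.1.mul (hκ.aestronglyMeasurable.mul mq0)) ?_,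
      (h.initial_J.norm.mul_const K₂).mono'
      (h.initial_J.1.inner (hκ.aestronglyMeasurable.smul mu0)) ?_⟩
    · filter_upwards [ae_restrict_mem hm] with x hx
      rw [norm_mul, norm_mul]
      exact mul_le_mul_of_nonneg_left ((mul_le_of_le_one_left (norm_nonneg _) (hκ1 x)).trans
        (hqK 0 h0T x hx)) (norm_nonneg _)
    · filter_upwards [ae_restrict_mem hm] with x hx
      refine (norm_inner_le_norm _ _).trans (mul_le_mul_of_nonneg_left ?_ (norm_nonneg _))
      rw [norm_smul]
      exact (mul_le_of_le_one_left (norm_nonneg _) (hκ1 x)).trans (huK 0 h0T x hx)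
  have iA0 : IntegrableOn (actionDensity γ ρ₀ J₀ r u 0) Ω.carrier := by
    obtain ⟨a1, a2⟩ := init (fun _ => 1) continuous_const (by simp)
    simp only [one_mul, one_smul] at a1 a2
    exact (a1.sub a2).add (hM 0 h0T).1
  refine ⟨iA0, ?_⟩
  -- the weak formulation at scale `n + 1`
  have hn0 : ∀ n : ℕ, (0 : ℝ) < n + 1 := fun n => by positivity
  have hmass := fun n : ℕ => h.mass_time hγ hε hT (hE.isTestScalar_potential hT hγ (hn0 n))
  have hmom := fun n : ℕ => h.momentum_time hγ hε hT (hE.isTestField_velocity hT (hn0 n))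
  have hpre := fun n : ℕ => hE.pressure_weak hT hγ (hn0 n)
  set a : ℕ → ℝ → ℝ := fun n t =>
    ∫ x in Ω.carrier, ρ t x * (cutoff ((n : ℝ) + 1) x * potential γ r u t x) with ha
  set b : ℕ → ℝ → ℝ := fun n t =>
    ∫ x in Ω.carrier, ⟪J t x, cutoff ((n : ℝ) + 1) x • u t x⟫_ℝ with hb
  set p : ℕ → ℝ → ℝ := fun n t =>
    ∫ x in Ω.carrier, cutoff ((n : ℝ) + 1) x * pressure γ (r t x) with hp
  set Da : ℕ → ℝ → ℝ := fun n t => ∫ x in Ω.carrier, massIntegrand T ρ J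
    (fun t x => cutoff ((n : ℝ) + 1) x * potential γ r u t x) t x with hDa
  set Db : ℕ → ℝ → ℝ := fun n t => ∫ x in Ω.carrier, momentumIntegrand T γ α ε ρ J Λ B H
    (fun t x => cutoff ((n : ℝ) + 1) x • u t x) t x with hDb
  set Dp : ℕ → ℝ → ℝ := fun n t => ∫ x in Ω.carrier,
    IsStrongEulerSolution.pressureRate γ r u (n + 1) t x with hDp
  set ml : ℝ → ℝ := fun t => ∫ x in Ω.carrier, actionDensity γ (ρ t) (J t) r u t x with hml
  have s1 : ∀ᵐ t ∂volume.restrict (Icc 0 T), ∀ n : ℕ, _ := ae_all_iff.2 fun n => (hmass n).2.2.1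
  have s2 : ∀ᵐ t ∂volume.restrict (Icc 0 T), ∀ n : ℕ, _ := ae_all_iff.2 fun n => (hmom n).2.2.1
  have hmn : ∀ᵐ t ∂volume.restrict (Icc 0 T), ∀ n : ℕ, a n t - b n t + p n t =
      ∫ x in Ω.carrier, cutoff ((n : ℝ) + 1) x * actionDensity γ (ρ t) (J t) r u t x := by
    filter_upwards [s1, s2, ae_restrict_mem measurableSet_Icc] with t h1 h2 ht n
    exact (integral_cutoff_action (h1 n).1 (h2 n).1 ((hpre n).2.2.1 t ht)).symm
  have imn : ∀ n, IntegrableOn (fun t => a n t - b n t + p n t) (Icc 0 T) := fun n =>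
    Integrable.add (Integrable.sub (hmass n).1 (hmom n).1) (hpre n).1
  have iD : ∀ n, IntegrableOn (fun t => Da n t - Db n t + Dp n t) (Icc 0 T) := fun n =>
    Integrable.add (Integrable.sub (hmass n).2.1 (hmom n).2.1) (hpre n).2.1
  have hlim : ∀ᵐ t ∂volume.restrict (Icc 0 T),
      Tendsto (fun n => a n t - b n t + p n t) atTop (𝓝 (ml t)) := by
    filter_upwards [hmn, act] with t h1 h2
    simp only [h1]
    exact tendsto_integral_cutoff_mul h2.1
  have hbd : ∀ᵐ t ∂volume.restrict (Icc 0 T), ∀ n, ‖a n t - b n t + p n t‖ ≤ MA := by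
    filter_upwards [hmn, act] with t h1 h2 n
    rw [h1 n]
    exact (norm_integral_cutoff_mul_le h2.1 _).trans h2.2
  have iml : IntegrableOn ml (Icc 0 T) := by
    refine Integrable.mono' (integrable_const MA)
      (aestronglyMeasurable_of_tendsto_ae atTop (fun n => (imn n).1) hlim) ?_
    filter_upwards [hlim, hbd] with t h1 h2
    exact le_of_tendsto h1.norm (Eventually.of_forall h2)
  have dens : ∀ᵐ t ∂volume.restrict (Icc 0 T),
      IntegrableOn (entropyDensity γ ε (ρ t) (Λ t) (B t) (r t) (u t)) Ω.carrier ∧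
      ∫ x in Ω.carrier, entropyDensity γ ε (ρ t) (Λ t) (B t) (r t) (u t) x ≤ E + ml t := by
    filter_upwards [slices, act, ae_restrict_mem measurableSet_Icc] with t h1 h2 ht
    exact hE.entropyDensity_integral_le hγ ht h1 h2.1
  -- The relative entropy is replaced by its majorant E + ml by `dens`, so that the inequality
  -- closes in `ml`; the cutoff errors appear with the factor 1/(n+1).
  have hDle : ∀ᵐ t ∂volume.restrict (Icc 0 T), ∀ n : ℕ, Da n t - Db n t + Dp n t ≤
      C * (ml t + ((n : ℝ) + 1)⁻¹ * (m + 2 * E + (γ - 1) * E + 2 * E + M) + (E + η)) := by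
    filter_upwards [s1, s2, slices, dens, ae_restrict_mem measurableSet_Icc] with t h1 h2 hs hd ht n
    have := hs.integral_le_of_production hC0 (hn0 n) (h1 n).2 (h2 n).2
      (hE.integral_dt_pressure hT hγ (hn0 n) ht).1 hd.1 (hM t ht).1 (hM t ht).2 (by
        filter_upwards [hs.nonneg, hs.J_eq, ae_restrict_mem hm] with x hx hJ hxΩ
        exact hC (n + 1) (by linarith [Nat.cast_nonneg (α := ℝ) n]) t ht x hxΩ ε ρ J Λ B H hx hJ)
    refine this.trans (mul_le_mul_of_nonneg_left ?_ hC0)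
    linarith [hd.2]
  have h0lim : Tendsto (fun n : ℕ => (∫ x in Ω.carrier,
      ρ₀ x * (cutoff ((n : ℝ) + 1) x * potential γ r u 0 x))
      - (∫ x in Ω.carrier, ⟪J₀ x, cutoff ((n : ℝ) + 1) x • u 0 x⟫_ℝ)
      + ∫ x in Ω.carrier, cutoff ((n : ℝ) + 1) x * pressure γ (r 0 x)) atTop
      (𝓝 (∫ x in Ω.carrier, actionDensity γ ρ₀ J₀ r u 0 x)) := by
    refine (tendsto_integral_cutoff_mul iA0).congr fun n => ?_
    obtain ⟨a1, a2⟩ := init (cutoff ((n : ℝ) + 1)) (contDiff_cutoff (n := 0) _).continuous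
      fun x => by rw [Real.norm_of_nonneg (cutoff_nonneg _ _)]; exact cutoff_le_one _ _
    exact integral_cutoff_action a1 a2 ((hpre n).2.2.1 0 h0T)
  -- Grönwall's lemma is applied to E + ml and not to the relative entropy: the energy is only known
  -- to stay below E, and no differential inequality is available for it.
  have key := ae_le_exp_of_weak_inequality (T := T) (C := C) (e := C * η) (m := fun t => E + ml t)
    (m₀ := E + ∫ x in Ω.carrier, actionDensity γ ρ₀ J₀ r u 0 x) hT (by positivity)
    (Integrable.add (integrable_const E) iml) (fun θ hθ hθ0 hθT => ?_) hC0
  · filter_upwards [key, dens] with t h1 h2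
    exact ⟨h2.1, h2.2.trans h1⟩
  · have cθ : ContinuousOn θ (Icc 0 T) := hθ.continuous.continuousOn
    have cθ' : ContinuousOn (deriv θ) (Icc 0 T) := (hθ.continuous_deriv le_rfl).continuousOn
    have w := weak_inequality_of_tendsto hθ hθ0 imn iD hlim hbd iml h0lim hDle fun n => by
      have j1 := IntegrableOn.continuousOn_mul cθ' (hmass n).1 isCompact_Icc
      have j2 := IntegrableOn.continuousOn_mul cθ' (hmom n).1 isCompact_Icc
      have j3 := IntegrableOn.continuousOn_mul cθ' (hpre n).1 isCompact_Icc
      have k1 := IntegrableOn.continuousOn_mul cθ (hmass n).2.1 isCompact_Icc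
      have k2 := IntegrableOn.continuousOn_mul cθ (hmom n).2.1 isCompact_Icc
      have k3 := IntegrableOn.continuousOn_mul cθ (hpre n).2.1 isCompact_Icc
      have e1 := (integral_linear_comb₃ j1 j2 j3 1 (-1) 1).2
      have e2 := (integral_linear_comb₃ k1 k2 k3 1 (-1) 1).2
      have f1 : ∀ t, deriv θ t * (a n t - b n t + p n t) = 1 * (deriv θ t * a n t)
          + (-1) * (deriv θ t * b n t) + 1 * (deriv θ t * p n t) := fun t => by ring
      have f2 : ∀ t, θ t * (Da n t - Db n t + Dp n t) = 1 * (θ t * Da n t)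
          + (-1) * (θ t * Db n t) + 1 * (θ t * Dp n t) := fun t => by ring
      simp only [f1, f2]
      rw [e1, e2]
      have g1 := (hmass n).2.2.2 θ hθ hθT
      have g2 := (hmom n).2.2.2 θ hθ hθT
      have g3 := (hpre n).2.2.2 θ hθ hθT
      linarith
    have iθ' : IntegrableOn (deriv θ) (Icc 0 T) := cθ'.integrableOn_compact isCompact_Icc
    have jl := IntegrableOn.continuousOn_mul cθ' iml isCompact_Icc
    -- As θ(T) = 0, the constant E contributes θ(0)E to the left side, which is its share of the
    -- initial value.
    have eθ : ∫ t in Icc 0 T, deriv θ t = -θ 0 := by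
      rw [integral_Icc_eq_integral_Ioc, ← intervalIntegral.integral_of_le hT.le,
        intervalIntegral.integral_deriv_eq_sub (fun t _ => hθ.differentiable (by norm_num) t)
        ((hθ.continuous_deriv le_rfl).intervalIntegrable _ _), hθT, zero_sub]
    have e3 := (integral_linear_comb₂ iθ' jl E 1).2
    have f3 : ∀ t, deriv θ t * (E + ml t) = E * deriv θ t + 1 * (deriv θ t * ml t) :=
      fun t => by ring
    have f4 : ∀ t, θ t * (C * (E + ml t) + C * η) = θ t * (C * ml t + C * (E + η)) :=
      fun t => by ring
    simp only [f3, f4]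
    rw [e3, eθ]
    linarith

/-! ### Coercivity of the relative internal energy -/

/-- The function s^γ - γs + γ - 1 is positive away from s = 1 and of order s^γ at infinity, so by
compactness it dominates |s-1|^γ wherever the latter is at least η. Near s = 1 it is only quadratic,
which for γ < 2 is weaker than |s-1|^γ; the error η covers this. -/
theorem exists_abs_sub_rpow_le_of_one {γ η : ℝ} (hγ : 1 < γ) (hη : 0 < η) :
    ∃ C : ℝ, 0 ≤ C ∧ ∀ s : ℝ, 0 ≤ s →
      |s - 1| ^ γ ≤ C * (s ^ γ - γ * s + (γ - 1)) + η := by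
  have hγ0 : 0 < γ := by linarith
  set F : ℝ → ℝ := fun s => s ^ γ - γ * s + (γ - 1) with hF
  have hFpos : ∀ s, 0 ≤ s → s ≠ 1 → 0 < F s := by
    intro s hs hs1
    have := one_add_mul_self_lt_rpow_one_add (by linarith : -1 ≤ s - 1) (sub_ne_zero.2 hs1) hγ
    rw [add_sub_cancel] at this
    simp only [hF]
    linarith
  have hF0 : ∀ s, 0 ≤ s → 0 ≤ F s := by
    intro s hs
    by_cases h : s = 1
    · simp [hF, h]
    · exact (hFpos s hs h).le
  have hFc : Continuous F :=
    ((Real.continuous_rpow_const hγ0.le).sub (continuous_const.mul continuous_id)).add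
      continuous_const
  have hGc : Continuous fun s : ℝ => |s - 1| ^ γ :=
    (Real.continuous_rpow_const hγ0.le).comp ((continuous_id.sub continuous_const).abs)
  -- large values
  set σ : ℝ := max 1 ((2 * γ) ^ (γ - 1)⁻¹) with hσ
  have large : ∀ s, σ ≤ s → |s - 1| ^ γ ≤ 2 * F s := by
    intro s hs
    have h1 : 1 ≤ s := (le_max_left _ _).trans hs
    have h2 : (2 * γ) ^ (γ - 1)⁻¹ ≤ s := (le_max_right _ _).trans hs
    have h3 : 2 * γ ≤ s ^ (γ - 1) := by
      have := Real.rpow_le_rpow (by positivity) h2 (by linarith : 0 ≤ γ - 1)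
      rwa [← Real.rpow_mul (by positivity), inv_mul_cancel₀ (by linarith), Real.rpow_one] at this
    have h4 : s ^ γ = s ^ (γ - 1) * s := by
      rw [← Real.rpow_add_one (by linarith), sub_add_cancel]
    have h5 : |s - 1| ^ γ ≤ s ^ γ := by
      refine Real.rpow_le_rpow (abs_nonneg _) ?_ hγ0.le
      rw [abs_of_nonneg (by linarith)]
      linarith
    have h6 : 2 * γ * s ≤ s ^ γ := by
      rw [h4]
      exact mul_le_mul_of_nonneg_right h3 (by linarith)
    simp only [hF]
    linarith
  -- bounded values away from `1`
  set S : Set ℝ := Icc 0 σ ∩ {s | η ≤ |s - 1| ^ γ} with hS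
  have hScomp : IsCompact S := isCompact_Icc.inter_right (isClosed_le continuous_const hGc)
  obtain ⟨c, hc0, hc⟩ : ∃ c : ℝ, 0 ≤ c ∧ ∀ s ∈ S, |s - 1| ^ γ ≤ c * F s := by
    have hne : ∀ s ∈ S, s ≠ 1 := by
      rintro s ⟨-, hs⟩ rfl
      simp only [mem_ofPred_eq, sub_self, abs_zero, Real.zero_rpow hγ0.ne'] at hs
      linarith
    have hcont : ContinuousOn (fun s => |s - 1| ^ γ / F s) S :=
      hGc.continuousOn.div hFc.continuousOn fun s hs => (hFpos s hs.1.1 (hne s hs)).ne'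
    obtain ⟨c, hc⟩ := hScomp.exists_bound_of_continuousOn hcont
    refine ⟨max c 0, le_max_right _ _, fun s hs => ?_⟩
    have h1 := hFpos s hs.1.1 (hne s hs)
    have h2 := (le_abs_self _).trans (hc s hs)
    rw [div_le_iff₀ h1] at h2
    exact h2.trans (mul_le_mul_of_nonneg_right (le_max_left _ _) h1.le)
  refine ⟨c + 2, by positivity, fun s hs => ?_⟩
  have h0 := hF0 s hs
  have e : (c + 2) * F s = c * F s + 2 * F s := by ring
  have h1 : 0 ≤ c * F s := mul_nonneg hc0 h0
  change |s - 1| ^ γ ≤ (c + 2) * F s + η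
  rw [e]
  by_cases hsσ : s ≤ σ
  · by_cases hsη : η ≤ |s - 1| ^ γ
    · linarith [hc s ⟨⟨hs, hsσ⟩, hsη⟩]
    · linarith [not_le.1 hsη]
  · linarith [large s (not_le.1 hsσ).le]

/-- Homogeneity: apply the case r = 1 to s/r and multiply by r^γ. The constant does not depend on r,
so densities tending to zero at infinity are allowed, and the error η r^γ is integrable. -/
theorem exists_abs_sub_rpow_le {γ η : ℝ} (hγ : 1 < γ) (hη : 0 < η) :
    ∃ C : ℝ, 0 ≤ C ∧ ∀ s r : ℝ, 0 ≤ s → 0 < r →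
      |s - r| ^ γ ≤ C * relInternalEnergy γ s r + η * r ^ γ := by
  obtain ⟨C, hC0, hC⟩ := exists_abs_sub_rpow_le_of_one hγ hη
  refine ⟨C * (γ - 1), mul_nonneg hC0 (by linarith), fun s r hs hr => ?_⟩
  have h1 := hC (s / r) (div_nonneg hs hr.le)
  have hp : 0 < r ^ γ := Real.rpow_pos_of_pos hr γ
  have h2 := mul_le_mul_of_nonneg_right h1 hp.le
  have e1 : |s / r - 1| ^ γ * r ^ γ = |s - r| ^ γ := by
    rw [← Real.mul_rpow (abs_nonneg _) hr.le]
    congr 1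
    nth_rewrite 2 [← abs_of_pos hr]
    rw [← abs_mul]
    congr 1
    field_simp
  have h5 : r ^ γ = r ^ (γ - 1) * r := by rw [← Real.rpow_add_one hr.ne', sub_add_cancel]
  have e2 : ((s / r) ^ γ - γ * (s / r) + (γ - 1)) * r ^ γ = (γ - 1) * relInternalEnergy γ s r := by
    have a1 : (s / r) ^ γ * r ^ γ = s ^ γ := by rw [Real.div_rpow hs hr.le]; field_simp
    have a2 : s / r * r ^ γ = r ^ (γ - 1) * s := by rw [h5]; field_simp
    rw [relInternalEnergy_eq hγ hr]
    linear_combination a1 - γ * a2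
  rw [e1] at h2
  linear_combination h2 + C * e2

theorem le_add_mul_rpow {γ δ y : ℝ} (hγ : 1 < γ) (hδ : 0 < δ) (hy : 0 ≤ y) :
    y ≤ δ + δ ^ (1 - γ) * y ^ γ := by
  have h0 : 0 ≤ δ ^ (1 - γ) * y ^ γ := by positivity
  rcases le_total y δ with h | h
  · linarith
  · have hy0 : 0 < y := hδ.trans_le h
    have h1 : y = y ^ (1 - γ) * y ^ γ := by
      rw [← Real.rpow_add hy0, sub_add_cancel, Real.rpow_one]
    have h2 : δ ^ (1 - γ) * δ ^ (γ - 1) = 1 := by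
      rw [← Real.rpow_add hδ]; simp
    have h3 : δ ^ (γ - 1) ≤ y ^ (γ - 1) := Real.rpow_le_rpow hδ.le h (by linarith)
    have h4 : y ^ γ = y ^ (γ - 1) * y := by
      rw [← Real.rpow_add_one hy0.ne', sub_add_cancel]
    have h5 : y ≤ δ ^ (1 - γ) * y ^ γ := by
      rw [h4]
      calc y = δ ^ (1 - γ) * (δ ^ (γ - 1) * y) := by rw [← mul_assoc, h2, one_mul]
        _ ≤ _ := by gcongr
    linarith

theorem exists_abs_sub_le {γ δ K : ℝ} (hγ : 1 < γ) (hδ : 0 < δ) (hK : 0 ≤ K) :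
    ∃ C : ℝ, 0 ≤ C ∧ ∀ s r : ℝ, 0 ≤ s → 0 < r → r ≤ K →
      |s - r| ≤ C * relInternalEnergy γ s r + δ := by
  set a := (δ / 2) ^ (1 - γ) with ha
  have ha0 : 0 < a := by positivity
  have hKγ : 0 ≤ K ^ γ := Real.rpow_nonneg hK γ
  -- Half of δ pays for passing from the power γ to the power one at the price of the factor a; this
  -- η makes a·η·r^γ at most the other half for r ≤ K.
  obtain ⟨C, hC0, hC⟩ := exists_abs_sub_rpow_le (η := δ / 2 / (a * (K ^ γ + 1))) hγ (by positivity)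
  refine ⟨a * C, by positivity, fun s r hs hr hrK => ?_⟩
  have h1 := le_add_mul_rpow hγ (half_pos hδ) (abs_nonneg (s - r))
  have h2 := mul_le_mul_of_nonneg_left (hC s r hs hr) ha0.le
  have h3 : a * (δ / 2 / (a * (K ^ γ + 1)) * r ^ γ) ≤ δ / 2 := by
    have h4 : r ^ γ ≤ K ^ γ + 1 := (Real.rpow_le_rpow hr.le hrK (by linarith)).trans (by linarith)
    have h5 : a * (δ / 2 / (a * (K ^ γ + 1)) * r ^ γ) = δ / 2 * (r ^ γ / (K ^ γ + 1)) := by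
      field_simp
    rw [h5]
    exact mul_le_of_le_one_right (by positivity) ((div_le_one (by positivity)).2 h4)
  rw [← ha] at h1
  linarith

/-! ### Convergence in `L^∞([0,T]; Lᵖ)` -/

theorem lintegral_enorm_rpow_le {X F : Type*} [MeasurableSpace X] [NormedAddCommGroup F]
    {μ : Measure X} {f : X → F} {p κ : ℝ} (hp : 0 ≤ p) (hi : Integrable (fun x => ‖f x‖ ^ p) μ)
    (hκ : ∫ x, ‖f x‖ ^ p ∂μ ≤ κ) : ∫⁻ x, ‖f x‖ₑ ^ p ∂μ ≤ ENNReal.ofReal κ := by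
  have e : ∀ x, ‖f x‖ₑ ^ p = ENNReal.ofReal (‖f x‖ ^ p) := fun x => by
    rw [← ofReal_norm, ENNReal.ofReal_rpow_of_nonneg (norm_nonneg _) hp]
  simp only [e]
  rw [← ofReal_integral_eq_lintegral_ofReal hi
    (Eventually.of_forall fun x => Real.rpow_nonneg (norm_nonneg _) p)]
  exact ENNReal.ofReal_le_ofReal hκ

theorem tendsto_normLinfLp_zero {d : ℕ} {F ι : Type*} [NormedAddCommGroup F] {T p : ℝ}
    {Ω : Set (Sp d)} {l : Filter ι} {f : ι → ℝ → Sp d → F} (hp : 0 < p)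
    (h : ∀ κ : ℝ, 0 < κ → ∀ᶠ i in l, ∀ᵐ t ∂volume.restrict (Icc 0 T),
      ∫⁻ x in Ω, ‖f i t x‖ₑ ^ p ≤ ENNReal.ofReal κ) :
    Tendsto (fun i => normLinfLp T Ω (ENNReal.ofReal p) (f i)) l (𝓝 0) := by
  rw [ENNReal.tendsto_nhds_zero]
  intro e he
  obtain ⟨e', he'0, he'⟩ : ∃ e' : ℝ, 0 < e' ∧ ENNReal.ofReal e' ≤ e := by
    by_cases htop : e = ⊤
    · exact ⟨1, one_pos, by simp [htop]⟩
    · exact ⟨e.toReal, ENNReal.toReal_pos he.ne' htop, (ENNReal.ofReal_toReal htop).le⟩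
  filter_upwards [h (e' ^ p) (by positivity)] with i hi
  refine le_trans (essSup_le_of_ae_le _ ?_) he'
  filter_upwards [hi] with t ht
  rw [eLpNorm_eq_lintegral_rpow_enorm_toReal (by simpa using hp) ENNReal.ofReal_ne_top,
    ENNReal.toReal_ofReal hp.le]
  refine (ENNReal.rpow_le_rpow ht (by positivity)).trans ?_
  rw [ENNReal.ofReal_rpow_of_pos (by positivity), ← Real.rpow_mul he'0.le,
    mul_one_div_cancel hp.ne', Real.rpow_one]

/-! ### The initial relative entropy -/

/-- Finite energy excludes momentum in vacuum, where the kinetic density would be infinite;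
elsewhere the formulas are algebra. -/
theorem ae_pseudoVelocity {d : ℕ} {Ω : Set (Sp d)} {γ : ℝ} {ρ₀ : Sp d → ℝ} {J₀ : Sp d → Sp d}
    (hρ : AEStronglyMeasurable ρ₀ (volume.restrict Ω))
    (hJ : AEStronglyMeasurable J₀ (volume.restrict Ω))
    (h0 : ∀ᵐ x ∂volume.restrict Ω, 0 ≤ ρ₀ x)
    (hfin : ∫⁻ x in Ω, (ENNReal.ofReal (‖J₀ x‖ ^ 2 / 2) / ENNReal.ofReal (ρ₀ x) +
      ENNReal.ofReal (internalEnergy γ (ρ₀ x))) ≠ ⊤) :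
    ∀ᵐ x ∂volume.restrict Ω, J₀ x = √(ρ₀ x) • pseudoVelocity ρ₀ J₀ x ∧
      ENNReal.ofReal (‖J₀ x‖ ^ 2 / 2) / ENNReal.ofReal (ρ₀ x) =
        ENNReal.ofReal (‖pseudoVelocity ρ₀ J₀ x‖ ^ 2 / 2) := by
  have hm : AEMeasurable (fun x => ENNReal.ofReal (‖J₀ x‖ ^ 2 / 2) / ENNReal.ofReal (ρ₀ x) +
      ENNReal.ofReal (internalEnergy γ (ρ₀ x))) (volume.restrict Ω) := by
    refine AEMeasurable.add (AEMeasurable.div ?_ hρ.aemeasurable.ennreal_ofReal) ?_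
    · exact ((hJ.norm.aemeasurable.pow_const 2).div_const 2).ennreal_ofReal
    · exact ((hρ.aemeasurable.pow_const γ).div_const (γ - 1)).ennreal_ofReal
  filter_upwards [ae_lt_top' hm hfin, h0] with x hx hx0
  have hx1 := (ENNReal.add_lt_top.1 hx).1
  rw [pseudoVelocity]
  rcases hx0.eq_or_lt with h | h
  · rw [← h] at hx1 ⊢
    have hJ0 : J₀ x = 0 := by
      by_contra hne
      have : ENNReal.ofReal (‖J₀ x‖ ^ 2 / 2) ≠ 0 := by
        have : 0 < ‖J₀ x‖ := norm_pos_iff.2 hne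
        exact (ENNReal.ofReal_pos.2 (by positivity)).ne'
      rw [ENNReal.ofReal_zero, ENNReal.div_zero this] at hx1
      exact lt_irrefl _ hx1
    simp [hJ0]
  · have hs : 0 < √(ρ₀ x) := Real.sqrt_pos.2 h
    refine ⟨by rw [smul_smul, mul_inv_cancel₀ hs.ne', one_smul], ?_⟩
    rw [← ENNReal.ofReal_div_of_pos h, norm_smul, mul_pow, norm_inv, Real.norm_of_nonneg hs.le,
      inv_pow, Real.sq_sqrt h.le]
    congr 1
    field_simp

namespace IsStrongEulerSolution

variable {d : ℕ} {Ω : C3Domain d} {γ T : ℝ} {r : ℝ → Sp d → ℝ} {u : ℝ → Sp d → Sp d}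

theorem aestronglyMeasurable_rho (hE : IsStrongEulerSolution Ω γ T r u) {t : ℝ}
    (ht : t ∈ Icc 0 T) : AEStronglyMeasurable (r t) (volume.restrict Ω.carrier) :=
  (hE.rho_space.spaceReg.extendsCont.continuousOn_slice ht).aestronglyMeasurable
    Ω.isOpen.measurableSet

/-- Energy and relative entropy share the same capillary part, and the remaining densities differ by
the action density. The resulting equality identifies the right side of the relative entropy bound,
taken with E the initial energy, as the initial relative entropy. -/
theorem initial_entropy (hE : IsStrongEulerSolution Ω γ T r u) (hT : 0 < T) (hγ : 1 < γ)
    {c α ε : ℝ} {ρ₀ : Sp d → ℝ} {J₀ : Sp d → Sp d} (h0 : ∀ᵐ x ∂volume.restrict Ω.carrier, 0 ≤ ρ₀ x)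
    (hρ : IntegrableOn ρ₀ Ω.carrier) (hJ : IntegrableOn J₀ Ω.carrier)
    (hfin : totalEnergy Ω.carrier γ c α ε ρ₀ J₀ < ⊤)
    (hA : IntegrableOn (actionDensity γ ρ₀ J₀ r u 0) Ω.carrier) :
    (∀ᵐ x ∂volume.restrict Ω.carrier, J₀ x = √(ρ₀ x) • pseudoVelocity ρ₀ J₀ x) ∧
    IntegrableOn (fun x => ‖pseudoVelocity ρ₀ J₀ x‖ ^ 2 / 2 + ρ₀ x ^ γ / (γ - 1)) Ω.carrier ∧
    ∫ x in Ω.carrier, (‖pseudoVelocity ρ₀ J₀ x‖ ^ 2 / 2 + ρ₀ x ^ γ / (γ - 1)) ≤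
      (totalEnergy Ω.carrier γ c α ε ρ₀ J₀).toReal ∧
    (relEntropy Ω.carrier γ c α ε ρ₀ (pseudoVelocity ρ₀ J₀) (r 0) (u 0)).toReal =
      (totalEnergy Ω.carrier γ c α ε ρ₀ J₀).toReal +
        ∫ x in Ω.carrier, actionDensity γ ρ₀ J₀ r u 0 x := by
  have hm := Ω.isOpen.measurableSet
  have ht : (0 : ℝ) ∈ Icc 0 T := ⟨le_rfl, hT.le⟩
  obtain ⟨hI, hcap⟩ := ENNReal.add_lt_top.1 hfin
  set cap := ENNReal.ofReal (ε ^ 2 / 2) *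
    dirichletEnergy Ω.carrier (fun x => capBeta c α (ρ₀ x)) with hcapdef
  set Λ₀ := pseudoVelocity ρ₀ J₀ with hΛ
  have hv := ae_pseudoVelocity hρ.1 hJ.1 h0 hI.ne
  set e : Sp d → ℝ := fun x => ‖Λ₀ x‖ ^ 2 / 2 + ρ₀ x ^ γ / (γ - 1) with he
  have hΛm : AEStronglyMeasurable Λ₀ (volume.restrict Ω.carrier) := by
    have : AEMeasurable (fun x => (√(ρ₀ x))⁻¹) (volume.restrict Ω.carrier) :=
      (Real.continuous_sqrt.comp_aestronglyMeasurable hρ.1).aemeasurable.inv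
    exact this.aestronglyMeasurable.smul hJ.1
  have hem : AEStronglyMeasurable e (volume.restrict Ω.carrier) :=
    (((hΛm.norm.aemeasurable.pow_const 2).div_const 2).add
      ((hρ.1.aemeasurable.pow_const γ).div_const (γ - 1))).aestronglyMeasurable
  have he0 : 0 ≤ᵐ[volume.restrict Ω.carrier] e := by
    filter_upwards [h0] with x hx
    have : 0 < γ - 1 := by linarith
    simp only [he, Pi.zero_apply]
    positivity
  have hIe : ∫⁻ x in Ω.carrier, (ENNReal.ofReal (‖J₀ x‖ ^ 2 / 2) / ENNReal.ofReal (ρ₀ x) +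
      ENNReal.ofReal (internalEnergy γ (ρ₀ x))) = ∫⁻ x in Ω.carrier, ENNReal.ofReal (e x) := by
    refine lintegral_congr_ae ?_
    filter_upwards [hv, h0] with x hx hx0
    have : 0 < γ - 1 := by linarith
    rw [hx.2, ← ENNReal.ofReal_add (by positivity) (by rw [internalEnergy]; positivity)]
    rfl
  have hei : IntegrableOn e Ω.carrier :=
    ⟨hem, (hasFiniteIntegral_iff_ofReal he0).2 (hIe ▸ hI)⟩
  have hE0 : (totalEnergy Ω.carrier γ c α ε ρ₀ J₀).toReal =
      (∫ x in Ω.carrier, e x) + cap.toReal := by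
    rw [totalEnergy, ENNReal.toReal_add hI.ne hcap.ne, hIe,
      ← ofReal_integral_eq_lintegral_ofReal hei he0,
      ENNReal.toReal_ofReal (integral_nonneg_of_ae he0)]
  have hD : ∀ᵐ x ∂volume.restrict Ω.carrier,
      ‖Λ₀ x - √(ρ₀ x) • u 0 x‖ ^ 2 / 2 + relInternalEnergy γ (ρ₀ x) (r 0 x) =
        1 * e x + 1 * actionDensity γ ρ₀ J₀ r u 0 x := by
    filter_upwards [hv, h0, ae_restrict_mem hm] with x hx hx0 hxΩ
    rw [relative_entropy_density_eq hγ (hE.pos ht hxΩ) hx0, ← hx.1, actionDensity, potential]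
    simp only [he]
    ring
  obtain ⟨iD, eD⟩ := integral_linear_comb₂ hei hA 1 1
  have hD0 : 0 ≤ᵐ[volume.restrict Ω.carrier]
      fun x => 1 * e x + 1 * actionDensity γ ρ₀ J₀ r u 0 x := by
    filter_upwards [hD, h0, ae_restrict_mem hm] with x hx hx0 hxΩ
    have := relInternalEnergy_nonneg hγ (hE.pos ht hxΩ) hx0
    rw [← hx, Pi.zero_apply]
    positivity
  have hrel : relEntropy Ω.carrier γ c α ε ρ₀ Λ₀ (r 0) (u 0) =
      ENNReal.ofReal (∫ x in Ω.carrier, (1 * e x + 1 * actionDensity γ ρ₀ J₀ r u 0 x)) + cap := by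
    rw [relEntropy, ofReal_integral_eq_lintegral_ofReal iD hD0]
    congr 1
    refine lintegral_congr_ae ?_
    filter_upwards [hD] with x hx
    rw [hx]
  refine ⟨hv.mono fun x hx => hx.1, hei, ?_, ?_⟩
  · rw [hE0]
    exact le_add_of_nonneg_right ENNReal.toReal_nonneg
  · rw [hrel, ENNReal.toReal_add ENNReal.ofReal_ne_top hcap.ne,
      ENNReal.toReal_ofReal (integral_nonneg_of_ae hD0), eD, hE0]
    ring

/-- A bound of the total energy by the relative entropy and the mass. -/
theorem exists_energy_bound (hE : IsStrongEulerSolution Ω γ T r u) (hT : 0 < T) (hγ : 1 < γ) :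
    ∃ C : ℝ, 0 ≤ C ∧ ∀ {c α ε : ℝ} {ρ₀ : Sp d → ℝ} {J₀ : Sp d → Sp d},
    (∀ᵐ x ∂volume.restrict Ω.carrier, 0 ≤ ρ₀ x) → IntegrableOn ρ₀ Ω.carrier →
    IntegrableOn J₀ Ω.carrier → totalEnergy Ω.carrier γ c α ε ρ₀ J₀ < ⊤ →
    IntegrableOn (actionDensity γ ρ₀ J₀ r u 0) Ω.carrier →
    (totalEnergy Ω.carrier γ c α ε ρ₀ J₀).toReal ≤
      2 * (relEntropy Ω.carrier γ c α ε ρ₀ (pseudoVelocity ρ₀ J₀) (r 0) (u 0)).toReal +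
        C * ∫ x in Ω.carrier, ρ₀ x := by
  have ht : (0 : ℝ) ∈ Icc 0 T := ⟨le_rfl, hT.le⟩
  obtain ⟨P, hP0, hP⟩ := (hE.potential_space hT hγ).spaceReg.extendsCont.exists_bound
  obtain ⟨K, hK0, hK⟩ := hE.u_space.spaceReg.extendsCont.exists_bound
  refine ⟨2 * (P + K ^ 2), by positivity, fun {c α ε ρ₀ J₀} h0 hρ hJ hfin hA => ?_⟩
  obtain ⟨hv, hei, hele, heq⟩ := hE.initial_entropy hT hγ h0 hρ hJ hfin hA
  obtain ⟨i1, e1⟩ := integral_linear_comb₃ hA hρ hei 1 (P + K ^ 2) (1 / 2)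
  -- Young's inequality absorbs J·u into half of the kinetic energy. That half is at most half of
  -- the total energy and moves to the left side, whence the factor 2 in the statement.
  have hpos : 0 ≤ ∫ x in Ω.carrier, (1 * actionDensity γ ρ₀ J₀ r u 0 x + (P + K ^ 2) * ρ₀ x +
      1 / 2 * (‖pseudoVelocity ρ₀ J₀ x‖ ^ 2 / 2 + ρ₀ x ^ γ / (γ - 1))) := by
    refine integral_nonneg_of_ae ?_
    filter_upwards [hv, h0, ae_restrict_mem Ω.isOpen.measurableSet] with x hx hx0 hxΩ
    have h1 := mul_le_mul_of_nonneg_left (neg_le_of_abs_le (hP 0 ht x hxΩ)) hx0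
    have h2 : ⟪J₀ x, u 0 x⟫_ℝ ≤ √(ρ₀ x) * ‖pseudoVelocity ρ₀ J₀ x‖ * K := by
      refine (real_inner_le_norm _ _).trans (mul_le_mul ?_ (hK 0 ht x hxΩ) (norm_nonneg _)
        (by positivity))
      nth_rewrite 1 [hx]
      rw [norm_smul, Real.norm_of_nonneg (Real.sqrt_nonneg _)]
    have h3 := Real.sq_sqrt hx0
    have h4 : √(ρ₀ x) * ‖pseudoVelocity ρ₀ J₀ x‖ * K ≤
        K ^ 2 * ρ₀ x + ‖pseudoVelocity ρ₀ J₀ x‖ ^ 2 / 4 := by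
      nlinarith [sq_nonneg (K * √(ρ₀ x) - ‖pseudoVelocity ρ₀ J₀ x‖ / 2)]
    have h5 : 0 ≤ ρ₀ x ^ γ / (γ - 1) :=
      div_nonneg (Real.rpow_nonneg hx0 γ) (by linarith)
    have h6 : 0 ≤ r 0 x ^ γ := Real.rpow_nonneg (hE.pos ht hxΩ).le γ
    simp only [actionDensity, Pi.zero_apply]
    linarith
  rw [e1] at hpos
  linarith

/-- The relative internal energy controls the `L¹` distance up to the mass far away. -/
theorem exists_lintegral_enorm_sub_le (hE : IsStrongEulerSolution Ω γ T r u) (hγ : 1 < γ)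
    {η : ℝ} (hη : 0 < η) (R : ℝ) :
    ∃ C : ℝ, 0 ≤ C ∧ ∀ t ∈ Icc 0 T, ∀ s : Sp d → ℝ,
      (∀ᵐ x ∂volume.restrict Ω.carrier, 0 ≤ s x) → ∀ a : ℝ, 0 ≤ a →
      ∫⁻ x in Ω.carrier, ENNReal.ofReal (relInternalEnergy γ (s x) (r t x)) ≤ ENNReal.ofReal a →
      ∫⁻ x in Ω.carrier, ‖s x - r t x‖ₑ ≤ ENNReal.ofReal (C * a + η) +
        ((∫⁻ x in Ω.carrier ∩ {x | R < ‖x‖}, ENNReal.ofReal (s x)) +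
          ∫⁻ x in Ω.carrier ∩ {x | R < ‖x‖}, ENNReal.ofReal (r t x)) := by
  have hm := Ω.isOpen.measurableSet
  obtain ⟨K, hK0, hK⟩ := hE.rho_space.spaceReg.extendsCont.exists_bound
  set V := (volume (Metric.closedBall (0 : Sp d) R)).toReal with hV
  have hVf : volume (Metric.closedBall (0 : Sp d) R) ≠ ⊤ := measure_closedBall_lt_top.ne
  -- The pointwise error is integrated over a set of volume at most V, which gives at most η.
  obtain ⟨C, hC0, hC⟩ := exists_abs_sub_le (δ := η / (V + 1)) hγ (by positivity) hK0
  refine ⟨C, hC0, fun t ht s h0 a ha hle => ?_⟩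
  set S : Set (Sp d) := {x | R < ‖x‖} with hS
  have hSm : MeasurableSet S := (isOpen_lt continuous_const continuous_norm).measurableSet
  have hr := hE.aestronglyMeasurable_rho ht
  have hsplit := lintegral_inter_add_sdiff (μ := volume) (fun x => ‖s x - r t x‖ₑ) Ω.carrier hSm
  rw [← hsplit, add_comm]
  refine add_le_add ?_ ?_
  · have hsub : Ω.carrier \ S ⊆ Ω.carrier := sdiff_subset
    have hball : Ω.carrier \ S ⊆ Metric.closedBall 0 R := fun x hx => by
      simpa [hS] using hx.2
    calc ∫⁻ x in Ω.carrier \ S, ‖s x - r t x‖ₑ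
        ≤ ∫⁻ x in Ω.carrier \ S, (ENNReal.ofReal C *
            ENNReal.ofReal (relInternalEnergy γ (s x) (r t x)) + ENNReal.ofReal (η / (V + 1))) := by
          refine lintegral_mono_ae ?_
          filter_upwards [ae_mono (Measure.restrict_mono hsub le_rfl) h0,
            ae_restrict_mem (hm.diff hSm)] with x hx hxΩ
          have hp := hE.pos ht hxΩ.1
          have hf := relInternalEnergy_nonneg hγ hp hx
          rw [← ENNReal.ofReal_mul hC0, ← ENNReal.ofReal_add (by positivity) (by positivity),
            Real.enorm_eq_ofReal_abs]
          exact ENNReal.ofReal_le_ofReal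
            (hC _ _ hx hp ((le_abs_self _).trans (hK t ht x hxΩ.1)))
      _ = ENNReal.ofReal C * (∫⁻ x in Ω.carrier \ S,
            ENNReal.ofReal (relInternalEnergy γ (s x) (r t x))) +
            ENNReal.ofReal (η / (V + 1)) * volume (Ω.carrier \ S) := by
          rw [lintegral_add_right _ measurable_const, lintegral_const_mul' _ _ ENNReal.ofReal_ne_top,
            lintegral_const, Measure.restrict_apply_univ]
      _ ≤ ENNReal.ofReal C * ENNReal.ofReal a + ENNReal.ofReal (η / (V + 1)) * ENNReal.ofReal V := by
          rw [hV, ENNReal.ofReal_toReal hVf]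
          gcongr
          exact (lintegral_mono_set hsub).trans hle
      _ ≤ ENNReal.ofReal (C * a + η) := by
          have hV0 : 0 ≤ V := ENNReal.toReal_nonneg
          rw [← ENNReal.ofReal_mul hC0, ← ENNReal.ofReal_mul (by positivity),
            ← ENNReal.ofReal_add (by positivity) (by positivity)]
          refine ENNReal.ofReal_le_ofReal (add_le_add_right ?_ _)
          rw [div_mul_eq_mul_div, div_le_iff₀ (by positivity)]
          nlinarith
  · have hsub : Ω.carrier ∩ S ⊆ Ω.carrier := inter_subset_left
    rw [← lintegral_add_right' _ (hr.mono_measure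
      (Measure.restrict_mono hsub le_rfl)).aemeasurable.ennreal_ofReal]
    refine lintegral_mono_ae ?_
    filter_upwards [ae_mono (Measure.restrict_mono hsub le_rfl) h0,
      ae_restrict_mem (hm.inter hSm)] with x hx hxΩ
    have hp := hE.pos ht hxΩ.1
    rw [← ENNReal.ofReal_add hx hp.le, Real.enorm_eq_ofReal_abs]
    refine ENNReal.ofReal_le_ofReal ((abs_sub _ _).trans ?_)
    rw [abs_of_nonneg hx, abs_of_pos hp]

end IsStrongEulerSolution

/-! ### Uniform estimates along the limit -/

namespace IsStrongEulerSolution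

variable {d : ℕ} {Ω : C3Domain d} {γ T : ℝ} {r : ℝ → Sp d → ℝ} {u : ℝ → Sp d → Sp d}

theorem integrableOn_actionDensity_zero (hE : IsStrongEulerSolution Ω γ T r u) (hT : 0 < T)
    (hγ : 1 < γ) (hr0 : IntegrableOn (r 0) Ω.carrier) {ρ₀ : Sp d → ℝ} {J₀ : Sp d → Sp d}
    (hρ : IntegrableOn ρ₀ Ω.carrier) (hJ : IntegrableOn J₀ Ω.carrier) :
    IntegrableOn (actionDensity γ ρ₀ J₀ r u 0) Ω.carrier := by
  have hm := Ω.isOpen.measurableSet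
  have ht : (0 : ℝ) ∈ Icc 0 T := ⟨le_rfl, hT.le⟩
  have xP := (hE.potential_space hT hγ).spaceReg.extendsCont
  have xu := hE.u_space.spaceReg.extendsCont
  obtain ⟨P, hP0, hP⟩ := xP.exists_bound
  obtain ⟨K, hK0, hK⟩ := xu.exists_bound
  obtain ⟨M, -, hM⟩ := hE.exists_rpow_bound hT hγ hr0
  have i1 : IntegrableOn (fun x => ρ₀ x * potential γ r u 0 x) Ω.carrier := by
    refine (hρ.norm.mul_const P).mono'
      (hρ.1.mul ((xP.continuousOn_slice ht).aestronglyMeasurable hm)) ?_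
    filter_upwards [ae_restrict_mem hm] with x hx
    rw [norm_mul]
    exact mul_le_mul_of_nonneg_left (hP 0 ht x hx) (norm_nonneg _)
  have i2 : IntegrableOn (fun x => ⟪J₀ x, u 0 x⟫_ℝ) Ω.carrier := by
    refine (hJ.norm.mul_const K).mono'
      (hJ.1.inner ((xu.continuousOn_slice ht).aestronglyMeasurable hm)) ?_
    filter_upwards [ae_restrict_mem hm] with x hx
    exact (norm_inner_le_norm _ _).trans
      (mul_le_mul_of_nonneg_left (hK 0 ht x hx) (norm_nonneg _))
  exact (i1.sub i2).add (hM 0 ht).1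

/-- A bound of the mass when the relative entropy is at most one. -/
theorem exists_mass_bound (hE : IsStrongEulerSolution Ω γ T r u) (hT : 0 < T) (hγ : 1 < γ)
    (hr0 : IntegrableOn (r 0) Ω.carrier) (R : ℝ) :
    ∃ m : ℝ, 0 ≤ m ∧ ∀ {c α ε : ℝ} {ρ₀ : Sp d → ℝ} {Λ₀ : Sp d → Sp d},
    (∀ᵐ x ∂volume.restrict Ω.carrier, 0 ≤ ρ₀ x) → IntegrableOn ρ₀ Ω.carrier →
    relEntropy Ω.carrier γ c α ε ρ₀ Λ₀ (r 0) (u 0) ≤ 1 →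
    ∫ x in Ω.carrier ∩ {x | R < ‖x‖}, ρ₀ x ≤ 1 → ∫ x in Ω.carrier, ρ₀ x ≤ m := by
  have hm := Ω.isOpen.measurableSet
  have ht : (0 : ℝ) ∈ Icc 0 T := ⟨le_rfl, hT.le⟩
  obtain ⟨C, hC0, hC⟩ := hE.exists_lintegral_enorm_sub_le hγ one_pos R
  have hrpos : 0 ≤ᵐ[volume.restrict Ω.carrier] r 0 := by
    filter_upwards [ae_restrict_mem hm] with x hx
    exact (hE.pos ht hx).le
  set M := ∫ x in Ω.carrier, r 0 x with hM
  have hM0 : 0 ≤ M := integral_nonneg_of_ae hrpos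
  have hMl : ∫⁻ x in Ω.carrier, ENNReal.ofReal (r 0 x) = ENNReal.ofReal M :=
    (ofReal_integral_eq_lintegral_ofReal hr0 hrpos).symm
  -- The bound C·1 + 1 controls |ρ₀ - r| inside the ball, 1 + M the two tails, and the last M the
  -- mass of r itself.
  refine ⟨C * 1 + 1 + (1 + M) + M, by positivity, fun {c α ε ρ₀ Λ₀} h0 hρ hrel htail => ?_⟩
  have hint : ∫⁻ x in Ω.carrier, ENNReal.ofReal (relInternalEnergy γ (ρ₀ x) (r 0 x)) ≤
      ENNReal.ofReal 1 := by
    rw [ENNReal.ofReal_one]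
    refine (lintegral_mono fun x => ENNReal.ofReal_le_ofReal ?_).trans
      (le_self_add.trans hrel)
    exact le_add_of_nonneg_left (by positivity)
  have hsub : Ω.carrier ∩ {x | R < ‖x‖} ⊆ Ω.carrier := inter_subset_left
  have h1 := hC 0 ht ρ₀ h0 1 zero_le_one hint
  have h2 : ∫⁻ x in Ω.carrier ∩ {x | R < ‖x‖}, ENNReal.ofReal (ρ₀ x) ≤ ENNReal.ofReal 1 := by
    rw [← ofReal_integral_eq_lintegral_ofReal (hρ.mono_set hsub)
      (ae_mono (Measure.restrict_mono hsub le_rfl) h0)]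
    exact ENNReal.ofReal_le_ofReal htail
  have h3 : ∫⁻ x in Ω.carrier ∩ {x | R < ‖x‖}, ENNReal.ofReal (r 0 x) ≤ ENNReal.ofReal M :=
    hMl ▸ lintegral_mono_set hsub
  have h4 : ∫⁻ x in Ω.carrier, ENNReal.ofReal (ρ₀ x) ≤
      (∫⁻ x in Ω.carrier, ‖ρ₀ x - r 0 x‖ₑ) + ∫⁻ x in Ω.carrier, ENNReal.ofReal (r 0 x) := by
    rw [← lintegral_add_right' _ hr0.1.aemeasurable.ennreal_ofReal]
    refine lintegral_mono_ae ?_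
    filter_upwards [hrpos] with x hx
    rw [Real.enorm_eq_ofReal_abs, ← ENNReal.ofReal_add (abs_nonneg _) hx]
    exact ENNReal.ofReal_le_ofReal (by linarith [le_abs_self (ρ₀ x - r 0 x)])
  refine (integrable_of_lintegral_ofReal_le (by positivity) hρ.1 h0 ?_).2
  rw [ENNReal.ofReal_add (by positivity) hM0, ENNReal.ofReal_add (by positivity) (by positivity),
    ENNReal.ofReal_add zero_le_one hM0]
  refine h4.trans (add_le_add (h1.trans (add_le_add le_rfl (add_le_add h2 h3))) hMl.le)

/-- Uniform bounds of the mass and of the energy of the initial data. -/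
theorem eventually_initial_bounds (hE : IsStrongEulerSolution Ω γ T r u) (hT : 0 < T) (hγ : 1 < γ)
    (hr0 : IntegrableOn (r 0) Ω.carrier) {c α : ℝ} {l : Filter ℝ}
    {ρ₀ : ℝ → Sp d → ℝ} {J₀ : ℝ → Sp d → Sp d} {ρ : ℝ → ℝ → Sp d → ℝ} {J Λ : ℝ → ℝ → Sp d → Sp d}
    (hsol : ∀ᶠ ε in l,
      IsFiniteEnergyWeakSolution Ω γ c α ε T (ρ₀ ε) (J₀ ε) (ρ ε) (J ε) (Λ ε))
    (htail : ∀ η : ℝ, 0 < η → ∃ R : ℝ, ∀ᶠ ε in l,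
      ∫ x in Ω.carrier ∩ {x | R < ‖x‖}, ρ₀ ε x ≤ η)
    (hinit : Tendsto (fun ε => relEntropy Ω.carrier γ c α ε (ρ₀ ε)
      (pseudoVelocity (ρ₀ ε) (J₀ ε)) (r 0) (u 0)) l (𝓝 0)) :
    ∃ m E : ℝ, 0 ≤ m ∧ 0 ≤ E ∧ ∀ᶠ ε in l, ∫ x in Ω.carrier, ρ₀ ε x ≤ m ∧
      totalEnergy Ω.carrier γ c α ε (ρ₀ ε) (J₀ ε) ≤ ENNReal.ofReal E := by
  obtain ⟨R, hR⟩ := htail 1 one_pos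
  obtain ⟨m, hm0, hm⟩ := hE.exists_mass_bound hT hγ hr0 R
  obtain ⟨C, hC0, hC⟩ := hE.exists_energy_bound hT hγ
  refine ⟨m, 2 * 1 + C * m, hm0, by positivity, ?_⟩
  filter_upwards [hsol, hR, ENNReal.tendsto_nhds_zero.1 hinit 1 one_pos]
    with ε ⟨B, H, hW⟩ hRε hrel
  have h1 := hm hW.initial_nonneg hW.initial_rho hrel hRε
  refine ⟨h1, ?_⟩
  have h2 := hC hW.initial_nonneg hW.initial_rho hW.initial_J hW.initial_energy
    (hE.integrableOn_actionDensity_zero hT hγ hr0 hW.initial_rho hW.initial_J)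
  have h3 : (relEntropy Ω.carrier γ c α ε (ρ₀ ε) (pseudoVelocity (ρ₀ ε) (J₀ ε)) (r 0)
      (u 0)).toReal ≤ 1 := ENNReal.toReal_mono ENNReal.one_ne_top hrel
  rw [← ENNReal.ofReal_toReal hW.initial_energy.ne]
  refine ENNReal.ofReal_le_ofReal (h2.trans ?_)
  have h4 := mul_le_mul_of_nonneg_left h1 hC0
  linarith

/-- The relative entropy of almost every time slice is small. -/
theorem eventually_slices_close (hE : IsStrongEulerSolution Ω γ T r u) (hT : 0 < T) (hγ : 1 < γ)
    (hr0 : IntegrableOn (r 0) Ω.carrier) {c α : ℝ} (hc : 0 < c) (hα : -1 ≤ α)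
    {ρ₀ : ℝ → Sp d → ℝ} {J₀ : ℝ → Sp d → Sp d} {ρ : ℝ → ℝ → Sp d → ℝ} {J Λ : ℝ → ℝ → Sp d → Sp d}
    (hsol : ∀ᶠ ε in 𝓝[>] (0 : ℝ),
      IsFiniteEnergyWeakSolution Ω γ c α ε T (ρ₀ ε) (J₀ ε) (ρ ε) (J ε) (Λ ε))
    (hinit : Tendsto (fun ε => relEntropy Ω.carrier γ c α ε (ρ₀ ε)
      (pseudoVelocity (ρ₀ ε) (J₀ ε)) (r 0) (u 0)) (𝓝[>] (0 : ℝ)) (𝓝 0))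
    {m E : ℝ} (hm0 : 0 ≤ m) (hE0 : 0 ≤ E)
    (hbd : ∀ᶠ ε in 𝓝[>] (0 : ℝ), ∫ x in Ω.carrier, ρ₀ ε x ≤ m ∧
      totalEnergy Ω.carrier γ c α ε (ρ₀ ε) (J₀ ε) ≤ ENNReal.ofReal E)
    {κ : ℝ} (hκ : 0 < κ) :
    ∀ᶠ ε in 𝓝[>] (0 : ℝ), ∀ᵐ t ∂volume.restrict (Icc 0 T),
      ∫⁻ x in Ω.carrier, ENNReal.ofReal (relInternalEnergy γ (ρ ε t x) (r t x)) ≤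
        ENNReal.ofReal κ ∧
      ∫⁻ x in Ω.carrier, ‖Λ ε t x - √(ρ ε t x) • u t x‖ₑ ^ (2 : ℝ) ≤ ENNReal.ofReal κ := by
  have hmΩ := Ω.isOpen.measurableSet
  obtain ⟨C, hC0, hC⟩ := hE.exists_relative_entropy_bound hT hγ hα hr0
  set X := Real.exp (C * T) with hX
  have hX0 : 0 < X := Real.exp_pos _
  -- With the initial relative entropy and TCη both at most κ/(4X), the Grönwall factor X gives κ/2;
  -- the remaining factor 2 undoes the half in |Λ - √ρ u|²/2.
  set η := κ / (4 * X * (T * C + 1)) with hη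
  have hη0 : 0 < η := by positivity
  have hηle : T * (C * η) ≤ κ / (4 * X) := by
    rw [hη, le_div_iff₀ (by positivity)]
    field_simp
    linarith
  -- The energy inequality gives ε²∫|B|² ≤ 2E.
  obtain ⟨ε₀, hε₀, hcap⟩ := Ω.capillary_small hc hα hm0 (by positivity : 0 ≤ 2 * E) hη0
  filter_upwards [hsol, hbd, Ioc_mem_nhdsGT hε₀, ENNReal.tendsto_nhds_zero.1 hinit
    (ENNReal.ofReal (κ / (4 * X))) (ENNReal.ofReal_pos.2 (by positivity))]
    with ε ⟨B, H, hW⟩ ⟨hmass, hen⟩ ⟨hε, hεε₀⟩ hrel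
  have hH : ∀ᵐ t ∂volume.restrict (Icc 0 T),
      ∫⁻ x in Ω.carrier, ‖H t x‖ₑ ≤ ENNReal.ofReal (η / ε ^ 2) := by
    filter_upwards [hW.ae_measurable_slices, hW.ae_integrable_mass_le hγ hε hT,
      hW.ae_energy hγ hε hE0 hen, hW.ae_energy_bounds hγ hε hE0 hen, hW.grad_beta, hW.grad_K,
      ae_restrict_mem measurableSet_Icc] with t ⟨m1, _, _, _⟩ ⟨i1, i2⟩ ⟨_, _, iB, _⟩ ⟨_, _, bB⟩
      gB gK ht
    refine hcap ε hε hεε₀ (ρ ε t) (B t) (H t) m1 (hW.nonneg t ht) ?_ gB gK ?_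
    · rw [← ofReal_integral_eq_lintegral_ofReal i1 (hW.nonneg t ht)]
      exact ENNReal.ofReal_le_ofReal (i2.trans hmass)
    · have := lintegral_enorm_rpow_le (f := B t) (p := 2) (κ := 2 * E / ε ^ 2) zero_le_two
        (by simpa [IntegrableOn] using iB)
        (by rw [le_div_iff₀ (by positivity), mul_comm]; simpa using bB)
      simpa using this
  -- From here on the energy of the given initial data is used, not the uniform bound E: only then
  -- does the right side reduce to the initial relative entropy.
  have hEeq := (ENNReal.ofReal_toReal hW.initial_energy.ne).ge
  obtain ⟨hA, hS⟩ := hC hW hε hη0.le hEeq ENNReal.toReal_nonneg hH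
  obtain ⟨-, -, -, heq⟩ := hE.initial_entropy hT hγ hW.initial_nonneg hW.initial_rho
    hW.initial_J hW.initial_energy hA
  rw [← heq] at hS
  have hrel' := ENNReal.toReal_le_of_le_ofReal (by positivity) hrel
  filter_upwards [hS, ae_restrict_mem measurableSet_Icc] with t ⟨iD, bD⟩ ht
  have hle : ∫ x in Ω.carrier, entropyDensity γ ε (ρ ε t) (Λ ε t) (B t) (r t) (u t) x ≤ κ / 2 := by
    refine bD.trans ?_
    have h1 : Real.exp (C * t) ≤ X :=
      Real.exp_le_exp.2 (mul_le_mul_of_nonneg_left ht.2 hC0)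
    have h2 : κ / 2 = X * (κ / (4 * X) + κ / (4 * X)) := by field_simp; norm_num
    rw [h2]
    refine mul_le_mul h1 (add_le_add hrel' hηle) ?_ hX0.le
    have : 0 ≤ T * (C * η) := by positivity
    exact add_nonneg ENNReal.toReal_nonneg this
  have hf : ∀ᵐ x ∂volume.restrict Ω.carrier, 0 ≤ relInternalEnergy γ (ρ ε t x) (r t x) := by
    filter_upwards [hW.nonneg t ht, ae_restrict_mem hmΩ] with x hx hxΩ
    exact relInternalEnergy_nonneg hγ (hE.pos ht hxΩ) hx
  have hD0 : ∀ᵐ x ∂volume.restrict Ω.carrier,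
      0 ≤ entropyDensity γ ε (ρ ε t) (Λ ε t) (B t) (r t) (u t) x := by
    filter_upwards [hf] with x hx
    rw [entropyDensity]
    positivity
  have hD2 : ∫⁻ x in Ω.carrier,
      ENNReal.ofReal (2 * entropyDensity γ ε (ρ ε t) (Λ ε t) (B t) (r t) (u t) x) ≤
      ENNReal.ofReal κ := by
    rw [← ofReal_integral_eq_lintegral_ofReal (iD.const_mul 2)
      (hD0.mono fun x hx => mul_nonneg zero_le_two hx), integral_const_mul]
    exact ENNReal.ofReal_le_ofReal (by linarith)
  constructor
  · refine le_trans (lintegral_mono_ae ?_) hD2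
    filter_upwards [hf] with x hx
    refine ENNReal.ofReal_le_ofReal ?_
    have h1 : 0 ≤ ‖Λ ε t x - √(ρ ε t x) • u t x‖ ^ 2 := by positivity
    have h2 : 0 ≤ ε ^ 2 / 2 * ‖B t x‖ ^ 2 := by positivity
    rw [entropyDensity]
    linarith
  · refine le_trans (lintegral_mono_ae ?_) hD2
    filter_upwards [hf] with x hx
    rw [ENNReal.rpow_two, ← ofReal_norm, ← ENNReal.ofReal_pow (norm_nonneg _)]
    refine ENNReal.ofReal_le_ofReal ?_
    have h2 : 0 ≤ ε ^ 2 / 2 * ‖B t x‖ ^ 2 := by positivity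
    rw [entropyDensity]
    linarith

end IsStrongEulerSolution

/-- The densities are uniformly small far away. -/
theorem eventually_slices_tail {d : ℕ} {Ω : C3Domain d} {γ c α T : ℝ} (hT : 0 < T) (hγ : 1 < γ)
    {ρ₀ : ℝ → Sp d → ℝ} {J₀ : ℝ → Sp d → Sp d} {ρ : ℝ → ℝ → Sp d → ℝ} {J Λ : ℝ → ℝ → Sp d → Sp d}
    (hsol : ∀ᶠ ε in 𝓝[>] (0 : ℝ),
      IsFiniteEnergyWeakSolution Ω γ c α ε T (ρ₀ ε) (J₀ ε) (ρ ε) (J ε) (Λ ε))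
    (htail : ∀ η : ℝ, 0 < η → ∃ R : ℝ, ∀ᶠ ε in 𝓝[>] (0 : ℝ),
      ∫ x in Ω.carrier ∩ {x | R < ‖x‖}, ρ₀ ε x ≤ η)
    {E : ℝ} (hE0 : 0 ≤ E) (hen : ∀ᶠ ε in 𝓝[>] (0 : ℝ),
      totalEnergy Ω.carrier γ c α ε (ρ₀ ε) (J₀ ε) ≤ ENNReal.ofReal E) {η : ℝ} (hη : 0 < η) :
    ∃ R : ℝ, ∀ᶠ ε in 𝓝[>] (0 : ℝ), ∀ᵐ t ∂volume.restrict (Icc 0 T),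
      ∫⁻ x in Ω.carrier ∩ {x | R < ‖x‖}, ENNReal.ofReal (ρ ε t x) ≤ ENNReal.ofReal η := by
  obtain ⟨C, hC0, hC⟩ := exists_tail_bound d
  set X := Real.exp (C * T) with hX
  have hX0 : 0 < X := Real.exp_pos _
  obtain ⟨R₁, hR₁⟩ := htail (η / (2 * X)) (by positivity)
  -- R ≥ 1 bounds the exponential by X, R ≥ R₁ makes the initial tail small, and the last summand
  -- makes T(C/R)(2E) at most η/(2X).
  set R := 1 + |R₁| + 4 * X * T * C * E / η with hR
  have hRpos : 0 ≤ 4 * X * T * C * E / η := by positivity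
  have hR1 : 1 ≤ R := by linarith [abs_nonneg R₁]
  have hRR₁ : R₁ ≤ R := by linarith [le_abs_self R₁]
  have hR0 : 0 < R := by linarith
  have hRη : 4 * X * T * C * E ≤ R * η := by
    rw [← div_le_iff₀ hη]
    linarith [abs_nonneg R₁]
  refine ⟨2 * R, ?_⟩
  filter_upwards [hsol, hR₁, hen, self_mem_nhdsWithin] with ε ⟨B, H, hW⟩ h1 h2 hε
  filter_upwards [hC hW hγ hε hT hE0 h2 hR0] with t ht
  refine ht.trans (ENNReal.ofReal_le_ofReal ?_)
  have hsub : Ω.carrier ∩ {x | R < ‖x‖} ⊆ Ω.carrier ∩ {x | R₁ < ‖x‖} :=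
    inter_subset_inter_right _ fun x hx => lt_of_le_of_lt hRR₁ hx
  have h3 : ∫ x in Ω.carrier ∩ {x | R < ‖x‖}, ρ₀ ε x ≤ η / (2 * X) :=
    (setIntegral_mono_set (hW.initial_rho.mono_set inter_subset_left)
      (ae_mono (Measure.restrict_mono inter_subset_left le_rfl) hW.initial_nonneg)
      (LE.le.eventuallyLE hsub)).trans h1
  have h4 : Real.exp (C / R * T) ≤ X :=
    Real.exp_le_exp.2 (mul_le_mul_of_nonneg_right (div_le_self hC0 hR1) hT.le)
  have h5 : T * (C / R * (2 * E)) ≤ η / (2 * X) := by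
    rw [le_div_iff₀ (by positivity)]
    have : T * (C / R * (2 * E)) * (2 * X) = 4 * X * T * C * E / R := by ring
    rw [this, div_le_iff₀ hR0]
    linarith
  have h6 : η = X * (η / (2 * X) + η / (2 * X)) := by field_simp; norm_num
  rw [h6]
  refine mul_le_mul h4 (add_le_add h3 h5) (add_nonneg ?_ (by positivity)) hX0.le
  exact integral_nonneg_of_ae
    (ae_mono (Measure.restrict_mono inter_subset_left le_rfl) hW.initial_nonneg)

/-! ### Convergence -/

namespace IsStrongEulerSolution

variable {d : ℕ} {Ω : C3Domain d} {γ T : ℝ} {r : ℝ → Sp d → ℝ} {u : ℝ → Sp d → Sp d}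
  {l : Filter ℝ} {ρ : ℝ → ℝ → Sp d → ℝ}

/-- In L¹ the coercivity error is a constant, integrable only over bounded sets, so the tails of
both densities must be uniformly small. Each of four contributions receives κ/4. -/
theorem eventually_lintegral_sub_le (hE : IsStrongEulerSolution Ω γ T r u) (hT : 0 < T)
    (hγ : 1 < γ) (hr0 : IntegrableOn (r 0) Ω.carrier)
    (h0 : ∀ᶠ ε in l, ∀ᵐ t ∂volume.restrict (Icc 0 T), ∀ᵐ x ∂volume.restrict Ω.carrier, 0 ≤ ρ ε t x)
    (hclose : ∀ κ : ℝ, 0 < κ → ∀ᶠ ε in l, ∀ᵐ t ∂volume.restrict (Icc 0 T),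
      ∫⁻ x in Ω.carrier, ENNReal.ofReal (relInternalEnergy γ (ρ ε t x) (r t x)) ≤ ENNReal.ofReal κ)
    (htail : ∀ η : ℝ, 0 < η → ∃ R : ℝ, ∀ᶠ ε in l, ∀ᵐ t ∂volume.restrict (Icc 0 T),
      ∫⁻ x in Ω.carrier ∩ {x | R < ‖x‖}, ENNReal.ofReal (ρ ε t x) ≤ ENNReal.ofReal η)
    {κ : ℝ} (hκ : 0 < κ) :
    ∀ᶠ ε in l, ∀ᵐ t ∂volume.restrict (Icc 0 T),
      ∫⁻ x in Ω.carrier, ‖ρ ε t x - r t x‖ₑ ≤ ENNReal.ofReal κ := by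
  obtain ⟨R₁, hR₁⟩ := htail (κ / 4) (by positivity)
  obtain ⟨R₂, hR₂⟩ := hE.exists_tail hT hr0 (by positivity : 0 < κ / 4)
  obtain ⟨C, hC0, hC⟩ := hE.exists_lintegral_enorm_sub_le hγ (by positivity : 0 < κ / 4) (max R₁ R₂)
  filter_upwards [h0, hR₁, hclose (κ / (4 * (C + 1))) (by positivity)] with ε h0ε h1 h2
  filter_upwards [h0ε, h1, h2, ae_restrict_mem measurableSet_Icc] with t h0t h1t h2t ht
  refine (hC t ht (ρ ε t) h0t _ (by positivity) h2t).trans ?_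
  have hfar : ∀ R ≤ max R₁ R₂, Ω.carrier ∩ {x | max R₁ R₂ < ‖x‖} ⊆ Ω.carrier ∩ {x | R < ‖x‖} :=
    fun R hR => inter_subset_inter_right _ fun x hx => lt_of_le_of_lt hR hx
  have h3 : ∫⁻ x in Ω.carrier ∩ {x | max R₁ R₂ < ‖x‖}, ENNReal.ofReal (ρ ε t x) ≤
      ENNReal.ofReal (κ / 4) :=
    (lintegral_mono_set (hfar _ (le_max_left _ _))).trans h1t
  have h4 : ∫⁻ x in Ω.carrier ∩ {x | max R₁ R₂ < ‖x‖}, ENNReal.ofReal (r t x) ≤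
      ENNReal.ofReal (κ / 4) :=
    (lintegral_mono_set (hfar _ (le_max_right _ _))).trans (hR₂ t ht)
  refine (add_le_add le_rfl (add_le_add h3 h4)).trans ?_
  rw [← ENNReal.ofReal_add (by positivity) (by positivity),
    ← ENNReal.ofReal_add (by positivity) (by positivity)]
  refine ENNReal.ofReal_le_ofReal ?_
  have : C * (κ / (4 * (C + 1))) ≤ κ / 4 := by
    rw [← mul_div_assoc, div_le_div_iff₀ (by positivity) (by positivity)]
    nlinarith
  linarith

/-- Unlike in L¹ no tails are split off: the coercivity error is a multiple of r^γ, whose integral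
is bounded uniformly in time. -/
theorem eventually_lintegral_sub_rpow_le (hE : IsStrongEulerSolution Ω γ T r u) (hT : 0 < T)
    (hγ : 1 < γ) (hr0 : IntegrableOn (r 0) Ω.carrier)
    (h0 : ∀ᶠ ε in l, ∀ᵐ t ∂volume.restrict (Icc 0 T), ∀ᵐ x ∂volume.restrict Ω.carrier, 0 ≤ ρ ε t x)
    (hclose : ∀ κ : ℝ, 0 < κ → ∀ᶠ ε in l, ∀ᵐ t ∂volume.restrict (Icc 0 T),
      ∫⁻ x in Ω.carrier, ENNReal.ofReal (relInternalEnergy γ (ρ ε t x) (r t x)) ≤ ENNReal.ofReal κ)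
    {κ : ℝ} (hκ : 0 < κ) :
    ∀ᶠ ε in l, ∀ᵐ t ∂volume.restrict (Icc 0 T),
      ∫⁻ x in Ω.carrier, ‖ρ ε t x - r t x‖ₑ ^ γ ≤ ENNReal.ofReal κ := by
  have hmΩ := Ω.isOpen.measurableSet
  obtain ⟨M, hM0, hM⟩ := hE.exists_rpow_bound hT hγ hr0
  obtain ⟨C, hC0, hC⟩ := exists_abs_sub_rpow_le (η := κ / (2 * (M + 1))) hγ (by positivity)
  filter_upwards [h0, hclose (κ / (2 * (C + 1))) (by positivity)] with ε h0ε h2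
  filter_upwards [h0ε, h2, ae_restrict_mem measurableSet_Icc] with t h0t h2t ht
  obtain ⟨iM, bM⟩ := hM t ht
  have hr : 0 ≤ᵐ[volume.restrict Ω.carrier] fun x => r t x ^ γ := by
    filter_upwards [ae_restrict_mem hmΩ] with x hx
    exact Real.rpow_nonneg (hE.pos ht hx).le γ
  calc ∫⁻ x in Ω.carrier, ‖ρ ε t x - r t x‖ₑ ^ γ
      ≤ ∫⁻ x in Ω.carrier, (ENNReal.ofReal C *
          ENNReal.ofReal (relInternalEnergy γ (ρ ε t x) (r t x)) +
          ENNReal.ofReal (κ / (2 * (M + 1))) * ENNReal.ofReal (r t x ^ γ)) := by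
        refine lintegral_mono_ae ?_
        filter_upwards [h0t, hr, ae_restrict_mem hmΩ] with x hx hrx hxΩ
        have hf := relInternalEnergy_nonneg hγ (hE.pos ht hxΩ) hx
        rw [Pi.zero_apply] at hrx
        rw [← ENNReal.ofReal_mul hC0, ← ENNReal.ofReal_mul (by positivity),
          ← ENNReal.ofReal_add (by positivity) (by positivity), Real.enorm_eq_ofReal_abs,
          ENNReal.ofReal_rpow_of_nonneg (abs_nonneg _) (by linarith)]
        exact ENNReal.ofReal_le_ofReal (hC _ _ hx (hE.pos ht hxΩ))
    _ = ENNReal.ofReal C *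
          (∫⁻ x in Ω.carrier, ENNReal.ofReal (relInternalEnergy γ (ρ ε t x) (r t x))) +
        ENNReal.ofReal (κ / (2 * (M + 1))) * ENNReal.ofReal (∫ x in Ω.carrier, r t x ^ γ) := by
        rw [lintegral_add_right' _ (iM.1.aemeasurable.ennreal_ofReal.const_mul _),
          lintegral_const_mul' _ _ ENNReal.ofReal_ne_top,
          lintegral_const_mul' _ _ ENNReal.ofReal_ne_top,
          ofReal_integral_eq_lintegral_ofReal iM hr]
    _ ≤ ENNReal.ofReal C * ENNReal.ofReal (κ / (2 * (C + 1))) +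
        ENNReal.ofReal (κ / (2 * (M + 1))) * ENNReal.ofReal M := by gcongr
    _ ≤ ENNReal.ofReal κ := by
        rw [← ENNReal.ofReal_mul hC0, ← ENNReal.ofReal_mul (by positivity),
          ← ENNReal.ofReal_add (by positivity) (by positivity)]
        refine ENNReal.ofReal_le_ofReal ?_
        have h1 : C * (κ / (2 * (C + 1))) ≤ κ / 2 := by
          rw [← mul_div_assoc, div_le_div_iff₀ (by positivity) (by positivity)]
          nlinarith
        have h2 : κ / (2 * (M + 1)) * M ≤ κ / 2 := by
          rw [div_mul_eq_mul_div, div_le_div_iff₀ (by positivity) (by positivity)]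
          nlinarith
        linarith

/-- Write J - r u = √ρ(Λ - √ρ u) + (ρ - r)u. The first part is handled by Young's inequality and the
mass bound, the second by the boundedness of u and the L¹ estimate. -/
theorem eventually_lintegral_momentum_sub_le (hE : IsStrongEulerSolution Ω γ T r u)
    {J Λ : ℝ → ℝ → Sp d → Sp d} {m : ℝ} (hm : 0 ≤ m)
    (h0 : ∀ᶠ ε in l, ∀ᵐ t ∂volume.restrict (Icc 0 T), ∀ᵐ x ∂volume.restrict Ω.carrier,
      0 ≤ ρ ε t x ∧ J ε t x = √(ρ ε t x) • Λ ε t x)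
    (hmass : ∀ᶠ ε in l, ∀ᵐ t ∂volume.restrict (Icc 0 T), IntegrableOn (ρ ε t) Ω.carrier ∧
      ∫ x in Ω.carrier, ρ ε t x ≤ m)
    (hclose : ∀ κ : ℝ, 0 < κ → ∀ᶠ ε in l, ∀ᵐ t ∂volume.restrict (Icc 0 T),
      ∫⁻ x in Ω.carrier, ‖Λ ε t x - √(ρ ε t x) • u t x‖ₑ ^ (2 : ℝ) ≤ ENNReal.ofReal κ)
    (hsub : ∀ κ : ℝ, 0 < κ → ∀ᶠ ε in l, ∀ᵐ t ∂volume.restrict (Icc 0 T),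
      ∫⁻ x in Ω.carrier, ‖ρ ε t x - r t x‖ₑ ≤ ENNReal.ofReal κ)
    {κ : ℝ} (hκ : 0 < κ) :
    ∀ᶠ ε in l, ∀ᵐ t ∂volume.restrict (Icc 0 T),
      ∫⁻ x in Ω.carrier, ‖J ε t x - r t x • u t x‖ₑ ≤ ENNReal.ofReal κ := by
  have hmΩ := Ω.isOpen.measurableSet
  obtain ⟨K, hK0, hK⟩ := hE.u_space.spaceReg.extendsCont.exists_bound
  -- The weight in Young's inequality: θ times the mass is at most κ/3, and 1/θ is compensated by
  -- asking for closeness θκ/3.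
  set θ := κ / (3 * (m + 1)) with hθ
  have hθ0 : 0 < θ := by positivity
  filter_upwards [h0, hmass, hclose (θ * (κ / 3)) (by positivity),
    hsub (κ / (3 * (K + 1))) (by positivity)] with ε h0ε hmε h1 h2
  filter_upwards [h0ε, hmε, h1, h2, ae_restrict_mem measurableSet_Icc]
    with t h0t ⟨im, bm⟩ h1t h2t ht
  have mr := hE.aestronglyMeasurable_rho ht
  calc ∫⁻ x in Ω.carrier, ‖J ε t x - r t x • u t x‖ₑ
      ≤ ∫⁻ x in Ω.carrier, (ENNReal.ofReal θ⁻¹ * ‖Λ ε t x - √(ρ ε t x) • u t x‖ₑ ^ (2 : ℝ) +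
          (ENNReal.ofReal θ * ENNReal.ofReal (ρ ε t x) +
            ENNReal.ofReal K * ‖ρ ε t x - r t x‖ₑ)) := by
        refine lintegral_mono_ae ?_
        filter_upwards [h0t, ae_restrict_mem hmΩ] with x ⟨hx, hJ⟩ hxΩ
        set v := Λ ε t x - √(ρ ε t x) • u t x with hv
        have e1 : J ε t x - r t x • u t x = √(ρ ε t x) • v + (ρ ε t x - r t x) • u t x := by
          rw [hJ, hv, smul_sub, smul_smul, Real.mul_self_sqrt hx, sub_smul]
          abel
        rw [ENNReal.rpow_two, ← ofReal_norm, ← ofReal_norm, ← ofReal_norm,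
          ← ENNReal.ofReal_pow (norm_nonneg _), ← ENNReal.ofReal_mul (by positivity),
          ← ENNReal.ofReal_mul (by positivity), ← ENNReal.ofReal_mul hK0,
          ← ENNReal.ofReal_add (by positivity) (by positivity),
          ← ENNReal.ofReal_add (by positivity) (by positivity), e1]
        refine ENNReal.ofReal_le_ofReal ((norm_add_le _ _).trans ?_)
        rw [norm_smul, norm_smul, Real.norm_of_nonneg (Real.sqrt_nonneg _)]
        have h3 := mul_le_mul_of_nonneg_left (hK t ht x hxΩ) (norm_nonneg (ρ ε t x - r t x))
        have h4 : √(ρ ε t x) * ‖v‖ ≤ θ⁻¹ * ‖v‖ ^ 2 + θ * ρ ε t x := by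
          have h5 : θ⁻¹ * ‖v‖ ^ 2 + θ * ρ ε t x - √(ρ ε t x) * ‖v‖ =
              θ⁻¹ * (‖v‖ - θ / 2 * √(ρ ε t x)) ^ 2 + 3 / 4 * (θ * ρ ε t x) := by
            have := Real.sq_sqrt hx
            have e2 : θ⁻¹ * θ = 1 := inv_mul_cancel₀ hθ0.ne'
            linear_combination (-θ / 4) * this +
              (√(ρ ε t x) * ‖v‖ - θ / 4 * √(ρ ε t x) ^ 2) * e2
          have h6 : 0 ≤ θ⁻¹ * (‖v‖ - θ / 2 * √(ρ ε t x)) ^ 2 + 3 / 4 * (θ * ρ ε t x) := by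
            positivity
          linarith
        linarith
    _ = ENNReal.ofReal θ⁻¹ *
          (∫⁻ x in Ω.carrier, ‖Λ ε t x - √(ρ ε t x) • u t x‖ₑ ^ (2 : ℝ)) +
        (ENNReal.ofReal θ * ENNReal.ofReal (∫ x in Ω.carrier, ρ ε t x) +
          ENNReal.ofReal K * ∫⁻ x in Ω.carrier, ‖ρ ε t x - r t x‖ₑ) := by
        have a1 : AEMeasurable (fun x => ENNReal.ofReal K * ‖ρ ε t x - r t x‖ₑ)
            (volume.restrict Ω.carrier) := (im.1.sub mr).enorm.const_mul _
        have a2 : AEMeasurable (fun x => ENNReal.ofReal θ * ENNReal.ofReal (ρ ε t x) +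
            ENNReal.ofReal K * ‖ρ ε t x - r t x‖ₑ) (volume.restrict Ω.carrier) :=
          (im.1.aemeasurable.ennreal_ofReal.const_mul _).add a1
        rw [lintegral_add_right' _ a2,
          lintegral_add_right' _ a1, lintegral_const_mul' _ _ ENNReal.ofReal_ne_top,
          lintegral_const_mul' _ _ ENNReal.ofReal_ne_top,
          lintegral_const_mul' _ _ ENNReal.ofReal_ne_top,
          ofReal_integral_eq_lintegral_ofReal im (h0t.mono fun x hx => hx.1)]
    _ ≤ ENNReal.ofReal θ⁻¹ * ENNReal.ofReal (θ * (κ / 3)) +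
        (ENNReal.ofReal θ * ENNReal.ofReal m +
          ENNReal.ofReal K * ENNReal.ofReal (κ / (3 * (K + 1)))) := by gcongr
    _ ≤ ENNReal.ofReal κ := by
        rw [← ENNReal.ofReal_mul (by positivity), ← ENNReal.ofReal_mul (by positivity),
          ← ENNReal.ofReal_mul hK0, ← ENNReal.ofReal_add (by positivity) (by positivity),
          ← ENNReal.ofReal_add (by positivity) (by positivity)]
        refine ENNReal.ofReal_le_ofReal ?_
        have h1 : θ⁻¹ * (θ * (κ / 3)) = κ / 3 := inv_mul_cancel_left₀ hθ0.ne' _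
        have h2 : θ * m ≤ κ / 3 := by
          rw [hθ, div_mul_eq_mul_div, div_le_div_iff₀ (by positivity) (by positivity)]
          nlinarith
        have h3 : K * (κ / (3 * (K + 1))) ≤ κ / 3 := by
          rw [← mul_div_assoc, div_le_div_iff₀ (by positivity) (by positivity)]
          nlinarith
        linarith

end IsStrongEulerSolution

end EulerKorteweg

end

open EulerKorteweg in
theorem mainTheorem1 {d : ℕ} (hd : 0 < d) (Ω : C3Domain d)
    {γ c α T : ℝ} (hγ : 1 < γ) (hc : 0 < c) (hα : -1 ≤ α) (hT : 0 < T)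
    (ρ₀ : ℝ → Sp d → ℝ) (J₀ : ℝ → Sp d → Sp d)
    (ρ : ℝ → ℝ → Sp d → ℝ) (J Λ : ℝ → ℝ → Sp d → Sp d)
    (hsol : ∀ᶠ ε in 𝓝[>] (0 : ℝ),
      IsFiniteEnergyWeakSolution Ω γ c α ε T (ρ₀ ε) (J₀ ε) (ρ ε) (J ε) (Λ ε))
    (ρE : ℝ → Sp d → ℝ) (uE : ℝ → Sp d → Sp d)
    (hE : IsStrongEulerSolution Ω γ T ρE uE)
    (hdecay : ¬ Bornology.IsBounded Ω.carrier →
      IntegrableOn (ρE 0) Ω.carrier ∧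
      ∀ η : ℝ, 0 < η → ∃ R : ℝ, ∀ᶠ ε in 𝓝[>] (0 : ℝ),
        ∫ x in Ω.carrier ∩ {x | R < ‖x‖}, ρ₀ ε x ≤ η)
    (hinit : Tendsto (fun ε => relEntropy Ω.carrier γ c α ε (ρ₀ ε)
      (pseudoVelocity (ρ₀ ε) (J₀ ε)) (ρE 0) (uE 0)) (𝓝[>] (0 : ℝ)) (𝓝 0)) :
    Tendsto (fun ε =>
        normLinfLp T Ω.carrier 1 (fun t x => ρ ε t x - ρE t x)
        + normLinfLp T Ω.carrier (ENNReal.ofReal γ) (fun t x => ρ ε t x - ρE t x)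
        + normLinfLp T Ω.carrier 2 (fun t x => Λ ε t x - √(ρ ε t x) • uE t x))
      (𝓝[>] (0 : ℝ)) (𝓝 0) ∧
    Tendsto (fun ε =>
        normLinfLp T Ω.carrier 1 (fun t x => J ε t x - ρE t x • uE t x))
      (𝓝[>] (0 : ℝ)) (𝓝 0) := by
  have hr0 : IntegrableOn (ρE 0) Ω.carrier := hE.integrableOn_zero hT fun h => (hdecay h).1
  -- On a bounded domain the region far away is empty, so the decay condition holds in both cases
  -- and they are treated together from here on.
  have htail : ∀ η : ℝ, 0 < η → ∃ R : ℝ, ∀ᶠ ε in 𝓝[>] (0 : ℝ),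
      ∫ x in Ω.carrier ∩ {x | R < ‖x‖}, ρ₀ ε x ≤ η := by
    intro η hη
    by_cases h : Bornology.IsBounded Ω.carrier
    · obtain ⟨R, hR⟩ := h.exists_norm_le
      have he : Ω.carrier ∩ {x | R < ‖x‖} = ∅ :=
        eq_empty_of_forall_notMem fun x hx => absurd (hR x hx.1) (not_le.2 hx.2)
      exact ⟨R, Eventually.of_forall fun ε => by simpa [he] using hη.le⟩
    · exact (hdecay h).2 η hη
  obtain ⟨m, E, hm0, hE0, hbd⟩ := hE.eventually_initial_bounds hT hγ hr0 hsol htail hinit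
  have hclose := fun κ (hκ : (0 : ℝ) < κ) =>
    hE.eventually_slices_close hT hγ hr0 hc hα hsol hinit hm0 hE0 hbd hκ
  have hclose₁ := fun κ hκ => (hclose κ hκ).mono fun ε h => h.mono fun t ht => ht.1
  have hclose₂ := fun κ hκ => (hclose κ hκ).mono fun ε h => h.mono fun t ht => ht.2
  have h0 : ∀ᶠ ε in 𝓝[>] (0 : ℝ), ∀ᵐ t ∂volume.restrict (Icc 0 T),
      ∀ᵐ x ∂volume.restrict Ω.carrier, 0 ≤ ρ ε t x ∧ J ε t x = √(ρ ε t x) • Λ ε t x := by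
    filter_upwards [hsol] with ε ⟨B, H, hW⟩
    filter_upwards [ae_restrict_mem measurableSet_Icc] with t ht
    exact (hW.nonneg t ht).and (hW.J_eq t ht)
  have h0' : ∀ᶠ ε in 𝓝[>] (0 : ℝ), ∀ᵐ t ∂volume.restrict (Icc 0 T),
      ∀ᵐ x ∂volume.restrict Ω.carrier, 0 ≤ ρ ε t x :=
    h0.mono fun ε h => h.mono fun t ht => ht.mono fun x hx => hx.1
  have hmass : ∀ᶠ ε in 𝓝[>] (0 : ℝ), ∀ᵐ t ∂volume.restrict (Icc 0 T),
      IntegrableOn (ρ ε t) Ω.carrier ∧ ∫ x in Ω.carrier, ρ ε t x ≤ m := by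
    filter_upwards [hsol, hbd, self_mem_nhdsWithin] with ε ⟨B, H, hW⟩ hb hε
    filter_upwards [hW.ae_integrable_mass_le hγ hε hT] with t ht
    exact ⟨ht.1, ht.2.trans hb.1⟩
  have hsub := fun κ (hκ : (0 : ℝ) < κ) => hE.eventually_lintegral_sub_le hT hγ hr0 h0' hclose₁
    (fun η hη => eventually_slices_tail hT hγ hsol htail hE0 (hbd.mono fun ε h => h.2) hη) hκ
  constructor
  · have t1 := tendsto_normLinfLp_zero (p := 1) (f := fun ε t x => ρ ε t x - ρE t x) one_pos
      fun κ hκ => by simpa using hsub κ hκ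
    have t2 := tendsto_normLinfLp_zero (f := fun ε t x => ρ ε t x - ρE t x) (one_pos.trans hγ)
      fun κ hκ => hE.eventually_lintegral_sub_rpow_le hT hγ hr0 h0' hclose₁ hκ
    have t3 := tendsto_normLinfLp_zero (p := 2)
      (f := fun ε t x => Λ ε t x - √(ρ ε t x) • uE t x) two_pos hclose₂
    rw [ENNReal.ofReal_one] at t1
    rw [ENNReal.ofReal_ofNat] at t3
    simpa using (t1.add t2).add t3
  · have t1 := tendsto_normLinfLp_zero (p := 1) (f := fun ε t x => J ε t x - ρE t x • uE t x) one_pos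
      fun κ hκ => by
        simpa using hE.eventually_lintegral_momentum_sub_le hm0 h0 hmass hclose₂ hsub hκ
    rwa [ENNReal.ofReal_one] at t1
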